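/- Let $t\in\mathbb C$, let $a=\sqrt{-2-t}$, $b=\sqrt{2-t}$ (principal branches), and let $R(z)=(z^2-a^2)(z^2-b^2)$. Suppose given a simple curve $\Gamma=(-L)\cup J_1\cup I\cup J_2\cup L$ in $\mathbb C$, where $J_2$ is a simple regular $C^1$ arc from $a$ to $b$, $J_1=-J_2$ is its mirror image, running from $-b$ to $-a$, $I$ is a simple regular $C^1$ arc from $-a$ to $a$, $L$ is an unbounded simple arc from $b$ to $\infty$, and these five arcs meet only at their common end points $\pm a,\pm b$. (In the two-cut region of the quartic potential $z^4/4+tz^2/2$, $J_1\cup J_2$ is the support of the equilibrium measure, $L$ is an orthogonal trajectory, and $I$ is an auxiliary arc.) Let $\mathfrak S$ be the compact Riemann surface of $w^2=R(z)$, with projection $\pi(z,w)=z$ and with two points on top of $\infty$. Let $R^{1/2}$ be the branch that is analytic off $J_1\cup J_2$ with $R^{1/2}(z)=z^2+\mathcal O(z)$ at $\infty$, and for $z\in\mathbb C\setminus(J_1\cup J_2)$ and $k\in\{0,1\}$ put $z^{(k)}=(z,(-1)^kR^{1/2}(z))\in\mathfrak S$. Let $\alpha=\pi^{-1}(I)$,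 oriented towards $-a$ on the sheet $k=0$, let $\beta=\pi^{-1}(J_1)$ with either orientation, and let $$\mathcal H=\Big(\int_\alpha\frac{dx}{w}\Big)^{-1}\frac{dz}{w},\qquad \mathrm B=\int_\beta\mathcal H .$$ For $x\in\mathbb C$ let $[x]$ be its class in $\mathbb C/(\mathbb Z+\mathrm B\mathbb Z)$. For $\boldsymbol z\in\mathfrak S\setminus(\alpha\cup\beta)$ let $\mathcal A(\boldsymbol z)=\int_b^{\boldsymbol z}\mathcal H$, where the path lies in $\mathfrak S\setminus(\alpha\cup\beta)$ and starts at the ramification point over $b$. The Abel map $\boldsymbol z\mapsto[\mathcal A(\boldsymbol z)]$ is defined on all of $\mathfrak S$ as the class of $\int_b^{\boldsymbol z}\mathcal H$ along a path in $\mathfrak S$. Then: 1. On $\mathfrak S\setminus(\alpha\cup\beta)$ the Abel map is the class of the abelian integral $\mathcal A$ just defined. 2. For $k\in\{0,1\}$ the Jacobi inversion problem $[\mathcal A(\boldsymbol z)]=[\mathcal A(0^{(k)})+\tfrac12]$, $\boldsymbol z\in\mathfrak S$, has exactly one solution, namely $\boldsymbol z=0^{(1-k)}$. 3. If moreover $0\in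 I$, so that $0^{(0)},0^{(1)}\in\alpha$, then the boundary values $\mathcal A_\pm(0^{(k)})$ of $\mathcal A$, taken along the normals to $\alpha$ from the left $(+)$ and from the right $(-)$ side of $\alpha$, exist and satisfy, for each of the two signs, $$\mathcal A_\pm(0^{(0)})=\mathcal A_\pm(0^{(1)})+\tfrac12 .$$ -/

import Mathlib

open Set Filter Topology
open scoped Pointwise

noncomputable section

namespace TwoCut

/-- The branch point `a₂(t) = √(-2 - t)` (principal branch). -/
def a₂ (t : ℂ) : ℂ := (-2 - t) ^ (1 / 2 : ℂ)

/-- The branch point `b₂(t) = √(2 - t)` (principal branch). -/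
def b₂ (t : ℂ) : ℂ := (2 - t) ^ (1 / 2 : ℂ)

/-- `R(z; t) = (z² - a₂²)(z² - b₂²)`. -/
def R (t z : ℂ) : ℂ := (z ^ 2 - a₂ t ^ 2) * (z ^ 2 - b₂ t ^ 2)

/-! ### The compact surface `w² = R(z; t)` -/

/-- The affine curve `w² = R(z; t)`, with points `(z, w)`. -/
abbrev AffineCurve (t : ℂ) : Type := {p : ℂ × ℂ // p.2 ^ 2 = R t p.1}

/-- The affine curve near infinity, in the coordinates `u = 1 / z`, `v = w / z²`. -/
abbrev InftyCurve (t : ℂ) : Type :=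
  {q : ℂ × ℂ // q.2 ^ 2 = (1 - a₂ t ^ 2 * q.1 ^ 2) * (1 - b₂ t ^ 2 * q.1 ^ 2)}

/-- The compact surface `𝔖`: the affine curve and two points on top of infinity;
`infty k` is the one at which `w / z² = (-1)ᵏ`. -/
inductive Surface (t : ℂ) : Type
  | pt (p : AffineCurve t) : Surface t
  | infty (k : Fin 2) : Surface t

namespace Surface

theorem inftyCurve_sq {t : ℂ} (q : InftyCurve t) (h : q.1.1 ≠ 0) :
    (q.1.2 / q.1.1 ^ 2) ^ 2 = R t (1 / q.1.1) := by
  have h1 := q.2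
  unfold R
  field_simp
  linear_combination h1

open Classical in
/-- The chart at infinity `(u, v) ↦ (z, w) = (1 / u, v / u²)`. -/
def ofInftyCurve {t : ℂ} (q : InftyCurve t) : Surface t :=
  if h : q.1.1 = 0 then infty (if q.1.2 = 1 then 0 else 1)
  else pt ⟨(1 / q.1.1, q.1.2 / q.1.1 ^ 2), inftyCurve_sq q h⟩

/-- The surface is glued from its two affine pieces: a set is open if and only if its traces on
both pieces are open. -/
instance (t : ℂ) : TopologicalSpace (Surface t) :=
  TopologicalSpace.coinduced pt inferInstance ⊔
    TopologicalSpace.coinduced ofInftyCurve inferInstance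

/-- The coordinate `z` on the finite part of the surface (with value `0` at the points on top of
infinity, where it is never used). -/
def z {t : ℂ} : Surface t → ℂ
  | pt p => p.1.1
  | infty _ => 0

/-- The coordinate `w` on the finite part of the surface (with value `0` at the points on top of
infinity, where it is never used). -/
def w {t : ℂ} : Surface t → ℂ
  | pt p => p.1.2
  | infty _ => 0

/-- The fiber `π⁻¹(K)` over a set `K` of finite points of the Riemann sphere. -/
def fiber {t : ℂ} (K : Set ℂ) : Set (Surface t) := {p | ∃ q : AffineCurve t, p = pt q ∧ q.1.1 ∈ K}

/-- The ramification point on top of `b₂`. -/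
def bPt (t : ℂ) : Surface t := pt ⟨(b₂ t, 0), by simp [R]⟩

/-- `γ : [0,1] → 𝔖` is a path along which `dz / w` can be integrated: it is continuous, away from
finitely many parameters it is at a finite point with `w ≠ 0` and differentiable there, and the
pulled back differential is integrable. (Ramification points and points on top of infinity may be
visited at the exceptional parameters.) -/
structure IsPath {t : ℂ} (γ : ℝ → Surface t) : Prop where
  continuousOn : ContinuousOn γ (Icc 0 1)
  regular : ∃ F : Finset ℝ, ∀ s ∈ Ioo (0 : ℝ) 1, s ∉ F →
    (γ s).w ≠ 0 ∧ DifferentiableAt ℝ (fun r => (γ r).z) s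
  integrable : IntervalIntegrable (fun s => deriv (fun r => (γ r).z) s / (γ s).w)
    MeasureTheory.volume 0 1

/-- The integral of `dz / w` along `γ : [0,1] → 𝔖`. -/
def pathIntegral {t : ℂ} (γ : ℝ → Surface t) : ℂ :=
  ∫ s in (0 : ℝ)..1, deriv (fun r => (γ r).z) s / (γ s).w

end Surface

/-! ### The contour -/

/-- `γ`, restricted to `[0,1]`, is a simple regular `C¹` arc from `p` to `q`. -/
structure IsArc (γ : ℝ → ℂ) (p q : ℂ) : Prop where
  contDiffOn : ContDiffOn ℝ 1 γ (Icc 0 1)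
  derivWithin_ne_zero : ∀ s ∈ Icc (0 : ℝ) 1, derivWithin γ (Icc 0 1) s ≠ 0
  injOn : InjOn γ (Icc 0 1)
  left : γ 0 = p
  right : γ 1 = q

/-- A two-cut contour: the simple curve
`(-L) ∪ (-J) ∪ I ∪ J ∪ L` through `-∞, -b₂, -a₂, a₂, b₂, ∞` in this order. Here `J` is the arc
`J_{t,2}` from `a₂` to `b₂`, its mirror image `-J` is the arc `J_{t,1}` from `-b₂` to `-a₂`,
`I` is the arc `I_t` from `-a₂` to `a₂` (it need not be symmetric), and `L` is the
unbounded arc that leads from `b₂` to infinity. -/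
structure Contour (t : ℂ) where
  J : ℝ → ℂ
  I : ℝ → ℂ
  L : ℝ → ℂ
  isArc_J : IsArc J (a₂ t) (b₂ t)
  isArc_I : IsArc I (-a₂ t) (a₂ t)
  continuousOn_L : ContinuousOn L (Ici 0)
  injOn_L : InjOn L (Ici 0)
  L_zero : L 0 = b₂ t
  tendsto_L : Tendsto L atTop (cocompact ℂ)
  J_neg_J : Disjoint (J '' Icc 0 1) (-(J '' Icc 0 1))
  I_J : I '' Icc 0 1 ∩ J '' Icc 0 1 = {a₂ t}
  I_neg_J : I '' Icc 0 1 ∩ -(J '' Icc 0 1) = {-a₂ t}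
  L_J : L '' Ici 0 ∩ J '' Icc 0 1 = {b₂ t}
  L_neg_J : Disjoint (L '' Ici 0) (-(J '' Icc 0 1))
  L_neg_L : Disjoint (L '' Ici 0) (-(L '' Ici 0))
  L_I : Disjoint (L '' Ici 0) (I '' Icc 0 1)
  neg_L_I : Disjoint (-(L '' Ici 0)) (I '' Icc 0 1)

namespace Contour

variable {t : ℂ} (c : Contour t)

/-- The parametrization of `J_{t,1} = -J_{t,2}` from `-b₂` to `-a₂`. -/
def J₁ (s : ℝ) : ℂ := -c.J (1 - s)

/-- The support `J_t = J_{t,1} ∪ J_{t,2}`. -/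
def cuts : Set ℂ := c.J₁ '' Icc 0 1 ∪ c.J '' Icc 0 1

/-- `f` is the branch of `√R` that is analytic off `J_t` and equal to `z² + O(z)` at infinity
(on `J_t` the values of `f` are some square roots of `R`). -/
def IsBranch (f : ℂ → ℂ) : Prop :=
  (∀ z, f z ^ 2 = R t z) ∧ DifferentiableOn ℂ f c.cutsᶜ ∧
    (fun z => f z - z ^ 2) =O[cocompact ℂ] (fun z => z)

open Classical in
/-- The branch `R^{1/2}`. -/
def sqrtR : ℂ → ℂ :=
  if h : ∃ f, c.IsBranch f then h.choose else fun z => R t z ^ (1 / 2 : ℂ)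

theorem sqrtR_sq (z : ℂ) : c.sqrtR z ^ 2 = R t z := by
  unfold sqrtR
  split_ifs with h
  · exact h.choose_spec.1 z
  · rw [← Complex.cpow_nat_mul]
    norm_num

/-- The point `z^{(k)}` of the sheet `𝔖^{(k)}` on top of a finite point `z ∉ J_t`. -/
def sheet (k : Fin 2) (z : ℂ) : Surface t :=
  .pt ⟨(z, (-1) ^ (k : ℕ) * c.sqrtR z), by
    rw [mul_pow, c.sqrtR_sq, ← pow_mul, mul_comm, mul_comm (k : ℕ) 2, pow_mul]; simp⟩

/-! ### Periods -/

/-- The integral of `dz / w` over the cycle `α = π⁻¹(I_t)`, which runs along `I_t` from `a₂` to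
`-a₂` in the sheet `𝔖^{(0)}` and returns from `-a₂` to `a₂` in `𝔖^{(1)}`. -/
def alphaPeriod : ℂ :=
  (∫ s in (0 : ℝ)..1, deriv (fun r => c.I (1 - r)) s / c.sqrtR (c.I (1 - s))) +
    ∫ s in (0 : ℝ)..1, deriv c.I s / (-c.sqrtR (c.I s))

/-- `s ↦ (J₁ s, ω s)` is a lift of `J_{t,1}` to the surface. There are two such lifts, `ω` and
`-ω`; they correspond to the two orientations of `β = π⁻¹(J_{t,1})`. -/
def IsBetaLift (ω : ℝ → ℂ) : Prop :=
  ContinuousOn ω (Icc 0 1) ∧ ∀ s ∈ Icc (0 : ℝ) 1, ω s ^ 2 = R t (c.J₁ s)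

/-- The integral `B` of the normalized differential `ℋ = (∫_α dz / w)⁻¹ dz / w` over the cycle
`β = π⁻¹(J_{t,1})`, which runs along the lift `(J₁, ω)` from `-b₂` to `-a₂` and returns along
`(J₁, -ω)`. -/
def B (ω : ℝ → ℂ) : ℂ :=
  c.alphaPeriod⁻¹ * ((∫ s in (0 : ℝ)..1, deriv c.J₁ s / ω s) +
    ∫ s in (0 : ℝ)..1, deriv (fun r => c.J₁ (1 - r)) s / (-ω (1 - s)))

/-- The lattice `ℤ + B ℤ`. -/
def lattice (ω : ℝ → ℂ) : AddSubgroup ℂ := AddSubgroup.closure {1, c.B ω}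

/-- The Jacobi variety `ℂ / (ℤ + B ℤ)`. -/
abbrev Jac (ω : ℝ → ℂ) : Type := ℂ ⧸ c.lattice ω

/-- The class `[x]` of `x ∈ ℂ` in the Jacobi variety. -/
def toJac (ω : ℝ → ℂ) (x : ℂ) : c.Jac ω := QuotientAddGroup.mk x

/-! ### The abelian integral and the Abel map -/

/-- The cut surface `𝔖 \ (α ∪ β)`. -/
def cutSurface : Set (Surface t) :=
  (Surface.fiber (c.I '' Icc 0 1 ∪ c.J₁ '' Icc 0 1))ᶜ

/-- `v` is the integral of `ℋ` along some path in `U` from `b₂` to `p`. -/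
def IsAbelValue (U : Set (Surface t)) (p : Surface t) (v : ℂ) : Prop :=
  ∃ γ : ℝ → Surface t, Surface.IsPath γ ∧ γ 0 = Surface.bPt t ∧ γ 1 = p ∧
    (∀ s ∈ Icc (0 : ℝ) 1, γ s ∈ U) ∧ v = c.alphaPeriod⁻¹ * Surface.pathIntegral γ

open Classical in
/-- The abelian integral `𝒜(p) = ∫_{b₂}^p ℋ` for `p ∈ 𝔖 \ (α ∪ β)`, the path of integration
being taken in `𝔖 \ (α ∪ β)`. -/
def abelIntegral (p : Surface t) : ℂ :=
  if h : ∃ v, c.IsAbelValue c.cutSurface p v then h.choose else 0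

open Classical in
/-- The Abel map `𝔖 → ℂ / (ℤ + B ℤ)` on the whole surface: the class of the integral of `ℋ`
along a path from `b₂` to `p` in `𝔖`. -/
def abelMap (ω : ℝ → ℂ) (p : Surface t) : c.Jac ω :=
  c.toJac ω (if h : ∃ v, c.IsAbelValue univ p v then h.choose else 0)

/-- `v` is the boundary value of `𝒜` at the point `x^{(k)}`, `x = I s`, of the oriented cycle `α`,
taken along the normal from the left side of `α` if `σ = 1` and from the right side if `σ = -1`.
In `𝔖^{(k)}` the direction of `α` at this point is `-(-1)ᵏ I'(s)`. -/
def IsBoundaryValue (σ : ℝ) (k : Fin 2) (s : ℝ) (v : ℂ) : Prop :=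
  Tendsto (fun ε : ℝ => c.abelIntegral
      (c.sheet k (c.I s + ε * σ * Complex.I * (-(-1) ^ (k : ℕ) * deriv c.I s))))
    (𝓝[>] 0) (𝓝 v)

end Contour

end TwoCut

end

/-! The differential dz/w has neither zeros nor poles on the compact surface, so its dual vector
field is holomorphic and complete: its flow `act` is an action of (ℂ, +). A path is the orbit of its
initial point, the time being the integral of dz/w (`IsPath.eq_act`). Hence the integrals of dz/w
from b₂ to p are exactly the times u with `act u (bPt t) = p`, and the Abel map inverts the orbit
map of b₂, which is onto and has the stabilizer `periods t`. Homology and Riemann-Roch are not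
needed.

The involution `rot`, (z, w) ↦ (-z, -w), preserves dz/w and therefore commutes with the flow.
Running from b₂ through J, I and J₁ to -b₂ takes the time `alphaIntegral 1`, half of the α-period,
because the contributions of J and J₁ cancel (`IsBetaLift.act_alpha`). So `rot` is the translation
by this half period, which is 1/2 after normalization, and it exchanges 0^{(0)} and 0^{(1)}. This
solves the inversion problem as soon as all periods are known to be integer combinations of the α-
and the β-period.

For that, and for the cut surface, let h be the integral of dz/w from b₂ within the sheet 0, off the
spine -J ∪ I ∪ J (`IsAbelian`). The spine is an arc that does not separate the plane, and a Runge
type approximation of the integrand by derivatives provides the primitive. Let v be the continuous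
lift of the spine to times. The limit values of h at a point of the spine have the form ±v + l with
periods l. The pairs (±1, l) propagate along the spine (`ClustersAt.propagate`). They can change
only where v and -v agree modulo periods, that is at the four branch points, and there l changes by
±2v. Starting from l = 0 at b₂, one finds l = 0 along J, l ∈ {0, ±2β} along I, where 2β is the
β-period of dz/w, and l in the lattice of the two periods everywhere.

A time u that leads to a point off the spine has the defect u ∓ h, the sign depending on the sheet.
Defects are locally constant modulo the lattice, and the plane of times is connected; so all periods
lie in the lattice (`IsAbelian.periods_eq`). Over the cut surface defects are locally constant
outright; so the component of 0 in the set of times that lead into the cut surface is mapped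
bijectively onto that surface, and the abelian integral is the inverse map.

At an inner point of I the limits of h along the two normals are v and v - 2β in some order. They
differ, since otherwise a reflection at the branch point a₂ would turn β into a period. Their sum is
therefore twice the integral along I from a₂ to the point. At the origin it is the integral over all
of I, because R^{1/2} is even: its reciprocal has a primitive off ±J and ±L which is odd up to a
constant and has a single limit at a₂ (`IsBetaLift.alphaIntegral_one_eq`). Since the abelian
integral is ∓h on the two sheets up to normalization, the exact identity follows. -/

noncomputable section

namespace TwoCut

/-! ### Holomorphic differential equations: existence -/

section Picard

open Metric

variable {E : Type*} [NormedAddCommGroup E] [NormedSpace ℂ E] [CompleteSpace E]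

/-- One step of the Picard iteration on a disc. -/
theorem exists_picard_step {V : E → E} (hV : Differentiable ℂ V) {φ : ℂ → E} {r : ℝ}
    (hφ : DifferentiableOn ℂ φ (ball 0 r)) (p : E) :
    ∃ ψ : ℂ → E, ψ 0 = p ∧ ∀ u ∈ ball (0 : ℂ) r, HasDerivAt ψ (V (φ u)) u := by
  have h : DifferentiableOn ℂ (fun u => V (φ u)) (ball 0 r) :=
    hV.comp_differentiableOn hφ
  obtain ⟨F, hF⟩ := h.isExactOn_ball.with_val_at 0 p
  exact ⟨F, hF.1, hF.2⟩

omit [CompleteSpace E] in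
theorem norm_sub_le_of_hasDerivAt_ball {f f' : ℂ → E} {r C : ℝ}
    (hf : ∀ u ∈ ball (0 : ℂ) r, HasDerivAt f (f' u) u) (hC : ∀ u ∈ ball (0 : ℂ) r, ‖f' u‖ ≤ C)
    {u : ℂ} (hu : u ∈ ball (0 : ℂ) r) : ‖f u - f 0‖ ≤ C * ‖u‖ := by
  have h0 : (0 : ℂ) ∈ ball (0 : ℂ) r := by
    rw [mem_ball_zero_iff] at hu; simpa using (norm_nonneg u).trans_lt hu
  have := (convex_ball (0 : ℂ) r).norm_image_sub_le_of_norm_hasDerivWithin_le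
    (fun x hx => (hf x hx).hasDerivWithinAt) hC h0 hu
  simpa using this

/-- Holomorphic solutions of autonomous holomorphic differential equations. -/
theorem exists_holomorphic_solution {V : E → E} (hV : Differentiable ℂ V) {p : E} {M K r : ℝ}
    (hM : ∀ x ∈ closedBall p 1, ‖V x‖ ≤ M)
    (hK : ∀ x ∈ closedBall p 1, ∀ y ∈ closedBall p 1, ‖V x - V y‖ ≤ K * ‖x - y‖)
    (hr : 0 < r) (hK0 : 0 ≤ K) (hrM : M * r ≤ 1) (hrK : K * r ≤ 1 / 2) :
    ∃ φ : ℂ → E, φ 0 = p ∧ ∀ u ∈ ball (0 : ℂ) r, HasDerivAt φ (V (φ u)) u := by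
  have hM0 : 0 ≤ M := (norm_nonneg _).trans (hM p (mem_closedBall_self zero_le_one))
  have step : ∀ φ : {φ : ℂ → E // DifferentiableOn ℂ φ (ball 0 r) ∧
      ∀ u ∈ ball (0 : ℂ) r, φ u ∈ closedBall p 1},
      ∃ ψ : {φ : ℂ → E // DifferentiableOn ℂ φ (ball 0 r) ∧
      ∀ u ∈ ball (0 : ℂ) r, φ u ∈ closedBall p 1},
      ψ.1 0 = p ∧ ∀ u ∈ ball (0 : ℂ) r, HasDerivAt ψ.1 (V (φ.1 u)) u := by
    intro φ
    obtain ⟨ψ, h0, hψ⟩ := exists_picard_step hV φ.2.1 p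
    refine ⟨⟨ψ, fun u hu => (hψ u hu).differentiableAt.differentiableWithinAt, fun u hu => ?_⟩,
      h0, hψ⟩
    have := norm_sub_le_of_hasDerivAt_ball hψ (fun v hv => hM _ (φ.2.2 v hv)) hu
    rw [mem_closedBall, dist_eq_norm, ← h0]
    rw [mem_ball_zero_iff] at hu
    calc _ ≤ M * ‖u‖ := this
      _ ≤ M * r := by gcongr
      _ ≤ 1 := hrM
  choose nxt hnxt0 hnxt using step
  let Y : ℕ → {φ : ℂ → E // DifferentiableOn ℂ φ (ball 0 r) ∧
      ∀ u ∈ ball (0 : ℂ) r, φ u ∈ closedBall p 1} := fun n =>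
    Nat.rec (nxt ⟨fun _ => p, differentiableOn_const _, fun _ _ =>
      mem_closedBall_self zero_le_one⟩) (fun _ φ => nxt φ) n
  have hY : ∀ n, Y (n + 1) = nxt (Y n) := fun n => rfl
  have hY0 : ∀ n, (Y n).1 0 = p := by
    intro n; cases n with
    | zero => exact hnxt0 _
    | succ n => rw [hY]; exact hnxt0 _
  have hd : ∀ n, ∀ u ∈ ball (0 : ℂ) r, HasDerivAt (Y (n + 1)).1 (V ((Y n).1 u)) u :=
    fun n u hu => hnxt (Y n) u hu
  -- Consecutive iterates lie in the same unit ball, so they differ by at most 2 at first; each step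
  -- gains the factor K r ≤ 1/2. The shape 4 / 2 / 2 ^ n is that of the criterion for geometric
  -- Cauchy sequences.
  have hdist : ∀ n, ∀ u ∈ ball (0 : ℂ) r, ‖(Y (n + 1)).1 u - (Y n).1 u‖ ≤ 4 / 2 / 2 ^ n := by
    intro n
    induction n with
    | zero =>
      intro u hu
      have h1 := (Y 1).2.2 u hu
      have h2 := (Y 0).2.2 u hu
      rw [← dist_eq_norm]
      rw [mem_closedBall] at h1 h2
      have := dist_triangle_right ((Y (0+1)).1 u) ((Y 0).1 u) p
      norm_num
      norm_num at this
      linarith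
    | succ n ih =>
      intro u hu
      have := norm_sub_le_of_hasDerivAt_ball (f := fun u => (Y (n+2)).1 u - (Y (n+1)).1 u)
        (C := K * (4 / 2 / 2 ^ n))
        (fun v hv => (hd (n + 1) v hv).sub (hd n v hv)) (fun v hv => by
          refine (hK _ ((Y (n+1)).2.2 v hv) _ ((Y n).2.2 v hv)).trans ?_
          gcongr
          exact ih v hv) hu
      simp only [hY0, sub_self, sub_zero] at this
      refine this.trans ?_
      rw [mem_ball_zero_iff] at hu
      have h3 : K * ‖u‖ ≤ 1 / 2 := by nlinarith
      calc _ = (4 / 2 / 2 ^ n) * (K * ‖u‖) := by ring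
        _ ≤ (4 / 2 / 2 ^ n) * (1 / 2) := by gcongr
        _ = _ := by rw [pow_succ]; ring
  have hcau : ∀ u ∈ ball (0 : ℂ) r, CauchySeq fun n => (Y n).1 u := fun u hu =>
    cauchySeq_of_le_geometric_two (C := 4) fun n => by
      rw [dist_comm, dist_eq_norm]; exact hdist n u hu
  have hlim : ∀ u : ℂ, ∃ y, u ∈ ball (0 : ℂ) r → Tendsto (fun n => (Y n).1 u) atTop (𝓝 y) := by
    intro u
    by_cases hu : u ∈ ball (0 : ℂ) r
    · obtain ⟨y, hy⟩ := cauchySeq_tendsto_of_complete (hcau u hu)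
      exact ⟨y, fun _ => hy⟩
    · exact ⟨0, fun h => absurd h hu⟩
  choose φ hφ using hlim
  have h0 : (0 : ℂ) ∈ ball (0 : ℂ) r := by simpa using hr
  have hφmem : ∀ u ∈ ball (0 : ℂ) r, φ u ∈ closedBall p 1 := fun u hu =>
    isClosed_closedBall.mem_of_tendsto (hφ u hu) (Eventually.of_forall fun n => (Y n).2.2 u hu)
  have hunif : ∀ n, ∀ u ∈ ball (0 : ℂ) r, ‖V (φ u) - V ((Y n).1 u)‖ ≤ K * (4 / 2 ^ n) := by
    intro n u hu
    refine (hK _ (hφmem u hu) _ ((Y n).2.2 u hu)).trans ?_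
    have := dist_le_of_le_geometric_two_of_tendsto (C := 4) (f := fun n => (Y n).1 u)
      (fun n => by rw [dist_comm, dist_eq_norm]; exact hdist n u hu) (hφ u hu) n
    rw [dist_comm, dist_eq_norm] at this
    gcongr
  refine ⟨φ, tendsto_nhds_unique (hφ 0 h0) (by simp [hY0]), fun u hu => ?_⟩
  refine hasDerivAt_of_tendstoUniformlyOn (l := atTop) (f := fun n => (Y (n + 1)).1)
    (f' := fun n u => V ((Y n).1 u)) (g' := fun u => V (φ u)) isOpen_ball ?_
    (Eventually.of_forall hd) (fun x hx => (hφ x hx).comp (tendsto_add_atTop_nat 1)) hu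
  rw [tendstoUniformlyOn_iff]
  intro ε hε
  have ht : Tendsto (fun n : ℕ => K * (4 / 2 ^ n : ℝ)) atTop (𝓝 0) := by
    have := tendsto_pow_atTop_nhds_zero_of_lt_one (r := (1 / 2 : ℝ)) (by norm_num) (by norm_num)
    have := (this.const_mul (K * 4))
    simp only [mul_zero] at this
    refine this.congr fun n => ?_
    rw [one_div, inv_pow]; ring
  filter_upwards [ht.eventually (gt_mem_nhds hε)] with n hn x hx
  rw [dist_eq_norm]
  exact (hunif n x hx).trans_lt hn

end Picard

/-! ### Holomorphic differential equations: uniqueness -/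

section Uniqueness

open Metric

variable {E : Type*} [NormedAddCommGroup E] [NormedSpace ℂ E]

/-- Local uniqueness for holomorphic differential equations. -/
theorem eventuallyEq_of_hasDerivAt {V : E → E} {φ₁ φ₂ : ℂ → E} {u₀ : ℂ}
    (hV : ContDiff ℂ 1 V)
    (h₁ : ∀ᶠ u in 𝓝 u₀, HasDerivAt φ₁ (V (φ₁ u)) u) (h₂ : ∀ᶠ u in 𝓝 u₀, HasDerivAt φ₂ (V (φ₂ u)) u)
    (h : φ₁ u₀ = φ₂ u₀) : φ₁ =ᶠ[𝓝 u₀] φ₂ := by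
  obtain ⟨K, N, hN, hK⟩ := (hV.contDiffAt (x := φ₁ u₀)).exists_lipschitzOnWith
  have c₁ : ContinuousAt φ₁ u₀ := h₁.self_of_nhds.continuousAt
  have c₂ : ContinuousAt φ₂ u₀ := h₂.self_of_nhds.continuousAt
  have cd : ∀ᶠ u in 𝓝 u₀, ‖φ₁ u - φ₂ u‖ ≤ 1 := by
    have : Tendsto (fun u => ‖φ₁ u - φ₂ u‖) (𝓝 u₀) (𝓝 0) := by
      have := (c₁.sub c₂).norm
      simpa [ContinuousAt, h] using this
    exact (this.eventually (gt_mem_nhds one_pos)).mono fun u hu => hu.le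
  have e₁ : ∀ᶠ u in 𝓝 u₀, φ₁ u ∈ N := c₁ hN
  have e₂ : ∀ᶠ u in 𝓝 u₀, φ₂ u ∈ N := c₂ (by rw [← h]; exact hN)
  obtain ⟨ρ, hρ, hb⟩ := Metric.eventually_nhds_iff_ball.1
    (((h₁.and h₂).and (e₁.and e₂)).and cd)
  -- On a disc of radius ρ' with K ρ' ≤ 1/2, integrating the Lipschitz estimate halves every bound
  -- for the difference of the solutions. So the bound 1 improves to 2⁻ⁿ for all n.
  set ρ' := min ρ (1 / (2 * (K + 1)))
  have hρ' : 0 < ρ' := lt_min hρ (by positivity)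
  have hKρ : (K : ℝ) * ρ' ≤ 1 / 2 := by
    have h1 : (K : ℝ) * ρ' ≤ K * (1 / (2 * (K + 1))) := by gcongr; exact min_le_right _ _
    have h2 : (K : ℝ) * (1 / (2 * (K + 1))) ≤ 1 / 2 := by
      rw [mul_one_div, div_le_div_iff₀ (by positivity) (by norm_num)]; nlinarith [K.2]
    linarith
  have key : ∀ n : ℕ, ∀ u ∈ ball u₀ ρ', ‖φ₁ u - φ₂ u‖ ≤ (1 / 2) ^ n := by
    intro n
    induction n with
    | zero => exact fun u hu => by simpa using (hb u (ball_subset_ball (min_le_left _ _) hu)).2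
    | succ n ih =>
      intro u hu
      have := (convex_ball u₀ ρ').norm_image_sub_le_of_norm_hasDerivWithin_le
        (f := fun u => φ₁ u - φ₂ u) (f' := fun u => V (φ₁ u) - V (φ₂ u))
        (C := K * (1 / 2) ^ n) (fun x hx =>
          ((hb x (ball_subset_ball (min_le_left _ _) hx)).1.1.1.sub
          (hb x (ball_subset_ball (min_le_left _ _) hx)).1.1.2).hasDerivWithinAt)
        (fun x hx => by
          have hx' := (hb x (ball_subset_ball (min_le_left _ _) hx)).1.2
          refine (hK.norm_sub_le hx'.1 hx'.2).trans ?_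
          gcongr
          exact ih x hx) (mem_ball_self hρ') hu
      simp only [h, sub_self, sub_zero] at this
      have hu' : ‖u - u₀‖ ≤ ρ' := by rw [← dist_eq_norm]; exact (mem_ball.1 hu).le
      calc _ ≤ _ := this
        _ ≤ K * (1 / 2) ^ n * ρ' := by gcongr
        _ = (1 / 2) ^ n * (K * ρ') := by ring
        _ ≤ (1 / 2) ^ n * (1 / 2) := by gcongr
        _ = _ := by rw [pow_succ]
  filter_upwards [ball_mem_nhds u₀ hρ'] with u hu
  have : ‖φ₁ u - φ₂ u‖ ≤ 0 :=
    ge_of_tendsto' (tendsto_pow_atTop_nhds_zero_of_lt_one (r := (1 / 2 : ℝ)) (by norm_num)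
      (by norm_num)) fun n => key n u hu
  exact sub_eq_zero.1 (norm_le_zero_iff.1 this)

end Uniqueness

/-! ### The vector fields of the two affine charts -/

section Hamiltonian

open Metric

/-- The vector field on `ℂ²` whose flow preserves `y² - (A x⁴ + B x² + D)`. -/
def quarticField (ε A B : ℂ) (p : ℂ × ℂ) : ℂ × ℂ := (ε * p.2, ε * (2 * A * p.1 ^ 3 + B * p.1))

theorem contDiff_quarticField (ε A B : ℂ) : ContDiff ℂ 1 (quarticField ε A B) := by
  unfold quarticField; fun_prop

/-- Solutions exist on discs whose radius depends only on a bound for the initial value. -/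
theorem exists_quarticField_solution (ε A B : ℂ) (C : ℝ) :
    ∃ r > 0, ∀ p : ℂ × ℂ, ‖p‖ ≤ C → ∃ φ : ℂ → ℂ × ℂ, φ 0 = p ∧
      ∀ u ∈ ball (0 : ℂ) r, HasDerivAt φ (quarticField ε A B (φ u)) u := by
  have hV := contDiff_quarticField ε A B
  have hcomp : IsCompact (closedBall (0 : ℂ × ℂ) (C + 1)) := isCompact_closedBall _ _
  obtain ⟨M, hM⟩ := hcomp.exists_bound_of_continuousOn hV.continuous.continuousOn
  obtain ⟨K, hK⟩ := hcomp.exists_bound_of_continuousOn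
    (hV.continuous_fderiv one_ne_zero).continuousOn
  -- The bounds M and K hold on the ball of radius C + 1, which contains the unit ball about every
  -- admissible initial value. The radius makes M r ≤ 1 and K r ≤ 1/2.
  refine ⟨1 / (1 + |M| + 2 * |K|), by positivity, fun p hp => ?_⟩
  have hsub : closedBall p 1 ⊆ closedBall 0 (C + 1) := by
    refine closedBall_subset_closedBall' ?_
    rw [dist_zero_right]; linarith
  refine exists_holomorphic_solution (M := |M|) (K := |K|) (hV.differentiable one_ne_zero)
    (fun x hx => (hM x (hsub hx)).trans (le_abs_self M)) (fun x hx y hy => ?_)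
    (by positivity) (abs_nonneg _) ?_ ?_
  · exact (convex_closedBall p 1).norm_image_sub_le_of_norm_fderiv_le
      (fun z _ => hV.differentiable one_ne_zero z)
      (fun z hz => (hK z (hsub hz)).trans (le_abs_self K)) hy hx
  · rw [mul_one_div, div_le_one (by positivity)]
    nlinarith [abs_nonneg K]
  · rw [mul_one_div, div_le_div_iff₀ (by positivity) (by norm_num)]
    nlinarith [abs_nonneg M]

theorem hasDerivAt_fst_of_quarticField {ε A B : ℂ} {φ : ℂ → ℂ × ℂ} {u : ℂ}
    (h : HasDerivAt φ (quarticField ε A B (φ u)) u) :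
    HasDerivAt (fun v => (φ v).1) (ε * (φ u).2) u := by
  simpa [quarticField] using h.hasFDerivAt.fst.hasDerivAt

theorem hasDerivAt_snd_of_quarticField {ε A B : ℂ} {φ : ℂ → ℂ × ℂ} {u : ℂ}
    (h : HasDerivAt φ (quarticField ε A B (φ u)) u) :
    HasDerivAt (fun v => (φ v).2) (ε * (2 * A * (φ u).1 ^ 3 + B * (φ u).1)) u := by
  simpa [quarticField] using h.hasFDerivAt.snd.hasDerivAt

/-- The flow preserves the curve `y² = A x⁴ + B x² + D`. -/
theorem quarticField_conserved {ε A B D : ℂ} {φ : ℂ → ℂ × ℂ} {r : ℝ}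
    (h : ∀ u ∈ ball (0 : ℂ) r, HasDerivAt φ (quarticField ε A B (φ u)) u)
    (h0 : (φ 0).2 ^ 2 = A * (φ 0).1 ^ 4 + B * (φ 0).1 ^ 2 + D) {u : ℂ} (hu : u ∈ ball (0 : ℂ) r) :
    (φ u).2 ^ 2 = A * (φ u).1 ^ 4 + B * (φ u).1 ^ 2 + D := by
  have := norm_sub_le_of_hasDerivAt_ball (C := 0)
    (f := fun u => (φ u).2 ^ 2 - (A * (φ u).1 ^ 4 + B * (φ u).1 ^ 2 + D)) (f' := fun _ => 0)
    (fun v hv => by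
      have h1 := hasDerivAt_fst_of_quarticField (h v hv)
      have h2 := hasDerivAt_snd_of_quarticField (h v hv)
      have h3 := (h2.pow 2).sub ((((h1.pow 4).const_mul A).add ((h1.pow 2).const_mul B)).add_const D)
      refine h3.congr_deriv ?_
      push_cast; ring) (fun v _ => by simp) hu
  simp only [h0, sub_self, sub_zero, zero_mul, norm_le_zero_iff] at this
  linear_combination this

/-- Holomorphic functions are analytic and so strictly differentiable, which is what the inverse
function theorem needs. -/
theorem hasStrictDerivAt_of_eventually {f f' : ℂ → ℂ} {u₀ : ℂ}
    (h : ∀ᶠ u in 𝓝 u₀, HasDerivAt f (f' u) u) : HasStrictDerivAt f (f' u₀) u₀ := by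
  have : AnalyticAt ℂ f u₀ := by
    rw [Complex.analyticAt_iff_eventually_differentiableAt]
    exact h.mono fun u hu => hu.differentiableAt
  have h2 := this.hasStrictDerivAt
  rwa [h.self_of_nhds.deriv] at h2

/-- At a smooth point of the curve `y² = A x⁴ + B x² + D` a solution covers a neighbourhood on the
curve. -/
theorem quarticField_open {ε A B D : ℂ} (hε : ε ≠ 0) {φ : ℂ → ℂ × ℂ} {u₀ : ℂ}
    (h : ∀ᶠ u in 𝓝 u₀, HasDerivAt φ (quarticField ε A B (φ u)) u)
    (hc : ∀ᶠ u in 𝓝 u₀, (φ u).2 ^ 2 = A * (φ u).1 ^ 4 + B * (φ u).1 ^ 2 + D)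
    (hs : (φ u₀).2 = 0 → 2 * A * (φ u₀).1 ^ 3 + B * (φ u₀).1 ≠ 0) {N : Set ℂ} (hN : N ∈ 𝓝 u₀) :
    ∀ᶠ q in 𝓝 (φ u₀), q.2 ^ 2 = A * q.1 ^ 4 + B * q.1 ^ 2 + D → q ∈ φ '' N := by
  have hx := hasStrictDerivAt_of_eventually (h.mono fun u hu => hasDerivAt_fst_of_quarticField hu)
  have hy := hasStrictDerivAt_of_eventually (h.mono fun u hu => hasDerivAt_snd_of_quarticField hu)
  by_cases hy0 : (φ u₀).2 = 0
  -- Where y = 0 the coordinate y of the solution is locally onto. A point of the curve with the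
  -- same y has the same value of the quartic in x, and this quartic is injective near a simple
  -- zero.
  · have hmap := hy.map_nhds_eq (mul_ne_zero hε (hs hy0))
    have hQ : HasStrictDerivAt (fun x : ℂ => A * x ^ 4 + B * x ^ 2 + D)
        (2 * (2 * A * (φ u₀).1 ^ 3 + B * (φ u₀).1)) (φ u₀).1 := by
      have h1 := (((hasStrictDerivAt_id (𝕜 := ℂ) (φ u₀).1).pow 4).const_mul A).add
        (((hasStrictDerivAt_id (𝕜 := ℂ) (φ u₀).1).pow 2).const_mul B)
      refine (h1.add_const D).congr_deriv ?_
      simp; ring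
    obtain ⟨S, hS, hinj⟩ : ∃ S ∈ 𝓝 (φ u₀).1, InjOn (fun x : ℂ => A * x ^ 4 + B * x ^ 2 + D) S := by
      have := (hQ.hasStrictFDerivAt_equiv (mul_ne_zero two_ne_zero (hs hy0)))
      exact ⟨_, this.toOpenPartialHomeomorph _ |>.open_source.mem_nhds
        this.mem_toOpenPartialHomeomorph_source, (this.toOpenPartialHomeomorph _).injOn⟩
    have hN' : N ∩ {u | (φ u).1 ∈ S} ∩
        {u | (φ u).2 ^ 2 = A * (φ u).1 ^ 4 + B * (φ u).1 ^ 2 + D} ∈ 𝓝 u₀ :=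
      inter_mem (inter_mem hN (hx.hasDerivAt.continuousAt hS)) hc
    have hm : (fun u => (φ u).2) '' (N ∩ {u | (φ u).1 ∈ S} ∩
        {u | (φ u).2 ^ 2 = A * (φ u).1 ^ 4 + B * (φ u).1 ^ 2 + D}) ∈ 𝓝 (φ u₀).2 := by
      rw [← hmap]; exact image_mem_map hN'
    filter_upwards [continuousAt_snd hm, continuousAt_fst hS] with q hq hq1 hqc
    obtain ⟨u, ⟨⟨huN, huS⟩, huc⟩, hu⟩ := hq
    refine ⟨u, huN, Prod.ext ?_ hu⟩
    apply hinj huS hq1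
    simp only at hu ⊢
    rw [← huc, ← hqc, hu]
  -- Where y ≠ 0 the coordinate x is locally onto, and y is determined by x up to its sign. Both y
  -- and -y cannot be closer to `(φ u₀).2` than the norm of that number.
  · have hmap := hx.map_nhds_eq (mul_ne_zero hε hy0)
    have hnb : {y : ℂ | ‖y - (φ u₀).2‖ < ‖(φ u₀).2‖} ∈ 𝓝 (φ u₀).2 := by
      have := ball_mem_nhds (φ u₀).2 (norm_pos_iff.2 hy0)
      filter_upwards [this] with y hy
      rwa [mem_ball, dist_eq_norm] at hy
    have hN' : N ∩ {u | ‖(φ u).2 - (φ u₀).2‖ < ‖(φ u₀).2‖} ∩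
        {u | (φ u).2 ^ 2 = A * (φ u).1 ^ 4 + B * (φ u).1 ^ 2 + D} ∈ 𝓝 u₀ :=
      inter_mem (inter_mem hN (hy.hasDerivAt.continuousAt hnb)) hc
    have hm := image_mem_map (m := fun u => (φ u).1) hN'
    rw [hmap] at hm
    filter_upwards [continuousAt_fst hm, continuousAt_snd hnb] with q hq hq2 hqc
    obtain ⟨u, ⟨⟨huN, huS⟩, huc⟩, hu⟩ := hq
    refine ⟨u, huN, Prod.ext hu ?_⟩
    simp only at hu
    rw [mem_ofPred_eq, hu, ← hqc, sq_eq_sq_iff_eq_or_eq_neg] at huc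
    rcases huc with huc | huc
    · exact huc
    · exfalso
      simp only [mem_ofPred_eq] at huS
      rw [huc] at huS
      have h1 : ‖q.2 - (φ u₀).2‖ < ‖(φ u₀).2‖ := hq2
      have h2 : (2 : ℂ) * (φ u₀).2 = -(q.2 - (φ u₀).2) - (-q.2 - (φ u₀).2) := by ring
      have h3 := norm_sub_le (-(q.2 - (φ u₀).2)) (-q.2 - (φ u₀).2)
      rw [← h2, norm_neg, norm_mul] at h3
      norm_num at h3
      linarith

end Hamiltonian

theorem a₂_sq (t : ℂ) : a₂ t ^ 2 = -2 - t := by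
  unfold a₂
  rw [← Complex.cpow_nat_mul]
  norm_num

theorem b₂_sq (t : ℂ) : b₂ t ^ 2 = 2 - t := by
  unfold b₂
  rw [← Complex.cpow_nat_mul]
  norm_num

theorem R_eq (t z : ℂ) : R t z = 1 * z ^ 4 + 2 * t * z ^ 2 + (t ^ 2 - 4) := by
  rw [R, a₂_sq, b₂_sq]; ring

/-- Both charts have an equation y² = A x⁴ + B x² + D with B = 2t. Passing from one to the other
exchanges A and D, so the same vector fields serve in both. -/
theorem R_infty_eq (t u : ℂ) : (1 - a₂ t ^ 2 * u ^ 2) * (1 - b₂ t ^ 2 * u ^ 2) =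
    (t ^ 2 - 4) * u ^ 4 + 2 * t * u ^ 2 + 1 := by
  rw [a₂_sq, b₂_sq]; ring

/-! ### The topology of the surface -/

namespace Surface

variable {t : ℂ}

theorem isOpen_iff {s : Set (Surface t)} :
    IsOpen s ↔ IsOpen (pt ⁻¹' s) ∧ IsOpen (ofInftyCurve ⁻¹' s) := Iff.rfl

theorem continuous_pt : Continuous (pt : AffineCurve t → Surface t) :=
  continuous_def.2 fun _ hs => (isOpen_iff.1 hs).1

theorem continuous_ofInftyCurve : Continuous (ofInftyCurve : InftyCurve t → Surface t) :=
  continuous_def.2 fun _ hs => (isOpen_iff.1 hs).2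

theorem pt_injective : Function.Injective (pt : AffineCurve t → Surface t) :=
  fun _ _ h => by injection h

theorem ofInftyCurve_of_ne {q : InftyCurve t} (h : q.1.1 ≠ 0) :
    ofInftyCurve q = pt ⟨(1 / q.1.1, q.1.2 / q.1.1 ^ 2), inftyCurve_sq q h⟩ := by
  rw [ofInftyCurve, dif_neg h]

theorem ofInftyCurve_of_eq {q : InftyCurve t} (h : q.1.1 = 0) :
    (q.1.2 = 1 ∧ ofInftyCurve q = infty 0) ∨ (q.1.2 = -1 ∧ ofInftyCurve q = infty 1) := by
  have h1 := q.2
  rw [h] at h1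
  have h2 : q.1.2 = 1 ∨ q.1.2 = -1 := by
    exact sq_eq_sq_iff_eq_or_eq_neg.1 (by simpa using h1)
  rcases h2 with h2 | h2
  · left; simp [ofInftyCurve, h, h2]
  · right
    have h3 : q.1.2 ≠ 1 := by rw [h2]; norm_num
    refine ⟨h2, ?_⟩
    rw [ofInftyCurve, dif_pos h, if_neg h3]

theorem ofInftyCurve_injective : Function.Injective (ofInftyCurve : InftyCurve t → Surface t) := by
  intro q q' h
  by_cases hq : q.1.1 = 0 <;> by_cases hq' : q'.1.1 = 0
  · rcases ofInftyCurve_of_eq hq with ⟨h1, h2⟩ | ⟨h1, h2⟩ <;>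
    rcases ofInftyCurve_of_eq hq' with ⟨h3, h4⟩ | ⟨h3, h4⟩ <;> rw [h2, h4] at h
    · exact Subtype.ext (Prod.ext (hq.trans hq'.symm) (h1.trans h3.symm))
    · simp at h
    · simp at h
    · exact Subtype.ext (Prod.ext (hq.trans hq'.symm) (h1.trans h3.symm))
  · rw [ofInftyCurve_of_ne hq'] at h
    rcases ofInftyCurve_of_eq hq with ⟨h1, h2⟩ | ⟨h1, h2⟩ <;> rw [h2] at h <;> cases h
  · rw [ofInftyCurve_of_ne hq] at h
    rcases ofInftyCurve_of_eq hq' with ⟨h1, h2⟩ | ⟨h1, h2⟩ <;> rw [h2] at h <;> cases h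
  · rw [ofInftyCurve_of_ne hq, ofInftyCurve_of_ne hq'] at h
    have h := congrArg Subtype.val (pt_injective h)
    simp only [Prod.mk.injEq, one_div, inv_inj] at h
    obtain ⟨h1, h2⟩ := h
    refine Subtype.ext (Prod.ext h1 ?_)
    rw [h1] at h2
    field_simp at h2
    exact h2

theorem exists_ofInftyCurve_eq_pt {p : AffineCurve t} (h : p.1.1 ≠ 0) :
    ∃ q : InftyCurve t, q.1 = (1 / p.1.1, p.1.2 / p.1.1 ^ 2) ∧ ofInftyCurve q = pt p := by
  have hq : (p.1.2 / p.1.1 ^ 2) ^ 2 =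
      (1 - a₂ t ^ 2 * (1 / p.1.1) ^ 2) * (1 - b₂ t ^ 2 * (1 / p.1.1) ^ 2) := by
    have h1 := p.2
    unfold R at h1
    field_simp
    exact h1
  refine ⟨⟨(1 / p.1.1, p.1.2 / p.1.1 ^ 2), hq⟩, rfl, ?_⟩
  rw [ofInftyCurve_of_ne (by simpa using h)]
  congr 1
  refine Subtype.ext (Prod.ext ?_ ?_)
  · simp
  · simp only; field_simp

theorem exists_ofInftyCurve_eq_infty (k : Fin 2) :
    ∃ q : InftyCurve t, q.1 = (0, (-1) ^ (k : ℕ)) ∧ ofInftyCurve q = infty k := by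
  refine ⟨⟨(0, (-1) ^ (k : ℕ)), by rw [← pow_mul, mul_comm, pow_mul]; simp⟩, rfl, ?_⟩
  fin_cases k
  · simp [ofInftyCurve]
  · have : (-1 : ℂ) ≠ 1 := by norm_num
    simp [ofInftyCurve, this]

/-- The transition map (u, v) ↦ (1/u, v/u²) is continuous off u = 0, and no point with u = 0 lies in
the affine chart. -/
theorem isOpenMap_pt : IsOpenMap (pt : AffineCurve t → Surface t) := by
  intro U hU
  refine isOpen_iff.2 ⟨by rwa [preimage_image_eq _ pt_injective], ?_⟩
  obtain ⟨W, hW, rfl⟩ := isOpen_induced_iff.1 hU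
  have : (ofInftyCurve ⁻¹' (pt '' (Subtype.val ⁻¹' W)) : Set (InftyCurve t)) =
      {q | q.1.1 ≠ 0 ∧ (1 / q.1.1, q.1.2 / q.1.1 ^ 2) ∈ W} := by
    ext q
    constructor
    · rintro ⟨p, hp, hpq⟩
      by_cases hq : q.1.1 = 0
      · rcases ofInftyCurve_of_eq hq with ⟨h1, h2⟩ | ⟨h1, h2⟩ <;> rw [h2] at hpq <;> cases hpq
      · rw [ofInftyCurve_of_ne hq] at hpq
        refine ⟨hq, ?_⟩
        rw [pt_injective hpq] at hp
        exact hp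
    · rintro ⟨hq, hqW⟩
      exact ⟨_, hqW, (ofInftyCurve_of_ne hq).symm⟩
  rw [this]
  rw [isOpen_iff_mem_nhds]
  rintro q ⟨hq, hqW⟩
  have c1 : ContinuousAt (fun q : InftyCurve t => q.1.1) q := by fun_prop
  have c2 : ContinuousAt (fun q : InftyCurve t => (1 / q.1.1, q.1.2 / q.1.1 ^ 2)) q := by
    have : q.1.1 ^ 2 ≠ 0 := pow_ne_zero 2 hq
    fun_prop (disch := assumption)
  exact inter_mem (c1.eventually_ne hq) (c2 (hW.mem_nhds hqW))

theorem isOpenMap_ofInftyCurve : IsOpenMap (ofInftyCurve : InftyCurve t → Surface t) := by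
  intro U hU
  refine isOpen_iff.2 ⟨?_, by rwa [preimage_image_eq _ ofInftyCurve_injective]⟩
  obtain ⟨W, hW, rfl⟩ := isOpen_induced_iff.1 hU
  have : (pt ⁻¹' (ofInftyCurve '' (Subtype.val ⁻¹' W)) : Set (AffineCurve t)) =
      {p | p.1.1 ≠ 0 ∧ (1 / p.1.1, p.1.2 / p.1.1 ^ 2) ∈ W} := by
    ext p
    constructor
    · rintro ⟨q, hq, hpq⟩
      by_cases hq0 : q.1.1 = 0
      · rcases ofInftyCurve_of_eq hq0 with ⟨h1, h2⟩ | ⟨h1, h2⟩ <;> rw [h2] at hpq <;> cases hpq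
      · have hp : p.1.1 ≠ 0 := by
          rw [ofInftyCurve_of_ne hq0] at hpq
          rw [← pt_injective hpq]; simpa using hq0
        obtain ⟨q', hq', hpq'⟩ := exists_ofInftyCurve_eq_pt hp
        refine ⟨hp, ?_⟩
        rw [← hq', ofInftyCurve_injective (hpq'.trans hpq.symm)]
        exact hq
    · rintro ⟨hp, hpW⟩
      obtain ⟨q', hq', hpq'⟩ := exists_ofInftyCurve_eq_pt hp
      exact ⟨q', by rw [mem_preimage, hq']; exact hpW, hpq'⟩
  rw [this]
  rw [isOpen_iff_mem_nhds]
  rintro q ⟨hq, hqW⟩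
  have c1 : ContinuousAt (fun q : AffineCurve t => q.1.1) q := by fun_prop
  have c2 : ContinuousAt (fun q : AffineCurve t => (1 / q.1.1, q.1.2 / q.1.1 ^ 2)) q := by
    have : q.1.1 ^ 2 ≠ 0 := pow_ne_zero 2 hq
    fun_prop (disch := assumption)
  exact inter_mem (c1.eventually_ne hq) (c2 (hW.mem_nhds hqW))

theorem isOpenEmbedding_pt : IsOpenEmbedding (pt : AffineCurve t → Surface t) :=
  .of_continuous_injective_isOpenMap continuous_pt pt_injective isOpenMap_pt

theorem isOpenEmbedding_ofInftyCurve : IsOpenEmbedding (ofInftyCurve : InftyCurve t → Surface t) :=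
  .of_continuous_injective_isOpenMap continuous_ofInftyCurve ofInftyCurve_injective
    isOpenMap_ofInftyCurve

/-- Points over 0 and points over ∞ are the only ones without a common chart. The sets |z| < 1 and
|1/z| < 1 separate them. -/
theorem separated_pt_infty (p : AffineCurve t) (hp : p.1.1 = 0) (k : Fin 2) :
    ∃ U V : Set (Surface t), IsOpen U ∧ IsOpen V ∧ pt p ∈ U ∧ infty k ∈ V ∧ Disjoint U V := by
  refine ⟨pt '' {q | ‖q.1.1‖ < 1}, ofInftyCurve '' {q | ‖q.1.1‖ < 1}, isOpenMap_pt _ ?_,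
    isOpenMap_ofInftyCurve _ ?_, ⟨p, by simp [hp], rfl⟩, ?_, ?_⟩
  · exact isOpen_lt (by fun_prop) (by fun_prop)
  · exact isOpen_lt (by fun_prop) (by fun_prop)
  · obtain ⟨q, hq, hqk⟩ := exists_ofInftyCurve_eq_infty (t := t) k
    exact ⟨q, by simp [hq], hqk⟩
  · rw [Set.disjoint_left]
    rintro _ ⟨q, hq, rfl⟩ ⟨q', hq', h⟩
    by_cases hq0 : q'.1.1 = 0
    · rcases ofInftyCurve_of_eq hq0 with ⟨h1, h2⟩ | ⟨h1, h2⟩ <;> rw [h2] at h <;> cases h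
    · rw [ofInftyCurve_of_ne hq0] at h
      have h := pt_injective h
      rw [← h] at hq
      simp only [mem_ofPred_eq, one_div, norm_inv] at hq hq'
      have := one_lt_inv_iff₀.2 ⟨norm_pos_iff.2 hq0, hq'⟩
      linarith

/-- The Hausdorff property makes coincidence sets of integral curves closed, which global uniqueness
of the flow relies on. -/
instance : T2Space (Surface t) := by
  refine ⟨fun p q hpq => ?_⟩
  have hpt : ∀ p q : AffineCurve t, pt p ≠ pt q → ∃ U V : Set (Surface t), IsOpen U ∧ IsOpen V ∧
      pt p ∈ U ∧ pt q ∈ V ∧ Disjoint U V := by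
    intro p q h
    obtain ⟨U, V, hU, hV, hp, hq, hd⟩ := t2_separation (fun hh => h (congrArg pt hh))
    exact ⟨_, _, isOpenMap_pt U hU, isOpenMap_pt V hV, mem_image_of_mem _ hp,
      mem_image_of_mem _ hq, (disjoint_image_iff pt_injective).2 hd⟩
  have hinf : ∀ p q : InftyCurve t, ofInftyCurve p ≠ ofInftyCurve q → ∃ U V : Set (Surface t),
      IsOpen U ∧ IsOpen V ∧ ofInftyCurve p ∈ U ∧ ofInftyCurve q ∈ V ∧ Disjoint U V := by
    intro p q h
    obtain ⟨U, V, hU, hV, hp, hq, hd⟩ := t2_separation (fun hh => h (congrArg ofInftyCurve hh))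
    exact ⟨_, _, isOpenMap_ofInftyCurve U hU, isOpenMap_ofInftyCurve V hV, mem_image_of_mem _ hp,
      mem_image_of_mem _ hq, (disjoint_image_iff ofInftyCurve_injective).2 hd⟩
  have hmix : ∀ (p : AffineCurve t) (k : Fin 2), ∃ U V : Set (Surface t), IsOpen U ∧ IsOpen V ∧
      pt p ∈ U ∧ infty k ∈ V ∧ Disjoint U V := by
    intro p k
    by_cases hp : p.1.1 = 0
    · exact separated_pt_infty p hp k
    · obtain ⟨q, -, hq⟩ := exists_ofInftyCurve_eq_pt hp
      obtain ⟨q', -, hq'⟩ := exists_ofInftyCurve_eq_infty (t := t) k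
      have := hinf q q' (by rw [hq, hq']; simp)
      rwa [hq, hq'] at this
  cases p with
  | pt p =>
    cases q with
    | pt q => exact hpt p q hpq
    | infty k => exact hmix p k
  | infty k =>
    cases q with
    | pt q =>
      obtain ⟨U, V, hU, hV, h1, h2, hd⟩ := hmix q k
      exact ⟨V, U, hV, hU, h2, h1, hd.symm⟩
    | infty l =>
      obtain ⟨q, -, hq⟩ := exists_ofInftyCurve_eq_infty (t := t) k
      obtain ⟨q', -, hq'⟩ := exists_ofInftyCurve_eq_infty (t := t) l
      have := hinf q q' (by rw [hq, hq']; exact hpq)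
      rwa [hq, hq'] at this

end Surface

/-- Integral curves come from maps into ℂ² that satisfy the equation of the curve only near the
given time; this passes continuity on to the surface. -/
theorem continuousAt_of_eventually_eq_subtype {X Y Z : Type*} [TopologicalSpace X]
    [TopologicalSpace Y] [TopologicalSpace Z] {P : Y → Prop} {g : {y // P y} → Z}
    (hg : Continuous g) {f : X → Y} {ψ : X → Z} {x : X} (hf : ContinuousAt f x)
    (h : ∀ᶠ v in 𝓝 x, ∃ hv : P (f v), ψ v = g ⟨f v, hv⟩) : ContinuousAt ψ x := by
  obtain ⟨hx, hψ⟩ := h.self_of_nhds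
  rw [ContinuousAt, hψ]
  intro S hS
  have h1 : g ⁻¹' S ∈ 𝓝 (⟨f x, hx⟩ : {y // P y}) := hg.continuousAt hS
  rw [nhds_subtype_eq_comap] at h1
  obtain ⟨W, hW, hWS⟩ := h1
  rw [mem_map]
  filter_upwards [h, hf hW] with v hv hvW
  obtain ⟨hv, hvψ⟩ := hv
  rw [mem_preimage, hvψ]
  exact hWS (show (⟨f v, hv⟩ : {y // P y}) ∈ Subtype.val ⁻¹' W from hvW)

/-! ### Integral curves on the surface -/

namespace Surface

variable {t : ℂ}

/-- Near `u` the map `ψ` is an integral curve, in the affine chart, of the vector field dual to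
`dz / w`. -/
def IsAffineFlowAt (ψ : ℂ → Surface t) (u : ℂ) : Prop :=
  ∃ f : ℂ → ℂ × ℂ, (∀ᶠ v in 𝓝 u, ∃ h, ψ v = pt ⟨f v, h⟩) ∧
    ∀ᶠ v in 𝓝 u, HasDerivAt f (quarticField 1 1 (2 * t) (f v)) v

/-- Near `u` the map `ψ` is an integral curve, in the chart at infinity, of the vector field dual
to `dz / w`. -/
def IsInftyFlowAt (ψ : ℂ → Surface t) (u : ℂ) : Prop :=
  ∃ f : ℂ → ℂ × ℂ, (∀ᶠ v in 𝓝 u, ∃ h, ψ v = ofInftyCurve ⟨f v, h⟩) ∧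
    ∀ᶠ v in 𝓝 u, HasDerivAt f (quarticField (-1) (t ^ 2 - 4) (2 * t) (f v)) v

/-- Near `u` the map `ψ` is a holomorphic integral curve of the vector field dual to `dz / w`. -/
def IsFlowAt (ψ : ℂ → Surface t) (u : ℂ) : Prop := IsAffineFlowAt ψ u ∨ IsInftyFlowAt ψ u

theorem IsFlowAt.continuousAt {ψ : ℂ → Surface t} {u : ℂ} (h : IsFlowAt ψ u) :
    ContinuousAt ψ u := by
  rcases h with ⟨f, h1, h2⟩ | ⟨f, h1, h2⟩
  · exact continuousAt_of_eventually_eq_subtype continuous_pt h2.self_of_nhds.continuousAt h1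
  · exact continuousAt_of_eventually_eq_subtype continuous_ofInftyCurve
      h2.self_of_nhds.continuousAt h1

/-- With z = 1/u and w = v/u² one has dz/w = -du/v. Hence the sign -1 of the field at infinity, and
the two notions agree where both charts apply. -/
theorem IsInftyFlowAt.isAffineFlowAt {ψ : ℂ → Surface t} {u : ℂ} (h : IsInftyFlowAt ψ u)
    {p : AffineCurve t} (hp : ψ u = pt p) : IsAffineFlowAt ψ u := by
  obtain ⟨f, h1, h2⟩ := h
  have hne : (f u).1 ≠ 0 := by
    obtain ⟨hu, hψ⟩ := h1.self_of_nhds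
    intro h0
    rcases ofInftyCurve_of_eq (q := ⟨f u, hu⟩) h0 with ⟨_, h4⟩ | ⟨_, h4⟩ <;>
      rw [hψ, h4] at hp <;> cases hp
  have hne' : ∀ᶠ v in 𝓝 u, (f v).1 ≠ 0 :=
    (continuousAt_fst.comp h2.self_of_nhds.continuousAt).eventually_ne hne
  refine ⟨fun v => (1 / (f v).1, (f v).2 / (f v).1 ^ 2), ?_, ?_⟩
  · filter_upwards [h1, hne'] with v hv hv0
    obtain ⟨hv, hvψ⟩ := hv
    exact ⟨inftyCurve_sq ⟨f v, hv⟩ hv0, by rw [hvψ, ofInftyCurve_of_ne (q := ⟨f v, hv⟩) hv0]⟩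
  · filter_upwards [h1, h2, hne'] with v hv hvd hv0
    obtain ⟨hv, -⟩ := hv
    have e := hv
    rw [R_infty_eq] at e
    have d1 := hasDerivAt_fst_of_quarticField hvd
    have d2 := hasDerivAt_snd_of_quarticField hvd
    have d3 := d1.inv hv0
    have d4 := d2.div (d1.pow 2) (pow_ne_zero 2 hv0)
    have d5 := d3.prodMk d4
    simp only [one_div]
    refine d5.congr_deriv (Prod.ext ?_ ?_)
    · simp [quarticField]
    · simp only [quarticField, Pi.pow_apply]
      field_simp
      linear_combination 2 * (f v).1 * e

theorem IsFlowAt.isAffineFlowAt {ψ : ℂ → Surface t} {u : ℂ} (h : IsFlowAt ψ u)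
    {p : AffineCurve t} (hp : ψ u = pt p) : IsAffineFlowAt ψ u :=
  h.elim id fun h => h.isAffineFlowAt hp

theorem IsFlowAt.isInftyFlowAt {ψ : ℂ → Surface t} {u : ℂ} (h : IsFlowAt ψ u)
    {k : Fin 2} (hp : ψ u = infty k) : IsInftyFlowAt ψ u := by
  refine h.elim (fun h => ?_) id
  obtain ⟨f, h1, h2⟩ := h
  obtain ⟨hu, hψ⟩ := h1.self_of_nhds
  rw [hp] at hψ; cases hψ

theorem IsFlowAt.eventuallyEq {ψ₁ ψ₂ : ℂ → Surface t} {u : ℂ} (h₁ : IsFlowAt ψ₁ u)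
    (h₂ : IsFlowAt ψ₂ u) (h : ψ₁ u = ψ₂ u) : ψ₁ =ᶠ[𝓝 u] ψ₂ := by
  cases hp : ψ₁ u with
  | pt p =>
    obtain ⟨f, hf1, hf2⟩ := h₁.isAffineFlowAt hp
    obtain ⟨g, hg1, hg2⟩ := h₂.isAffineFlowAt (h.symm.trans hp)
    have hfg : f u = g u := by
      obtain ⟨_, e1⟩ := hf1.self_of_nhds
      obtain ⟨_, e2⟩ := hg1.self_of_nhds
      exact congrArg Subtype.val (pt_injective (e1.symm.trans (h.trans e2)))
    filter_upwards [hf1, hg1, eventuallyEq_of_hasDerivAt (contDiff_quarticField _ _ _) hf2 hg2 hfg]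
      with v hv1 hv2 hv
    obtain ⟨_, e1⟩ := hv1
    obtain ⟨_, e2⟩ := hv2
    rw [e1, e2]; simp [hv]
  | infty k =>
    obtain ⟨f, hf1, hf2⟩ := h₁.isInftyFlowAt hp
    obtain ⟨g, hg1, hg2⟩ := h₂.isInftyFlowAt (h.symm.trans hp)
    have hfg : f u = g u := by
      obtain ⟨_, e1⟩ := hf1.self_of_nhds
      obtain ⟨_, e2⟩ := hg1.self_of_nhds
      exact congrArg Subtype.val (ofInftyCurve_injective (e1.symm.trans (h.trans e2)))
    filter_upwards [hf1, hg1, eventuallyEq_of_hasDerivAt (contDiff_quarticField _ _ _) hf2 hg2 hfg]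
      with v hv1 hv2 hv
    obtain ⟨_, e1⟩ := hv1
    obtain ⟨_, e2⟩ := hv2
    rw [e1, e2]; simp [hv]

theorem eqOn_of_isFlowAt {ψ₁ ψ₂ : ℂ → Surface t} {U : Set ℂ} (hU : IsPreconnected U)
    (h₁ : ∀ u ∈ U, IsFlowAt ψ₁ u) (h₂ : ∀ u ∈ U, IsFlowAt ψ₂ u) {u₀ : ℂ} (hu₀ : u₀ ∈ U)
    (h : ψ₁ u₀ = ψ₂ u₀) : EqOn ψ₁ ψ₂ U := by
  have c : ContinuousOn (fun u => (ψ₁ u, ψ₂ u)) U := fun u hu =>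
    ((h₁ u hu).continuousAt.prodMk (h₂ u hu).continuousAt).continuousWithinAt
  have := hU.subset_of_closure_inter_subset (u := {u | ψ₁ =ᶠ[𝓝 u] ψ₂})
    (isOpen_iff_mem_nhds.2 fun u hu => eventually_eventually_nhds.2 hu)
    ⟨u₀, hu₀, (h₁ u₀ hu₀).eventuallyEq (h₂ u₀ hu₀) h⟩ (by
      rintro u ⟨hu, huU⟩
      refine (h₁ u huU).eventuallyEq (h₂ u huU) ?_
      -- At a limit point of the coincidence set different values would, by the Hausdorff property,
      -- remain different nearby. So the values agree and local uniqueness applies again.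
      by_contra hne
      have hev := ((h₁ u huU).continuousAt.prodMk (h₂ u huU).continuousAt).eventually
        (isClosed_diagonal.isOpen_compl.mem_nhds (by simpa using hne))
      obtain ⟨v, hv1, hv2⟩ := (mem_closure_iff_nhds.1 hu) _ hev
      exact hv1 (by simpa using hv2.self_of_nhds))
  exact fun u hu => (this hu).self_of_nhds

theorem IsFlowAt.comp_add {ψ : ℂ → Surface t} {u c : ℂ} (h : IsFlowAt ψ (u + c)) :
    IsFlowAt (fun v => ψ (v + c)) u := by
  have hc : Tendsto (fun v => v + c) (𝓝 u) (𝓝 (u + c)) :=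
    (continuous_add_const c).tendsto u
  rcases h with ⟨f, h1, h2⟩ | ⟨f, h1, h2⟩
  · exact Or.inl ⟨fun v => f (v + c), hc.eventually h1, (hc.eventually h2).mono fun v hv =>
      hv.comp_add_const v c⟩
  · exact Or.inr ⟨fun v => f (v + c), hc.eventually h1, (hc.eventually h2).mono fun v hv =>
      hv.comp_add_const v c⟩

theorem IsFlowAt.congr {ψ₁ ψ₂ : ℂ → Surface t} {u : ℂ} (h : IsFlowAt ψ₁ u)
    (he : ψ₁ =ᶠ[𝓝 u] ψ₂) : IsFlowAt ψ₂ u := by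
  rcases h with ⟨f, h1, h2⟩ | ⟨f, h1, h2⟩
  · refine Or.inl ⟨f, ?_, h2⟩
    filter_upwards [h1, he] with v hv hv'
    rwa [← hv']
  · refine Or.inr ⟨f, ?_, h2⟩
    filter_upwards [h1, he] with v hv hv'
    rwa [← hv']

/-- Local flows exist on discs of a uniform radius. -/
theorem exists_local_flow (t : ℂ) : ∃ r > 0, ∀ p : Surface t, ∃ ψ : ℂ → Surface t, ψ 0 = p ∧
    ∀ u ∈ Metric.ball (0 : ℂ) r, IsFlowAt ψ u := by
  -- Each point satisfies |z| ≤ 2 in the affine chart or |u| ≤ 1 in the chart at infinity, and C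
  -- bounds the initial values in both cases. The uniform radius that results is what compactness
  -- contributes: it makes the flow complete.
  set C : ℝ := 4 + 16 + 4 * ‖2 * t‖ + ‖t ^ 2 - 4‖ with hC
  obtain ⟨r₁, hr₁, h₁⟩ := exists_quarticField_solution 1 1 (2 * t) C
  obtain ⟨r₂, hr₂, h₂⟩ := exists_quarticField_solution (-1) (t ^ 2 - 4) (2 * t) C
  have aff : ∀ p : AffineCurve t, ‖p.1.1‖ ≤ 2 → ∃ ψ : ℂ → Surface t, ψ 0 = pt p ∧
      ∀ u ∈ Metric.ball (0 : ℂ) r₁, IsFlowAt ψ u := by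
    intro p hp
    have hpc : p.1.2 ^ 2 = 1 * p.1.1 ^ 4 + 2 * t * p.1.1 ^ 2 + (t ^ 2 - 4) := by
      rw [p.2, R_eq]
    have hw : ‖p.1.2‖ ≤ C := by
      have h3 : ‖p.1.2‖ ^ 2 ≤ 16 + ‖2 * t‖ * 4 + ‖t ^ 2 - 4‖ := by
        rw [← norm_pow, hpc]
        refine (norm_add₃_le).trans ?_
        rw [one_mul, norm_pow, norm_mul _ (p.1.1 ^ 2), norm_pow p.1.1 2]
        have : ‖p.1.1‖ ^ 4 ≤ 2 ^ 4 := by gcongr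
        have : ‖p.1.1‖ ^ 2 ≤ 2 ^ 2 := by gcongr
        have : ‖2 * t‖ * ‖p.1.1‖ ^ 2 ≤ ‖2 * t‖ * 2 ^ 2 := by gcongr
        linarith
      nlinarith [norm_nonneg (2 * t), norm_nonneg (t ^ 2 - 4), norm_nonneg p.1.2]
    obtain ⟨φ, hφ0, hφ⟩ := h₁ p.1 (by
      rw [Prod.norm_def]
      refine max_le ?_ hw
      nlinarith [norm_nonneg (2 * t), norm_nonneg (t ^ 2 - 4)])
    have hcons : ∀ u ∈ Metric.ball (0 : ℂ) r₁, (φ u).2 ^ 2 = R t (φ u).1 := fun u hu => by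
      rw [R_eq]
      exact quarticField_conserved hφ (by rw [hφ0, hpc]) hu
    classical
    refine ⟨fun u => if h : (φ u).2 ^ 2 = R t (φ u).1 then pt ⟨φ u, h⟩ else pt p, ?_, ?_⟩
    · have : (φ 0).2 ^ 2 = R t (φ 0).1 := hcons 0 (by simpa using hr₁)
      simp only [this, dite_true]
      congr 1
      exact Subtype.ext hφ0
    · intro u hu
      have hn := Metric.isOpen_ball.mem_nhds hu
      refine Or.inl ⟨φ, ?_, ?_⟩
      · filter_upwards [hn] with v hv
        exact ⟨hcons v hv, by simp [hcons v hv]⟩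
      · filter_upwards [hn] with v hv using hφ v hv
  have inf : ∀ p : InftyCurve t, ‖p.1.1‖ ≤ 1 → ∃ ψ : ℂ → Surface t, ψ 0 = ofInftyCurve p ∧
      ∀ u ∈ Metric.ball (0 : ℂ) r₂, IsFlowAt ψ u := by
    intro p hp
    have hpc : p.1.2 ^ 2 = (t ^ 2 - 4) * p.1.1 ^ 4 + 2 * t * p.1.1 ^ 2 + 1 := by
      rw [p.2, R_infty_eq]
    have hw : ‖p.1.2‖ ≤ C := by
      have h3 : ‖p.1.2‖ ^ 2 ≤ ‖t ^ 2 - 4‖ * 1 + ‖2 * t‖ * 1 + 1 := by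
        rw [← norm_pow, hpc]
        refine (norm_add₃_le).trans ?_
        rw [norm_mul _ (p.1.1 ^ 4), norm_pow p.1.1 4, norm_mul _ (p.1.1 ^ 2), norm_pow p.1.1 2,
          norm_one]
        have : ‖p.1.1‖ ^ 4 ≤ 1 := pow_le_one₀ (norm_nonneg _) hp
        have : ‖p.1.1‖ ^ 2 ≤ 1 := pow_le_one₀ (norm_nonneg _) hp
        gcongr
      nlinarith [norm_nonneg (2 * t), norm_nonneg (t ^ 2 - 4), norm_nonneg p.1.2]
    obtain ⟨φ, hφ0, hφ⟩ := h₂ p.1 (by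
      rw [Prod.norm_def]
      refine max_le ?_ hw
      nlinarith [norm_nonneg (2 * t), norm_nonneg (t ^ 2 - 4)])
    have hcons : ∀ u ∈ Metric.ball (0 : ℂ) r₂, (φ u).2 ^ 2 =
        (1 - a₂ t ^ 2 * (φ u).1 ^ 2) * (1 - b₂ t ^ 2 * (φ u).1 ^ 2) := fun u hu => by
      rw [R_infty_eq]
      exact quarticField_conserved hφ (by rw [hφ0, hpc]) hu
    classical
    refine ⟨fun u => if h : (φ u).2 ^ 2 = (1 - a₂ t ^ 2 * (φ u).1 ^ 2) *
      (1 - b₂ t ^ 2 * (φ u).1 ^ 2) then ofInftyCurve ⟨φ u, h⟩ else ofInftyCurve p, ?_, ?_⟩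
    · have := hcons 0 (by simpa using hr₂)
      simp only [this, dite_true]
      congr 1
      exact Subtype.ext hφ0
    · intro u hu
      have hn := Metric.isOpen_ball.mem_nhds hu
      refine Or.inr ⟨φ, ?_, ?_⟩
      · filter_upwards [hn] with v hv
        exact ⟨hcons v hv, by simp [hcons v hv]⟩
      · filter_upwards [hn] with v hv using hφ v hv
  refine ⟨min r₁ r₂, lt_min hr₁ hr₂, fun p => ?_⟩
  have hb₁ : Metric.ball (0 : ℂ) (min r₁ r₂) ⊆ Metric.ball 0 r₁ :=
    Metric.ball_subset_ball (min_le_left _ _)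
  have hb₂ : Metric.ball (0 : ℂ) (min r₁ r₂) ⊆ Metric.ball 0 r₂ :=
    Metric.ball_subset_ball (min_le_right _ _)
  cases p with
  | pt p =>
    by_cases hp : ‖p.1.1‖ ≤ 2
    · obtain ⟨ψ, h0, hψ⟩ := aff p hp
      exact ⟨ψ, h0, fun u hu => hψ u (hb₁ hu)⟩
    · push Not at hp
      have hp0 : p.1.1 ≠ 0 := norm_pos_iff.1 (by linarith)
      obtain ⟨q, hq, hqp⟩ := exists_ofInftyCurve_eq_pt hp0
      obtain ⟨ψ, h0, hψ⟩ := inf q (by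
        rw [hq]; simp only [one_div, norm_inv]; exact inv_le_one_of_one_le₀ (by linarith))
      exact ⟨ψ, h0.trans hqp, fun u hu => hψ u (hb₂ hu)⟩
  | infty k =>
    obtain ⟨q, hq, hqp⟩ := exists_ofInftyCurve_eq_infty (t := t) k
    obtain ⟨ψ, h0, hψ⟩ := inf q (by rw [hq]; simp)
    exact ⟨ψ, h0.trans hqp, fun u hu => hψ u (hb₂ hu)⟩

end Surface

namespace Surface

variable {t : ℂ}

/-! ### The global flow -/

/-- A radius on which all local flows exist. -/
def flowRadius (t : ℂ) : ℝ := (exists_local_flow t).choose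

theorem flowRadius_pos (t : ℂ) : 0 < flowRadius t := (exists_local_flow t).choose_spec.1

/-- The local flow of the vector field dual to `dz / w`. -/
def localFlow (u : ℂ) (p : Surface t) : Surface t :=
  ((exists_local_flow t).choose_spec.2 p).choose u

theorem localFlow_zero (p : Surface t) : localFlow 0 p = p :=
  ((exists_local_flow t).choose_spec.2 p).choose_spec.1

theorem isFlowAt_localFlow (p : Surface t) {u : ℂ} (hu : ‖u‖ < flowRadius t) :
    IsFlowAt (fun v => localFlow v p) u :=
  ((exists_local_flow t).choose_spec.2 p).choose_spec.2 u (mem_ball_zero_iff.2 hu)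

/-- As functions of v, both sides are integral curves on a disc, and they agree at v = 0. -/
theorem localFlow_add (p : Surface t) {u v : ℂ} (h : ‖u‖ + ‖v‖ < flowRadius t) :
    localFlow (v + u) p = localFlow v (localFlow u p) := by
  refine eqOn_of_isFlowAt (U := Metric.ball 0 (flowRadius t - ‖u‖))
    (ψ₁ := fun v => localFlow (v + u) p) (ψ₂ := fun v => localFlow v (localFlow u p))
    (convex_ball _ _).isPreconnected (fun x hx => ?_) (fun x hx => ?_) (u₀ := 0) ?_ ?_ ?_
  · rw [mem_ball_zero_iff] at hx
    exact IsFlowAt.comp_add (ψ := fun v => localFlow v p)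
      (isFlowAt_localFlow p ((norm_add_le _ _).trans_lt (by linarith)))
  · rw [mem_ball_zero_iff] at hx
    exact isFlowAt_localFlow _ (by linarith [norm_nonneg u])
  · simp only [Metric.mem_ball, dist_self]; linarith [norm_nonneg v]
  · simp [localFlow_zero]
  · rw [mem_ball_zero_iff]; linarith

theorem localFlow_iterate (p : Surface t) (u : ℂ) (m : ℕ) (h : m * ‖u‖ < flowRadius t) :
    (localFlow u)^[m] p = localFlow (m * u) p := by
  induction m with
  | zero => simp [localFlow_zero]
  | succ m ih =>
    push_cast at h
    rw [Function.iterate_succ_apply', ih (by nlinarith [norm_nonneg u]), ← localFlow_add]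
    · congr 1; push_cast; ring
    · rw [norm_mul, Complex.norm_natCast]; linarith

/-- The action of `(ℂ, +)` on the surface by the flow of the vector field dual to `dz / w`. -/
def act (u : ℂ) (p : Surface t) : Surface t :=
  (localFlow (u / (⌊‖u‖ / flowRadius t⌋₊ + 1 : ℕ)))^[⌊‖u‖ / flowRadius t⌋₊ + 1] p

/-- A subdivision into short steps may be refined without changing the result. Any two subdivisions
therefore agree, through a common refinement. -/
theorem localFlow_iterate_div (p : Surface t) (u : ℂ) {n : ℕ} (hn : n ≠ 0) (m : ℕ) (hm : m ≠ 0)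
    (h : ‖u‖ / n < flowRadius t) :
    (localFlow (u / (n * m : ℕ)))^[n * m] p = (localFlow (u / n))^[n] p := by
  have hn' : (n : ℂ) ≠ 0 := by exact_mod_cast hn
  have hm' : (m : ℂ) ≠ 0 := by exact_mod_cast hm
  have : (localFlow (u / (n * m : ℕ)))^[m] = (localFlow (u / n) : Surface t → Surface t) := by
    funext q
    rw [localFlow_iterate]
    · congr 1; push_cast; field_simp
    · rw [norm_div, Complex.norm_natCast]
      push_cast
      have hmr : (m : ℝ) ≠ 0 := by exact_mod_cast hm
      have : (m : ℝ) * (‖u‖ / (n * m)) = ‖u‖ / n := by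
        field_simp
      rwa [this]
  rw [← this, ← Function.iterate_mul, mul_comm]

theorem act_eq_iterate (p : Surface t) (u : ℂ) {n : ℕ} (hn : n ≠ 0) (h : ‖u‖ / n < flowRadius t) :
    act u p = (localFlow (u / n))^[n] p := by
  set N := ⌊‖u‖ / flowRadius t⌋₊ + 1 with hN
  have hNu : ‖u‖ / N < flowRadius t := by
    have := Nat.lt_floor_add_one (‖u‖ / flowRadius t)
    rw [div_lt_iff₀ (flowRadius_pos t)] at this
    rw [div_lt_iff₀ (by positivity), hN]
    push_cast; linarith
  have hN0 : N ≠ 0 := by omega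
  have h1 := localFlow_iterate_div p u hn N hN0 h
  have h2 := localFlow_iterate_div p u hN0 n hn hNu
  rw [mul_comm] at h2
  rw [← h1, h2]; rfl

theorem act_eq_localFlow (p : Surface t) {u : ℂ} (h : ‖u‖ < flowRadius t) :
    act u p = localFlow u p := by
  rw [act_eq_iterate p u one_ne_zero (by simpa using h)]; simp

theorem act_zero (p : Surface t) : act 0 p = p := by
  rw [act_eq_localFlow p (by simpa using flowRadius_pos t), localFlow_zero]

/-- Divide both times by the same large n. The short flows of u/n and v/n commute, since each
composition is the flow of (u + v)/n, and so their n-th iterates combine. -/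
theorem act_add (u v : ℂ) (p : Surface t) : act (u + v) p = act u (act v p) := by
  obtain ⟨n, hn⟩ := exists_nat_gt ((‖u‖ + ‖v‖) / flowRadius t)
  have hr := flowRadius_pos t
  have hn0 : (0 : ℝ) < n := lt_of_le_of_lt (by positivity) hn
  have hn1 : n ≠ 0 := by rintro rfl; simp at hn0
  rw [div_lt_iff₀ hr] at hn
  have hs : ‖u‖ / n + ‖v‖ / n < flowRadius t := by
    rw [← add_div, div_lt_iff₀ hn0]; linarith
  have hu : ‖u‖ / n < flowRadius t := by linarith [div_nonneg (norm_nonneg v) hn0.le]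
  have hv : ‖v‖ / n < flowRadius t := by linarith [div_nonneg (norm_nonneg u) hn0.le]
  have e1 : ∀ q : Surface t, localFlow ((u + v) / n) q = localFlow (u / n) (localFlow (v / n) q) := by
    intro q
    rw [add_div, localFlow_add]
    rw [norm_div, norm_div, Complex.norm_natCast]; linarith
  have e2 : ∀ q : Surface t, localFlow ((u + v) / n) q = localFlow (v / n) (localFlow (u / n) q) := by
    intro q
    rw [add_comm, add_div, localFlow_add]
    rw [norm_div, norm_div, Complex.norm_natCast]; linarith
  have hcomm : Function.Commute (localFlow (u / n) : Surface t → Surface t) (localFlow (v / n)) :=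
    fun q => (e1 q).symm.trans (e2 q)
  rw [act_eq_iterate _ u hn1 hu, act_eq_iterate _ v hn1 hv, act_eq_iterate _ (u + v) hn1,
    ← Function.comp_apply (f := (localFlow (u / n))^[n]), ← hcomm.comp_iterate]
  · congr 1
    funext q
    exact e1 q
  · refine lt_of_le_of_lt ?_ hs
    rw [← add_div]
    gcongr
    exact norm_add_le _ _

/-- Near u the orbit is the local flow started at `act u p`, at the time v - u. -/
theorem isFlowAt_act (p : Surface t) (u : ℂ) : IsFlowAt (fun v => act v p) u := by
  have h1 : IsFlowAt (fun v => localFlow v (act u p)) (u + -u) := by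
    rw [add_neg_cancel]
    exact isFlowAt_localFlow _ (by simpa using flowRadius_pos t)
  refine h1.comp_add.congr ?_
  filter_upwards [Metric.ball_mem_nhds u (flowRadius_pos t)] with v hv
  rw [Metric.mem_ball, dist_eq_norm] at hv
  rw [← sub_eq_add_neg, ← act_eq_localFlow _ hv, ← act_add]; simp

theorem continuous_act (p : Surface t) : Continuous fun u => act u p :=
  continuous_iff_continuousAt.2 fun u => (isFlowAt_act p u).continuousAt

theorem eq_act_of_isFlowAt {ψ : ℂ → Surface t} (h : ∀ u, IsFlowAt ψ u) (u : ℂ) :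
    ψ u = act u (ψ 0) :=
  eqOn_of_isFlowAt isPreconnected_univ (fun u _ => h u) (fun u _ => isFlowAt_act (ψ 0) u)
    (mem_univ 0) (act_zero _).symm (mem_univ u)

theorem act_neg_act (u : ℂ) (p : Surface t) : act (-u) (act u p) = p := by
  rw [← act_add, neg_add_cancel, act_zero]

theorem act_eq_iff {u v : ℂ} {p q : Surface t} : act u p = act v q ↔ act (u - v) p = q := by
  constructor
  · intro h
    rw [show u - v = -v + u by ring, act_add, h, act_neg_act]
  · rintro rfl
    rw [← act_add]; congr 1; ring

/-! ### Involutions -/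

/-- The hyperelliptic involution `(z, w) ↦ (z, -w)`. -/
def conj : Surface t → Surface t
  | pt p => pt ⟨(p.1.1, -p.1.2), by rw [neg_sq]; exact p.2⟩
  | infty k => infty (1 - k)

theorem R_neg (z : ℂ) : R t (-z) = R t z := by simp [R]

/-- The involution `(z, w) ↦ (-z, -w)`. -/
def rot : Surface t → Surface t
  | pt p => pt ⟨(-p.1.1, -p.1.2), by rw [neg_sq, R_neg]; exact p.2⟩
  | infty k => infty (1 - k)

theorem conj_ofInftyCurve (x y : ℂ) (h) (h') :
    conj (ofInftyCurve ⟨(x, y), h⟩ : Surface t) = ofInftyCurve ⟨(x, -y), h'⟩ := by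
  by_cases hx : x = 0
  · rcases ofInftyCurve_of_eq (q := ⟨(x, y), h⟩) hx with ⟨h1, h2⟩ | ⟨h1, h2⟩ <;>
    rcases ofInftyCurve_of_eq (q := ⟨(x, -y), h'⟩) hx with ⟨h3, h4⟩ | ⟨h3, h4⟩ <;> rw [h2, h4]
    · simp only at h1 h3; rw [h1] at h3; norm_num at h3
    · rfl
    · rfl
    · simp only at h1 h3; rw [h1] at h3; norm_num at h3
  · rw [ofInftyCurve_of_ne (q := ⟨(x, y), h⟩) hx, ofInftyCurve_of_ne (q := ⟨(x, -y), h'⟩) hx]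
    simp [conj, neg_div]

theorem rot_ofInftyCurve (x y : ℂ) (h) (h') :
    rot (ofInftyCurve ⟨(x, y), h⟩ : Surface t) = ofInftyCurve ⟨(-x, -y), h'⟩ := by
  by_cases hx : x = 0
  · have hx' : -x = 0 := by simp [hx]
    rcases ofInftyCurve_of_eq (q := ⟨(x, y), h⟩) hx with ⟨h1, h2⟩ | ⟨h1, h2⟩ <;>
    rcases ofInftyCurve_of_eq (q := ⟨(-x, -y), h'⟩) hx' with ⟨h3, h4⟩ | ⟨h3, h4⟩ <;> rw [h2, h4]
    · simp only at h1 h3; rw [h1] at h3; norm_num at h3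
    · rfl
    · rfl
    · simp only at h1 h3; rw [h1] at h3; norm_num at h3
  · rw [ofInftyCurve_of_ne (q := ⟨(x, y), h⟩) hx,
      ofInftyCurve_of_ne (q := ⟨(-x, -y), h'⟩) (by simpa using hx)]
    simp [rot, neg_div, div_neg]

theorem conj_conj (p : Surface t) : conj (conj p) = p := by
  cases p <;> simp [conj]

/-- The change of sign of w changes the sign of dz/w, so it reverses time. -/
theorem isFlowAt_conj {ψ : ℂ → Surface t} {u : ℂ} (h : IsFlowAt ψ (-u)) :
    IsFlowAt (fun v => conj (ψ (-v))) u := by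
  have hc : Tendsto (fun v : ℂ => -v) (𝓝 u) (𝓝 (-u)) := continuous_neg.tendsto u
  rcases h with ⟨f, h1, h2⟩ | ⟨f, h1, h2⟩
  · refine Or.inl ⟨fun v => ((f (-v)).1, -(f (-v)).2), ?_, ?_⟩
    · filter_upwards [hc.eventually h1] with v hv
      obtain ⟨h, e⟩ := hv
      exact ⟨by simpa using h, by rw [e]; rfl⟩
    · filter_upwards [hc.eventually h2] with v hv
      have d1 := (hasDerivAt_fst_of_quarticField hv).scomp v (hasDerivAt_neg v)
      have d2 := (hasDerivAt_snd_of_quarticField hv).scomp v (hasDerivAt_neg v)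
      refine (d1.prodMk d2.neg).congr_deriv (Prod.ext ?_ ?_) <;> simp [quarticField]
  · refine Or.inr ⟨fun v => ((f (-v)).1, -(f (-v)).2), ?_, ?_⟩
    · filter_upwards [hc.eventually h1] with v hv
      obtain ⟨h, e⟩ := hv
      refine ⟨by simpa using h, by rw [e, ← conj_ofInftyCurve (h := h)]⟩
    · filter_upwards [hc.eventually h2] with v hv
      have d1 := (hasDerivAt_fst_of_quarticField hv).scomp v (hasDerivAt_neg v)
      have d2 := (hasDerivAt_snd_of_quarticField hv).scomp v (hasDerivAt_neg v)
      refine (d1.prodMk d2.neg).congr_deriv (Prod.ext ?_ ?_) <;> simp [quarticField]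

/-- d(-z)/(-w) = dz/w, so time is preserved. This symmetry is the origin of the half period. -/
theorem isFlowAt_rot {ψ : ℂ → Surface t} {u : ℂ} (h : IsFlowAt ψ u) :
    IsFlowAt (fun v => rot (ψ v)) u := by
  rcases h with ⟨f, h1, h2⟩ | ⟨f, h1, h2⟩
  · refine Or.inl ⟨fun v => (-(f v).1, -(f v).2), ?_, ?_⟩
    · filter_upwards [h1] with v hv
      obtain ⟨h, e⟩ := hv
      exact ⟨by simpa [R_neg] using h, by rw [e]; rfl⟩
    · filter_upwards [h2] with v hv
      have d1 := (hasDerivAt_fst_of_quarticField hv)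
      have d2 := (hasDerivAt_snd_of_quarticField hv)
      refine (d1.neg.prodMk d2.neg).congr_deriv (Prod.ext ?_ ?_) <;> simp [quarticField]
      ring
  · refine Or.inr ⟨fun v => (-(f v).1, -(f v).2), ?_, ?_⟩
    · filter_upwards [h1] with v hv
      obtain ⟨h, e⟩ := hv
      refine ⟨by simpa using h, by rw [e, ← rot_ofInftyCurve (h := h)]⟩
    · filter_upwards [h2] with v hv
      have d1 := (hasDerivAt_fst_of_quarticField hv)
      have d2 := (hasDerivAt_snd_of_quarticField hv)
      refine (d1.neg.prodMk d2.neg).congr_deriv (Prod.ext ?_ ?_) <;> simp [quarticField]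
      ring

theorem conj_act (u : ℂ) (p : Surface t) : conj (act u p) = act (-u) (conj p) := by
  have := eq_act_of_isFlowAt (fun v => isFlowAt_conj (u := v) (isFlowAt_act p (-v))) (-u)
  simpa [act_zero] using this

theorem rot_act (u : ℂ) (p : Surface t) : rot (act u p) = act u (rot p) := by
  have := eq_act_of_isFlowAt (fun v => isFlowAt_rot (u := v) (isFlowAt_act p v)) u
  simpa [act_zero] using this

/-! ### Local properties of the flow -/

theorem IsFlowAt.hasDerivAt_z {ψ : ℂ → Surface t} {u : ℂ} (h : IsFlowAt ψ u) {p : AffineCurve t}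
    (hp : ψ u = pt p) : HasDerivAt (fun v => (ψ v).z) ((ψ u).w) u := by
  obtain ⟨f, h1, h2⟩ := h.isAffineFlowAt hp
  have e := h1.self_of_nhds
  obtain ⟨hu, e⟩ := e
  have := hasDerivAt_fst_of_quarticField h2.self_of_nhds
  rw [e]
  refine (this.congr_of_eventuallyEq ?_).congr_deriv (by simp [w])
  filter_upwards [h1] with v hv
  obtain ⟨hv, e⟩ := hv
  rw [e]; rfl

/-- A common zero of R and R' has z = 0, with R = t² - 4, or z² = -t, with R = -4. Neither value
vanishes. -/
theorem smooth_of_ne (ht : t ^ 2 ≠ 4) {p : ℂ × ℂ} (hp : p.2 ^ 2 = R t p.1) (hw : p.2 = 0) :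
    2 * 1 * p.1 ^ 3 + 2 * t * p.1 ≠ 0 := by
  intro h
  rw [hw, R_eq] at hp
  have h1 : p.1 * (p.1 ^ 2 + t) = 0 := by linear_combination h / 2
  rcases mul_eq_zero.1 h1 with h2 | h2
  · rw [h2] at hp; exact ht (by linear_combination -hp)
  · have h3 : p.1 ^ 2 = -t := by linear_combination h2
    have : (0 : ℂ) = -4 := by linear_combination hp + (p.1 ^ 2 + t) * h3
    norm_num at this

/-- The vector field vanishes nowhere on the smooth curve, so orbit maps are open. Covering by
orbits and discreteness of times both rest on this. -/
theorem IsFlowAt.image_mem_nhds (ht : t ^ 2 ≠ 4) {ψ : ℂ → Surface t} {u : ℂ} (h : IsFlowAt ψ u)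
    {N : Set ℂ} (hN : N ∈ 𝓝 u) : ψ '' N ∈ 𝓝 (ψ u) := by
  cases hp : ψ u with
  | pt p =>
    obtain ⟨f, h1, h2⟩ := h.isAffineFlowAt hp
    obtain ⟨hu, e⟩ := h1.self_of_nhds
    have hopen := quarticField_open (D := t ^ 2 - 4) one_ne_zero h2
      (h1.mono fun v hv => by obtain ⟨hv, -⟩ := hv; rw [hv, R_eq]) (smooth_of_ne ht hu)
      (inter_mem hN h1)
    have hfu : f u = p.1 := congrArg Subtype.val (pt_injective (e.symm.trans hp))
    rw [hfu] at hopen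
    have h3 : ∀ᶠ q in 𝓝 p, pt q ∈ ψ '' N := by
      filter_upwards [continuousAt_subtype_val hopen] with q hq
      obtain ⟨v, ⟨hvN, hv1, hv2⟩, hvq⟩ := hq (by rw [q.2, R_eq])
      exact ⟨v, hvN, by rw [hv2]; congr 1; exact Subtype.ext hvq⟩
    rw [← isOpenEmbedding_pt.map_nhds_eq]
    exact h3
  | infty k =>
    obtain ⟨f, h1, h2⟩ := h.isInftyFlowAt hp
    obtain ⟨hu, e⟩ := h1.self_of_nhds
    obtain ⟨q₀, hq₀, hk⟩ := exists_ofInftyCurve_eq_infty (t := t) k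
    have hfu : (⟨f u, hu⟩ : InftyCurve t) = q₀ := ofInftyCurve_injective (e.symm.trans (hp.trans hk.symm))
    have hfu' : f u = q₀.1 := congrArg Subtype.val hfu
    have hopen := quarticField_open (D := 1) (neg_ne_zero.2 one_ne_zero) h2
      (h1.mono fun v hv => by obtain ⟨hv, -⟩ := hv; rw [hv, R_infty_eq])
      (by rw [hfu', hq₀]; simp) (inter_mem hN h1)
    rw [hfu'] at hopen
    have h3 : ∀ᶠ q in 𝓝 q₀, ofInftyCurve q ∈ ψ '' N := by
      filter_upwards [continuousAt_subtype_val hopen] with q hq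
      obtain ⟨v, ⟨hvN, hv1, hv2⟩, hvq⟩ := hq (by rw [q.2, R_infty_eq])
      exact ⟨v, hvN, by rw [hv2]; congr 1; exact Subtype.ext hvq⟩
    rw [← hk, ← isOpenEmbedding_ofInftyCurve.map_nhds_eq]
    exact h3

/-- Ramification points are simple zeros of w along an orbit, and points at infinity are simple
zeros of 1/z. Since `w` is 0 by convention at infinity, nonvanishing of `w` excludes both kinds of
points. -/
theorem IsFlowAt.eventually_w_ne_zero (ht : t ^ 2 ≠ 4) {ψ : ℂ → Surface t} {u : ℂ}
    (h : IsFlowAt ψ u) : ∀ᶠ v in 𝓝[≠] u, (ψ v).w ≠ 0 := by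
  cases hp : ψ u with
  | pt p =>
    obtain ⟨f, h1, h2⟩ := h.isAffineFlowAt hp
    obtain ⟨hu, e⟩ := h1.self_of_nhds
    have d2 := hasDerivAt_snd_of_quarticField h2.self_of_nhds
    have h3 : ∀ᶠ v in 𝓝[≠] u, (f v).2 ≠ 0 := by
      by_cases h0 : (f u).2 = 0
      · exact d2.eventually_ne (by simpa using smooth_of_ne ht hu h0)
      · exact eventually_nhdsWithin_of_eventually_nhds (d2.continuousAt.eventually_ne h0)
    filter_upwards [h3, eventually_nhdsWithin_of_eventually_nhds h1] with v hv hv1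
    obtain ⟨hv1, e⟩ := hv1
    rw [e]; exact hv
  | infty k =>
    obtain ⟨f, h1, h2⟩ := h.isInftyFlowAt hp
    obtain ⟨hu, e⟩ := h1.self_of_nhds
    obtain ⟨q₀, hq₀, hk⟩ := exists_ofInftyCurve_eq_infty (t := t) k
    have hfu : (⟨f u, hu⟩ : InftyCurve t) = q₀ := ofInftyCurve_injective (e.symm.trans (hp.trans hk.symm))
    have hfu' : f u = q₀.1 := congrArg Subtype.val hfu
    have hy0 : (f u).2 ≠ 0 := by rw [hfu', hq₀]; simp
    have d1 := hasDerivAt_fst_of_quarticField h2.self_of_nhds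
    have d2 := hasDerivAt_snd_of_quarticField h2.self_of_nhds
    have h3 : ∀ᶠ v in 𝓝[≠] u, (f v).1 ≠ 0 := d1.eventually_ne (by simpa using hy0)
    have h4 : ∀ᶠ v in 𝓝[≠] u, (f v).2 ≠ 0 :=
      eventually_nhdsWithin_of_eventually_nhds (d2.continuousAt.eventually_ne hy0)
    filter_upwards [h3, h4, eventually_nhdsWithin_of_eventually_nhds h1] with v hv hv' hv1
    obtain ⟨hv1, e⟩ := hv1
    rw [e, ofInftyCurve_of_ne (q := ⟨f v, hv1⟩) hv]
    exact div_ne_zero hv' (pow_ne_zero 2 hv)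

end Surface

namespace Surface

variable {t : ℂ}

theorem exists_eq_pt_of_w_ne_zero {p : Surface t} (h : p.w ≠ 0) : ∃ q, p = pt q := by
  cases p with
  | pt q => exact ⟨q, rfl⟩
  | infty k => exact absurd rfl h

theorem continuousAt_z {p : AffineCurve t} : ContinuousAt (z : Surface t → ℂ) (pt p) := by
  rw [ContinuousAt, ← isOpenEmbedding_pt.map_nhds_eq, tendsto_map'_iff]
  exact (continuous_fst.comp continuous_subtype_val).continuousAt

theorem continuousAt_w {p : AffineCurve t} : ContinuousAt (w : Surface t → ℂ) (pt p) := by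
  rw [ContinuousAt, ← isOpenEmbedding_pt.map_nhds_eq, tendsto_map'_iff]
  exact (continuous_snd.comp continuous_subtype_val).continuousAt

/-- Near a point with `w ≠ 0`, the time of the flow is a primitive of `dz / w`. -/
theorem exists_local_primitive (ht : t ^ 2 ≠ 4) {p : Surface t} (hp : p.w ≠ 0) :
    ∃ G : ℂ → ℂ, G p.z = 0 ∧ ∀ᶠ q in 𝓝 p, q.w ≠ 0 ∧ act (G q.z) p = q ∧
      HasDerivAt G (q.w)⁻¹ q.z := by
  have hflow := fun v => isFlowAt_act p v
  have h0 : act 0 p = p := act_zero p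
  obtain ⟨p₀, hp₀⟩ := exists_eq_pt_of_w_ne_zero hp
  have hwc : ∀ᶠ v in 𝓝 (0 : ℂ), (act v p).w ≠ 0 := by
    have : Tendsto (fun v => (act v p).w) (𝓝 0) (𝓝 p.w) := by
      have h1 := (continuous_act p).tendsto 0
      rw [h0, hp₀] at h1
      rw [hp₀]
      exact continuousAt_w.tendsto.comp h1
    exact this.eventually_ne hp
  have hd : ∀ᶠ v in 𝓝 (0 : ℂ), HasDerivAt (fun v => (act v p).z) ((act v p).w) v := by
    filter_upwards [hwc] with v hv
    obtain ⟨q, hq⟩ := exists_eq_pt_of_w_ne_zero hv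
    exact (hflow v).hasDerivAt_z hq
  have hs := hasStrictDerivAt_of_eventually hd
  have hne : (act (0 : ℂ) p).w ≠ 0 := by rwa [h0]
  -- Since z has the derivative w ≠ 0 along the orbit, z is locally invertible as a function of
  -- time; the inverse is the primitive.
  set e := (hs.hasStrictFDerivAt_equiv hne).toOpenPartialHomeomorph (fun v => (act v p).z) with he
  have hcoe : ∀ v, e v = (act v p).z := fun v => rfl
  have hsrc : e.source ∈ 𝓝 (0 : ℂ) := e.open_source.mem_nhds
    (hs.hasStrictFDerivAt_equiv hne).mem_toOpenPartialHomeomorph_source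
  refine ⟨e.symm, ?_, ?_⟩
  · have := e.left_inv (mem_of_mem_nhds hsrc)
    rwa [hcoe, h0] at this
  · have hN := (hflow 0).image_mem_nhds ht (inter_mem hsrc (inter_mem hwc hd))
    simp only [h0] at hN
    filter_upwards [hN] with q hq
    obtain ⟨v, ⟨hv1, hv2, hv3⟩, rfl⟩ := hq
    have h1 : e.symm (act v p).z = v := by rw [← hcoe, e.left_inv hv1]
    refine ⟨hv2, by simp only [h1], ?_⟩
    refine e.hasDerivAt_symm (by rw [← hcoe]; exact e.map_source hv1) hv2 ?_
    rw [h1]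
    exact hv3

/-! ### Paths are orbits -/

/-- The integral of `dz / w` along the initial piece of a path. -/
def partialIntegral (γ : ℝ → Surface t) (s : ℝ) : ℂ :=
  ∫ x in (0 : ℝ)..s, deriv (fun r => (γ r).z) x / (γ x).w

theorem IsPath.intervalIntegrable {γ : ℝ → Surface t} (hγ : IsPath γ) {x y : ℝ}
    (hx : x ∈ Icc (0 : ℝ) 1) (hy : y ∈ Icc (0 : ℝ) 1) :
    IntervalIntegrable (fun s => deriv (fun r => (γ r).z) s / (γ s).w) MeasureTheory.volume x y := by
  refine hγ.integrable.mono_set ?_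
  rw [uIcc_of_le zero_le_one]
  exact uIcc_subset_Icc hx hy

theorem IsPath.partialIntegral_sub {γ : ℝ → Surface t} (hγ : IsPath γ) {x y : ℝ}
    (hx : x ∈ Icc (0 : ℝ) 1) (hy : y ∈ Icc (0 : ℝ) 1) :
    partialIntegral γ y - partialIntegral γ x =
      ∫ s in x..y, deriv (fun r => (γ r).z) s / (γ s).w := by
  unfold partialIntegral
  rw [sub_eq_iff_eq_add, add_comm, intervalIntegral.integral_add_adjacent_intervals]
  · exact hγ.intervalIntegrable ⟨le_rfl, zero_le_one⟩ hx
  · exact hγ.intervalIntegrable hx hy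

theorem IsPath.continuousOn_partialIntegral {γ : ℝ → Surface t} (hγ : IsPath γ) :
    ContinuousOn (partialIntegral γ) (Icc 0 1) := by
  have := intervalIntegral.continuousOn_primitive_interval (μ := MeasureTheory.volume)
    (a := (0 : ℝ)) (b := 1) (f := fun s => deriv (fun r => (γ r).z) s / (γ s).w) (by
      rw [uIcc_of_le zero_le_one, integrableOn_Icc_iff_integrableOn_Ioc]
      exact (intervalIntegrable_iff_integrableOn_Ioc_of_le zero_le_one).1 hγ.integrable)
  rwa [uIcc_of_le zero_le_one] at this

/-- The local primitive G of dz/w, composed with the path, is a primitive of the integrand. So the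
elapsed integral is the elapsed time of the flow. -/
theorem IsPath.eventually_eq_act (ht : t ^ 2 ≠ 4) {γ : ℝ → Surface t} (hγ : IsPath γ)
    {F : Finset ℝ} (hF : ∀ s ∈ Ioo (0 : ℝ) 1, s ∉ F →
      (γ s).w ≠ 0 ∧ DifferentiableAt ℝ (fun r => (γ r).z) s) {s₀ : ℝ} (hs₀ : s₀ ∈ Ioo (0 : ℝ) 1)
    (hs₀F : s₀ ∉ F) :
    ∀ᶠ s in 𝓝 s₀, γ s = act (partialIntegral γ s - partialIntegral γ s₀) (γ s₀) := by
  obtain ⟨G, hG0, hG⟩ := exists_local_primitive ht (hF s₀ hs₀ hs₀F).1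
  have hcont : ContinuousAt γ s₀ := hγ.continuousOn.continuousAt (Icc_mem_nhds hs₀.1 hs₀.2)
  have hev : ∀ᶠ s in 𝓝 s₀, s ∈ Ioo (0 : ℝ) 1 ∧ s ∉ F ∧ act (G (γ s).z) (γ s₀) = γ s ∧
      HasDerivAt G ((γ s).w)⁻¹ (γ s).z := by
    have h1 : (F : Set ℝ)ᶜ ∈ 𝓝 s₀ := F.finite_toSet.isClosed.isOpen_compl.mem_nhds (by simpa using hs₀F)
    filter_upwards [Ioo_mem_nhds hs₀.1 hs₀.2, h1, hcont hG] with s h1 h2 h3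
    exact ⟨h1, by simpa using h2, h3.2⟩
  obtain ⟨δ, hδ, hball⟩ := Metric.eventually_nhds_iff_ball.1 hev
  filter_upwards [Metric.ball_mem_nhds s₀ hδ] with s hs
  have hsub : uIcc s₀ s ⊆ Metric.ball s₀ δ := by
    rw [← segment_eq_uIcc]
    exact (convex_ball s₀ δ).segment_subset (Metric.mem_ball_self hδ) hs
  have hI := hγ.partialIntegral_sub (x := s₀) (y := s) (Ioo_subset_Icc_self hs₀)
    (Ioo_subset_Icc_self (hball s hs).1)
  have hFTC : ∫ x in s₀..s, deriv (fun r => (γ r).z) x / (γ x).w = G (γ s).z - G (γ s₀).z := by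
    refine intervalIntegral.integral_eq_sub_of_hasDerivAt (f := fun x => G (γ x).z)
      (fun x hx => ?_) ?_
    · obtain ⟨h1, h2, -, h4⟩ := hball x (hsub hx)
      have := h4.scomp x (hF x h1 h2).2.hasDerivAt
      rw [smul_eq_mul, ← div_eq_mul_inv] at this
      exact this
    · exact hγ.intervalIntegrable (Ioo_subset_Icc_self hs₀) (Ioo_subset_Icc_self (hball s hs).1)
  rw [hI, hFTC, hG0, sub_zero]
  exact (hball s hs).2.2.1.symm

/-- A path is the orbit of its initial point, the time being the integral of `dz / w`. -/
theorem IsPath.eq_act (ht : t ^ 2 ≠ 4) {γ : ℝ → Surface t} (hγ : IsPath γ) {s : ℝ}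
    (hs : s ∈ Icc (0 : ℝ) 1) : γ s = act (partialIntegral γ s) (γ 0) := by
  obtain ⟨F, hF⟩ := hγ.regular
  have hU := hγ.continuousOn_partialIntegral
  -- On an interval without exceptional parameters the local statement spreads by connectedness.
  have hinterval : ∀ c d : ℝ, Ioo c d ⊆ Ioo 0 1 → (∀ s ∈ Ioo c d, s ∉ F) → ∀ x ∈ Ioo c d,
      ∀ y ∈ Ioo c d, γ y = act (partialIntegral γ y - partialIntegral γ x) (γ x) := by
    intro c d hcd hFcd x hx y hy
    refine isPreconnected_Ioo.induction₂ (fun x y => γ y =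
      act (partialIntegral γ y - partialIntegral γ x) (γ x)) (fun x hx => ?_) ?_ ?_ hx hy
    · exact eventually_nhdsWithin_of_eventually_nhds
        (hγ.eventually_eq_act ht hF (hcd hx) (hFcd x hx))
    · intro x y z _ _ _ h1 h2
      rw [h2, h1, ← act_add]; congr 1; ring
    · intro x y _ _ h1
      rw [h1, ← act_add]; simp [act_zero]
  have hT : Icc (0 : ℝ) 1 ⊆ {s | γ s = act (partialIntegral γ s) (γ 0)} := by
    -- The set of good parameters is closed. To continue to the right of x, use an interval next to
    -- x without exceptional parameters; x itself may be exceptional and is reached by continuity.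
    refine IsClosed.Icc_subset_of_forall_mem_nhdsWithin ?_ ?_ ?_
    · have h1 : ContinuousOn (fun s => (γ s, act (partialIntegral γ s) (γ 0))) (Icc 0 1) :=
        hγ.continuousOn.prodMk ((continuous_act (γ 0)).comp_continuousOn hU)
      have := h1.preimage_isClosed_of_isClosed isClosed_Icc isClosed_diagonal
      rwa [inter_comm] at this
    · simp [partialIntegral, act_zero]
    · rintro x ⟨hx, hx0, hx1⟩
      have hFx : ∀ᶠ s in 𝓝[>] x, s ∈ Ioo x 1 ∧ s ∉ F := by
        have h1 : ∀ᶠ s in 𝓝[≠] x, s ∉ F := by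
          have : ((F : Set ℝ) \ {x})ᶜ ∈ 𝓝 x :=
            (F.finite_toSet.subset sdiff_subset).isClosed.isOpen_compl.mem_nhds (by simp)
          filter_upwards [mem_nhdsWithin_of_mem_nhds this, self_mem_nhdsWithin] with s h1 h2
          intro h3
          exact h1 ⟨by simpa using h3, h2⟩
        filter_upwards [Ioo_mem_nhdsGT hx1, nhdsGT_le_nhdsNE x h1] with s h1 h2
        exact ⟨h1, h2⟩
      obtain ⟨d, hd, hsub⟩ := (mem_nhdsGT_iff_exists_Ioo_subset).1 hFx
      have hcd : Ioo x d ⊆ Ioo 0 1 := fun s hs =>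
        ⟨hx0.trans_lt hs.1, (hsub hs).1.2⟩
      have key := hinterval x d hcd (fun s hs => (hsub hs).2)
      filter_upwards [Ioo_mem_nhdsGT hd] with y hy
      have hlim : γ x = act (partialIntegral γ x - partialIntegral γ y) (γ y) := by
        have hxI : x ∈ Icc (0 : ℝ) 1 := ⟨hx0, hx1.le⟩
        have hle : 𝓝[Ioo x d] x ≤ 𝓝[Icc 0 1] x :=
          nhdsWithin_mono _ (hcd.trans Ioo_subset_Icc_self)
        have c1 : Tendsto γ (𝓝[Ioo x d] x) (𝓝 (γ x)) := (hγ.continuousOn x hxI).mono_left hle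
        have c2 : Tendsto (fun s => act (partialIntegral γ s - partialIntegral γ y) (γ y))
            (𝓝[Ioo x d] x) (𝓝 (act (partialIntegral γ x - partialIntegral γ y) (γ y))) :=
          ((continuous_act (γ y)).tendsto _).comp
            (((hU x hxI).mono_left hle).sub_const (partialIntegral γ y))
        have : (𝓝[Ioo x d] x).NeBot := by
          rw [nhdsWithin_Ioo_eq_nhdsGT hd]; infer_instance
        refine tendsto_nhds_unique c1 (c2.congr' ?_)
        filter_upwards [self_mem_nhdsWithin] with s hs
        exact (key y hy s hs).symm
      rw [hx] at hlim
      have := congrArg (act (partialIntegral γ y - partialIntegral γ x)) hlim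
      rw [← act_add, ← act_add] at this
      simp only [sub_add_cancel, sub_add_sub_cancel, sub_self, act_zero] at this
      exact this.symm
  exact hT hs

theorem IsPath.apply_one (ht : t ^ 2 ≠ 4) {γ : ℝ → Surface t} (hγ : IsPath γ) :
    γ 1 = act (pathIntegral γ) (γ 0) := hγ.eq_act ht ⟨zero_le_one, le_rfl⟩

/-! ### Orbits along polynomial curves are paths -/

/-- The zeros are isolated, hence finite in number on a compact set of times. -/
theorem finite_w_eq_zero (ht : t ^ 2 ≠ 4) (p : Surface t) {K : Set ℂ} (hK : IsCompact K) :
    {u ∈ K | (act u p).w = 0}.Finite := by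
  by_contra hinf
  obtain ⟨x, -, hx⟩ := Set.Infinite.exists_accPt_of_subset_isCompact hinf hK (sep_subset _ _)
  have := accPt_iff_frequently_nhdsNE.1 hx
  exact this (((isFlowAt_act p x).eventually_w_ne_zero ht).mono fun v hv hv' => hv hv'.2)

open Polynomial in
-- An arbitrary curve of times might meet the zeros of w infinitely often. A nonconstant polynomial
-- takes each value finitely often, so only finitely many parameters are exceptional, and elsewhere
-- the integrand is P'.
theorem isPath_act_polynomial (ht : t ^ 2 ≠ 4) (p : Surface t) {P : ℂ[X]} (hP : P.natDegree ≠ 0) :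
    IsPath (fun s : ℝ => act (P.eval (s : ℂ)) p) ∧
      pathIntegral (fun s : ℝ => act (P.eval (s : ℂ)) p) = P.eval 1 - P.eval 0 := by
  have hc : Continuous fun s : ℝ => P.eval (s : ℂ) :=
    P.continuous.comp Complex.continuous_ofReal
  have hfin : {s : ℝ | s ∈ Icc (0 : ℝ) 1 ∧ (act (P.eval (s : ℂ)) p).w = 0}.Finite := by
    have h1 := finite_w_eq_zero ht p (isCompact_Icc.image hc : IsCompact
      ((fun s : ℝ => P.eval (s : ℂ)) '' Icc 0 1))
    have h2 : (⋃ u ∈ {u ∈ (fun s : ℝ => P.eval (s : ℂ)) '' Icc 0 1 | (act u p).w = 0},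
        {s : ℝ | P.eval (s : ℂ) = u}).Finite := by
      refine h1.biUnion fun u _ => ?_
      have hne : P - C u ≠ 0 := by
        intro h
        apply hP
        rw [sub_eq_zero.1 h, natDegree_C]
      have h3 : {x : ℂ | (P - C u).IsRoot x}.Finite := Polynomial.finite_setOfPred_isRoot hne
      refine (h3.preimage (f := fun s : ℝ => (s : ℂ)) Complex.ofReal_injective.injOn).subset ?_
      intro s hs
      simp only [mem_ofPred_eq] at hs
      simp [IsRoot, hs]
    refine h2.subset fun s hs => ?_
    simp only [mem_iUnion]
    exact ⟨P.eval (s : ℂ), ⟨⟨s, hs.1, rfl⟩, hs.2⟩, rfl⟩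
  have hder : ∀ s : ℝ, (act (P.eval (s : ℂ)) p).w ≠ 0 →
      HasDerivAt (fun r : ℝ => (act (P.eval (r : ℂ)) p).z)
        (P.derivative.eval (s : ℂ) * (act (P.eval (s : ℂ)) p).w) s := by
    intro s hs
    obtain ⟨q, hq⟩ := exists_eq_pt_of_w_ne_zero hs
    have h1 := (isFlowAt_act p (P.eval (s : ℂ))).hasDerivAt_z hq
    have h2 : HasDerivAt (fun r : ℝ => P.eval (r : ℂ)) (P.derivative.eval (s : ℂ)) s :=
      (P.hasDerivAt (s : ℂ)).comp_ofReal
    exact h1.scomp s h2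
  have hae : ∀ᵐ s : ℝ ∂(MeasureTheory.volume.restrict (Ioc (0 : ℝ) 1)),
      P.derivative.eval (s : ℂ) = deriv (fun r : ℝ => (act (P.eval (r : ℂ)) p).z) s /
        (act (P.eval (s : ℂ)) p).w := by
    rw [MeasureTheory.ae_restrict_iff' measurableSet_Ioc]
    have := hfin.measure_zero MeasureTheory.volume
    filter_upwards [MeasureTheory.measure_eq_zero_iff_ae_notMem.1 this] with s hs hs1
    have hw : (act (P.eval (s : ℂ)) p).w ≠ 0 := fun h => hs ⟨Ioc_subset_Icc_self hs1, h⟩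
    rw [(hder s hw).deriv, mul_div_cancel_right₀ _ hw]
  have hcd : Continuous fun s : ℝ => P.derivative.eval (s : ℂ) :=
    P.derivative.continuous.comp Complex.continuous_ofReal
  have hint : IntervalIntegrable (fun s : ℝ => P.derivative.eval (s : ℂ))
      MeasureTheory.volume 0 1 := hcd.intervalIntegrable _ _
  refine ⟨⟨((continuous_act p).comp hc).continuousOn, ⟨hfin.toFinset, fun s hs hsF => ?_⟩, ?_⟩, ?_⟩
  · have hw : (act (P.eval (s : ℂ)) p).w ≠ 0 := fun h => hsF (by
      simpa using ⟨⟨hs.1.le, hs.2.le⟩, h⟩)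
    exact ⟨hw, (hder s hw).differentiableAt⟩
  · refine hint.congr_ae ?_
    rwa [uIoc_of_le zero_le_one]
  · have h1 : pathIntegral (fun s : ℝ => act (P.eval (s : ℂ)) p) =
        ∫ s in (0 : ℝ)..1, P.derivative.eval (s : ℂ) := by
      unfold pathIntegral
      refine intervalIntegral.integral_congr_ae_restrict ?_
      rw [uIoc_of_le zero_le_one]
      filter_upwards [hae] with s hs using hs.symm
    rw [h1, intervalIntegral.integral_eq_sub_of_hasDerivAt (f := fun s : ℝ => P.eval (s : ℂ))
      (fun s _ => (P.hasDerivAt (s : ℂ)).comp_ofReal) hint]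
    simp

end Surface

open Polynomial in
/-- Two points that are joined in an open set of the plane are joined by a nonconstant polynomial
curve. -/
theorem exists_polynomial_joinedIn {U : Set ℂ} (hU : IsOpen U) {x y : ℂ} (h : JoinedIn U x y) :
    ∃ P : ℂ[X], P.natDegree ≠ 0 ∧ P.eval 0 = x ∧ P.eval 1 = y ∧
      ∀ s ∈ Icc (0 : ℝ) 1, P.eval (s : ℂ) ∈ U := by
  obtain ⟨γ, hγ⟩ := h
  have hcomp : IsCompact (range γ) := isCompact_range γ.continuous
  obtain ⟨ε, hε, hsub⟩ := hcomp.exists_thickening_subset_open hU (range_subset_iff.2 hγ)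
  set g : ℝ → ℂ := fun s => γ.extend s with hg
  have hgc : Continuous g := γ.extend.continuous
  -- Errors of ε/12 in the real and the imaginary part give ε/6. The correction of the two end
  -- points costs at most ε/6 each, in all less than ε/2.
  obtain ⟨p, hp⟩ := exists_polynomial_near_of_continuousOn 0 1 (fun s => (g s).re)
    (Complex.continuous_re.comp hgc).continuousOn (ε / 12) (by positivity)
  obtain ⟨q, hq⟩ := exists_polynomial_near_of_continuousOn 0 1 (fun s => (g s).im)
    (Complex.continuous_im.comp hgc).continuousOn (ε / 12) (by positivity)
  set P₁ : ℂ[X] := p.map (algebraMap ℝ ℂ) + C Complex.I * q.map (algebraMap ℝ ℂ) with hP₁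
  have hev : ∀ s : ℝ, P₁.eval (s : ℂ) = (p.eval s : ℝ) + Complex.I * (q.eval s : ℝ) := by
    intro s
    have h1 : ∀ p : ℝ[X], (p.map (algebraMap ℝ ℂ)).eval (s : ℂ) = (p.eval s : ℝ) := by
      intro p
      have := Polynomial.eval_map_algebraMap (B := ℂ) p (s : ℂ)
      rw [this]
      exact Polynomial.aeval_ofReal p s
    simp only [hP₁, eval_add, eval_mul, eval_C, h1]
  have hnear : ∀ s ∈ Icc (0 : ℝ) 1, ‖P₁.eval (s : ℂ) - g s‖ < ε / 6 := by
    intro s hs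
    rw [hev]
    refine (Complex.norm_le_abs_re_add_abs_im _).trans_lt ?_
    have h1 := hp s hs
    have h2 := hq s hs
    simp only [Complex.sub_re, Complex.add_re, Complex.ofReal_re, Complex.mul_re, Complex.I_re,
      Complex.I_im, Complex.ofReal_im, Complex.sub_im, Complex.add_im, Complex.mul_im]
    ring_nf at h1 h2 ⊢
    linarith
  set P₂ : ℂ[X] := P₁ + C (x - P₁.eval 0) * (1 - X) + C (y - P₁.eval 1) * X with hP₂
  have hg0 : g 0 = x := by simp [hg]
  have hg1 : g 1 = y := by simp [hg]
  have e0 : ‖x - P₁.eval 0‖ < ε / 6 := by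
    have := hnear 0 ⟨le_rfl, zero_le_one⟩
    rw [hg0, norm_sub_rev] at this
    simpa using this
  have e1 : ‖y - P₁.eval 1‖ < ε / 6 := by
    have := hnear 1 ⟨zero_le_one, le_rfl⟩
    rw [hg1, norm_sub_rev] at this
    simpa using this
  have hnear₂ : ∀ s ∈ Icc (0 : ℝ) 1, ‖P₂.eval (s : ℂ) - g s‖ < ε / 2 := by
    intro s hs
    have h1 : P₂.eval (s : ℂ) - g s = (P₁.eval (s : ℂ) - g s) + (x - P₁.eval 0) * ((1 - s : ℝ) : ℂ)
        + (y - P₁.eval 1) * ((s : ℝ) : ℂ) := by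
      simp [hP₂]; ring
    rw [h1]
    refine norm_add₃_le.trans_lt ?_
    rw [norm_mul, norm_mul, Complex.norm_real, Complex.norm_real, Real.norm_eq_abs,
      Real.norm_eq_abs, abs_of_nonneg hs.1, abs_of_nonneg (sub_nonneg.2 hs.2)]
    have := hnear s hs
    have h3 : ‖x - P₁.eval 0‖ * (1 - s) ≤ ε / 6 * 1 := by
      have h0 : 0 ≤ 1 - s := by linarith [hs.2]
      exact mul_le_mul e0.le (by linarith [hs.1]) h0 (by positivity)
    have h4 : ‖y - P₁.eval 1‖ * s ≤ ε / 6 * 1 := by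
      gcongr
      · exact hs.1
      · exact hs.2
    linarith
  have final : ∀ P : ℂ[X], (∀ s ∈ Icc (0 : ℝ) 1, ‖P.eval (s : ℂ) - g s‖ < ε) →
      ∀ s ∈ Icc (0 : ℝ) 1, P.eval (s : ℂ) ∈ U := by
    intro P h s hs
    refine hsub (Metric.mem_thickening_iff.2 ⟨g s, ?_, by rw [dist_eq_norm]; exact h s hs⟩)
    simp only [hg]
    rw [γ.extend_apply hs]
    exact mem_range_self _
  by_cases hdeg : P₂.natDegree = 0
  -- A constant curve is made nonconstant by adding a small multiple of X - X², which vanishes at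
  -- both end points.
  · have hdeg1 : (C (ε / 2 : ℂ) * (X - X ^ 2) : ℂ[X]).natDegree = 2 := by
      have hε' : (ε / 2 : ℂ) ≠ 0 := by
        have : (ε : ℂ) ≠ 0 := by exact_mod_cast hε.ne'
        simpa using this
      rw [natDegree_C_mul hε']
      compute_degree!
    refine ⟨P₂ + C (ε / 2 : ℂ) * (X - X ^ 2), ?_, by simp [hP₂], by simp [hP₂], final _ ?_⟩
    · rw [natDegree_add_eq_right_of_natDegree_lt (by omega)]; omega
    · intro s hs
      have h1 : (P₂ + C (ε / 2 : ℂ) * (X - X ^ 2)).eval (s : ℂ) - g s =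
          (P₂.eval (s : ℂ) - g s) + ((ε / 2 * (s - s ^ 2) : ℝ) : ℂ) := by
        simp; ring
      rw [h1]
      refine (norm_add_le _ _).trans_lt ?_
      have h2 : 0 ≤ s - s ^ 2 := by nlinarith [hs.1, hs.2]
      have h3 : s - s ^ 2 ≤ 1 := by nlinarith [hs.1, hs.2]
      rw [Complex.norm_real, Real.norm_eq_abs, abs_of_nonneg (by positivity)]
      have := hnear₂ s hs
      nlinarith
  · exact ⟨P₂, hdeg, by simp [hP₂], by simp [hP₂], final _ fun s hs =>
      (hnear₂ s hs).trans (by linarith)⟩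

section Arcs

open MeasureTheory

/-! ### Arcs -/

theorem IsArc.continuousOn {γ : ℝ → ℂ} {p q : ℂ} (h : IsArc γ p q) : ContinuousOn γ (Icc 0 1) :=
  h.contDiffOn.continuousOn

theorem IsArc.differentiableOn {γ : ℝ → ℂ} {p q : ℂ} (h : IsArc γ p q) :
    DifferentiableOn ℝ γ (Icc 0 1) := h.contDiffOn.differentiableOn one_ne_zero

theorem IsArc.differentiableAt {γ : ℝ → ℂ} {p q : ℂ} (h : IsArc γ p q) {s : ℝ}
    (hs : s ∈ Ioo (0 : ℝ) 1) : DifferentiableAt ℝ γ s :=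
  (h.differentiableOn s (Ioo_subset_Icc_self hs)).differentiableAt (Icc_mem_nhds hs.1 hs.2)

theorem IsArc.deriv_eq {γ : ℝ → ℂ} {p q : ℂ} (_ : IsArc γ p q) {s : ℝ}
    (hs : s ∈ Ioo (0 : ℝ) 1) : deriv γ s = derivWithin γ (Icc 0 1) s :=
  (derivWithin_of_mem_nhds (Icc_mem_nhds hs.1 hs.2)).symm

theorem IsArc.continuousOn_derivWithin {γ : ℝ → ℂ} {p q : ℂ} (h : IsArc γ p q) :
    ContinuousOn (derivWithin γ (Icc 0 1)) (Icc 0 1) :=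
  h.contDiffOn.continuousOn_derivWithin (uniqueDiffOn_Icc zero_lt_one) le_rfl

theorem IsArc.continuousOn_deriv {γ : ℝ → ℂ} {p q : ℂ} (h : IsArc γ p q) :
    ContinuousOn (deriv γ) (Ioo 0 1) :=
  (h.continuousOn_derivWithin.mono Ioo_subset_Icc_self).congr fun _ hs => h.deriv_eq hs

theorem IsArc.reverse {γ : ℝ → ℂ} {p q : ℂ} (h : IsArc γ p q) : IsArc (fun s => γ (1 - s)) q p := by
  have hmaps : MapsTo (fun s : ℝ => 1 - s) (Icc 0 1) (Icc 0 1) := fun s hs =>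
    ⟨by linarith [hs.2], by linarith [hs.1]⟩
  refine ⟨h.contDiffOn.comp (by fun_prop) hmaps, fun s hs => ?_, fun x hx y hy hxy => ?_,
    by simpa using h.right, by simpa using h.left⟩
  · have h1 : HasDerivWithinAt (fun s : ℝ => 1 - s) (-1) (Icc 0 1) s :=
      ((hasDerivAt_id s).const_sub 1).hasDerivWithinAt
    have h2 := (h.differentiableOn (1 - s) (hmaps hs)).hasDerivWithinAt.scomp s h1 hmaps
    have h3 := h2.derivWithin (uniqueDiffOn_Icc zero_lt_one s hs)
    change derivWithin (γ ∘ fun s => 1 - s) _ _ ≠ 0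
    rw [h3, neg_smul, one_smul, neg_ne_zero]
    exact h.derivWithin_ne_zero _ (hmaps hs)
  · have := h.injOn (hmaps hx) (hmaps hy) hxy
    linarith

theorem IsArc.neg {γ : ℝ → ℂ} {p q : ℂ} (h : IsArc γ p q) : IsArc (fun s => -γ s) (-p) (-q) := by
  refine ⟨h.contDiffOn.neg, fun s hs => ?_, fun x hx y hy hxy => h.injOn hx hy (neg_inj.1 hxy),
    by rw [h.left], by rw [h.right]⟩
  have := derivWithin.fun_neg (f := γ) (s := Icc (0 : ℝ) 1) (x := s) (𝕜 := ℝ)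
  rw [this, neg_ne_zero]
  exact h.derivWithin_ne_zero s hs

/-- A zero at 0 is simple by hypothesis, so f grows at least linearly; without a zero the bound is
trivial. -/
theorem exists_lower_bound_nhdsGT {f : ℝ → ℂ} (hf : DifferentiableWithinAt ℝ f (Icc 0 1) 0)
    (h0 : f 0 = 0 → derivWithin f (Icc 0 1) 0 ≠ 0) (hc : ContinuousWithinAt f (Icc 0 1) 0) :
    ∃ c > 0, ∀ᶠ s in 𝓝[>] (0 : ℝ), c * s ≤ ‖f s‖ := by
  have hle : 𝓝[>] (0 : ℝ) ≤ 𝓝[Icc 0 1] 0 := by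
    rw [← nhdsWithin_Ioo_eq_nhdsGT zero_lt_one]
    exact nhdsWithin_mono _ Ioo_subset_Icc_self
  by_cases h : f 0 = 0
  · have hd := hf.hasDerivWithinAt
    set d := derivWithin f (Icc 0 1) 0 with hd_def
    have hd0 : 0 < ‖d‖ := norm_pos_iff.2 (h0 h)
    refine ⟨‖d‖ / 2, by positivity, ?_⟩
    have h1 := (hasDerivWithinAt_iff_isLittleO.1 hd).def (c := ‖d‖ / 2) (by positivity)
    filter_upwards [hle h1, self_mem_nhdsWithin] with s hs hs0
    have hs0 : 0 < s := hs0
    simp only [h, sub_zero, Complex.real_smul, Real.norm_eq_abs, abs_of_pos hs0] at hs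
    have h2 : ‖(s : ℂ) * d‖ = s * ‖d‖ := by
      rw [norm_mul, Complex.norm_real, Real.norm_eq_abs, abs_of_pos hs0]
    have h3 := norm_sub_norm_le ((s : ℂ) * d) (f s)
    rw [norm_sub_rev] at h3
    nlinarith
  · have hpos : 0 < ‖f 0‖ := norm_pos_iff.2 h
    refine ⟨‖f 0‖ / 2, by positivity, ?_⟩
    have h1 : ∀ᶠ s in 𝓝[>] (0 : ℝ), ‖f 0‖ / 2 < ‖f s‖ :=
      (hc.norm.mono_left hle).eventually (lt_mem_nhds (by linarith))
    have h2 : ∀ᶠ s in 𝓝[>] (0 : ℝ), s ∈ Ioo (0 : ℝ) 1 := Ioo_mem_nhdsGT zero_lt_one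
    filter_upwards [h1, h2] with s hs hs1
    nlinarith [hs1.1, hs1.2]

theorem exists_lower_bound_Ioo {f : ℝ → ℂ} (hf : DifferentiableOn ℝ f (Icc 0 1))
    (h0 : f 0 = 0 → derivWithin f (Icc 0 1) 0 ≠ 0) (h1 : f 1 = 0 → derivWithin f (Icc 0 1) 1 ≠ 0)
    (hne : ∀ s ∈ Ioo (0 : ℝ) 1, f s ≠ 0) :
    ∃ c > 0, ∀ s ∈ Ioo (0 : ℝ) 1, c * (s * (1 - s)) ≤ ‖f s‖ := by
  have m0 : (0 : ℝ) ∈ Icc (0 : ℝ) 1 := ⟨le_rfl, zero_le_one⟩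
  have m1 : (1 : ℝ) ∈ Icc (0 : ℝ) 1 := ⟨zero_le_one, le_rfl⟩
  have hmaps : MapsTo (fun s : ℝ => 1 - s) (Icc 0 1) (Icc 0 1) := fun s hs =>
    ⟨by linarith [hs.2], by linarith [hs.1]⟩
  have hg : DifferentiableOn ℝ (fun s => f (1 - s)) (Icc 0 1) :=
    hf.comp (by fun_prop) hmaps
  have hg0 : derivWithin (fun s => f (1 - s)) (Icc 0 1) 0 = -derivWithin f (Icc 0 1) 1 := by
    have e1 : HasDerivWithinAt (fun s : ℝ => 1 - s) (-1) (Icc 0 1) 0 :=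
      ((hasDerivAt_id (0 : ℝ)).const_sub 1).hasDerivWithinAt
    have e2 : HasDerivWithinAt f (derivWithin f (Icc 0 1) (1 - 0)) (Icc 0 1) (1 - 0) :=
      (hf (1 - 0) (by simp)).hasDerivWithinAt
    have e3 := (e2.scomp (0 : ℝ) e1 hmaps).derivWithin (uniqueDiffOn_Icc zero_lt_one 0 m0)
    rw [sub_zero] at e3
    simpa [Function.comp_def] using e3
  obtain ⟨c₁, hc₁, hb₁⟩ := exists_lower_bound_nhdsGT (hf 0 m0) h0 (hf.continuousOn 0 m0)
  obtain ⟨c₂, hc₂, hb₂⟩ := exists_lower_bound_nhdsGT (f := fun s => f (1 - s)) (hg 0 m0)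
    (fun h => by rw [hg0, neg_ne_zero]; exact h1 (by simpa using h)) (hg.continuousOn 0 m0)
  obtain ⟨δ₁, hδ₁, hs₁⟩ := mem_nhdsGT_iff_exists_Ioo_subset.1 hb₁
  obtain ⟨δ₂, hδ₂, hs₂⟩ := mem_nhdsGT_iff_exists_Ioo_subset.1 hb₂
  simp only [mem_Ioi] at hδ₁ hδ₂
  set δ := min (min δ₁ δ₂) (1 / 2) with hδ
  have hδ0 : 0 < δ := lt_min (lt_min hδ₁ hδ₂) (by norm_num)
  have hδh : δ ≤ 1 / 2 := min_le_right _ _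
  have hδ1 : δ ≤ δ₁ := (min_le_left _ _).trans (min_le_left _ _)
  have hδ2 : δ ≤ δ₂ := (min_le_left _ _).trans (min_le_right _ _)
  obtain ⟨x, hx, hmin⟩ := (isCompact_Icc (a := δ) (b := 1 - δ)).exists_isMinOn
    ⟨δ, le_rfl, by linarith⟩ ((hf.continuousOn.norm).mono
      (Icc_subset_Icc hδ0.le (by linarith)))
  have hfx : 0 < ‖f x‖ := norm_pos_iff.2 (hne x ⟨by linarith [hx.1], by linarith [hx.2]⟩)
  refine ⟨min (min c₁ c₂) ‖f x‖, lt_min (lt_min hc₁ hc₂) hfx, fun s hs => ?_⟩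
  have hs1 : 0 < 1 - s := by linarith [hs.2]
  have hs0 : 0 < s := hs.1
  set c := min (min c₁ c₂) ‖f x‖
  have hcc₁ : c ≤ c₁ := (min_le_left _ _).trans (min_le_left _ _)
  have hcc₂ : c ≤ c₂ := (min_le_left _ _).trans (min_le_right _ _)
  have hccx : c ≤ ‖f x‖ := min_le_right _ _
  have hc0 : 0 < c := lt_min (lt_min hc₁ hc₂) hfx
  rcases lt_or_ge s δ with h | h
  · have := hs₁ ⟨hs0, h.trans_le hδ1⟩
    simp only [mem_ofPred_eq] at this
    have e1 : c * (s * (1 - s)) ≤ c * s := by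
      gcongr; nlinarith
    have e2 : c * s ≤ c₁ * s := by gcongr
    linarith
  · rcases le_or_gt s (1 - δ) with h' | h'
    · have := hmin ⟨h, h'⟩
      simp only [mem_ofPred_eq] at this
      have e1 : c * (s * (1 - s)) ≤ c * 1 := by gcongr; nlinarith
      linarith
    · have := hs₂ ⟨hs1, (by linarith : 1 - s < δ).trans_le hδ2⟩
      simp only [mem_ofPred_eq, sub_sub_cancel] at this
      have e1 : c * (s * (1 - s)) ≤ c * (1 - s) := by
        gcongr; nlinarith
      have e2 : c * (1 - s) ≤ c₂ * (1 - s) := by gcongr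
      linarith

/-- This is the integrand of the beta function at (1/2, 1/2). -/
theorem intervalIntegrable_rsqrt :
    IntervalIntegrable (fun s : ℝ => (Real.sqrt (s * (1 - s)))⁻¹) volume 0 1 := by
  have h := (Complex.betaIntegral_convergent (u := 1 / 2) (v := 1 / 2) (by norm_num)
    (by norm_num)).norm
  refine h.congr_ae ?_
  rw [uIoc_of_le zero_le_one, EventuallyEq, ae_restrict_iff' measurableSet_Ioc]
  have h1 : ∀ᵐ s : ℝ ∂volume, s ≠ 1 := by simp [ae_iff, measure_singleton]
  filter_upwards [h1] with s hs1 hs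
  have hs0 : 0 < s := hs.1
  have hs2 : 0 < 1 - s := by
    have := lt_of_le_of_ne hs.2 hs1
    linarith
  have e2 : (1 - (s : ℂ)) = ((1 - s : ℝ) : ℂ) := by push_cast; ring
  rw [norm_mul, e2, Complex.norm_cpow_eq_rpow_re_of_pos hs0,
    Complex.norm_cpow_eq_rpow_re_of_pos hs2, Real.sqrt_mul hs0.le, mul_inv, Real.sqrt_eq_rpow,
    Real.sqrt_eq_rpow, ← Real.rpow_neg hs0.le, ← Real.rpow_neg hs2.le]
  norm_num

theorem hasDerivAt_R (t z : ℂ) : HasDerivAt (R t) (4 * z ^ 3 + 4 * t * z) z := by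
  have h : R t = fun z => z ^ 4 + 2 * t * z ^ 2 + (t ^ 2 - 4) := by
    funext z; rw [R_eq]; ring
  rw [h]
  have := (((hasDerivAt_id z).pow 4).add (((hasDerivAt_id z).pow 2).const_mul (2 * t))).add_const
    (t ^ 2 - 4)
  refine this.congr_deriv ?_
  simp; ring

theorem continuous_R (t : ℂ) : Continuous (R t) :=
  continuous_iff_continuousAt.2 fun z => (hasDerivAt_R t z).continuousAt

theorem deriv_R_ne_zero {t : ℂ} (ht : t ^ 2 ≠ 4) {z : ℂ} (hz : R t z = 0) :
    4 * z ^ 3 + 4 * t * z ≠ 0 := by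
  have := Surface.smooth_of_ne (t := t) ht (p := (z, 0)) (by simp [hz]) rfl
  intro h
  exact this (by simp only; linear_combination h / 2)

variable {t : ℂ}

open Classical in
/-- The path `s ↦ (γ s, y s)` on the surface. -/
def liftPath (t : ℂ) (γ y : ℝ → ℂ) (s : ℝ) : Surface t :=
  if h : y s ^ 2 = R t (γ s) then .pt ⟨(γ s, y s), h⟩ else Surface.bPt t

theorem liftPath_eq {γ y : ℝ → ℂ} {s : ℝ} (h : y s ^ 2 = R t (γ s)) :
    liftPath t γ y s = .pt ⟨(γ s, y s), h⟩ := dif_pos h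

/-- The zeros of R are simple and the arc is regular up to its ends, so |R| ≥ c s(1 - s) along it.
As |y| is the square root of |R|, the integrand is dominated by a multiple of (s(1 - s))^{-1/2}. -/
theorem IsArc.intervalIntegrable_div (ht : t ^ 2 ≠ 4) {γ y : ℝ → ℂ} {p q : ℂ} (hγ : IsArc γ p q)
    (hy : ContinuousOn y (Icc 0 1)) (hsq : ∀ s ∈ Icc (0 : ℝ) 1, y s ^ 2 = R t (γ s))
    (hne : ∀ s ∈ Ioo (0 : ℝ) 1, R t (γ s) ≠ 0) :
    IntervalIntegrable (fun s => deriv γ s / y s) volume 0 1 := by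
  have hder : ∀ s ∈ Icc (0 : ℝ) 1, HasDerivWithinAt (fun s => R t (γ s))
      (derivWithin γ (Icc 0 1) s • (4 * γ s ^ 3 + 4 * t * γ s)) (Icc 0 1) s := fun s hs =>
    (hasDerivAt_R t (γ s)).scomp_hasDerivWithinAt s (hγ.differentiableOn s hs).hasDerivWithinAt
  have hend : ∀ s ∈ Icc (0 : ℝ) 1, R t (γ s) = 0 →
      derivWithin (fun s => R t (γ s)) (Icc 0 1) s ≠ 0 := by
    intro s hs h0
    rw [(hder s hs).derivWithin (uniqueDiffOn_Icc zero_lt_one s hs), smul_eq_mul]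
    exact mul_ne_zero (hγ.derivWithin_ne_zero s hs) (deriv_R_ne_zero ht h0)
  obtain ⟨c, hc, hlow⟩ := exists_lower_bound_Ioo (f := fun s => R t (γ s))
    (fun s hs => (hder s hs).differentiableWithinAt) (hend 0 ⟨le_rfl, zero_le_one⟩)
    (hend 1 ⟨zero_le_one, le_rfl⟩) hne
  obtain ⟨M, hM⟩ := isCompact_Icc.exists_bound_of_continuousOn hγ.continuousOn_derivWithin
  have hM0 : 0 ≤ M := (norm_nonneg _).trans (hM 0 ⟨le_rfl, zero_le_one⟩)
  have hy0 : ∀ s ∈ Ioo (0 : ℝ) 1, y s ≠ 0 := fun s hs h => hne s hs (by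
    rw [← hsq s (Ioo_subset_Icc_self hs), h]; simp)
  have hres : volume.restrict (uIoc (0 : ℝ) 1) = volume.restrict (Ioo (0 : ℝ) 1) := by
    rw [uIoc_of_le zero_le_one]; exact (Measure.restrict_congr_set Ioo_ae_eq_Ioc).symm
  refine (intervalIntegrable_rsqrt.const_mul (M / Real.sqrt c)).mono_fun ?_ ?_
  · rw [hres]
    refine ContinuousOn.aestronglyMeasurable ?_ measurableSet_Ioo
    exact hγ.continuousOn_deriv.div (hy.mono Ioo_subset_Icc_self) hy0
  · rw [hres, EventuallyLE, ae_restrict_iff' measurableSet_Ioo]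
    refine Eventually.of_forall fun s hs => ?_
    have hs2 : 0 < s * (1 - s) := mul_pos hs.1 (by linarith [hs.2])
    have h1 : ‖y s‖ = Real.sqrt ‖R t (γ s)‖ := by
      rw [← hsq s (Ioo_subset_Icc_self hs), norm_pow, Real.sqrt_sq (norm_nonneg _)]
    have h2 : Real.sqrt c * Real.sqrt (s * (1 - s)) ≤ ‖y s‖ := by
      rw [h1, ← Real.sqrt_mul hc.le]
      exact Real.sqrt_le_sqrt (hlow s hs)
    have h3 : 0 < Real.sqrt c * Real.sqrt (s * (1 - s)) :=
      mul_pos (Real.sqrt_pos.2 hc) (Real.sqrt_pos.2 hs2)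
    rw [norm_div, hγ.deriv_eq hs, Real.norm_eq_abs, abs_of_nonneg (by positivity), div_mul_eq_mul_div,
      ← div_eq_mul_inv, div_div, mul_comm (Real.sqrt (s * (1 - s)))]
    gcongr
    exact hM s (Ioo_subset_Icc_self hs)

theorem deriv_liftPath_z {γ y : ℝ → ℂ} (hsq : ∀ s ∈ Icc (0 : ℝ) 1, y s ^ 2 = R t (γ s)) {s : ℝ}
    (hs : s ∈ Ioo (0 : ℝ) 1) : (fun r => (liftPath t γ y r).z) =ᶠ[𝓝 s] γ := by
  filter_upwards [Icc_mem_nhds hs.1 hs.2] with r hr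
  rw [liftPath_eq (hsq r hr)]; rfl

theorem IsArc.isPath_liftPath (ht : t ^ 2 ≠ 4) {γ y : ℝ → ℂ} {p q : ℂ} (hγ : IsArc γ p q)
    (hy : ContinuousOn y (Icc 0 1)) (hsq : ∀ s ∈ Icc (0 : ℝ) 1, y s ^ 2 = R t (γ s))
    (hne : ∀ s ∈ Ioo (0 : ℝ) 1, R t (γ s) ≠ 0) : Surface.IsPath (liftPath t γ y) := by
  have hy0 : ∀ s ∈ Ioo (0 : ℝ) 1, y s ≠ 0 := fun s hs h => hne s hs (by
    rw [← hsq s (Ioo_subset_Icc_self hs), h]; simp)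
  refine ⟨?_, ⟨∅, fun s hs _ => ⟨?_, ?_⟩⟩, ?_⟩
  · rw [continuousOn_iff_continuous_domRestrict]
    have : (Icc (0 : ℝ) 1).domRestrict (liftPath t γ y) =
        fun s : Icc (0 : ℝ) 1 => Surface.pt ⟨(γ s, y s), hsq s s.2⟩ := by
      funext s; exact liftPath_eq (hsq s s.2)
    rw [this]
    refine Surface.continuous_pt.comp (Continuous.subtype_mk ?_ _)
    exact (continuousOn_iff_continuous_domRestrict.1 hγ.continuousOn).prodMk
      (continuousOn_iff_continuous_domRestrict.1 hy)
  · rw [liftPath_eq (hsq s (Ioo_subset_Icc_self hs))]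
    exact hy0 s hs
  · exact (hγ.differentiableAt hs).congr_of_eventuallyEq (deriv_liftPath_z hsq hs)
  · refine (hγ.intervalIntegrable_div ht hy hsq hne).congr_ae ?_
    rw [uIoc_of_le zero_le_one, ← Measure.restrict_congr_set Ioo_ae_eq_Ioc, EventuallyEq,
      ae_restrict_iff' measurableSet_Ioo]
    refine Eventually.of_forall fun s hs => ?_
    rw [(deriv_liftPath_z hsq hs).deriv_eq, liftPath_eq (hsq s (Ioo_subset_Icc_self hs))]
    rfl

theorem partialIntegral_liftPath {γ y : ℝ → ℂ}
    (hsq : ∀ s ∈ Icc (0 : ℝ) 1, y s ^ 2 = R t (γ s)) {s : ℝ} (hs : s ∈ Icc (0 : ℝ) 1) :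
    Surface.partialIntegral (liftPath t γ y) s = ∫ x in (0 : ℝ)..s, deriv γ x / y x := by
  unfold Surface.partialIntegral
  refine intervalIntegral.integral_congr_ae_restrict ?_
  rw [uIoc_of_le hs.1, ← Measure.restrict_congr_set Ioo_ae_eq_Ioc, EventuallyEq,
    ae_restrict_iff' measurableSet_Ioo]
  refine Eventually.of_forall fun x hx => ?_
  have hx' : x ∈ Ioo (0 : ℝ) 1 := ⟨hx.1, hx.2.trans_le hs.2⟩
  rw [(deriv_liftPath_z hsq hx').deriv_eq, liftPath_eq (hsq x (Ioo_subset_Icc_self hx'))]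
  rfl

/-- Integration of `dz / w` along a lifted arc. -/
theorem IsArc.act_integral (ht : t ^ 2 ≠ 4) {γ y : ℝ → ℂ} {p q : ℂ} (hγ : IsArc γ p q)
    (hy : ContinuousOn y (Icc 0 1)) (hsq : ∀ s ∈ Icc (0 : ℝ) 1, y s ^ 2 = R t (γ s))
    (hne : ∀ s ∈ Ioo (0 : ℝ) 1, R t (γ s) ≠ 0) {s : ℝ} (hs : s ∈ Icc (0 : ℝ) 1) :
    liftPath t γ y s = Surface.act (∫ x in (0 : ℝ)..s, deriv γ x / y x) (liftPath t γ y 0) := by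
  have := (hγ.isPath_liftPath ht hy hsq hne).eq_act ht hs
  rwa [partialIntegral_liftPath hsq hs] at this

end Arcs

section TameArc

open Metric

/-! ### Circles -/

theorem exists_eq_circleMap {c z : ℂ} {r : ℝ} (hz : z ∈ sphere c r) (hr : 0 < r) (θ₀ : ℝ) :
    ∃ θ ∈ Ico θ₀ (θ₀ + 2 * Real.pi), circleMap c r θ = z := by
  have h1 : z ∈ circleMap c r '' Ioc 0 (2 * Real.pi) := by
    rw [image_circleMap_Ioc, abs_of_pos hr]; exact hz
  obtain ⟨θ, -, rfl⟩ := h1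
  obtain ⟨y, hy, e⟩ := Function.Periodic.exists_mem_Ico (periodic_circleMap c r) Real.two_pi_pos θ θ₀
  exact ⟨y, hy, e.symm⟩

theorem circleMap_injOn_Ico (c : ℂ) {r : ℝ} (hr : r ≠ 0) (θ₀ : ℝ) :
    InjOn (circleMap c r) (Ico θ₀ (θ₀ + 2 * Real.pi)) :=
  injOn_circleMap_of_abs_sub_le' hr (by linarith)

theorem circleMap_image_preconnected (c : ℂ) (r : ℝ) {s : Set ℝ} (hs : IsPreconnected s) :
    IsPreconnected (circleMap c r '' s) :=
  hs.image _ (continuous_circleMap c r).continuousOn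

/-- On a circle from which two points are removed, each point can be moved up to the first of the
two points. -/
theorem exists_arc_to {c p q z : ℂ} {r : ℝ} (hr : 0 < r) (hp : p ∈ sphere c r)
    (hz : z ∈ sphere c r) (hzp : z ≠ p) (hzq : z ≠ q) :
    ∃ W : Set ℂ, IsPreconnected W ∧ z ∈ W ∧ W ⊆ sphere c r \ {p, q} ∧ p ∈ closure W := by
  obtain ⟨θ₀, -, rfl⟩ := exists_eq_circleMap hp hr 0
  have hinj := circleMap_injOn_Ico c hr.ne' θ₀
  have h0 : θ₀ ∈ Ico θ₀ (θ₀ + 2 * Real.pi) := ⟨le_rfl, by linarith [Real.pi_pos]⟩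
  obtain ⟨θz, hθz, rfl⟩ := exists_eq_circleMap hz hr θ₀
  have hlt : θ₀ < θz := lt_of_le_of_ne hθz.1 (by rintro rfl; exact hzp rfl)
  have hmem : ∀ θ, circleMap c r θ ∈ sphere c r := fun θ => circleMap_mem_sphere c hr.le θ
  -- Start the angle at p. If q lies between p and z, move from z onwards through the full turn,
  -- otherwise backwards; both ways end at p.
  by_cases hq : q ∈ circleMap c r '' Ioc θ₀ θz
  · obtain ⟨θq, hθq, rfl⟩ := hq
    have hqz : θq < θz := lt_of_le_of_ne hθq.2 (by rintro rfl; exact hzq rfl)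
    refine ⟨circleMap c r '' Ico θz (θ₀ + 2 * Real.pi),
      circleMap_image_preconnected c r isPreconnected_Ico, ⟨θz, ⟨le_rfl, hθz.2⟩, rfl⟩, ?_, ?_⟩
    · rintro _ ⟨θ, hθ, rfl⟩
      have hθ' : θ ∈ Ico θ₀ (θ₀ + 2 * Real.pi) := ⟨hθz.1.trans hθ.1, hθ.2⟩
      refine ⟨hmem θ, ?_⟩
      rintro (h | h)
      · exact (hlt.trans_le hθ.1).ne' (hinj hθ' h0 h)
      · exact (hqz.trans_le hθ.1).ne' (hinj hθ' ⟨hθq.1.le, hqz.trans hθz.2⟩ h)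
    · have h1 : circleMap c r θ₀ = circleMap c r (θ₀ + 2 * Real.pi) :=
        (periodic_circleMap c r θ₀).symm
      rw [h1]
      have := image_closure_subset_closure_image (continuous_circleMap c r)
        (s := Ico θz (θ₀ + 2 * Real.pi))
      refine this ⟨_, ?_, rfl⟩
      rw [closure_Ico hθz.2.ne]
      exact ⟨hθz.2.le, le_rfl⟩
  · refine ⟨circleMap c r '' Ioc θ₀ θz, circleMap_image_preconnected c r isPreconnected_Ioc,
      ⟨θz, ⟨hlt, le_rfl⟩, rfl⟩, ?_, ?_⟩
    · rintro _ ⟨θ, hθ, rfl⟩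
      have hθ' : θ ∈ Ico θ₀ (θ₀ + 2 * Real.pi) := ⟨hθ.1.le, hθ.2.trans_lt hθz.2⟩
      refine ⟨hmem θ, ?_⟩
      rintro (h | h)
      · exact hθ.1.ne' (hinj hθ' h0 h)
      · exact hq ⟨θ, hθ, h⟩
    · have := image_closure_subset_closure_image (continuous_circleMap c r) (s := Ioc θ₀ θz)
      refine this ⟨_, ?_, rfl⟩
      rw [closure_Ioc hlt.ne]
      exact ⟨le_rfl, hlt.le⟩

theorem isPreconnected_sphere_diff_singleton {c p : ℂ} {r : ℝ} (hr : 0 < r) (hp : p ∈ sphere c r) :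
    IsPreconnected (sphere c r \ {p}) := by
  obtain ⟨θ₀, -, rfl⟩ := exists_eq_circleMap hp hr 0
  have hinj := circleMap_injOn_Ico c hr.ne' θ₀
  have h0 : θ₀ ∈ Ico θ₀ (θ₀ + 2 * Real.pi) := ⟨le_rfl, by linarith [Real.pi_pos]⟩
  have : sphere c r \ {circleMap c r θ₀} = circleMap c r '' Ioo θ₀ (θ₀ + 2 * Real.pi) := by
    ext z
    constructor
    · rintro ⟨hz, hzp⟩
      obtain ⟨θz, hθz, rfl⟩ := exists_eq_circleMap hz hr θ₀
      exact ⟨θz, ⟨lt_of_le_of_ne hθz.1 (by rintro rfl; exact hzp rfl), hθz.2⟩, rfl⟩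
    · rintro ⟨θ, hθ, rfl⟩
      exact ⟨circleMap_mem_sphere c hr.le θ, fun h => hθ.1.ne' (hinj ⟨hθ.1.le, hθ.2⟩ h0 h)⟩
  rw [this]
  exact circleMap_image_preconnected c r isPreconnected_Ioo

theorem exists_mem_sphere_ne (c p q : ℂ) {r : ℝ} (hr : 0 < r) : ∃ z ∈ sphere c r, z ≠ p ∧ z ≠ q := by
  have hr' : (r : ℂ) ≠ 0 := by exact_mod_cast hr.ne'
  have m1 : c + r ∈ sphere c r := by simp [abs_of_pos hr]
  have m2 : c - r ∈ sphere c r := by simp [abs_of_pos hr]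
  have m3 : c + r * Complex.I ∈ sphere c r := by simp [abs_of_pos hr]
  have h12 : c + r ≠ c - r := by
    intro h; apply hr'; linear_combination h / 2
  have hI : (1 : ℂ) - Complex.I ≠ 0 := by
    intro h; have := congrArg Complex.re h; simp at this
  have hI' : (1 : ℂ) + Complex.I ≠ 0 := by
    intro h; have := congrArg Complex.re h; simp at this
  have h13 : c + r ≠ c + r * Complex.I := by
    intro h
    exact mul_ne_zero hr' hI (by linear_combination h)
  have h23 : c - r ≠ c + r * Complex.I := by
    intro h
    exact mul_ne_zero hr' hI' (by linear_combination -h)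
  by_cases a1 : c + r = p
  · by_cases b2 : c - r = q
    · exact ⟨_, m3, fun h => h13 (a1.trans h.symm), fun h => h23 (b2.trans h.symm)⟩
    · exact ⟨_, m2, fun h => h12 (a1.trans h.symm), b2⟩
  · by_cases b1 : c + r = q
    · by_cases a2 : c - r = p
      · exact ⟨_, m3, fun h => h23 (a2.trans h.symm), fun h => h13 (b1.trans h.symm)⟩
      · exact ⟨_, m2, a2, fun h => h12 (b1.trans h.symm)⟩
    · exact ⟨_, m1, a1, b1⟩

/-! ### Tame arcs -/

/-- A simple arc such that, on either side of each of its points, the distance from that point is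
at first strictly monotone along the arc. -/
structure IsTameArc (κ : ℝ → ℂ) (T : ℝ) : Prop where
  pos : 0 < T
  continuousOn : ContinuousOn κ (Icc 0 T)
  injOn : InjOn κ (Icc 0 T)
  left : ∀ s ∈ Ioc 0 T, ∃ η > 0, η ≤ s ∧ StrictAntiOn (fun x => dist (κ x) (κ s)) (Icc (s - η) s)
  right : ∀ s ∈ Ico 0 T, ∃ η > 0, s + η ≤ T ∧ StrictMonoOn (fun x => dist (κ x) (κ s)) (Icc s (s + η))

/-- Close to s the derivative differs from its value d at s by less than ‖d‖/4. After division by d,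
chords lie in a narrow cone about the positive real axis, so consecutive chords make an acute angle
and the distance grows. -/
theorem IsArc.exists_strictMonoOn_dist {γ : ℝ → ℂ} {p q : ℂ} (h : IsArc γ p q) {s : ℝ}
    (hs : s ∈ Ico (0 : ℝ) 1) :
    ∃ η > 0, s + η ≤ 1 ∧ StrictMonoOn (fun x => dist (γ x) (γ s)) (Icc s (s + η)) := by
  have hsI : s ∈ Icc (0 : ℝ) 1 := Ico_subset_Icc_self hs
  set d := derivWithin γ (Icc 0 1) s with hd
  have hd0 : d ≠ 0 := h.derivWithin_ne_zero s hsI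
  have hcont := h.continuousOn_derivWithin s hsI
  have hev : ∀ᶠ x in 𝓝[Icc 0 1] s, ‖derivWithin γ (Icc 0 1) x - d‖ < ‖d‖ / 4 := by
    have := (hcont.sub_const d).norm
    simp only [← hd, sub_self, norm_zero] at this
    exact this.eventually (gt_mem_nhds (by have := norm_pos_iff.2 hd0; linarith))
  obtain ⟨δ, hδ, hball⟩ := Metric.mem_nhdsWithin_iff.1 hev
  set η := min (δ / 2) (1 - s) with hη
  have hη0 : 0 < η := lt_min (by linarith) (by linarith [hs.2])
  have hη1 : s + η ≤ 1 := by have := min_le_right (δ / 2) (1 - s); linarith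
  have hsub : Icc s (s + η) ⊆ Icc 0 1 := Icc_subset_Icc hs.1 hη1
  have hmv : ∀ x ∈ Icc s (s + η), ∀ y ∈ Icc s (s + η), x ≤ y →
      ‖(γ y - γ x) / d - (y - x : ℝ)‖ ≤ 1 / 4 * (y - x) := by
    intro x hx y hy hxy
    have := (convex_Icc s (s + η)).norm_image_sub_le_of_norm_hasDerivWithin_le
      (f := fun u => γ u - u • d) (f' := fun u => derivWithin γ (Icc 0 1) u - d) (C := ‖d‖ / 4)
      (fun u hu => by
        have h1 := ((h.differentiableOn u (hsub hu)).hasDerivWithinAt).mono hsub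
        have h2 := ((hasDerivAt_id u).smul_const d).hasDerivWithinAt (s := Icc s (s + η))
        rw [one_smul] at h2
        exact h1.sub h2)
      (fun u hu => by
        refine (hball ⟨?_, hsub hu⟩ : ‖derivWithin γ (Icc 0 1) u - d‖ < ‖d‖ / 4).le
        rw [mem_ball, Real.dist_eq, abs_of_nonneg (by linarith [hu.1])]
        have := min_le_left (δ / 2) (1 - s)
        linarith [hu.2]) hx hy
    rw [Real.norm_eq_abs, abs_of_nonneg (sub_nonneg.2 hxy)] at this
    have e : (γ y - γ x) / d - (y - x : ℝ) = (γ y - y • d - (γ x - x • d)) / d := by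
      simp only [Complex.real_smul]; push_cast; field_simp; ring
    rw [e, norm_div, div_le_iff₀ (norm_pos_iff.2 hd0)]
    linarith
  refine ⟨η, hη0, hη1, fun x hx y hy hxy => ?_⟩
  have hsm : s ∈ Icc s (s + η) := ⟨le_rfl, by linarith⟩
  simp only [dist_eq_norm]
  set u := (γ x - γ s) / d with hu
  set v := (γ y - γ x) / d with hv
  have e1 : γ x - γ s = u * d := by rw [hu]; field_simp
  have e2 : γ y - γ s = (u + v) * d := by rw [hu, hv]; field_simp; ring
  rw [e1, e2, norm_mul, norm_mul]
  refine mul_lt_mul_of_pos_right ?_ (norm_pos_iff.2 hd0)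
  have b1 := hmv s hsm x hx hx.1
  have b2 := hmv x hx y hy hxy.le
  rw [← hu] at b1
  rw [← hv] at b2
  have r1 := (Complex.abs_re_le_norm _).trans b1
  have i1 := (Complex.abs_im_le_norm _).trans b1
  have r2 := (Complex.abs_re_le_norm _).trans b2
  have i2 := (Complex.abs_im_le_norm _).trans b2
  simp only [Complex.sub_re, Complex.sub_im, Complex.ofReal_re, Complex.ofReal_im, sub_zero,
    abs_le] at r1 i1 r2 i2
  have hX : 0 ≤ x - s := by linarith [hx.1]
  have hY : 0 < y - x := by linarith
  refine lt_of_pow_lt_pow_left₀ 2 (norm_nonneg _) ?_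
  rw [Complex.sq_norm, Complex.sq_norm, Complex.normSq_apply, Complex.normSq_apply, Complex.add_re,
    Complex.add_im]
  have k1 : 0 ≤ u.re * v.re + u.im * v.im := by
    have a1 : 3 / 4 * (x - s) * (3 / 4 * (y - x)) ≤ u.re * v.re := by
      apply mul_le_mul <;> linarith
    have a2 : |u.im * v.im| ≤ 1 / 4 * (x - s) * (1 / 4 * (y - x)) := by
      rw [abs_mul]
      apply mul_le_mul (abs_le.2 i1) (abs_le.2 i2) (abs_nonneg _) (by linarith)
    have a3 := (abs_le.1 a2).1
    nlinarith [mul_nonneg hX hY.le]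
  have k2 : 0 < v.re := by linarith
  nlinarith [mul_pos k2 k2, mul_self_nonneg v.im]

theorem IsArc.isTameArc {γ : ℝ → ℂ} {p q : ℂ} (h : IsArc γ p q) : IsTameArc γ 1 := by
  refine ⟨one_pos, h.continuousOn, h.injOn, fun s hs => ?_, fun s hs => h.exists_strictMonoOn_dist hs⟩
  obtain ⟨η, hη, hη1, hm⟩ := h.reverse.exists_strictMonoOn_dist (s := 1 - s)
    ⟨by linarith [hs.2], by linarith [hs.1]⟩
  refine ⟨η, hη, by linarith, fun x hx y hy hxy => ?_⟩
  have := hm (a := 1 - y) (b := 1 - x) ⟨by linarith [hy.2], by linarith [hy.1]⟩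
    ⟨by linarith [hx.2], by linarith [hx.1]⟩ (by linarith)
  simpa using this

theorem IsTameArc.reverse {κ : ℝ → ℂ} {T : ℝ} (h : IsTameArc κ T) :
    IsTameArc (fun s => κ (T - s)) T := by
  have hmaps : MapsTo (fun s : ℝ => T - s) (Icc 0 T) (Icc 0 T) := fun s hs =>
    ⟨by linarith [hs.2], by linarith [hs.1]⟩
  refine ⟨h.pos, h.continuousOn.comp (by fun_prop) hmaps, fun x hx y hy hxy => ?_,
    fun s hs => ?_, fun s hs => ?_⟩
  · have := h.injOn (hmaps hx) (hmaps hy) hxy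
    linarith
  · obtain ⟨η, hη, hη1, hm⟩ := h.right (T - s) ⟨by linarith [hs.2], by linarith [hs.1]⟩
    exact ⟨η, hη, by linarith, fun x hx y hy hxy => hm ⟨by linarith [hy.2], by linarith [hy.1]⟩
      ⟨by linarith [hx.2], by linarith [hx.1]⟩ (by linarith)⟩
  · obtain ⟨η, hη, hη1, hm⟩ := h.left (T - s) ⟨by linarith [hs.2], by linarith [hs.1]⟩
    exact ⟨η, hη, by linarith, fun x hx y hy hxy => hm ⟨by linarith [hy.2], by linarith [hy.1]⟩
      ⟨by linarith [hx.2], by linarith [hx.1]⟩ (by linarith)⟩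

/-- The concatenation of two parametrized curves. -/
def concat (κ₁ κ₂ : ℝ → ℂ) (T₁ : ℝ) (s : ℝ) : ℂ := if s ≤ T₁ then κ₁ s else κ₂ (s - T₁)

theorem concat_left {κ₁ κ₂ : ℝ → ℂ} {T₁ s : ℝ} (h : s ≤ T₁) : concat κ₁ κ₂ T₁ s = κ₁ s := if_pos h

theorem concat_right {κ₁ κ₂ : ℝ → ℂ} {T₁ s : ℝ} (h0 : κ₁ T₁ = κ₂ 0) (h : T₁ ≤ s) :
    concat κ₁ κ₂ T₁ s = κ₂ (s - T₁) := by
  rcases h.eq_or_lt with rfl | h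
  · rw [concat_left le_rfl, h0, sub_self]
  · exact if_neg (not_le.2 h)

/-- Tameness is a one-sided condition at each parameter, so the tangents need not match at the
junction. This is why it replaces regularity for the spine. -/
theorem IsTameArc.concat {κ₁ κ₂ : ℝ → ℂ} {T₁ T₂ : ℝ} (h₁ : IsTameArc κ₁ T₁) (h₂ : IsTameArc κ₂ T₂)
    (h0 : κ₁ T₁ = κ₂ 0) (hd : ∀ s ∈ Icc 0 T₁, ∀ s' ∈ Icc 0 T₂, κ₁ s = κ₂ s' → s = T₁ ∧ s' = 0) :
    IsTameArc (concat κ₁ κ₂ T₁) (T₁ + T₂) := by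
  have p1 := h₁.pos
  have p2 := h₂.pos
  have hr : ∀ {s}, T₁ ≤ s → TwoCut.concat κ₁ κ₂ T₁ s = κ₂ (s - T₁) := fun h => concat_right h0 h
  have hl : ∀ {s}, s ≤ T₁ → TwoCut.concat κ₁ κ₂ T₁ s = κ₁ s := fun h => concat_left h
  refine ⟨by linarith, ?_, ?_, ?_, ?_⟩
  · have c1 : ContinuousOn (TwoCut.concat κ₁ κ₂ T₁) (Icc 0 T₁) :=
      h₁.continuousOn.congr fun s hs => hl hs.2
    have c2 : ContinuousOn (TwoCut.concat κ₁ κ₂ T₁) (Icc T₁ (T₁ + T₂)) := by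
      refine ContinuousOn.congr (f := fun s => κ₂ (s - T₁)) ?_ fun s hs => hr hs.1
      exact h₂.continuousOn.comp (by fun_prop) fun s hs =>
        ⟨by linarith [hs.1], by linarith [hs.2]⟩
    rw [← Icc_union_Icc_eq_Icc p1.le (by linarith : T₁ ≤ T₁ + T₂)]
    exact c1.union_of_isClosed c2 isClosed_Icc isClosed_Icc
  · have key : ∀ x ∈ Icc 0 (T₁ + T₂), ∀ y ∈ Icc 0 (T₁ + T₂), x ≤ y →
        TwoCut.concat κ₁ κ₂ T₁ x = TwoCut.concat κ₁ κ₂ T₁ y → x = y := by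
      intro x hx y hy hxy e
      rcases le_total y T₁ with hy1 | hy1
      · rw [hl hy1, hl (hxy.trans hy1)] at e
        exact h₁.injOn ⟨hx.1, hxy.trans hy1⟩ ⟨hy.1, hy1⟩ e
      · rcases le_total x T₁ with hx1 | hx1
        · rw [hl hx1, hr hy1] at e
          obtain ⟨e1, e2⟩ := hd x ⟨hx.1, hx1⟩ (y - T₁) ⟨by linarith, by linarith [hy.2]⟩ e
          linarith
        · rw [hr hx1, hr hy1] at e
          have := h₂.injOn ⟨by linarith, by linarith [hx.2]⟩ ⟨by linarith, by linarith [hy.2]⟩ e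
          linarith
    intro x hx y hy e
    rcases le_total x y with h | h
    · exact key x hx y hy h e
    · exact (key y hy x hx h e.symm).symm
  · intro s hs
    rcases le_or_gt s T₁ with hs1 | hs1
    · obtain ⟨η, hη, hη1, hm⟩ := h₁.left s ⟨hs.1, hs1⟩
      refine ⟨η, hη, hη1, fun x hx y hy hxy => ?_⟩
      simp only [hl hs1, hl (hx.2.trans hs1), hl (hy.2.trans hs1)]
      exact hm hx hy hxy
    · obtain ⟨η, hη, hη1, hm⟩ := h₂.left (s - T₁) ⟨by linarith, by linarith [hs.2]⟩
      refine ⟨η, hη, by linarith, fun x hx y hy hxy => ?_⟩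
      simp only [hr hs1.le, hr (by linarith [hx.1] : T₁ ≤ x), hr (by linarith [hy.1] : T₁ ≤ y)]
      exact hm ⟨by linarith [hx.1], by linarith [hx.2]⟩ ⟨by linarith [hy.1], by linarith [hy.2]⟩
        (by linarith)
  · intro s hs
    rcases lt_or_ge s T₁ with hs1 | hs1
    · obtain ⟨η, hη, hη1, hm⟩ := h₁.right s ⟨hs.1, hs1⟩
      refine ⟨η, hη, by linarith, fun x hx y hy hxy => ?_⟩
      simp only [hl hs1.le, hl (hx.2.trans hη1), hl (hy.2.trans hη1)]
      exact hm hx hy hxy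
    · obtain ⟨η, hη, hη1, hm⟩ := h₂.right (s - T₁) ⟨by linarith, by linarith [hs.2]⟩
      refine ⟨η, hη, by linarith, fun x hx y hy hxy => ?_⟩
      simp only [hr hs1, hr (by linarith [hx.1] : T₁ ≤ x), hr (by linarith [hy.1] : T₁ ≤ y)]
      exact hm ⟨by linarith [hx.1], by linarith [hx.2]⟩ ⟨by linarith [hy.1], by linarith [hy.2]⟩
        (by linarith)

variable {κ : ℝ → ℂ} {T : ℝ}

theorem IsTameArc.isCompact (h : IsTameArc κ T) : IsCompact (κ '' Icc 0 T) :=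
  isCompact_Icc.image_of_continuousOn h.continuousOn

/-- Small circles meet the arc exactly once before the given point. -/
theorem IsTameArc.circle_left (h : IsTameArc κ T) {s₀ : ℝ} (hs₀ : s₀ ∈ Ioc 0 T) {η : ℝ}
    (hη : 0 < η) : ∃ δ > 0, ∀ r ∈ Ioo 0 δ, ∃ s ∈ Ioo (s₀ - η) s₀, 0 ≤ s ∧ dist (κ s) (κ s₀) = r ∧
      ∀ s' ∈ Icc 0 s₀, dist (κ s') (κ s₀) = r → s' = s := by
  obtain ⟨η₁, hη₁, hle, hm⟩ := h.left s₀ hs₀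
  set η₀ := min η₁ (η / 2) with hη₀
  have p0 : 0 < η₀ := lt_min hη₁ (by linarith)
  have le1 : η₀ ≤ η₁ := min_le_left _ _
  have le2 : η₀ ≤ η / 2 := min_le_right _ _
  have hm' : StrictAntiOn (fun x => dist (κ x) (κ s₀)) (Icc (s₀ - η₀) s₀) :=
    hm.mono (Icc_subset_Icc (by linarith) le_rfl)
  have hc : ContinuousOn (fun x => dist (κ x) (κ s₀)) (Icc 0 s₀) :=
    continuous_dist.comp_continuousOn
      ((h.continuousOn.mono (Icc_subset_Icc le_rfl hs₀.2)).prodMk continuousOn_const)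
  -- Radii below the least distance from the remote earlier part meet the arc only on the stretch
  -- where the distance is monotone.
  obtain ⟨x, hx, hmin⟩ := (isCompact_Icc (a := 0) (b := s₀ - η₀)).exists_isMinOn
    ⟨0, le_rfl, by linarith⟩ (hc.mono (Icc_subset_Icc le_rfl (by linarith)))
  have hpos : 0 < dist (κ x) (κ s₀) := by
    rw [dist_pos]
    intro e
    have := h.injOn ⟨hx.1, by linarith [hx.2, hs₀.2]⟩ ⟨hs₀.1.le, hs₀.2⟩ e
    linarith [hx.2]
  have hmin' : ∀ s ∈ Icc 0 (s₀ - η₀), dist (κ x) (κ s₀) ≤ dist (κ s) (κ s₀) := fun s hs => hmin hs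
  refine ⟨dist (κ x) (κ s₀), hpos, fun r hr => ?_⟩
  have hiv := intermediate_value_Icc' (by linarith : s₀ - η₀ ≤ s₀)
    (hc.mono (Icc_subset_Icc (by linarith) le_rfl))
  have hend := hmin' (s₀ - η₀) ⟨by linarith, le_rfl⟩
  obtain ⟨s, hs, hsr⟩ := hiv ⟨by simpa using hr.1.le, hr.2.le.trans hend⟩
  simp only at hsr
  have hs1 : s < s₀ := lt_of_le_of_ne hs.2 (by rintro rfl; rw [dist_self] at hsr; linarith [hr.1])
  refine ⟨s, ⟨by linarith [hs.1], hs1⟩, by linarith [hs.1], hsr, fun s' hs' e => ?_⟩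
  rcases le_or_gt s' (s₀ - η₀) with h1 | h1
  · have := hmin' s' ⟨hs'.1, h1⟩
    linarith [hr.2]
  · exact hm'.injOn ⟨h1.le, hs'.2⟩ hs (e.trans hsr.symm)

theorem IsTameArc.circle_right (h : IsTameArc κ T) {s₀ : ℝ} (hs₀ : s₀ ∈ Ico 0 T) {η : ℝ}
    (hη : 0 < η) : ∃ δ > 0, ∀ r ∈ Ioo 0 δ, ∃ s ∈ Ioo s₀ (s₀ + η), s ≤ T ∧ dist (κ s) (κ s₀) = r ∧
      ∀ s' ∈ Icc s₀ T, dist (κ s') (κ s₀) = r → s' = s := by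
  obtain ⟨δ, hδ, hh⟩ := h.reverse.circle_left (s₀ := T - s₀)
    ⟨by linarith [hs₀.2], by linarith [hs₀.1]⟩ hη
  refine ⟨δ, hδ, fun r hr => ?_⟩
  obtain ⟨s, hs, h0, hsr, huniq⟩ := hh r hr
  rw [sub_sub_cancel] at hsr
  refine ⟨T - s, ⟨by linarith [hs.2], by linarith [hs.1]⟩, by linarith, hsr, fun s' hs' e => ?_⟩
  have := huniq (T - s') ⟨by linarith [hs'.2], by linarith [hs'.1]⟩ (by simpa using e)
  linarith

/-- Off the arc and close to one of its points, one can move along a circle to earlier points of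
the arc. -/
theorem IsTameArc.join_left (h : IsTameArc κ T) {s₀ : ℝ} (hs₀ : s₀ ∈ Ioc 0 T) {η : ℝ}
    (hη : 0 < η) : ∃ δ > 0, ∀ z ∉ κ '' Icc 0 T, dist z (κ s₀) < δ → ∃ s ∈ Ioo (s₀ - η) s₀, 0 ≤ s ∧
      ∃ W, IsPreconnected W ∧ z ∈ W ∧ W ⊆ sphere (κ s₀) (dist z (κ s₀)) \ κ '' Icc 0 T ∧
        κ s ∈ closure W := by
  obtain ⟨δ₁, hδ₁, h₁⟩ := h.circle_left hs₀ hη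
  obtain ⟨δ₂, hδ₂, h₂⟩ : ∃ δ > 0, ∀ r ∈ Ioo 0 δ, ∃ q : ℂ, ∀ s' ∈ Icc s₀ T,
      dist (κ s') (κ s₀) = r → κ s' = q := by
    rcases hs₀.2.eq_or_lt with h2 | h2
    · refine ⟨1, one_pos, fun r hr => ⟨0, fun s' hs' e => ?_⟩⟩
      have : s' = s₀ := le_antisymm (hs'.2.trans h2.ge) hs'.1
      rw [this, dist_self] at e
      linarith [hr.1]
    · obtain ⟨δ, hδ, hh⟩ := h.circle_right ⟨hs₀.1.le, h2⟩ one_pos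
      refine ⟨δ, hδ, fun r hr => ?_⟩
      obtain ⟨s, -, -, -, hu⟩ := hh r hr
      exact ⟨κ s, fun s' hs' e => by rw [hu s' hs' e]⟩
  refine ⟨min δ₁ δ₂, lt_min hδ₁ hδ₂, fun z hz hzd => ?_⟩
  have hr : 0 < dist z (κ s₀) := dist_pos.2 fun e => hz (e ▸ ⟨s₀, ⟨hs₀.1.le, hs₀.2⟩, rfl⟩)
  obtain ⟨s, hs, hs0, hsr, hu⟩ := h₁ _ ⟨hr, hzd.trans_le (min_le_left _ _)⟩
  obtain ⟨q, hq⟩ := h₂ _ ⟨hr, hzd.trans_le (min_le_right _ _)⟩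
  have hsT : s ∈ Icc 0 T := ⟨hs0, hs.2.le.trans hs₀.2⟩
  -- Here q stands for the only possible point of the later arc on the circle. If z = q, which is
  -- off the arc, there is no such point and only κ s has to be avoided.
  by_cases hzq : z = q
  · have hz2 : z ≠ κ s := fun e => hz (e ▸ ⟨s, hsT, rfl⟩)
    obtain ⟨W, hW, hzW, hWs, hcl⟩ := exists_arc_to (q := κ s) hr (p := κ s) hsr rfl hz2 hz2
    refine ⟨s, hs, hs0, W, hW, hzW, fun x hx => ⟨(hWs hx).1, ?_⟩, hcl⟩
    rintro ⟨s', hs', rfl⟩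
    have hd : dist (κ s') (κ s₀) = dist z (κ s₀) := (hWs hx).1
    rcases le_total s' s₀ with h1 | h1
    · have := hu s' ⟨hs'.1, h1⟩ hd
      exact (hWs hx).2 (by rw [this]; simp)
    · have := hq s' ⟨h1, hs'.2⟩ hd
      exact hz ⟨s', hs', this.trans hzq.symm⟩
  · obtain ⟨W, hW, hzW, hWs, hcl⟩ := exists_arc_to (q := q) hr (p := κ s) hsr rfl
      (fun e => hz (e ▸ ⟨s, hsT, rfl⟩)) hzq
    refine ⟨s, hs, hs0, W, hW, hzW, fun x hx => ⟨(hWs hx).1, ?_⟩, hcl⟩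
    rintro ⟨s', hs', rfl⟩
    have hd : dist (κ s') (κ s₀) = dist z (κ s₀) := (hWs hx).1
    rcases le_total s' s₀ with h1 | h1
    · have := hu s' ⟨hs'.1, h1⟩ hd
      exact (hWs hx).2 (by rw [this]; simp)
    · have := hq s' ⟨h1, hs'.2⟩ hd
      exact (hWs hx).2 (by rw [this]; simp)

/-- A small circle about the end point meets the arc exactly once, and a circle without one point is
connected. -/
theorem IsTameArc.exists_circle_diff (h : IsTameArc κ T) : ∃ δ > 0, ∀ r ∈ Ioo 0 δ,
    IsPreconnected (sphere (κ 0) r \ κ '' Icc 0 T) ∧ (sphere (κ 0) r \ κ '' Icc 0 T).Nonempty := by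
  obtain ⟨δ, hδ, hh⟩ := h.circle_right (s₀ := 0) ⟨le_rfl, h.pos⟩ one_pos
  refine ⟨δ, hδ, fun r hr => ?_⟩
  obtain ⟨s, hs, hsT, hsr, hu⟩ := hh r hr
  have : sphere (κ 0) r \ κ '' Icc 0 T = sphere (κ 0) r \ {κ s} := by
    ext z
    constructor
    · rintro ⟨h1, h2⟩
      exact ⟨h1, fun e => h2 (by rw [mem_singleton_iff.1 e]; exact ⟨s, ⟨hs.1.le, hsT⟩, rfl⟩)⟩
    · rintro ⟨h1, h2⟩
      refine ⟨h1, ?_⟩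
      rintro ⟨s', hs', rfl⟩
      exact h2 (by rw [hu s' hs' h1]; rfl)
  rw [this]
  refine ⟨isPreconnected_sphere_diff_singleton hr.1 hsr, ?_⟩
  obtain ⟨z, hz, hz1, -⟩ := exists_mem_sphere_ne (κ 0) (κ s) (κ s) hr.1
  exact ⟨z, hz, hz1⟩

/-- Near its end point an arc does not separate the plane. -/
theorem IsTameArc.exists_ball_diff (h : IsTameArc κ T) : ∃ δ > 0, ∀ ρ, 0 < ρ → ρ ≤ δ →
    IsPreconnected (ball (κ 0) ρ \ κ '' Icc 0 T) ∧ (ball (κ 0) ρ \ κ '' Icc 0 T).Nonempty := by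
  obtain ⟨δ, hδ, hh⟩ := h.exists_circle_diff
  refine ⟨δ, hδ, fun ρ hρ hρδ => ?_⟩
  set K := κ '' Icc 0 T with hK
  have hKo : IsOpen Kᶜ := h.isCompact.isClosed.isOpen_compl
  have hh' : ∀ r ∈ Ioo 0 ρ, IsPreconnected (sphere (κ 0) r \ K) ∧ (sphere (κ 0) r \ K).Nonempty :=
    fun r hr => hh r ⟨hr.1, hr.2.trans_le hρδ⟩
  have hsub : ∀ r ∈ Ioo 0 ρ, sphere (κ 0) r \ K ⊆ ball (κ 0) ρ \ K := fun r hr x hx =>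
    ⟨by rw [mem_ball, mem_sphere.1 hx.1]; exact hr.2, hx.2⟩
  have h0K : κ 0 ∈ K := ⟨0, ⟨le_rfl, h.pos.le⟩, rfl⟩
  constructor
  · have key : ∀ r ∈ Ioo 0 ρ, ∀ r' ∈ Ioo 0 ρ, ∀ z ∈ sphere (κ 0) r \ K, ∀ z' ∈ sphere (κ 0) r' \ K,
        ∃ W ⊆ ball (κ 0) ρ \ K, z ∈ W ∧ z' ∈ W ∧ IsPreconnected W := by
      intro r hr r' hr'
      refine isPreconnected_Ioo.induction₂ (fun r r' => ∀ z ∈ sphere (κ 0) r \ K,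
        ∀ z' ∈ sphere (κ 0) r' \ K, ∃ W ⊆ ball (κ 0) ρ \ K, z ∈ W ∧ z' ∈ W ∧ IsPreconnected W)
        ?_ ?_ ?_ hr hr'
      -- A point of one slit circle that is off the arc can be moved radially a little, which joins
      -- it to the neighbouring slit circles.
      · intro r hr
        obtain ⟨z₀, hz₀, hz₀K⟩ := (hh' r hr).2
        have hr0 : (r : ℂ) ≠ 0 := by exact_mod_cast hr.1.ne'
        set f : ℝ → ℂ := fun x => κ 0 + (x / r : ℂ) * (z₀ - κ 0) with hf
        have hfc : Continuous f := by fun_prop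
        have hfr : f r = z₀ := by simp [hf, div_self hr0]
        have hdist : ∀ x, 0 < x → dist (f x) (κ 0) = x := by
          intro x hx
          rw [dist_eq_norm]
          simp only [hf, add_sub_cancel_left, norm_mul, norm_div, Complex.norm_real,
            Real.norm_eq_abs, abs_of_pos hx, abs_of_pos hr.1]
          rw [← dist_eq_norm, mem_sphere.1 hz₀]
          exact div_mul_cancel₀ _ hr.1.ne'
        have hev : ∀ᶠ x in 𝓝 r, f x ∈ Kᶜ ∧ x ∈ Ioo 0 ρ := by
          refine (hfc.continuousAt.eventually ?_).and (Ioo_mem_nhds hr.1 hr.2)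
          rw [hfr]; exact hKo.mem_nhds hz₀K
        obtain ⟨ε, hε, hball⟩ := Metric.eventually_nhds_iff_ball.1 hev
        refine eventually_nhdsWithin_of_eventually_nhds ?_
        filter_upwards [ball_mem_nhds r hε] with r' hr' z hz z' hz'
        have hr'ρ := (hball r' hr').2
        refine ⟨(sphere (κ 0) r \ K) ∪ f '' ball r ε ∪ (sphere (κ 0) r' \ K), ?_,
          Or.inl (Or.inl hz), Or.inr hz', ?_⟩
        · refine union_subset (union_subset (hsub r hr) ?_) (hsub r' hr'ρ)
          rintro _ ⟨x, hx, rfl⟩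
          have := hball x hx
          exact ⟨by rw [mem_ball, hdist x this.2.1]; exact this.2.2, this.1⟩
        · have c1 : IsPreconnected ((sphere (κ 0) r \ K) ∪ f '' ball r ε) :=
            (hh' r hr).1.union z₀ ⟨hz₀, hz₀K⟩ ⟨r, mem_ball_self hε, hfr⟩
              ((convex_ball r ε).isPreconnected.image _ hfc.continuousOn)
          exact c1.union (f r') (Or.inr ⟨r', hr', rfl⟩)
            ⟨hdist r' hr'ρ.1, (hball r' hr').1⟩ (hh' r' hr'ρ).1
      · intro x y w hx hy hw h1 h2 z hz z' hz'
        obtain ⟨m, hm⟩ := (hh' y hy).2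
        obtain ⟨W1, s1, a1, b1, c1⟩ := h1 z hz m hm
        obtain ⟨W2, s2, a2, b2, c2⟩ := h2 m hm z' hz'
        exact ⟨W1 ∪ W2, union_subset s1 s2, Or.inl a1, Or.inr b2, c1.union m b1 a2 c2⟩
      · intro x y hx hy h1 z hz z' hz'
        obtain ⟨W, s, a, b, c⟩ := h1 z' hz' z hz
        exact ⟨W, s, b, a, c⟩
    refine isPreconnected_of_forall_pair fun z hz z' hz' => ?_
    have hd : ∀ z ∈ ball (κ 0) ρ \ K, dist z (κ 0) ∈ Ioo 0 ρ := fun z hz =>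
      ⟨dist_pos.2 fun e => hz.2 (e ▸ h0K), hz.1⟩
    exact key _ (hd z hz) _ (hd z' hz') z ⟨rfl, hz.2⟩ z' ⟨rfl, hz'.2⟩
  · have hr : ρ / 2 ∈ Ioo 0 ρ := ⟨by linarith, by linarith⟩
    exact (hh' _ hr).2.mono (hsub _ hr)

/-- The complement of a tame arc is connected. -/
theorem IsTameArc.isPreconnected_compl (h : IsTameArc κ T) : IsPreconnected (κ '' Icc 0 T)ᶜ := by
  set K := κ '' Icc 0 T with hK
  have hKo : IsOpen Kᶜ := h.isCompact.isClosed.isOpen_compl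
  have h0K : κ 0 ∈ K := ⟨0, ⟨le_rfl, h.pos.le⟩, rfl⟩
  obtain ⟨δ, hδ, hh⟩ := h.exists_ball_diff
  obtain ⟨hpre, z₀, hz₀⟩ := hh δ hδ le_rfl
  have key : ∀ z ∈ Kᶜ, z₀ ∈ connectedComponentIn Kᶜ z := by
    intro z hz
    set U := connectedComponentIn Kᶜ z with hU
    have hUo : IsOpen U := hKo.connectedComponentIn
    have hUK : U ⊆ Kᶜ := connectedComponentIn_subset _ _
    have hzU : z ∈ U := mem_connectedComponentIn hz
    have hext : ∀ W, IsPreconnected W → W ⊆ Kᶜ → ∀ x ∈ W, x ∈ U → W ⊆ U := by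
      intro W hW hWK x hxW hxU
      have := hW.subset_connectedComponentIn hxW hWK
      rwa [← connectedComponentIn_eq hxU] at this
    -- A component of the complement that does not accumulate at the arc would be open and closed in
    -- the plane.
    have hS : ∃ s ∈ Icc 0 T, κ s ∈ closure U := by
      by_contra hcon
      push Not at hcon
      have hclosed : IsClosed U := by
        rw [← closure_subset_iff_isClosed]
        intro x hx
        have hxK : x ∈ Kᶜ := fun ⟨s, hs, e⟩ => hcon s hs (e ▸ hx)
        obtain ⟨y, hy1, hy2⟩ := mem_closure_iff.1 hx _ hKo.connectedComponentIn
          (mem_connectedComponentIn hxK)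
        exact hext _ isPreconnected_connectedComponentIn (connectedComponentIn_subset _ _) y hy1 hy2
          (mem_connectedComponentIn hxK)
      have := (isClopen_iff.1 ⟨hclosed, hUo⟩).resolve_left (Set.nonempty_iff_ne_empty.1 ⟨z, hzU⟩)
      exact hUK (this ▸ mem_univ (κ 0)) h0K
    have hScomp : IsCompact (Icc 0 T ∩ κ ⁻¹' closure U) :=
      isCompact_Icc.of_isClosed_subset
        (h.continuousOn.preimage_isClosed_of_isClosed isClosed_Icc isClosed_closure)
        inter_subset_left
    obtain ⟨s, hs, hsmin⟩ := hScomp.exists_isLeast (by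
      obtain ⟨s, hs, h1⟩ := hS
      exact ⟨s, hs, h1⟩)
    -- Take the first parameter at which the component accumulates. If it were positive, sliding
    -- along a small circle would give an earlier one. So each component reaches the end κ 0, near
    -- which the complement is connected.
    have hs0 : s = 0 := by
      by_contra hne
      have hs' : s ∈ Ioc 0 T := ⟨lt_of_le_of_ne hs.1.1 (Ne.symm hne), hs.1.2⟩
      obtain ⟨δ', hδ', hj⟩ := h.join_left hs' one_pos
      obtain ⟨x, hxU, hxd⟩ := Metric.mem_closure_iff.1 hs.2 δ' hδ'
      obtain ⟨s', hs's, hs'0, W, hW, hxW, hWs, hcl⟩ := hj x (hUK hxU) (by rwa [dist_comm])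
      have hWU := hext W hW (fun y hy => (hWs hy).2) x hxW hxU
      have := hsmin ⟨⟨hs'0, hs's.2.le.trans hs'.2⟩, closure_mono hWU hcl⟩
      linarith [hs's.2]
    have hcl : κ 0 ∈ closure U := hs0 ▸ hs.2
    obtain ⟨x, hxU, hxd⟩ := Metric.mem_closure_iff.1 hcl δ hδ
    exact hext _ hpre (fun y hy => hy.2) x ⟨by rwa [mem_ball, dist_comm], hUK hxU⟩ hxU hz₀
  refine isPreconnected_of_forall z₀ fun z hz => ⟨connectedComponentIn Kᶜ z,
    connectedComponentIn_subset _ _, key z hz, mem_connectedComponentIn hz,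
    isPreconnected_connectedComponentIn⟩

/-- A small circle about a point of the arc contains at most one earlier and one later point of the
arc. -/
theorem IsTameArc.dense_compl (h : IsTameArc κ T) : Dense (κ '' Icc 0 T)ᶜ := by
  have hleft : ∀ s₀ ∈ Icc 0 T, ∃ δ > 0, ∀ r ∈ Ioo 0 δ, ∃ q : ℂ, ∀ s' ∈ Icc 0 s₀,
      dist (κ s') (κ s₀) = r → κ s' = q := by
    intro s₀ hs₀
    rcases hs₀.1.eq_or_lt with h2 | h2
    · refine ⟨1, one_pos, fun r hr => ⟨0, fun s' hs' e => ?_⟩⟩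
      have : s' = s₀ := le_antisymm hs'.2 (h2 ▸ hs'.1)
      rw [this, dist_self] at e
      linarith [hr.1]
    · obtain ⟨δ, hδ, hh⟩ := h.circle_left ⟨h2, hs₀.2⟩ one_pos
      refine ⟨δ, hδ, fun r hr => ?_⟩
      obtain ⟨s, -, -, -, hu⟩ := hh r hr
      exact ⟨κ s, fun s' hs' e => by rw [hu s' hs' e]⟩
  have hright : ∀ s₀ ∈ Icc 0 T, ∃ δ > 0, ∀ r ∈ Ioo 0 δ, ∃ q : ℂ, ∀ s' ∈ Icc s₀ T,
      dist (κ s') (κ s₀) = r → κ s' = q := by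
    intro s₀ hs₀
    rcases hs₀.2.eq_or_lt with h2 | h2
    · refine ⟨1, one_pos, fun r hr => ⟨0, fun s' hs' e => ?_⟩⟩
      have : s' = s₀ := le_antisymm (hs'.2.trans h2.ge) hs'.1
      rw [this, dist_self] at e
      linarith [hr.1]
    · obtain ⟨δ, hδ, hh⟩ := h.circle_right ⟨hs₀.1, h2⟩ one_pos
      refine ⟨δ, hδ, fun r hr => ?_⟩
      obtain ⟨s, -, -, -, hu⟩ := hh r hr
      exact ⟨κ s, fun s' hs' e => by rw [hu s' hs' e]⟩
  intro x
  by_cases hx : x ∈ κ '' Icc 0 T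
  · obtain ⟨s₀, hs₀, rfl⟩ := hx
    rw [Metric.mem_closure_iff]
    intro ε hε
    obtain ⟨δ₁, hδ₁, h₁⟩ := hleft s₀ hs₀
    obtain ⟨δ₂, hδ₂, h₂⟩ := hright s₀ hs₀
    set r := min ε (min δ₁ δ₂) / 2 with hr
    have hm : 0 < min ε (min δ₁ δ₂) := lt_min hε (lt_min hδ₁ hδ₂)
    have hr0 : 0 < r := by linarith
    have r1 : r < min ε (min δ₁ δ₂) := by linarith
    obtain ⟨p, hp⟩ := h₁ r ⟨hr0, r1.trans_le ((min_le_right _ _).trans (min_le_left _ _))⟩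
    obtain ⟨q, hq⟩ := h₂ r ⟨hr0, r1.trans_le ((min_le_right _ _).trans (min_le_right _ _))⟩
    obtain ⟨z, hz, hzp, hzq⟩ := exists_mem_sphere_ne (κ s₀) p q hr0
    refine ⟨z, ?_, by rw [dist_comm, mem_sphere.1 hz]; exact r1.trans_le (min_le_left _ _)⟩
    rintro ⟨s', hs', rfl⟩
    rcases le_total s' s₀ with h1 | h1
    · exact hzp (hp s' ⟨hs'.1, h1⟩ hz)
    · exact hzq (hq s' ⟨h1, hs'.2⟩ hz)
  · exact subset_closure hx

end TameArc

/-! ### The geometry of the contour and its spine -/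

namespace Contour

variable {t : ℂ} (c : Contour t)

theorem J_zero : c.J 0 = a₂ t := c.isArc_J.left

theorem J_one : c.J 1 = b₂ t := c.isArc_J.right

theorem I_zero : c.I 0 = -a₂ t := c.isArc_I.left

theorem I_one : c.I 1 = a₂ t := c.isArc_I.right

theorem isArc_J₁ : IsArc c.J₁ (-b₂ t) (-a₂ t) := c.isArc_J.reverse.neg

theorem image_J₁ : c.J₁ '' Icc 0 1 = -(c.J '' Icc 0 1) := by
  ext z
  constructor
  · rintro ⟨s, hs, rfl⟩
    exact ⟨1 - s, ⟨by linarith [hs.2], by linarith [hs.1]⟩, by simp [J₁]⟩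
  · rintro ⟨s, hs, h⟩
    exact ⟨1 - s, ⟨by linarith [hs.2], by linarith [hs.1]⟩, by simp [J₁, h]⟩

theorem a_mem_J : a₂ t ∈ c.J '' Icc 0 1 := ⟨0, ⟨le_rfl, zero_le_one⟩, c.J_zero⟩

theorem b_mem_J : b₂ t ∈ c.J '' Icc 0 1 := ⟨1, ⟨zero_le_one, le_rfl⟩, c.J_one⟩

theorem a_ne_zero (c : Contour t) : a₂ t ≠ 0 := fun h =>
  Set.disjoint_left.1 c.J_neg_J c.a_mem_J (by
    have := Set.neg_mem_neg.2 c.a_mem_J; rw [h, neg_zero] at this; rwa [h])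

theorem b_ne_zero (c : Contour t) : b₂ t ≠ 0 := fun h =>
  Set.disjoint_left.1 c.J_neg_J c.b_mem_J (by
    have := Set.neg_mem_neg.2 c.b_mem_J; rw [h, neg_zero] at this; rwa [h])

/-- a₂² b₂² = t² - 4, and neither factor vanishes because J and -J are disjoint. -/
theorem sq_ne_four (c : Contour t) : t ^ 2 ≠ 4 := by
  intro h
  have h1 : a₂ t ^ 2 * b₂ t ^ 2 = 0 := by rw [a₂_sq, b₂_sq]; linear_combination h
  exact mul_ne_zero (pow_ne_zero 2 c.a_ne_zero) (pow_ne_zero 2 c.b_ne_zero) h1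

theorem a_ne_b (c : Contour t) : a₂ t ≠ b₂ t := fun h => by
  have := c.isArc_J.injOn (x₁ := 0) ⟨le_rfl, zero_le_one⟩ (x₂ := 1) ⟨zero_le_one, le_rfl⟩
    (by rw [c.J_zero, c.J_one, h])
  norm_num at this

theorem R_eq_zero_iff {z : ℂ} : R t z = 0 ↔ (z = a₂ t ∨ z = -a₂ t) ∨ z = b₂ t ∨ z = -b₂ t := by
  unfold R
  rw [mul_eq_zero, sub_eq_zero, sub_eq_zero, sq_eq_sq_iff_eq_or_eq_neg, sq_eq_sq_iff_eq_or_eq_neg]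

theorem neg_mem_cuts {z : ℂ} : -z ∈ c.cuts ↔ z ∈ c.cuts := by
  unfold cuts
  rw [image_J₁, mem_union, mem_union, Set.neg_mem_neg, Set.mem_neg, or_comm]

theorem isCompact_cuts : IsCompact c.cuts :=
  (isCompact_Icc.image_of_continuousOn c.isArc_J₁.continuousOn).union
    (isCompact_Icc.image_of_continuousOn c.isArc_J.continuousOn)

theorem isOpen_compl_cuts : IsOpen c.cutsᶜ := c.isCompact_cuts.isClosed.isOpen_compl

theorem a_mem_cuts : a₂ t ∈ c.cuts := Or.inr c.a_mem_J

theorem b_mem_cuts : b₂ t ∈ c.cuts := Or.inr c.b_mem_J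

theorem R_ne_zero {z : ℂ} (hz : z ∉ c.cuts) : R t z ≠ 0 := by
  rw [Ne, R_eq_zero_iff]
  rintro ((rfl | rfl) | (rfl | rfl))
  · exact hz c.a_mem_cuts
  · exact hz (c.neg_mem_cuts.2 c.a_mem_cuts)
  · exact hz c.b_mem_cuts
  · exact hz (c.neg_mem_cuts.2 c.b_mem_cuts)

theorem sqrtR_ne_zero {z : ℂ} (hz : z ∉ c.cuts) : c.sqrtR z ≠ 0 := fun h =>
  c.R_ne_zero hz (by rw [← c.sqrtR_sq, h]; simp)

theorem I_notMem_cuts {s : ℝ} (hs : s ∈ Ioo (0 : ℝ) 1) : c.I s ∉ c.cuts := by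
  have hs' := Ioo_subset_Icc_self hs
  unfold cuts
  rw [image_J₁]
  rintro (h | h)
  · have : c.I s ∈ ({-a₂ t} : Set ℂ) := c.I_neg_J ▸ ⟨⟨s, hs', rfl⟩, h⟩
    have := c.isArc_I.injOn hs' (x₂ := 0) ⟨le_rfl, zero_le_one⟩ (this.trans c.I_zero.symm)
    linarith [hs.1]
  · have : c.I s ∈ ({a₂ t} : Set ℂ) := c.I_J ▸ ⟨⟨s, hs', rfl⟩, h⟩
    have := c.isArc_I.injOn hs' (x₂ := 1) ⟨zero_le_one, le_rfl⟩ (this.trans c.I_one.symm)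
    linarith [hs.2]

theorem R_J_ne_zero {s : ℝ} (hs : s ∈ Ioo (0 : ℝ) 1) : R t (c.J s) ≠ 0 := by
  have hs' := Ioo_subset_Icc_self hs
  have hmem : c.J s ∈ c.J '' Icc 0 1 := ⟨s, hs', rfl⟩
  rw [Ne, R_eq_zero_iff]
  rintro ((h | h) | (h | h))
  · have := c.isArc_J.injOn hs' (x₂ := 0) ⟨le_rfl, zero_le_one⟩ (h.trans c.J_zero.symm)
    linarith [hs.1]
  · exact Set.disjoint_left.1 c.J_neg_J hmem (by rw [h]; exact Set.neg_mem_neg.2 c.a_mem_J)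
  · have := c.isArc_J.injOn hs' (x₂ := 1) ⟨zero_le_one, le_rfl⟩ (h.trans c.J_one.symm)
    linarith [hs.2]
  · exact Set.disjoint_left.1 c.J_neg_J hmem (by rw [h]; exact Set.neg_mem_neg.2 c.b_mem_J)

theorem R_J₁_ne_zero {s : ℝ} (hs : s ∈ Ioo (0 : ℝ) 1) : R t (c.J₁ s) ≠ 0 := by
  rw [J₁, Surface.R_neg]
  exact c.R_J_ne_zero ⟨by linarith [hs.2], by linarith [hs.1]⟩

/-- The arc that runs through `b₂`, `a₂`, `-a₂`, `-b₂` in this order, parametrized by `[0, 3]`. -/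
def spine : ℝ → ℂ :=
  concat (fun s => c.J (1 - s)) (concat (fun s => c.I (1 - s)) (fun s => c.J₁ (1 - s)) 1) 1

theorem spine_of_le_one {s : ℝ} (hs : s ≤ 1) : c.spine s = c.J (1 - s) := concat_left hs

theorem spine_of_mem_Icc {s : ℝ} (hs : s ∈ Icc (1 : ℝ) 2) : c.spine s = c.I (2 - s) := by
  unfold spine
  rw [concat_right _ hs.1, concat_left (by linarith [hs.2])]
  · ring_nf
  · rw [concat_left zero_le_one]; simp [c.J_zero, c.I_one]

theorem spine_of_two_le {s : ℝ} (hs : 2 ≤ s) : c.spine s = c.J₁ (3 - s) := by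
  unfold spine
  rw [concat_right _ (by linarith), concat_right _ (by linarith)]
  · ring_nf
  · simp [c.I_zero, J₁, c.J_zero]
  · rw [concat_left zero_le_one]; simp [c.J_zero, c.I_one]

/-- The arcs meet only at their common end points, so they join to a simple arc. Viewing -J ∪ I ∪ J
as one arc is what makes connectedness of its complement available. -/
theorem isTameArc_spine : IsTameArc c.spine 3 := by
  have hJ := c.isArc_J.reverse.isTameArc
  have hI := c.isArc_I.reverse.isTameArc
  have hJ₁ := c.isArc_J₁.reverse.isTameArc
  have hmem : ∀ {s : ℝ}, s ∈ Icc (0 : ℝ) 1 → 1 - s ∈ Icc (0 : ℝ) 1 := fun hs =>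
    ⟨by linarith [hs.2], by linarith [hs.1]⟩
  have h2 : IsTameArc (concat (fun s => c.I (1 - s)) (fun s => c.J₁ (1 - s)) 1) (1 + 1) := by
    refine hI.concat hJ₁ (by simp [c.I_zero, J₁, c.J_zero]) fun s hs s' hs' e => ?_
    have : c.I (1 - s) ∈ ({-a₂ t} : Set ℂ) := by
      rw [← c.I_neg_J]
      exact ⟨⟨_, hmem hs, rfl⟩, by
        rw [← c.image_J₁]; exact ⟨_, hmem hs', e.symm⟩⟩
    have e1 := c.isArc_I.injOn (hmem hs) (x₂ := 0) ⟨le_rfl, zero_le_one⟩ (this.trans c.I_zero.symm)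
    have e2 := c.isArc_J₁.injOn (hmem hs') (x₂ := 1) ⟨zero_le_one, le_rfl⟩
      (e.symm.trans (this.trans c.isArc_J₁.right.symm))
    exact ⟨by linarith, by linarith⟩
  have h3 : IsTameArc c.spine (1 + (1 + 1)) := by
    refine hJ.concat h2 (by rw [concat_left zero_le_one]; simp [c.J_zero, c.I_one])
      fun s hs s' hs' e => ?_
    have hsJ : c.J (1 - s) ∈ c.J '' Icc 0 1 := ⟨_, hmem hs, rfl⟩
    rcases le_total s' 1 with h1 | h1
    · rw [concat_left h1] at e
      have : c.I (1 - s') ∈ ({a₂ t} : Set ℂ) := by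
        rw [← c.I_J]
        exact ⟨⟨_, hmem ⟨hs'.1, h1⟩, rfl⟩, by rw [← e]; exact hsJ⟩
      have e1 := c.isArc_I.injOn (hmem ⟨hs'.1, h1⟩) (x₂ := 1) ⟨zero_le_one, le_rfl⟩
        (this.trans c.I_one.symm)
      have e2 := c.isArc_J.injOn (hmem hs) (x₂ := 0) ⟨le_rfl, zero_le_one⟩
        (e.trans (this.trans c.J_zero.symm))
      exact ⟨by linarith, by linarith⟩
    · rw [concat_right (by simp [c.I_zero, J₁, c.J_zero]) h1] at e
      exfalso
      refine Set.disjoint_left.1 c.J_neg_J hsJ ?_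
      rw [← c.image_J₁, e]
      exact ⟨_, hmem ⟨by linarith, by linarith [hs'.2]⟩, rfl⟩
  norm_num at h3
  exact h3

/-- The image of the arc `-J ∪ I ∪ J`. -/
def spineSet : Set ℂ := c.spine '' Icc 0 3

theorem spineSet_eq : c.spineSet = c.cuts ∪ c.I '' Icc 0 1 := by
  ext z
  constructor
  · rintro ⟨s, hs, rfl⟩
    rcases le_total s 1 with h1 | h1
    · rw [c.spine_of_le_one h1]
      exact Or.inl (Or.inr ⟨_, ⟨by linarith, by linarith [hs.1]⟩, rfl⟩)
    · rcases le_total s 2 with h2 | h2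
      · rw [c.spine_of_mem_Icc ⟨h1, h2⟩]
        exact Or.inr ⟨_, ⟨by linarith, by linarith⟩, rfl⟩
      · rw [c.spine_of_two_le h2]
        exact Or.inl (Or.inl ⟨_, ⟨by linarith [hs.2], by linarith⟩, rfl⟩)
  · rintro ((⟨s, hs, rfl⟩ | ⟨s, hs, rfl⟩) | ⟨s, hs, rfl⟩)
    · refine ⟨3 - s, ⟨by linarith [hs.2], by linarith [hs.1]⟩, ?_⟩
      rw [c.spine_of_two_le (by linarith [hs.2])]; ring_nf
    · refine ⟨1 - s, ⟨by linarith [hs.2], by linarith [hs.1]⟩, ?_⟩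
      rw [c.spine_of_le_one (by linarith [hs.1])]; ring_nf
    · refine ⟨2 - s, ⟨by linarith [hs.2], by linarith [hs.1]⟩, ?_⟩
      rw [c.spine_of_mem_Icc ⟨by linarith [hs.2], by linarith [hs.1]⟩]; ring_nf

theorem cuts_subset_spineSet : c.cuts ⊆ c.spineSet := by
  rw [spineSet_eq]; exact subset_union_left

theorem isOpen_compl_spineSet : IsOpen c.spineSetᶜ :=
  c.isTameArc_spine.isCompact.isClosed.isOpen_compl

theorem dense_compl_spineSet : Dense c.spineSetᶜ := c.isTameArc_spine.dense_compl

theorem isPreconnected_compl_spineSet : IsPreconnected c.spineSetᶜ :=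
  c.isTameArc_spine.isPreconnected_compl

/-- The set lies between the connected complement of the spine and its closure, which is the whole
plane. A separate argument for two disjoint arcs is not needed. -/
theorem isPreconnected_compl_cuts : IsPreconnected c.cutsᶜ :=
  c.isPreconnected_compl_spineSet.subset_closure (compl_subset_compl.2 c.cuts_subset_spineSet)
    fun z _ => c.dense_compl_spineSet z

end Contour

section Runge

open MeasureTheory

/-! ### Uniform approximation on compact sets -/

variable {C : Set ℂ}

/-- The functions on the plane whose restriction to `C` belongs to `𝒜`. -/
def extensions (𝒜 : Subalgebra ℂ C(C, ℂ)) : Subalgebra ℂ (ℂ → ℂ) where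
  carrier := {g | ∃ f ∈ 𝒜, ∀ z : C, f z = g z}
  mul_mem' := by
    rintro _ _ ⟨f, hf, h⟩ ⟨f', hf', h'⟩
    exact ⟨f * f', mul_mem hf hf', fun z => by simp [h, h']⟩
  add_mem' := by
    rintro _ _ ⟨f, hf, h⟩ ⟨f', hf', h'⟩
    exact ⟨f + f', add_mem hf hf', fun z => by simp [h, h']⟩
  algebraMap_mem' r := ⟨algebraMap ℂ _ r, 𝒜.algebraMap_mem r, fun z => rfl⟩

theorem extensions_congr {𝒜 : Subalgebra ℂ C(C, ℂ)} {g g' : ℂ → ℂ} (hg : g ∈ extensions 𝒜)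
    (h : ∀ z ∈ C, g z = g' z) : g' ∈ extensions 𝒜 := by
  obtain ⟨f, hf, hfg⟩ := hg
  exact ⟨f, hf, fun z => (hfg z).trans (h z z.2)⟩

theorem const_mem_extensions (𝒜 : Subalgebra ℂ C(C, ℂ)) (r : ℂ) :
    (fun _ => r) ∈ extensions 𝒜 := (extensions 𝒜).algebraMap_mem r

/-- The exponential series converges in the closed subalgebra, and evaluation at a point is a
continuous homomorphism. -/
theorem exp_mem_extensions [CompactSpace C] {𝒜 : Subalgebra ℂ C(C, ℂ)}
    (h𝒜 : IsClosed (𝒜 : Set C(C, ℂ))) {g : ℂ → ℂ} (hg : g ∈ extensions 𝒜) :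
    (fun z => Complex.exp (g z)) ∈ extensions 𝒜 := by
  obtain ⟨f, hf, hfg⟩ := hg
  refine ⟨NormedSpace.exp f, NormedSpace.exp_mem (R := ℂ) h𝒜 hf, fun z => ?_⟩
  have h1 : Continuous (ContinuousMap.evalAlgHom ℂ ℂ z : C(C, ℂ) →ₐ[ℂ] ℂ) :=
    continuous_eval_const z
  have h2 := NormedSpace.map_exp (ContinuousMap.evalAlgHom ℂ ℂ z : C(C, ℂ) →ₐ[ℂ] ℂ) h1 f
  have h3 : (NormedSpace.exp f) z = NormedSpace.exp (f z) := h2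
  rw [h3, hfg, Complex.exp_eq_exp_ℂ]

/-- Neumann series in the complete algebra 𝒜. -/
theorem inv_one_sub_mem_extensions [CompactSpace C] {𝒜 : Subalgebra ℂ C(C, ℂ)}
    (h𝒜 : IsClosed (𝒜 : Set C(C, ℂ))) {g : ℂ → ℂ} (hg : g ∈ extensions 𝒜) {r : ℝ} (hr0 : 0 ≤ r)
    (hr : r < 1) (hgr : ∀ z ∈ C, ‖g z‖ ≤ r) : (fun z => (1 - g z)⁻¹) ∈ extensions 𝒜 := by
  obtain ⟨f, hf, hfg⟩ := hg
  have : CompleteSpace 𝒜 := h𝒜.isComplete.completeSpace_coe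
  set x : 𝒜 := ⟨f, hf⟩ with hx
  have hn : ‖x‖ < 1 := by
    refine lt_of_le_of_lt (?_ : ‖f‖ ≤ r) hr
    rw [ContinuousMap.norm_le _ hr0]
    intro z
    rw [hfg]
    exact hgr z z.2
  obtain ⟨u, hu⟩ := isUnit_one_sub_of_norm_lt_one hn
  refine ⟨((u⁻¹ : 𝒜ˣ) : 𝒜), ((u⁻¹ : 𝒜ˣ) : 𝒜).2, fun z => ?_⟩
  have e1 : (1 - x) * ((u⁻¹ : 𝒜ˣ) : 𝒜) = 1 := by rw [← hu, Units.mul_inv]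
  have e2 := congrArg (fun y : 𝒜 => (y : C(C, ℂ)) z) e1
  have e3 : (1 - f z) * (((u⁻¹ : 𝒜ˣ) : 𝒜) : C(C, ℂ)) z = 1 := by
    simpa [hx] using e2
  rw [hfg] at e3
  exact eq_inv_of_mul_eq_one_right e3

/-- 1/(z - ζ) = (z - ζ₀)⁻¹ (1 - (ζ - ζ₀)/(z - ζ₀))⁻¹, with the quotient uniformly smaller than 1 on
C. -/
theorem resolvent_mem_of_norm_lt [CompactSpace C] {𝒜 : Subalgebra ℂ C(C, ℂ)}
    (h𝒜 : IsClosed (𝒜 : Set C(C, ℂ))) {ζ₀ ζ : ℂ} {r : ℝ} (hr : 0 < r)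
    (hdist : ∀ z ∈ C, r ≤ ‖z - ζ₀‖) (hζ : ‖ζ - ζ₀‖ < r)
    (h : (fun z => (z - ζ₀)⁻¹) ∈ extensions 𝒜) : (fun z => (z - ζ)⁻¹) ∈ extensions 𝒜 := by
  have h1 := inv_one_sub_mem_extensions h𝒜
    (mul_mem (const_mem_extensions 𝒜 (ζ - ζ₀)) h) (r := ‖ζ - ζ₀‖ * r⁻¹) (by positivity)
    (by rw [← div_eq_mul_inv, div_lt_one hr]; exact hζ) (fun z hz => by
      simp only [Pi.mul_apply, norm_mul, norm_inv]
      have := hdist z hz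
      gcongr)
  refine extensions_congr (mul_mem h h1) fun z hz => ?_
  have hz0 : z - ζ₀ ≠ 0 := by
    intro h0
    have := hdist z hz
    rw [h0, norm_zero] at this
    linarith
  simp only [Pi.mul_apply]
  rw [← mul_inv]
  congr 1
  field_simp
  ring

/-- 1/(z - ζ) = -ζ⁻¹ (1 - z/ζ)⁻¹: a pole outside a disc that contains C can be replaced by
polynomials. -/
theorem resolvent_mem_of_lt_norm [CompactSpace C] {𝒜 : Subalgebra ℂ C(C, ℂ)}
    (h𝒜 : IsClosed (𝒜 : Set C(C, ℂ))) {ζ : ℂ} {r : ℝ} (hr : 0 ≤ r) (hC : ∀ z ∈ C, ‖z‖ ≤ r)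
    (hζ : r < ‖ζ‖) (h : (fun z => z) ∈ extensions 𝒜) :
    (fun z => (z - ζ)⁻¹) ∈ extensions 𝒜 := by
  have hζ0 : 0 < ‖ζ‖ := hr.trans_lt hζ
  have hζ1 : ζ ≠ 0 := norm_pos_iff.1 hζ0
  have h1 := inv_one_sub_mem_extensions h𝒜
    (mul_mem (const_mem_extensions 𝒜 ζ⁻¹) h) (r := ‖ζ‖⁻¹ * r) (by positivity)
    (by rw [inv_mul_lt_iff₀ hζ0]; linarith) (fun z hz => by
      simp only [Pi.mul_apply, norm_mul, norm_inv]
      have := hC z hz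
      gcongr)
  refine extensions_congr (mul_mem (const_mem_extensions 𝒜 (-ζ⁻¹)) h1) fun z _ => ?_
  simp only [Pi.mul_apply]
  rw [neg_mul, ← mul_inv, ← inv_neg]
  congr 1
  field_simp
  ring

/-- Poles can be moved along connected sets in the complement of `C`. -/
theorem resolvent_mem_of_isPreconnected (hC : IsCompact C) [CompactSpace C]
    {𝒜 : Subalgebra ℂ C(C, ℂ)} (h𝒜 : IsClosed (𝒜 : Set C(C, ℂ))) {M : Set ℂ}
    (hM : IsPreconnected M) (hMC : Disjoint M C) {ζ₀ ζ : ℂ} (hζ₀ : ζ₀ ∈ M) (hζ : ζ ∈ M)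
    (h : (fun z => (z - ζ₀)⁻¹) ∈ extensions 𝒜) : (fun z => (z - ζ)⁻¹) ∈ extensions 𝒜 := by
  refine (hM.induction₂ (fun x y => (fun z : ℂ => (z - x)⁻¹) ∈ extensions 𝒜 ↔
    (fun z : ℂ => (z - y)⁻¹) ∈ extensions 𝒜) (fun x hx => ?_) (fun _ _ _ _ _ _ h1 h2 => h1.trans h2)
    (fun _ _ _ _ h1 => h1.symm) hζ₀ hζ).1 h
  have hxC : x ∈ Cᶜ := fun hxC => Set.disjoint_left.1 hMC hx hxC
  obtain ⟨δ, hδ, hball⟩ := Metric.isOpen_iff.1 hC.isClosed.isOpen_compl x hxC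
  have hd : ∀ z ∈ C, δ ≤ ‖z - x‖ := fun z hz => by
    by_contra hlt
    exact hball (by rw [Metric.mem_ball, dist_eq_norm]; exact not_le.1 hlt) hz
  refine eventually_nhdsWithin_of_eventually_nhds ?_
  -- Within half of the distance δ to C the pole can be moved in both directions, since the new pole
  -- is still at distance at least δ/2 from C.
  filter_upwards [Metric.ball_mem_nhds x (half_pos hδ)] with y hy
  rw [Metric.mem_ball, dist_eq_norm] at hy
  refine ⟨resolvent_mem_of_norm_lt h𝒜 hδ hd (by linarith),
    resolvent_mem_of_norm_lt h𝒜 (half_pos hδ) (fun z hz => ?_) (by rwa [norm_sub_rev])⟩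
  have h1 := hd z hz
  have h2 : ‖z - x‖ ≤ ‖z - y‖ + ‖y - x‖ := norm_sub_le_norm_sub_add_norm_sub _ _ _
  linarith

/-! ### Cauchy integrals -/

/-- The Cauchy integral `∫_γ dζ / (ζ - z)`. -/
def cauchyLog (γ : ℝ → ℂ) (z : ℂ) : ℂ :=
  ∫ s in (0 : ℝ)..1, derivWithin γ (Icc 0 1) s * (γ s - z)⁻¹

theorem continuousOn_cauchyKernel {γ : ℝ → ℂ} {p q : ℂ} (hγ : IsArc γ p q) {z : ℂ}
    (hz : z ∉ γ '' Icc 0 1) :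
    ContinuousOn (fun s => derivWithin γ (Icc 0 1) s * (γ s - z)⁻¹) (Icc 0 1) := by
  refine hγ.continuousOn_derivWithin.mul ((hγ.continuousOn.sub continuousOn_const).inv₀ ?_)
  intro s hs h
  exact hz ⟨s, hs, sub_eq_zero.1 h⟩

/-- The Cauchy integral is an integral of multiples of resolvents in C(C, ℂ). Over the unit interval
it is an average, so it stays in the closed subspace 𝒜. The projection onto [0, 1] only serves to
extend the integrand continuously to all parameters. -/
theorem cauchyLog_mem_extensions [CompactSpace C] {𝒜 : Subalgebra ℂ C(C, ℂ)}
    (h𝒜 : IsClosed (𝒜 : Set C(C, ℂ))) {γ : ℝ → ℂ} {p q : ℂ} (hγ : IsArc γ p q)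
    (hd : Disjoint (γ '' Icc 0 1) C)
    (h : ∀ ζ ∈ γ '' Icc 0 1, (fun z => (z - ζ)⁻¹) ∈ extensions 𝒜) :
    cauchyLog γ ∈ extensions 𝒜 := by
  set pr : ℝ → Icc (0 : ℝ) 1 := projIcc 0 1 zero_le_one with hpr
  have hprc : Continuous pr := continuous_projIcc
  have c1 : Continuous fun s : ℝ => γ (pr s) :=
    hγ.continuousOn.comp_continuous (continuous_subtype_val.comp hprc) fun s => (pr s).2
  have c2 : Continuous fun s : ℝ => derivWithin γ (Icc 0 1) (pr s) :=
    hγ.continuousOn_derivWithin.comp_continuous (continuous_subtype_val.comp hprc)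
      fun s => (pr s).2
  have hne : ∀ x : ℝ × C, γ (pr x.1) - (x.2 : ℂ) ≠ 0 := fun x h0 =>
    Set.disjoint_left.1 hd ⟨pr x.1, (pr x.1).2, rfl⟩ (sub_eq_zero.1 h0 ▸ x.2.2)
  let F : C(ℝ × C, ℂ) := ⟨fun x => derivWithin γ (Icc 0 1) (pr x.1) * (γ (pr x.1) - (x.2 : ℂ))⁻¹, by
    refine (c2.comp continuous_fst).mul (Continuous.inv₀ ?_ hne)
    exact (c1.comp continuous_fst).sub (continuous_subtype_val.comp continuous_snd)⟩
  have hFint : IntervalIntegrable (fun s => F.curry s) volume 0 1 :=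
    F.curry.continuous.intervalIntegrable 0 1
  have hFi : Integrable (fun s => F.curry s) (volume.restrict (Ioc (0 : ℝ) 1)) := by
    rwa [intervalIntegrable_iff_integrableOn_Ioc_of_le zero_le_one] at hFint
  refine ⟨∫ s in Ioc (0 : ℝ) 1, F.curry s, ?_, fun z => ?_⟩
  · have : IsProbabilityMeasure (volume.restrict (Ioc (0 : ℝ) 1)) := ⟨by simp⟩
    refine Convex.integral_mem (s := (𝒜 : Set C(C, ℂ)))
      (𝒜.toSubmodule.restrictScalars ℝ).convex h𝒜 (Eventually.of_forall fun s => ?_) hFi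
    obtain ⟨f, hf, hfg⟩ := h (γ (pr s)) ⟨pr s, (pr s).2, rfl⟩
    have : F.curry s = (-derivWithin γ (Icc 0 1) (pr s)) • f := by
      ext z
      change derivWithin γ (Icc 0 1) (pr s) * (γ (pr s) - (z : ℂ))⁻¹ = _
      rw [ContinuousMap.smul_apply, hfg, smul_eq_mul, ← neg_sub, inv_neg]
      ring
    rw [this]
    exact 𝒜.smul_mem hf _
  · rw [ContinuousMap.integral_apply hFi, cauchyLog, intervalIntegral.integral_of_le zero_le_one]
    refine setIntegral_congr_fun measurableSet_Ioc fun s hs => ?_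
    have : (pr s : ℝ) = s := by rw [hpr, projIcc_of_mem zero_le_one (Ioc_subset_Icc_self hs)]
    change derivWithin γ (Icc 0 1) (pr s) * (γ (pr s) - (z : ℂ))⁻¹ = _
    rw [this]

/-- After differentiation under the integral sign, the integrand is the derivative of -(γ - z)⁻¹
along the arc. Thus `cauchyLog` has the derivative of a logarithm of (z - q)/(z - p). -/
theorem hasDerivAt_cauchyLog {γ : ℝ → ℂ} {p q : ℂ} (hγ : IsArc γ p q) {z : ℂ}
    (hz : z ∉ γ '' Icc 0 1) : HasDerivAt (cauchyLog γ) ((p - z)⁻¹ - (q - z)⁻¹) z := by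
  have hcomp : IsCompact (γ '' Icc 0 1) := isCompact_Icc.image_of_continuousOn hγ.continuousOn
  obtain ⟨δ, hδ, hball⟩ := Metric.isOpen_iff.1 hcomp.isClosed.isOpen_compl z hz
  obtain ⟨M, hM⟩ := isCompact_Icc.exists_bound_of_continuousOn hγ.continuousOn_derivWithin
  have hM0 : 0 ≤ M := (norm_nonneg _).trans (hM 0 ⟨le_rfl, zero_le_one⟩)
  have hlow : ∀ x ∈ Metric.ball z (δ / 2), ∀ s ∈ Icc (0 : ℝ) 1, δ / 2 ≤ ‖γ s - x‖ := by
    intro x hx s hs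
    have h1 : δ ≤ ‖γ s - z‖ := by
      by_contra hlt
      exact hball (by rw [Metric.mem_ball, dist_eq_norm]; exact not_le.1 hlt) ⟨s, hs, rfl⟩
    have h2 : ‖γ s - z‖ ≤ ‖γ s - x‖ + ‖x - z‖ := norm_sub_le_norm_sub_add_norm_sub _ _ _
    rw [Metric.mem_ball, dist_eq_norm] at hx
    linarith
  have hnm : ∀ x ∈ Metric.ball z (δ / 2), x ∉ γ '' Icc 0 1 := by
    rintro x hx ⟨s, hs, rfl⟩
    have := hlow _ hx s hs
    rw [sub_self, norm_zero] at this
    linarith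
  have hsub : uIoc (0 : ℝ) 1 ⊆ Icc 0 1 := by
    rw [uIoc_of_le zero_le_one]; exact Ioc_subset_Icc_self
  have hmain := (intervalIntegral.hasDerivAt_integral_of_dominated_loc_of_deriv_le
    (F := fun x s => derivWithin γ (Icc 0 1) s * (γ s - x)⁻¹)
    (F' := fun x s => derivWithin γ (Icc 0 1) s * ((γ s - x) ^ 2)⁻¹)
    (bound := fun _ => M * ((δ / 2) ^ 2)⁻¹) (μ := volume) (a := 0) (b := 1)
    (Metric.ball_mem_nhds z (half_pos hδ)) ?_ ?_ ?_ ?_ ?_ ?_).2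
  · have hFTC : ∫ s in (0 : ℝ)..1, derivWithin γ (Icc 0 1) s * ((γ s - z) ^ 2)⁻¹ =
        (-(γ 1 - z)⁻¹) - (-(γ 0 - z)⁻¹) := by
      refine intervalIntegral.integral_eq_sub_of_hasDeriv_right_of_le (f := fun s => -(γ s - z)⁻¹)
        zero_le_one ?_ (fun s hs => ?_) ?_
      · refine ((hγ.continuousOn.sub continuousOn_const).inv₀ ?_).neg
        intro s hs h
        exact hz ⟨s, hs, sub_eq_zero.1 h⟩
      · have hne : γ s - z ≠ 0 := fun h => hz ⟨s, Ioo_subset_Icc_self hs, sub_eq_zero.1 h⟩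
        have h1 := (hγ.differentiableAt hs).hasDerivAt.sub_const z
        have h2 := (hasDerivAt_inv hne).neg.scomp s h1
        rw [hγ.deriv_eq hs] at h2
        have h3 := h2.hasDerivWithinAt (s := Ioi s)
        refine h3.congr_deriv ?_
        simp
      · refine ContinuousOn.intervalIntegrable ?_
        rw [uIcc_of_le zero_le_one]
        refine hγ.continuousOn_derivWithin.mul
          (((hγ.continuousOn.sub continuousOn_const).pow 2).inv₀ ?_)
        intro s hs h
        exact hz ⟨s, hs, sub_eq_zero.1 (pow_eq_zero_iff two_ne_zero |>.1 h)⟩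
    rw [hFTC, hγ.left, hγ.right] at hmain
    refine hmain.congr_deriv ?_
    ring
  · filter_upwards [Metric.ball_mem_nhds z (half_pos hδ)] with x hx
    exact ((continuousOn_cauchyKernel hγ (hnm x hx)).mono hsub).aestronglyMeasurable
      measurableSet_uIoc
  · refine ContinuousOn.intervalIntegrable ?_
    rw [uIcc_of_le zero_le_one]
    exact continuousOn_cauchyKernel hγ hz
  · refine ContinuousOn.aestronglyMeasurable ?_ measurableSet_uIoc
    refine ContinuousOn.mono ?_ hsub
    refine hγ.continuousOn_derivWithin.mul
      (((hγ.continuousOn.sub continuousOn_const).pow 2).inv₀ ?_)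
    intro s hs h
    exact hz ⟨s, hs, sub_eq_zero.1 (pow_eq_zero_iff two_ne_zero |>.1 h)⟩
  · refine Eventually.of_forall fun s hs x hx => ?_
    rw [norm_mul, norm_inv, norm_pow]
    have h1 := hlow x hx s (hsub hs)
    gcongr
    exact hM s (hsub hs)
  · exact intervalIntegrable_const
  · refine Eventually.of_forall fun s hs x hx => ?_
    have hne : γ s - x ≠ 0 := fun h => hnm x hx ⟨s, hsub hs, sub_eq_zero.1 h⟩
    have h1 := (((hasDerivAt_id x).const_sub (γ s)).inv hne).const_mul (derivWithin γ (Icc 0 1) s)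
    refine h1.congr_deriv ?_
    simp

theorem exists_norm_cauchyLog_mul_le {γ : ℝ → ℂ} {p q : ℂ} (hγ : IsArc γ p q) :
    ∃ M : ℝ, ∀ᶠ z in cocompact ℂ, ‖cauchyLog γ z‖ ≤ M * ‖z‖⁻¹ := by
  obtain ⟨M, hM⟩ := isCompact_Icc.exists_bound_of_continuousOn hγ.continuousOn_derivWithin
  obtain ⟨N, hN⟩ := isCompact_Icc.exists_bound_of_continuousOn hγ.continuousOn
  have hM0 : 0 ≤ M := (norm_nonneg _).trans (hM 0 ⟨le_rfl, zero_le_one⟩)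
  have hN0 : 0 ≤ N := (norm_nonneg _).trans (hN 0 ⟨le_rfl, zero_le_one⟩)
  refine ⟨2 * M, ?_⟩
  have hev := (tendsto_norm_cocompact_atTop (E := ℂ)).eventually (eventually_ge_atTop (2 * N + 1))
  filter_upwards [hev] with z hz
  have hz0 : 0 < ‖z‖ := by linarith
  have := intervalIntegral.norm_integral_le_of_norm_le_const (a := (0 : ℝ)) (b := 1)
    (f := fun s => derivWithin γ (Icc 0 1) s * (γ s - z)⁻¹) (C := M * (‖z‖ / 2)⁻¹) (fun s hs => by
      rw [uIoc_of_le zero_le_one] at hs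
      have hs' := Ioc_subset_Icc_self hs
      rw [norm_mul, norm_inv]
      have h1 : ‖z‖ / 2 ≤ ‖γ s - z‖ := by
        have h2 := norm_sub_norm_le z (γ s)
        rw [norm_sub_rev] at h2
        linarith [hN s hs']
      gcongr
      exact hM s hs')
  rw [cauchyLog]
  refine this.trans (le_of_eq ?_)
  rw [sub_zero, abs_one, mul_one, inv_div]
  ring

theorem tendsto_cauchyLog {γ : ℝ → ℂ} {p q : ℂ} (hγ : IsArc γ p q) :
    Tendsto (cauchyLog γ) (cocompact ℂ) (𝓝 0) := by
  obtain ⟨M, hM⟩ := exists_norm_cauchyLog_mul_le hγ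
  refine squeeze_zero_norm' hM ?_
  have := (tendsto_norm_cocompact_atTop (E := ℂ)).inv_tendsto_atTop.const_mul M
  simpa using this

/-- The quotient of the two sides has derivative 0 on the connected complement of the arc and tends
to 1 at infinity. -/
theorem exp_cauchyLog {γ : ℝ → ℂ} {p q : ℂ} (hγ : IsArc γ p q) {z : ℂ} (hz : z ∉ γ '' Icc 0 1) :
    Complex.exp (cauchyLog γ z) * (z - p) = z - q := by
  set U := (γ '' Icc 0 1)ᶜ with hU
  have hcomp : IsCompact (γ '' Icc 0 1) := isCompact_Icc.image_of_continuousOn hγ.continuousOn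
  have hUo : IsOpen U := hcomp.isClosed.isOpen_compl
  have hUc : IsPreconnected U := hγ.isTameArc.isPreconnected_compl
  have hp : ∀ z ∈ U, z - p ≠ 0 := fun z hz h =>
    hz ⟨0, ⟨le_rfl, zero_le_one⟩, by rw [hγ.left, sub_eq_zero.1 h]⟩
  have hq : ∀ z ∈ U, z - q ≠ 0 := fun z hz h =>
    hz ⟨1, ⟨zero_le_one, le_rfl⟩, by rw [hγ.right, sub_eq_zero.1 h]⟩
  set f : ℂ → ℂ := fun z => Complex.exp (cauchyLog γ z) * (z - p) / (z - q) with hf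
  have hder : ∀ z ∈ U, HasDerivAt f 0 z := by
    intro z hz
    have h1 := (((hasDerivAt_cauchyLog hγ hz).cexp.mul ((hasDerivAt_id z).sub_const p)).div
      ((hasDerivAt_id z).sub_const q) (hq z hz))
    refine h1.congr_deriv ?_
    have e1 := hp z hz
    have e2 := hq z hz
    have e3 : p - z ≠ 0 := by rwa [← neg_sub, neg_ne_zero]
    have e4 : q - z ≠ 0 := by rwa [← neg_sub, neg_ne_zero]
    simp only [id, Pi.mul_apply]
    field_simp
    ring
  have hconst : ∀ x ∈ U, ∀ y ∈ U, f x = f y := fun x hx y hy =>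
    hUo.is_const_of_deriv_eq_zero hUc
      (fun z hz => (hder z hz).differentiableAt.differentiableWithinAt)
      (fun z hz => (hder z hz).deriv) hx hy
  have hlim : Tendsto f (cocompact ℂ) (𝓝 1) := by
    have h1 : Tendsto (fun z => Complex.exp (cauchyLog γ z)) (cocompact ℂ) (𝓝 1) := by
      have := (Complex.continuous_exp.tendsto 0).comp (tendsto_cauchyLog hγ)
      rwa [Complex.exp_zero] at this
    have h2 : Tendsto (fun z : ℂ => 1 + (q - p) * (z - q)⁻¹) (cocompact ℂ) (𝓝 1) := by
      have h3 : Tendsto (fun z : ℂ => (z - q)⁻¹) (cocompact ℂ) (𝓝 0) := by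
        refine (tendsto_inv₀_cobounded (α := ℂ)).comp ?_
        rw [← Metric.cobounded_eq_cocompact]
        exact tendsto_sub_const_cobounded q
      simpa using (h3.const_mul (q - p)).const_add 1
    have h3 := h1.mul h2
    rw [one_mul] at h3
    refine h3.congr' ?_
    filter_upwards [hcomp.compl_mem_cocompact] with z hz
    have := hq z hz
    rw [hf]
    field_simp
    ring
  have h1 : f z = 1 := by
    have : Tendsto f (cocompact ℂ) (𝓝 (f z)) := by
      refine tendsto_const_nhds.congr' ?_
      filter_upwards [hcomp.compl_mem_cocompact] with y hy
      exact hconst z hz y hy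
    exact tendsto_nhds_unique this hlim
  rw [hf] at h1
  have := hq z hz
  field_simp at h1
  exact h1

end Runge

/-- A function that can be approximated by derivatives, uniformly on compact sets, has a
primitive. -/
theorem exists_primitive_of_approx {U : Set ℂ} (hU : IsOpen U) (hc : IsPreconnected U) {g : ℂ → ℂ}
    (happ : ∀ C ⊆ U, IsCompact C → ∀ ε > 0, ∃ f f' : ℂ → ℂ, (∀ z ∈ U, HasDerivAt f (f' z) z) ∧
      ∀ z ∈ C, ‖f' z - g z‖ ≤ ε) : ∃ h : ℂ → ℂ, ∀ z ∈ U, HasDerivAt h (g z) z := by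
  rcases U.eq_empty_or_nonempty with rfl | ⟨x₀, hx₀⟩
  · exact ⟨0, fun z hz => hz.elim⟩
  have : LocallyCompactSpace U := hU.locallyCompactSpace
  let K : CompactExhaustion U := default
  set C : ℕ → Set ℂ := fun n => Subtype.val '' K n with hC
  have hCU : ∀ n, C n ⊆ U := fun n => by rintro _ ⟨x, -, rfl⟩; exact x.2
  have hCc : ∀ n, IsCompact (C n) := fun n => (K.isCompact n).image continuous_subtype_val
  have hCm : Monotone C := fun m n h => image_mono (K.subset h)
  have hCn : ∀ x ∈ U, ∃ n, C n ∈ 𝓝 x := by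
    intro x hx
    obtain ⟨n, hn⟩ := K.exists_mem_nhds ⟨x, hx⟩
    exact ⟨n, hU.isOpenEmbedding_subtypeVal.image_mem_nhds.2 hn⟩
  choose f f' hf hff using fun n : ℕ => happ (C n) (hCU n) (hCc n) (1 / ((n : ℝ) + 1))
    Nat.one_div_pos_of_nat
  set F : ℕ → ℂ → ℂ := fun n z => f n z - f n x₀ with hF
  have hFd : ∀ n, ∀ z ∈ U, HasDerivAt (F n) (f' n z) z := fun n z hz => (hf n z hz).sub_const _
  have hunif : ∀ N, TendstoUniformlyOn f' g atTop (C N) := by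
    intro N
    rw [Metric.tendstoUniformlyOn_iff]
    intro ε hε
    filter_upwards [eventually_ge_atTop N,
      (tendsto_one_div_add_atTop_nhds_zero_nat (𝕜 := ℝ)).eventually (gt_mem_nhds hε)] with n hn hn'
    intro x hx
    rw [dist_comm, dist_eq_norm]
    exact (hff n x (hCm hn hx)).trans_lt hn'
  -- The antiderivatives are normalized to vanish at x₀. Uniform convergence of the derivatives
  -- carries the Cauchy property from the centre of a disc to the whole disc, and connectedness
  -- carries it through U.
  have hcauchy : ∀ x ∈ U, Cauchy (map (fun n => F n x) atTop) := by
    intro x hx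
    refine (hc.induction₂ (fun x y => Cauchy (map (fun n => F n x) atTop) ↔
      Cauchy (map (fun n => F n y) atTop)) (fun x hx => ?_)
      (fun _ _ _ _ _ _ h1 h2 => h1.trans h2) (fun _ _ _ _ h => h.symm) hx₀ hx).1 ?_
    · obtain ⟨N, hN⟩ := hCn x hx
      obtain ⟨r, hr, hball⟩ := Metric.mem_nhds_iff.1 hN
      have hstep : ∀ y ρ, Metric.ball y ρ ⊆ C N → Cauchy (map (fun n => F n y) atTop) →
          ∀ w ∈ Metric.ball y ρ, Cauchy (map (fun n => F n w) atTop) := by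
        intro y ρ hsub hy w hw
        exact (uniformCauchySeqOn_ball_of_deriv ((hunif N).uniformCauchySeqOn.mono hsub)
          (fun n z hz => hFd n z (hCU N (hsub hz))) hy).cauchy_map hw
      refine eventually_nhdsWithin_of_eventually_nhds ?_
      filter_upwards [Metric.ball_mem_nhds x (half_pos hr)] with y hy
      rw [Metric.mem_ball] at hy
      refine ⟨fun h => hstep x r hball h y (by rw [Metric.mem_ball]; linarith), fun h =>
        hstep y (r / 2) (fun w hw => hball ?_) h x (by rwa [Metric.mem_ball, dist_comm])⟩
      rw [Metric.mem_ball] at hw ⊢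
      linarith [dist_triangle w y x]
    · simp only [hF, sub_self]
      exact tendsto_const_nhds.cauchy_map
  choose! h hh using fun x (hx : x ∈ U) => cauchy_iff_exists_le_nhds.1 (hcauchy x hx)
  refine ⟨h, fun z hz => ?_⟩
  refine hasDerivAt_of_tendstoLocallyUniformlyOn (l := atTop) (f := F) (f' := f') hU ?_
    (Eventually.of_forall fun n => hFd n) (fun x hx => hh x hx) hz
  intro u hu x hx
  obtain ⟨N, hN⟩ := hCn x hx
  exact ⟨C N, mem_nhdsWithin_of_mem_nhds hN, hunif N u hu⟩

/-! ### The branch of the square root -/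

namespace Contour

variable {t : ℂ} (c : Contour t)

theorem notMem_J_of_notMem_cuts {z : ℂ} (hz : z ∉ c.cuts) : z ∉ c.J '' Icc 0 1 :=
  fun h => hz (Or.inr h)

/-- An explicit branch of the square root of `R`. -/
def branch (z : ℂ) : ℂ :=
  (z ^ 2 - a₂ t ^ 2) * Complex.exp ((cauchyLog c.J z + cauchyLog c.J (-z)) / 2)

theorem branch_neg (z : ℂ) : c.branch (-z) = c.branch z := by
  unfold branch
  rw [neg_neg, neg_sq, add_comm (cauchyLog c.J (-z))]

/-- The exponentials of the two Cauchy integrals are (z - b)/(z - a) and (z + b)/(z + a), so the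
square is (z² - a²)² (z² - b²)/(z² - a²). -/
theorem branch_sq {z : ℂ} (hz : z ∉ c.cuts) : c.branch z ^ 2 = R t z := by
  have h1 := exp_cauchyLog c.isArc_J (c.notMem_J_of_notMem_cuts hz)
  have h2 := exp_cauchyLog c.isArc_J (c.notMem_J_of_notMem_cuts (mt c.neg_mem_cuts.1 hz))
  unfold branch R
  rw [mul_pow, ← Complex.exp_nat_mul]
  have e : ((2 : ℕ) : ℂ) * ((cauchyLog c.J z + cauchyLog c.J (-z)) / 2) =
      cauchyLog c.J z + cauchyLog c.J (-z) := by push_cast; ring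
  rw [e, Complex.exp_add]
  linear_combination (z ^ 2 - a₂ t ^ 2) * (z + b₂ t) * h1 -
    Complex.exp (cauchyLog c.J z) * (z - a₂ t) * (z ^ 2 - a₂ t ^ 2) * h2

theorem differentiableOn_branch : DifferentiableOn ℂ c.branch c.cutsᶜ := by
  intro z hz
  have h1 := (hasDerivAt_cauchyLog c.isArc_J (c.notMem_J_of_notMem_cuts hz)).differentiableAt
  have h2 := (hasDerivAt_cauchyLog c.isArc_J
    (c.notMem_J_of_notMem_cuts (mt c.neg_mem_cuts.1 hz))).differentiableAt
  have h3 : DifferentiableAt ℂ (fun z => cauchyLog c.J (-z)) z :=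
    DifferentiableAt.comp z h2 differentiableAt_id.neg
  refine DifferentiableAt.differentiableWithinAt ?_
  unfold branch
  exact ((differentiableAt_id.pow 2).sub_const _).mul ((h1.add h3).div_const 2).cexp

open Asymptotics in
-- The Cauchy integrals are O(1/z), so the exponential factor is 1 + O(1/z).
theorem branch_isBigO : (fun z => c.branch z - z ^ 2) =O[cocompact ℂ] (fun z => z) := by
  obtain ⟨M, hM⟩ := exists_norm_cauchyLog_mul_le c.isArc_J
  have hneg : Tendsto (fun z : ℂ => -z) (cocompact ℂ) (cocompact ℂ) :=
    (Homeomorph.neg ℂ).isClosedEmbedding.tendsto_cocompact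
  have hlog : ∀ᶠ z in cocompact ℂ,
      ‖(cauchyLog c.J z + cauchyLog c.J (-z)) / 2‖ ≤ M * ‖z‖⁻¹ := by
    filter_upwards [hM, hneg.eventually hM] with z h1 h2
    rw [norm_neg] at h2
    rw [norm_div, Complex.norm_ofNat, div_le_iff₀ two_pos]
    exact (norm_add_le _ _).trans (by linarith)
  have hinv : Tendsto (fun z : ℂ => M * ‖z‖⁻¹) (cocompact ℂ) (𝓝 0) := by
    have := (tendsto_norm_cocompact_atTop (E := ℂ)).inv_tendsto_atTop.const_mul M
    simpa using this
  have hsmall := hinv.eventually (gt_mem_nhds one_pos)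
  have hbig := (tendsto_norm_cocompact_atTop (E := ℂ)).eventually (eventually_ge_atTop 1)
  have hMn : ∀ᶠ z in cocompact ℂ, 0 ≤ M * ‖z‖⁻¹ := by
    filter_upwards [hM] with z hz using (norm_nonneg _).trans hz
  refine IsBigO.of_bound (2 * |M| * (1 + ‖a₂ t‖ ^ 2) + ‖a₂ t‖ ^ 2) ?_
  filter_upwards [hlog, hsmall, hbig] with z h1 h2 h3
  set L := (cauchyLog c.J z + cauchyLog c.J (-z)) / 2 with hL
  have hexp : ‖Complex.exp L - 1‖ ≤ 2 * (|M| * ‖z‖⁻¹) := by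
    refine (Complex.norm_exp_sub_one_le (by linarith)).trans ?_
    have : M * ‖z‖⁻¹ ≤ |M| * ‖z‖⁻¹ := by gcongr; exact le_abs_self M
    linarith
  have hz0 : 0 < ‖z‖ := by linarith
  have e : c.branch z - z ^ 2 = (z ^ 2 - a₂ t ^ 2) * (Complex.exp L - 1) - a₂ t ^ 2 := by
    unfold branch; ring
  rw [e]
  have hsq : ‖z ^ 2 - a₂ t ^ 2‖ ≤ ‖z‖ ^ 2 * (1 + ‖a₂ t‖ ^ 2) := by
    refine (norm_sub_le _ _).trans ?_
    rw [norm_pow, norm_pow]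
    nlinarith [sq_nonneg ‖a₂ t‖, pow_le_pow_left₀ zero_le_one h3 2]
  refine (norm_sub_le _ _).trans ?_
  rw [norm_mul, norm_pow (a₂ t)]
  calc ‖z ^ 2 - a₂ t ^ 2‖ * ‖Complex.exp L - 1‖ + ‖a₂ t‖ ^ 2
      ≤ ‖z‖ ^ 2 * (1 + ‖a₂ t‖ ^ 2) * (2 * (|M| * ‖z‖⁻¹)) + ‖a₂ t‖ ^ 2 * ‖z‖ := by
        gcongr
        nlinarith [sq_nonneg ‖a₂ t‖]
    _ = _ := by field_simp

/-- `sqrtR` is a chosen branch only if one exists, and `branch` shows that one does. On the cuts it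
is replaced by an arbitrary square root of R. -/
theorem isBranch_sqrtR : c.IsBranch c.sqrtR := by
  classical
  have hex : ∃ f, c.IsBranch f := by
    refine ⟨fun z => if z ∈ c.cuts then R t z ^ (1 / 2 : ℂ) else c.branch z, fun z => ?_, ?_, ?_⟩
    · simp only
      split_ifs with h
      · rw [← Complex.cpow_nat_mul]
        norm_num
      · exact c.branch_sq h
    · exact c.differentiableOn_branch.congr fun z hz => if_neg hz
    · refine c.branch_isBigO.congr' ?_ EventuallyEq.rfl
      filter_upwards [c.isCompact_cuts.compl_mem_cocompact] with z hz
      rw [if_neg hz]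
  unfold sqrtR
  rw [dif_pos hex]
  exact hex.choose_spec

theorem differentiableAt_sqrtR {z : ℂ} (hz : z ∉ c.cuts) : DifferentiableAt ℂ c.sqrtR z :=
  c.isBranch_sqrtR.2.1.differentiableAt (c.isOpen_compl_cuts.mem_nhds hz)

/-- The branch of the square root is determined up to its sign. -/
theorem sqrtR_eq_branch : (∀ z ∉ c.cuts, c.sqrtR z = c.branch z) ∨
    ∀ z ∉ c.cuts, c.sqrtR z = -c.branch z := by
  have h1 : ContinuousOn c.sqrtR c.cutsᶜ := c.isBranch_sqrtR.2.1.continuousOn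
  have h2 : ContinuousOn c.branch c.cutsᶜ := c.differentiableOn_branch.continuousOn
  exact c.isPreconnected_compl_cuts.eq_or_eq_neg_of_sq_eq h1 h2
    (fun z hz => by simp only [Pi.pow_apply]; rw [c.sqrtR_sq, c.branch_sq hz])
    (fun {z} hz h => c.R_ne_zero hz (by rw [← c.branch_sq hz, h]; simp))

/-- Up to a sign `sqrtR` is the explicit branch, which is visibly even; the sign itself never
matters. -/
theorem sqrtR_neg {z : ℂ} (hz : z ∉ c.cuts) : c.sqrtR (-z) = c.sqrtR z := by
  have hz' : -z ∉ c.cuts := mt c.neg_mem_cuts.1 hz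
  rcases c.sqrtR_eq_branch with h | h <;> rw [h z hz, h (-z) hz', c.branch_neg]

end Contour

/-! ### Primitives of the reciprocal of the square root -/

section Primitive

open Polynomial

theorem exists_derivative_eq (P : ℂ[X]) : ∃ Q : ℂ[X], Q.derivative = P := by
  induction P using Polynomial.induction_on' with
  | add p q hp hq =>
    obtain ⟨P, hP⟩ := hp
    obtain ⟨Q, hQ⟩ := hq
    exact ⟨P + Q, by rw [derivative_add, hP, hQ]⟩
  | monomial n r =>
    refine ⟨monomial (n + 1) (r / (n + 1)), ?_⟩
    rw [derivative_monomial, Nat.add_sub_cancel]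
    congr 1
    have : (n : ℂ) + 1 ≠ 0 := Nat.cast_add_one_ne_zero n
    push_cast
    field_simp

/-- The polynomials in e are dense in the closed algebra generated by e. -/
theorem exists_polynomial_approx {C : Set ℂ} [CompactSpace C] (e : C(C, ℂ)) {g : ℂ → ℂ}
    (hg : g ∈ extensions (Algebra.adjoin ℂ {e}).topologicalClosure) {ε : ℝ} (hε : 0 < ε) :
    ∃ P : ℂ[X], ∀ z : C, ‖P.eval (e z) - g z‖ < ε := by
  obtain ⟨f, hf, hfg⟩ := hg
  obtain ⟨f₁, hf₁, hd⟩ := Metric.mem_closure_iff.1 hf ε hε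
  rw [SetLike.mem_coe, Algebra.adjoin_singleton_eq_range_aeval] at hf₁
  obtain ⟨P, rfl⟩ := hf₁
  refine ⟨P, fun z => ?_⟩
  have h1 : (aeval e P) z = P.eval (e z) := by
    have := Polynomial.aeval_algHom_apply (ContinuousMap.evalAlgHom ℂ ℂ z : C(C, ℂ) →ₐ[ℂ] ℂ) e P
    exact this.symm.trans (Polynomial.coe_aeval_eq_eval (e z) ▸ rfl)
  rw [← h1, ← hfg, ← dist_eq_norm, dist_comm]
  exact (ContinuousMap.dist_apply_le_dist z).trans_lt hd

namespace Contour

variable {t : ℂ} (c : Contour t)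

theorem cauchyLog_neg_apply (z : ℂ) : cauchyLog c.J (-z) = cauchyLog (fun s => -c.J s) z := by
  unfold cauchyLog
  refine intervalIntegral.integral_congr fun s _ => ?_
  simp only
  rw [derivWithin.fun_neg, sub_neg_eq_add, neg_mul, ← mul_neg, ← inv_neg]
  congr 2
  ring

/-- The exponent is built from Cauchy integrals over ±J, so resolvents with poles on the cuts
suffice. -/
theorem exp_neg_mem_extensions {C : Set ℂ} [CompactSpace C] {𝒜 : Subalgebra ℂ C(C, ℂ)}
    (h𝒜 : IsClosed (𝒜 : Set C(C, ℂ))) (hd : Disjoint c.cuts C)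
    (h : ∀ ζ ∈ c.cuts, (fun z => (z - ζ)⁻¹) ∈ extensions 𝒜) :
    (fun z => Complex.exp (-((cauchyLog c.J z + cauchyLog c.J (-z)) / 2))) ∈ extensions 𝒜 := by
  have hJ : c.J '' Icc 0 1 ⊆ c.cuts := subset_union_right
  have hnJ : (fun s => -c.J s) '' Icc 0 1 ⊆ c.cuts := by
    rintro _ ⟨s, hs, rfl⟩
    exact c.neg_mem_cuts.2 (hJ ⟨s, hs, rfl⟩)
  have h1 := cauchyLog_mem_extensions h𝒜 c.isArc_J (hd.mono_left hJ) fun ζ hζ => h ζ (hJ hζ)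
  have h2 := cauchyLog_mem_extensions h𝒜 c.isArc_J.neg (hd.mono_left hnJ) fun ζ hζ => h ζ (hnJ hζ)
  have h3 := mul_mem (const_mem_extensions 𝒜 (-(1 / 2))) (add_mem h1 h2)
  refine extensions_congr (exp_mem_extensions h𝒜 h3) fun z _ => ?_
  simp only [Pi.mul_apply, Pi.add_apply]
  rw [c.cauchyLog_neg_apply]
  congr 1
  ring

theorem inv_branch (z : ℂ) : (c.branch z)⁻¹ =
    (z - a₂ t)⁻¹ * (z - -a₂ t)⁻¹ * Complex.exp (-((cauchyLog c.J z + cauchyLog c.J (-z)) / 2)) := by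
  unfold branch
  rw [mul_inv, ← Complex.exp_neg, ← mul_inv]
  congr 2
  ring

theorem exists_primitive_of_branch {U : Set ℂ} (hU : U ⊆ c.cutsᶜ)
    (h : ∃ g : ℂ → ℂ, ∀ z ∈ U, HasDerivAt g (c.branch z)⁻¹ z) :
    ∃ g : ℂ → ℂ, ∀ z ∈ U, HasDerivAt g (c.sqrtR z)⁻¹ z := by
  obtain ⟨g, hg⟩ := h
  rcases c.sqrtR_eq_branch with h | h
  · exact ⟨g, fun z hz => by rw [h z (hU hz)]; exact hg z hz⟩
  · exact ⟨-g, fun z hz => by rw [h z (hU hz), inv_neg]; exact (hg z hz).neg⟩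

/-- On the complement of the spine, `1 / R^{1/2}` has a primitive. -/
theorem exists_primitive_compl_spineSet :
    ∃ g : ℂ → ℂ, ∀ z ∈ c.spineSetᶜ, HasDerivAt g (c.sqrtR z)⁻¹ z := by
  have hcs := c.cuts_subset_spineSet
  refine c.exists_primitive_of_branch (compl_subset_compl.2 hcs) ?_
  refine exists_primitive_of_approx c.isOpen_compl_spineSet c.isPreconnected_compl_spineSet
    fun C hCU hC ε hε => ?_
  have : CompactSpace C := isCompact_iff_compactSpace.1 hC
  have hd : Disjoint c.spineSet C := Set.disjoint_left.2 fun z hz hzC => hCU hzC hz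
  have hbK : b₂ t ∈ c.spineSet := hcs c.b_mem_cuts
  have hne : ∀ z ∉ c.spineSet, z - b₂ t ≠ 0 := fun z hz h => hz (sub_eq_zero.1 h ▸ hbK)
  -- All poles can be moved along the connected spine to b₂, so the approximation is by polynomials
  -- in 1/(z - b₂).
  let e : C(C, ℂ) := ⟨fun z => ((z : ℂ) - b₂ t)⁻¹,
    Continuous.inv₀ (continuous_subtype_val.sub continuous_const) fun z => hne z (hCU z.2)⟩
  set 𝒜 := (Algebra.adjoin ℂ {e}).topologicalClosure with h𝒜'
  have h𝒜 : IsClosed (𝒜 : Set C(C, ℂ)) := Subalgebra.isClosed_topologicalClosure _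
  have hb : (fun z => (z - b₂ t)⁻¹) ∈ extensions 𝒜 :=
    ⟨e, Subalgebra.le_topologicalClosure _ (Algebra.subset_adjoin rfl), fun z => rfl⟩
  have hconn : IsPreconnected c.spineSet :=
    isPreconnected_Icc.image _ c.isTameArc_spine.continuousOn
  have hres : ∀ ζ ∈ c.spineSet, (fun z => (z - ζ)⁻¹) ∈ extensions 𝒜 := fun ζ hζ =>
    resolvent_mem_of_isPreconnected hC h𝒜 hconn hd hbK hζ hb
  have hexp := c.exp_neg_mem_extensions h𝒜 (hd.mono_left hcs) fun ζ hζ => hres ζ (hcs hζ)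
  have ha := hres _ (hcs c.a_mem_cuts)
  have hna := hres _ (hcs (c.neg_mem_cuts.2 c.a_mem_cuts))
  have hquot := mul_mem (mul_mem
    (add_mem (one_mem _) (mul_mem (const_mem_extensions 𝒜 (a₂ t - b₂ t)) ha))
    (add_mem (one_mem _) (mul_mem (const_mem_extensions 𝒜 (-a₂ t - b₂ t)) hna))) hexp
  -- The factor (z - b₂)² is split off because d(1/(z - b₂)) = -(z - b₂)⁻² dz: each polynomial in
  -- 1/(z - b₂), multiplied by (z - b₂)⁻², then has a primitive. This reflects that 1/R^{1/2} decays
  -- like z⁻² and has no residue at infinity.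
  have hq : (fun z => (z - b₂ t) ^ 2 * (c.branch z)⁻¹) ∈ extensions 𝒜 := by
    refine extensions_congr hquot fun z hz => ?_
    have h1 : z - a₂ t ≠ 0 := fun h => hCU hz (sub_eq_zero.1 h ▸ hcs c.a_mem_cuts)
    have h2 : z - -a₂ t ≠ 0 := fun h =>
      hCU hz (sub_eq_zero.1 h ▸ hcs (c.neg_mem_cuts.2 c.a_mem_cuts))
    simp only [Pi.mul_apply, Pi.add_apply, Pi.one_apply]
    rw [c.inv_branch, ← mul_assoc]
    congr 1
    field_simp
    ring
  obtain ⟨M, hM⟩ := isCompact_univ.exists_bound_of_continuousOn (f := fun z : C => e z)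
    e.continuous.continuousOn
  obtain ⟨P, hP⟩ := exists_polynomial_approx e hq (ε := ε / (M ^ 2 + 1)) (by positivity)
  obtain ⟨Q, hQ⟩ := exists_derivative_eq P
  refine ⟨fun z => -Q.eval (z - b₂ t)⁻¹, fun z => P.eval (z - b₂ t)⁻¹ * ((z - b₂ t) ^ 2)⁻¹,
    fun z hz => ?_, fun z hz => ?_⟩
  · have h1 := ((hasDerivAt_id z).sub_const (b₂ t)).inv (hne z hz)
    have h2 := (Q.hasDerivAt ((z - b₂ t)⁻¹)).comp z h1
    rw [hQ] at h2
    refine h2.neg.congr_deriv ?_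
    simp only [id]
    ring
  · have hz0 := hne z (hCU hz)
    have h1 := hP ⟨z, hz⟩
    have h2 := hM ⟨z, hz⟩ (mem_univ _)
    change ‖P.eval (z - b₂ t)⁻¹ - _‖ < _ at h1
    change ‖(z - b₂ t)⁻¹‖ ≤ M at h2
    have e1 : P.eval (z - b₂ t)⁻¹ * ((z - b₂ t) ^ 2)⁻¹ - (c.branch z)⁻¹ =
        (P.eval (z - b₂ t)⁻¹ - (z - b₂ t) ^ 2 * (c.branch z)⁻¹) * ((z - b₂ t)⁻¹) ^ 2 := by
      field_simp
    rw [e1, norm_mul, norm_pow]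
    calc _ ≤ ε / (M ^ 2 + 1) * M ^ 2 := by gcongr
      _ ≤ ε := by
        rw [div_mul_eq_mul_div, div_le_iff₀ (by positivity)]
        nlinarith [sq_nonneg M]

/-- The arcs of the contour, except for `I`. -/
def slits : Set ℂ := c.cuts ∪ (c.L '' Ici 0 ∪ -(c.L '' Ici 0))

theorem neg_mem_slits {z : ℂ} : -z ∈ c.slits ↔ z ∈ c.slits := by
  unfold slits
  rw [mem_union, mem_union, mem_union, mem_union, neg_mem_cuts, Set.neg_mem_neg, Set.mem_neg,
    or_comm (a := -z ∈ _)]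

theorem isClosed_L : IsClosed (c.L '' Ici 0) := by
  rw [← isOpen_compl_iff, isOpen_iff_mem_nhds]
  intro x hx
  have hev := c.tendsto_L.eventually (isCompact_closedBall x 1).compl_mem_cocompact
  obtain ⟨N, hN⟩ := eventually_atTop.1 hev
  have hcomp : IsCompact (c.L '' Icc 0 N) :=
    isCompact_Icc.image_of_continuousOn (c.continuousOn_L.mono Icc_subset_Ici_self)
  have hx' : x ∈ (c.L '' Icc 0 N)ᶜ := fun h => hx (image_mono Icc_subset_Ici_self h)
  filter_upwards [hcomp.isClosed.isOpen_compl.mem_nhds hx', Metric.closedBall_mem_nhds x one_pos]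
    with y hy1 hy2
  rintro ⟨s, hs, rfl⟩
  rcases le_total s N with h | h
  · exact hy1 ⟨s, ⟨hs, h⟩, rfl⟩
  · exact hN s h hy2

theorem isOpen_compl_slits : IsOpen c.slitsᶜ :=
  (c.isCompact_cuts.isClosed.union (c.isClosed_L.union c.isClosed_L.neg)).isOpen_compl

theorem isPreconnected_L : IsPreconnected (c.L '' Ici 0) :=
  isPreconnected_Ici.image _ c.continuousOn_L

/-- On a connected open set that avoids `±J` and `±L`, `1 / R^{1/2}` has a primitive. -/
theorem exists_primitive_of_subset_compl_slits {U : Set ℂ} (hUo : IsOpen U)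
    (hUc : IsPreconnected U) (hU : U ⊆ c.slitsᶜ) :
    ∃ g : ℂ → ℂ, ∀ z ∈ U, HasDerivAt g (c.sqrtR z)⁻¹ z := by
  have hcs : c.cuts ⊆ c.slits := subset_union_left
  refine c.exists_primitive_of_branch (hU.trans (compl_subset_compl.2 hcs)) ?_
  refine exists_primitive_of_approx hUo hUc fun C hCU hC ε hε => ?_
  have : CompactSpace C := isCompact_iff_compactSpace.1 hC
  have hd : Disjoint c.slits C := Set.disjoint_left.2 fun z hz hzC => hU (hCU hzC) hz
  let e : C(C, ℂ) := ⟨fun z => (z : ℂ), continuous_subtype_val⟩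
  set 𝒜 := (Algebra.adjoin ℂ {e}).topologicalClosure with h𝒜'
  have h𝒜 : IsClosed (𝒜 : Set C(C, ℂ)) := Subalgebra.isClosed_topologicalClosure _
  have hid : (fun z => z) ∈ extensions 𝒜 :=
    ⟨e, Subalgebra.le_topologicalClosure _ (Algebra.subset_adjoin rfl), fun z => rfl⟩
  obtain ⟨r, hr0, hr⟩ : ∃ r, 0 ≤ r ∧ ∀ z ∈ C, ‖z‖ ≤ r := by
    obtain ⟨r, hr⟩ := hC.exists_bound_of_continuousOn (f := fun z => z) continuousOn_id
    exact ⟨|r|, abs_nonneg r, fun z hz => (hr z hz).trans (le_abs_self r)⟩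
  obtain ⟨s, hs0, hs⟩ : ∃ s ∈ Ici (0 : ℝ), r < ‖c.L s‖ := by
    have h1 := (tendsto_norm_cocompact_atTop.comp c.tendsto_L).eventually (eventually_gt_atTop r)
    obtain ⟨s, hs, hs'⟩ := (h1.and (eventually_ge_atTop 0)).exists
    exact ⟨s, hs', hs⟩
  have hbL : b₂ t ∈ c.L '' Ici 0 := ⟨0, self_mem_Ici, c.L_zero⟩
  have hLd : Disjoint (c.L '' Ici 0) C := hd.mono_left fun z hz => Or.inr (Or.inl hz)
  have hnLd : Disjoint (-(c.L '' Ici 0)) C := hd.mono_left fun z hz => Or.inr (Or.inr hz)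
  -- The pole at b₂ is pushed along L out of a disc that contains C, and the pole at -b₂ along -L.
  -- The remaining poles on ±J are moved to ±b₂ first, so plain polynomials approximate 1/R^{1/2}.
  have hb : (fun z => (z - b₂ t)⁻¹) ∈ extensions 𝒜 :=
    resolvent_mem_of_isPreconnected hC h𝒜 c.isPreconnected_L hLd ⟨s, hs0, rfl⟩ hbL
      (resolvent_mem_of_lt_norm h𝒜 hr0 hr hs hid)
  have hnLc : IsPreconnected (-(c.L '' Ici 0)) := by
    rw [← Set.image_neg_eq_neg]
    exact c.isPreconnected_L.image _ continuous_neg.continuousOn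
  have hnb : (fun z => (z - -b₂ t)⁻¹) ∈ extensions 𝒜 :=
    resolvent_mem_of_isPreconnected hC h𝒜 hnLc hnLd (Set.neg_mem_neg.2 ⟨s, hs0, rfl⟩)
      (Set.neg_mem_neg.2 hbL) (resolvent_mem_of_lt_norm h𝒜 hr0 hr (by rwa [norm_neg]) hid)
  have hres : ∀ ζ ∈ c.cuts, (fun z => (z - ζ)⁻¹) ∈ extensions 𝒜 := by
    rintro ζ (hζ | hζ)
    · exact resolvent_mem_of_isPreconnected hC h𝒜
        (isPreconnected_Icc.image _ c.isArc_J₁.continuousOn)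
        (hd.mono_left fun z hz => Or.inl (Or.inl hz))
        ⟨0, ⟨le_rfl, zero_le_one⟩, c.isArc_J₁.left⟩ hζ hnb
    · exact resolvent_mem_of_isPreconnected hC h𝒜
        (isPreconnected_Icc.image _ c.isArc_J.continuousOn)
        (hd.mono_left fun z hz => Or.inl (Or.inr hz)) c.b_mem_J hζ hb
  have hexp := c.exp_neg_mem_extensions h𝒜 (hd.mono_left hcs) hres
  have hq : (fun z => (c.branch z)⁻¹) ∈ extensions 𝒜 := by
    refine extensions_congr (mul_mem (mul_mem (hres _ c.a_mem_cuts)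
      (hres _ (c.neg_mem_cuts.2 c.a_mem_cuts))) hexp) fun z _ => ?_
    rw [c.inv_branch]
    rfl
  obtain ⟨P, hP⟩ := exists_polynomial_approx e hq hε
  obtain ⟨Q, hQ⟩ := exists_derivative_eq P
  refine ⟨fun z => Q.eval z, fun z => P.eval z, fun z _ => hQ ▸ Q.hasDerivAt z, fun z hz => ?_⟩
  exact (hP ⟨z, hz⟩).le

end Contour

end Primitive

/-! ### Functions with discrete limit sets -/

/-- A continuous function on a connected set that is everywhere close to a separated set is
everywhere close to the same point of that set. -/
theorem dist_lt_of_isPreconnected {X : Type*} [TopologicalSpace X] {f : X → ℂ} {W : Set X}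
    (hW : IsPreconnected W) (hf : ContinuousOn f W) {S : Set ℂ} {ε : ℝ}
    (hsep : ∀ x ∈ S, ∀ y ∈ S, dist x y < 2 * ε → x = y) (hS : ∀ z ∈ W, ∃ x ∈ S, dist (f z) x < ε)
    {z₀ z x₀ : _} (hz₀ : z₀ ∈ W) (hz : z ∈ W) (hx₀ : x₀ ∈ S) (h0 : dist (f z₀) x₀ < ε) :
    dist (f z) x₀ < ε := by
  have hfW : IsPreconnected (f '' W) := hW.image f hf
  have hsub : f '' W ⊆ Metric.ball x₀ ε := by
    refine hfW.subset_left_of_subset_union (v := ⋃ x ∈ S \ {x₀}, Metric.ball x ε)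
      Metric.isOpen_ball (isOpen_biUnion fun _ _ => Metric.isOpen_ball) ?_ ?_
      ⟨f z₀, ⟨z₀, hz₀, rfl⟩, h0⟩
    · rw [Set.disjoint_left]
      intro w hw hw'
      obtain ⟨x, hx, hwx⟩ := mem_iUnion₂.1 hw'
      refine hx.2 (hsep x hx.1 x₀ hx₀ ?_)
      rw [Metric.mem_ball] at hw hwx
      have := dist_triangle_left x x₀ w
      linarith
    · rintro _ ⟨w, hw, rfl⟩
      obtain ⟨x, hx, hwx⟩ := hS w hw
      by_cases hxx : x = x₀
      · exact Or.inl (hxx ▸ hwx)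
      · exact Or.inr (mem_iUnion₂.2 ⟨x, ⟨hx, hxx⟩, hwx⟩)
  exact hsub ⟨z, hz, rfl⟩

/-- Two small elements of a coset of a discrete group differ by a small element of the group, so a
coset has no nonzero elements near 0. -/
theorem exists_separation {Λ : AddSubgroup ℂ} (hΛ : ∃ δ > 0, ∀ x ∈ Λ, ‖x‖ < δ → x = 0) (x : ℂ) :
    ∃ δ > 0, ∀ l ∈ Λ, ‖x + l‖ < δ → x + l = 0 := by
  obtain ⟨δ, hδ, h⟩ := hΛ
  by_cases hex : ∃ l ∈ Λ, x + l ≠ 0 ∧ ‖x + l‖ < δ / 2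
  · obtain ⟨l₀, hl₀, hne, hlt⟩ := hex
    refine ⟨‖x + l₀‖, norm_pos_iff.2 hne, fun l hl hl' => ?_⟩
    have := h (l - l₀) (sub_mem hl hl₀) (by
      have e : l - l₀ = (x + l) - (x + l₀) := by ring
      rw [e]
      exact (norm_sub_le _ _).trans_lt (by linarith))
    rw [sub_eq_zero.1 this] at hl'
    exact absurd hl' (lt_irrefl _)
  · push Not at hex
    refine ⟨δ / 2, half_pos hδ, fun l hl hl' => ?_⟩
    by_contra hne
    exact absurd hl' (not_lt.2 (hex l hl hne))

/-- The affine functions `x ↦ ±x + l`, `l ∈ Λ`, as pairs of coefficients. -/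
def signedTranslations (Λ : AddSubgroup ℂ) : Set (ℂ × ℂ) := {y | (y.1 = 1 ∨ y.1 = -1) ∧ y.2 ∈ Λ}

/-- Differences of two such values lie in Λ or in ±2v + Λ, and each of these sets is separated from
0 except for 0 itself. -/
theorem exists_separation_signedTranslations {Λ : AddSubgroup ℂ}
    (hΛ : ∃ δ > 0, ∀ x ∈ Λ, ‖x‖ < δ → x = 0) (v : ℂ) :
    ∃ δ > 0, ∀ x ∈ signedTranslations Λ, ∀ y ∈ signedTranslations Λ,
      dist (x.1 * v + x.2) (y.1 * v + y.2) < δ → x.1 * v + x.2 = y.1 * v + y.2 := by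
  obtain ⟨δ₀, hδ₀, h₀⟩ := hΛ
  obtain ⟨δ₁, hδ₁, h₁⟩ := exists_separation ⟨δ₀, hδ₀, h₀⟩ (2 * v)
  obtain ⟨δ₂, hδ₂, h₂⟩ := exists_separation ⟨δ₀, hδ₀, h₀⟩ (-(2 * v))
  refine ⟨min δ₀ (min δ₁ δ₂), lt_min hδ₀ (lt_min hδ₁ hδ₂), ?_⟩
  rintro ⟨e, l⟩ ⟨he, hl⟩ ⟨e', l'⟩ ⟨he', hl'⟩ hd
  simp only at he he' hl hl' hd ⊢
  have hll := sub_mem hl hl'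
  rw [dist_eq_norm] at hd
  rw [← sub_eq_zero]
  rcases he with rfl | rfl <;> rcases he' with rfl | rfl
  · have e1 : 1 * v + l - (1 * v + l') = l - l' := by ring
    rw [e1] at hd ⊢
    exact h₀ _ hll (hd.trans_le (min_le_left _ _))
  · have e1 : 1 * v + l - (-1 * v + l') = 2 * v + (l - l') := by ring
    rw [e1] at hd ⊢
    exact h₁ _ hll (hd.trans_le ((min_le_right _ _).trans (min_le_left _ _)))
  · have e1 : -1 * v + l - (1 * v + l') = -(2 * v) + (l - l') := by ring
    rw [e1] at hd ⊢
    exact h₂ _ hll (hd.trans_le ((min_le_right _ _).trans (min_le_right _ _)))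
  · have e1 : -1 * v + l - (-1 * v + l') = l - l' := by ring
    rw [e1] at hd ⊢
    exact h₀ _ hll (hd.trans_le (min_le_left _ _))

/-- All limit values of `h` at `z₀`, along `D`, are of the form `e * v + l` with `(e, l) ∈ F`. -/
def ClustersAt (h : ℂ → ℂ) (D : Set ℂ) (F : Set (ℂ × ℂ)) (z₀ v : ℂ) : Prop :=
  ∀ ε > 0, ∀ᶠ z in 𝓝[D] z₀, ∃ y ∈ F, dist (h z) (y.1 * v + y.2) < ε

theorem ClustersAt.inter {h : ℂ → ℂ} {D : Set ℂ} {Λ : AddSubgroup ℂ}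
    (hΛ : ∃ δ > 0, ∀ x ∈ Λ, ‖x‖ < δ → x = 0) {F F' G : Set (ℂ × ℂ)} {z₀ v : ℂ}
    (hF : F ⊆ signedTranslations Λ) (hF' : F' ⊆ signedTranslations Λ)
    (h1 : ClustersAt h D F z₀ v) (h2 : ClustersAt h D F' z₀ v)
    (hG : ∀ x ∈ F, ∀ y ∈ F', x.1 * v + x.2 = y.1 * v + y.2 → x ∈ G) : ClustersAt h D G z₀ v := by
  obtain ⟨δ, hδ, hsep⟩ := exists_separation_signedTranslations hΛ v
  intro ε hε
  filter_upwards [h1 (min ε (δ / 2)) (by positivity), h2 (δ / 2) (by positivity)] with z hz1 hz2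
  obtain ⟨x, hx, hxz⟩ := hz1
  obtain ⟨y, hy, hyz⟩ := hz2
  refine ⟨x, hG x hx y hy (hsep x (hF hx) y (hF' hy) ?_), hxz.trans_le (min_le_left _ _)⟩
  have := dist_triangle_left (x.1 * v + x.2) (y.1 * v + y.2) (h z)
  linarith [hxz.trans_le (min_le_right ε (δ / 2))]

theorem ClustersAt.mono {h : ℂ → ℂ} {D : Set ℂ} {F F' : Set (ℂ × ℂ)} {z₀ v : ℂ} (hFF : F ⊆ F')
    (h1 : ClustersAt h D F z₀ v) : ClustersAt h D F' z₀ v := fun ε hε =>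
  (h1 ε hε).mono fun _ ⟨y, hy, hyz⟩ => ⟨y, hFF hy, hyz⟩

theorem norm_eq_one_of_mem_signedTranslations {Λ : AddSubgroup ℂ} {y : ℂ × ℂ}
    (hy : y ∈ signedTranslations Λ) : ‖y.1‖ = 1 := by
  rcases hy.1 with h | h <;> simp [h]

theorem dist_signedTranslations {Λ : AddSubgroup ℂ} {y : ℂ × ℂ} (hy : y ∈ signedTranslations Λ)
    (v v' : ℂ) : dist (y.1 * v + y.2) (y.1 * v' + y.2) = dist v v' := by
  rw [dist_add_right, dist_eq_norm, ← mul_sub, norm_mul,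
    norm_eq_one_of_mem_signedTranslations hy, one_mul, ← dist_eq_norm]

/-! ### Propagation of limit values along an arc -/

section Propagation

variable {κ : ℝ → ℂ} {T : ℝ} {h : ℂ → ℂ} {v : ℝ → ℂ} {Λ : AddSubgroup ℂ} {F : Set (ℂ × ℂ)}

/-- Near κ s the function is close to a value from F, and near κ s' to the value of some pair x. By
continuity of v and discreteness these two values agree at v s, so x belongs to F by the saturation
hypothesis `hsat`. The radius δ/8 leaves room for all errors. -/
theorem ClustersAt.eventually_right (hκ : IsTameArc κ T) (hv : ContinuousOn v (Icc 0 T))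
    (hΛ : ∃ δ > 0, ∀ x ∈ Λ, ‖x‖ < δ → x = 0) (hF : F ⊆ signedTranslations Λ)
    (hfull : ∀ s ∈ Icc 0 T, ClustersAt h (κ '' Icc 0 T)ᶜ (signedTranslations Λ) (κ s) (v s))
    {s : ℝ} (hs : s ∈ Icc 0 T)
    (hsat : ∀ x ∈ signedTranslations Λ, ∀ y ∈ F, x.1 * v s + x.2 = y.1 * v s + y.2 → x ∈ F)
    (hcl : ClustersAt h (κ '' Icc 0 T)ᶜ F (κ s) (v s)) :
    ∃ η > 0, ∀ s' ∈ Icc 0 T, dist s' s < η → ClustersAt h (κ '' Icc 0 T)ᶜ F (κ s') (v s') := by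
  set D := (κ '' Icc 0 T)ᶜ with hD
  obtain ⟨δ, hδ, hsep⟩ := exists_separation_signedTranslations hΛ (v s)
  obtain ⟨ρ, hρ, hball⟩ := Metric.mem_nhdsWithin_iff.1 (hcl (δ / 8) (by positivity))
  have hv' := Metric.continuousOn_iff.1 hv s hs (δ / 8) (by positivity)
  have hκ' := Metric.continuousOn_iff.1 hκ.continuousOn s hs (ρ / 2) (by positivity)
  obtain ⟨η₁, hη₁, h1⟩ := hv'
  obtain ⟨η₂, hη₂, h2⟩ := hκ'
  refine ⟨min η₁ η₂, lt_min hη₁ hη₂, fun s' hs' hd => ?_⟩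
  have a1 := h1 s' hs' (hd.trans_le (min_le_left _ _))
  have a2 := h2 s' hs' (hd.trans_le (min_le_right _ _))
  intro ε hε
  have hn : ∀ᶠ z in 𝓝[D] κ s', z ∈ Metric.ball (κ s') (ρ / 2) ∩ D :=
    inter_mem (mem_nhdsWithin_of_mem_nhds (Metric.ball_mem_nhds _ (by positivity)))
      self_mem_nhdsWithin
  filter_upwards [hn, hfull s' hs' (min ε (δ / 8)) (by positivity)] with z hz hz'
  obtain ⟨x, hx, hxz⟩ := hz'
  obtain ⟨y, hy, hyz⟩ := hball ⟨by
    rw [Metric.mem_ball]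
    have := dist_triangle z (κ s') (κ s)
    have := Metric.mem_ball.1 hz.1
    linarith, hz.2⟩
  refine ⟨x, hsat x hx y hy (hsep x hx y (hF hy) ?_), hxz.trans_le (min_le_left _ _)⟩
  have b1 := dist_signedTranslations hx (v s) (v s')
  rw [dist_comm (v s)] at b1
  have b2 := hxz.trans_le (min_le_right ε (δ / 8))
  rw [dist_comm] at b2
  have b3 := dist_triangle (x.1 * v s + x.2) (x.1 * v s' + x.2) (y.1 * v s + y.2)
  have b4 := dist_triangle (x.1 * v s' + x.2) (h z) (y.1 * v s + y.2)
  linarith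

/-- From a point z close to κ s one can slide along a circle, off the arc, up to earlier points of
the arc, where F governs the values. On the way h cannot jump between the separated limit values.
Saturation is not needed at s. -/
theorem ClustersAt.of_left (hκ : IsTameArc κ T) (hh : ContinuousOn h (κ '' Icc 0 T)ᶜ)
    (hv : ContinuousOn v (Icc 0 T))
    (hΛ : ∃ δ > 0, ∀ x ∈ Λ, ‖x‖ < δ → x = 0) (hF : F ⊆ signedTranslations Λ)
    (hfull : ∀ s ∈ Icc 0 T, ClustersAt h (κ '' Icc 0 T)ᶜ (signedTranslations Λ) (κ s) (v s))
    {s₀ s : ℝ} (hs₀ : 0 ≤ s₀) (hs₀s : s₀ < s) (hsT : s ≤ T)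
    (hcl : ∀ s' ∈ Ico s₀ s, ClustersAt h (κ '' Icc 0 T)ᶜ F (κ s') (v s')) :
    ClustersAt h (κ '' Icc 0 T)ᶜ F (κ s) (v s) := by
  set D := (κ '' Icc 0 T)ᶜ with hD
  have hs : s ∈ Icc 0 T := ⟨hs₀.trans hs₀s.le, hsT⟩
  obtain ⟨δ, hδ, hsep⟩ := exists_separation_signedTranslations hΛ (v s)
  intro ε hε
  set ε₁ := min ε (δ / 2) / 2 with hε₁
  have hm : 0 < min ε (δ / 2) := by positivity
  have p1 : 0 < ε₁ := by positivity
  have p2 : 2 * ε₁ ≤ ε := by have := min_le_left ε (δ / 2); linarith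
  have p3 : 2 * (2 * ε₁) ≤ δ := by have := min_le_right ε (δ / 2); linarith
  obtain ⟨ρ, hρ, hball⟩ := Metric.mem_nhdsWithin_iff.1 (hfull s hs ε₁ p1)
  obtain ⟨η₁, hη₁, h1⟩ := Metric.continuousOn_iff.1 hv s hs ε₁ p1
  obtain ⟨δ', hδ', hj⟩ := hκ.join_left (s₀ := s) ⟨hs₀.trans_lt hs₀s, hsT⟩
    (lt_min hη₁ (sub_pos.2 hs₀s))
  have hn : ∀ᶠ z in 𝓝[D] κ s, z ∈ Metric.ball (κ s) (min ρ δ') ∩ D :=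
    inter_mem (mem_nhdsWithin_of_mem_nhds (Metric.ball_mem_nhds _ (lt_min hρ hδ')))
      self_mem_nhdsWithin
  filter_upwards [hn] with z hz
  have hzd := Metric.mem_ball.1 hz.1
  obtain ⟨s', hs', hs'0, W, hW, hzW, hWs, hclW⟩ := hj z hz.2 (hzd.trans_le (min_le_right _ _))
  have q1 : s' ∈ Ico s₀ s := ⟨by have := min_le_right η₁ (s - s₀); linarith [hs'.1], hs'.2⟩
  have q2 : dist s' s < η₁ := by
    rw [dist_comm, Real.dist_eq, abs_of_pos (by linarith [hs'.2])]
    have := min_le_left η₁ (s - s₀); linarith [hs'.1]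
  have q3 := h1 s' ⟨hs'0, q1.2.le.trans hsT⟩ q2
  have hWD : W ⊆ D := fun w hw => (hWs hw).2
  obtain ⟨w, hwW, y, hy, hyw⟩ : ∃ w ∈ W, ∃ y ∈ F, dist (h w) (y.1 * v s' + y.2) < ε₁ := by
    have := mem_closure_iff_nhdsWithin_neBot.1 hclW
    have hev := (hcl s' q1 ε₁ p1).filter_mono (nhdsWithin_mono (κ s') hWD)
    obtain ⟨w, hw, hwW⟩ := (hev.and self_mem_nhdsWithin).exists
    exact ⟨w, hwW, hw⟩
  refine ⟨y, hy, (dist_lt_of_isPreconnected hW (hh.mono hWD)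
    (S := (fun x : ℂ × ℂ => x.1 * v s + x.2) '' signedTranslations Λ) (ε := 2 * ε₁) ?_ ?_ hwW hzW
    ⟨y, hF hy, rfl⟩ ?_).trans_le p2⟩
  · rintro _ ⟨x, hx, rfl⟩ _ ⟨x', hx', rfl⟩ hd
    exact hsep x hx x' hx' (hd.trans_le p3)
  · intro w' hw'
    obtain ⟨x, hx, hxw⟩ := hball ⟨by
      rw [Metric.mem_ball, Metric.mem_sphere.1 (hWs hw').1]
      exact hzd.trans_le (min_le_left _ _), hWD hw'⟩
    exact ⟨_, ⟨x, hx, rfl⟩, hxw.trans (by linarith)⟩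
  · have b1 := dist_signedTranslations (hF hy) (v s') (v s)
    have b2 := dist_triangle (h w) (y.1 * v s' + y.2) (y.1 * v s + y.2)
    simp only
    linarith

/-- Propagation of the limit values along a tame arc. -/
theorem ClustersAt.propagate (hκ : IsTameArc κ T) (hh : ContinuousOn h (κ '' Icc 0 T)ᶜ)
    (hv : ContinuousOn v (Icc 0 T))
    (hΛ : ∃ δ > 0, ∀ x ∈ Λ, ‖x‖ < δ → x = 0) (hF : F ⊆ signedTranslations Λ)
    (hfull : ∀ s ∈ Icc 0 T, ClustersAt h (κ '' Icc 0 T)ᶜ (signedTranslations Λ) (κ s) (v s))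
    {s₀ s₁ : ℝ} (hs₀ : 0 ≤ s₀) (hs₁ : s₁ ≤ T)
    (hsat : ∀ s ∈ Ico s₀ s₁, ∀ x ∈ signedTranslations Λ, ∀ y ∈ F,
      x.1 * v s + x.2 = y.1 * v s + y.2 → x ∈ F)
    (hcl : ClustersAt h (κ '' Icc 0 T)ᶜ F (κ s₀) (v s₀)) :
    ∀ s ∈ Icc s₀ s₁, ClustersAt h (κ '' Icc 0 T)ᶜ F (κ s) (v s) := by
  set A := {s | s ∈ Icc s₀ s₁ ∧ ∀ s' ∈ Icc s₀ s, ClustersAt h (κ '' Icc 0 T)ᶜ F (κ s') (v s')}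
    with hA
  rcases le_or_gt s₀ s₁ with h01 | h01
  swap
  · intro s hs; exact absurd (hs.1.trans hs.2) (not_le.2 h01)
  have hs₀A : s₀ ∈ A := ⟨⟨le_rfl, h01⟩, fun s' hs' => by
    rw [le_antisymm hs'.2 hs'.1]; exact hcl⟩
  have hbdd : BddAbove A := ⟨s₁, fun s hs => hs.1.2⟩
  set m := sSup A with hm
  have hm0 : s₀ ≤ m := le_csSup hbdd hs₀A
  have hm1 : m ≤ s₁ := csSup_le ⟨s₀, hs₀A⟩ fun s hs => hs.1.2
  have hlt : ∀ s' ∈ Ico s₀ m, ClustersAt h (κ '' Icc 0 T)ᶜ F (κ s') (v s') := by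
    intro s' hs'
    obtain ⟨s, hs, hs's⟩ := exists_lt_of_lt_csSup ⟨s₀, hs₀A⟩ hs'.2
    exact hs.2 s' ⟨hs'.1, hs's.le⟩
  have hmc : ClustersAt h (κ '' Icc 0 T)ᶜ F (κ m) (v m) := by
    rcases hm0.eq_or_lt with h' | h'
    · rw [← h']; exact hcl
    · exact ClustersAt.of_left hκ hh hv hΛ hF hfull hs₀ h' (hm1.trans hs₁) hlt
  have hle : ∀ s' ∈ Icc s₀ m, ClustersAt h (κ '' Icc 0 T)ᶜ F (κ s') (v s') := by
    intro s' hs'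
    rcases hs'.2.eq_or_lt with h' | h'
    · rw [h']; exact hmc
    · exact hlt s' ⟨hs'.1, h'⟩
  -- The supremum m of the good parameters is good by `ClustersAt.of_left`; if it were smaller than
  -- s₁, `ClustersAt.eventually_right` would lead beyond it.
  have hms : m = s₁ := by
    by_contra hne
    have hml : m < s₁ := lt_of_le_of_ne hm1 hne
    have hmT : m ∈ Icc 0 T := ⟨hs₀.trans hm0, hm1.trans hs₁⟩
    obtain ⟨η, hη, hr⟩ := ClustersAt.eventually_right hκ hv hΛ hF hfull hmT
      (hsat m ⟨hm0, hml⟩) hmc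
    set m' := min (m + η / 2) s₁ with hm'
    have l1 : m < m' := lt_min (by linarith) hml
    have l2 : m' ≤ m + η / 2 := min_le_left _ _
    have : m' ∈ A := by
      refine ⟨⟨hm0.trans l1.le, min_le_right _ _⟩, fun s' hs' => ?_⟩
      rcases le_or_gt s' m with h' | h'
      · exact hle s' ⟨hs'.1, h'⟩
      · refine hr s' ⟨hs₀.trans hs'.1, (hs'.2.trans (min_le_right _ _)).trans hs₁⟩ ?_
        rw [Real.dist_eq, abs_of_pos (by linarith)]
        linarith [hs'.2]
    exact absurd (le_csSup hbdd this) (not_le.2 l1)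
  rw [← hms]
  exact hle

end Propagation

/-! ### The group of periods -/

namespace Surface

variable {t : ℂ}

/-- The periods of `dz / w`, seen as the stabilizer of the ramification point on top of `b₂`. -/
def periods (t : ℂ) : AddSubgroup ℂ where
  carrier := {u | act u (bPt t) = bPt t}
  zero_mem' := act_zero _
  add_mem' := fun {u v} hu hv => by
    change act (u + v) (bPt t) = bPt t
    rw [act_add, show act v (bPt t) = bPt t from hv]; exact hu
  neg_mem' := fun {u} hu => by
    change act (-u) (bPt t) = bPt t
    have h : act u (bPt t) = bPt t := hu
    rw [← h, act_neg_act, h]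

theorem mem_periods {u : ℂ} : u ∈ periods t ↔ act u (bPt t) = bPt t := Iff.rfl

theorem act_bPt_eq_iff {u v : ℂ} : act u (bPt t) = act v (bPt t) ↔ u - v ∈ periods t := act_eq_iff

theorem pt_eq_pt {z w z' w' : ℂ} {h h'} :
    (pt ⟨(z, w), h⟩ : Surface t) = pt ⟨(z', w'), h'⟩ ↔ z = z' ∧ w = w' := by
  simp

theorem conj_bPt : conj (bPt t) = bPt t := by
  simp [conj, bPt]

theorem conj_act_bPt (u : ℂ) : conj (act u (bPt t)) = act (-u) (bPt t) := by
  rw [conj_act, conj_bPt]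

/-- The point over b₂ has w = 0, while w ≠ 0 at all other small times. -/
theorem periods_discrete (ht : t ^ 2 ≠ 4) : ∃ δ > 0, ∀ x ∈ periods t, ‖x‖ < δ → x = 0 := by
  have h := (isFlowAt_act (bPt t) 0).eventually_w_ne_zero ht
  obtain ⟨δ, hδ, hball⟩ := Metric.mem_nhdsWithin_iff.1 h
  refine ⟨δ, hδ, fun x hx hxδ => ?_⟩
  by_contra hne
  have h1 : (act x (bPt t)).w ≠ 0 := hball ⟨by simpa using hxδ, hne⟩
  rw [mem_periods.1 hx] at h1
  exact h1 rfl

/-- The orbit map is open, so nearby points are reached at nearby times, up to a period. -/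
theorem exists_nhds_act (ht : t ^ 2 ≠ 4) (u₀ : ℂ) {ε : ℝ} (hε : 0 < ε) :
    ∃ V ∈ 𝓝 (act u₀ (bPt t)), ∀ u, act u (bPt t) ∈ V → ∃ l ∈ periods t, dist u (u₀ + l) < ε := by
  refine ⟨_, (isFlowAt_act (bPt t) u₀).image_mem_nhds ht (Metric.ball_mem_nhds u₀ hε), ?_⟩
  rintro u ⟨v, hv, hvu⟩
  have hl := act_bPt_eq_iff.1 hvu.symm
  refine ⟨u - v, hl, ?_⟩
  rw [Metric.mem_ball] at hv
  rw [show u = v + (u - v) by ring, add_sub_cancel_left]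
  rwa [dist_add_right]

/-- Over a point close to `z₀`, every point of the surface is close to one of the points over
`z₀`. -/
theorem eventually_pt_mem_or {z₀ w₀ : ℂ} (h₀ : w₀ ^ 2 = R t z₀) {V V' : Set (Surface t)}
    (hV : V ∈ 𝓝 (pt ⟨(z₀, w₀), h₀⟩ : Surface t)) (hV' : V' ∈ 𝓝 (conj (pt ⟨(z₀, w₀), h₀⟩) : Surface t)) :
    ∀ᶠ z in 𝓝 z₀, ∀ (w : ℂ) (h : w ^ 2 = R t z), pt ⟨(z, w), h⟩ ∈ V ∨ pt ⟨(z, w), h⟩ ∈ V' := by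
  have hball : ∀ (w₁ : ℂ) (h₁ : w₁ ^ 2 = R t z₀) (V : Set (Surface t)),
      V ∈ 𝓝 (pt ⟨(z₀, w₁), h₁⟩ : Surface t) →
      ∃ δ > 0, ∀ (z w : ℂ) (h : w ^ 2 = R t z), dist z z₀ < δ → dist w w₁ < δ →
        pt ⟨(z, w), h⟩ ∈ V := by
    intro w₁ h₁ V hV
    have h1 := continuous_pt.continuousAt (x := (⟨(z₀, w₁), h₁⟩ : AffineCurve t)) hV
    obtain ⟨δ, hδ, hb⟩ := Metric.mem_nhds_iff.1 h1
    refine ⟨δ, hδ, fun z w h hz hw => hb ?_⟩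
    rw [Metric.mem_ball, Subtype.dist_eq, Prod.dist_eq]
    exact max_lt hz hw
  obtain ⟨δ₁, hδ₁, h1⟩ := hball w₀ h₀ V hV
  obtain ⟨δ₂, hδ₂, h2⟩ := hball (-w₀) (by rwa [neg_sq]) V' hV'
  have hm : 0 < min δ₁ δ₂ := lt_min hδ₁ hδ₂
  have hc : ∀ᶠ z in 𝓝 z₀, dist (R t z) (R t z₀) < (min δ₁ δ₂) ^ 2 :=
    (continuous_R t).continuousAt.eventually (Metric.ball_mem_nhds _ (by positivity))
  filter_upwards [hc, Metric.ball_mem_nhds z₀ hm] with z hz hz' w h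
  rw [Metric.mem_ball] at hz'
  by_contra hcon
  push Not at hcon
  have d1 : min δ₁ δ₂ ≤ dist w w₀ := by
    by_contra hlt
    push Not at hlt
    exact hcon.1 (h1 z w h (hz'.trans_le (min_le_left _ _)) (hlt.trans_le (min_le_left _ _)))
  have d2 : min δ₁ δ₂ ≤ dist w (-w₀) := by
    by_contra hlt
    push Not at hlt
    exact hcon.2 (h2 z w h (hz'.trans_le (min_le_right _ _)) (hlt.trans_le (min_le_right _ _)))
  rw [dist_eq_norm] at hz d1 d2
  have e : R t z - R t z₀ = (w - w₀) * (w - -w₀) := by rw [← h, ← h₀]; ring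
  rw [e, norm_mul] at hz
  nlinarith

end Surface

open Surface

theorem IsArc.continuousOn_integral {t : ℂ} (ht : t ^ 2 ≠ 4) {γ y : ℝ → ℂ} {p q : ℂ}
    (hγ : IsArc γ p q)
    (hy : ContinuousOn y (Icc 0 1)) (hsq : ∀ s ∈ Icc (0 : ℝ) 1, y s ^ 2 = R t (γ s))
    (hne : ∀ s ∈ Ioo (0 : ℝ) 1, R t (γ s) ≠ 0) :
    ContinuousOn (fun s => ∫ x in (0 : ℝ)..s, deriv γ x / y x) (Icc 0 1) :=
  (hγ.isPath_liftPath ht hy hsq hne).continuousOn_partialIntegral.congr fun _ hs =>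
    (partialIntegral_liftPath hsq hs).symm

/-! ### The arcs of the contour and the half periods -/

namespace Contour

variable {t : ℂ} (c : Contour t)

theorem sheet_zero (z : ℂ) (h : c.sqrtR z ^ 2 = R t z) :
    c.sheet 0 z = pt ⟨(z, c.sqrtR z), h⟩ := by
  simp [sheet]

theorem sheet_one (z : ℂ) (h : (-c.sqrtR z) ^ 2 = R t z) :
    c.sheet 1 z = pt ⟨(z, -c.sqrtR z), h⟩ := by
  simp [sheet]

theorem conj_sheet_zero (z : ℂ) : conj (c.sheet 0 z) = c.sheet 1 z := by
  simp [sheet, conj]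

theorem conj_sheet_one (z : ℂ) : conj (c.sheet 1 z) = c.sheet 0 z := by
  rw [← conj_sheet_zero, conj_conj]

theorem continuousAt_sheet_zero {z : ℂ} (hz : z ∉ c.cuts) : ContinuousAt (c.sheet 0) z := by
  refine continuousAt_of_eventually_eq_subtype continuous_pt
    (f := fun z => (z, c.sqrtR z)) (continuousAt_id.prodMk (c.differentiableAt_sqrtR hz).continuousAt)
    (Eventually.of_forall fun z => ⟨c.sqrtR_sq z, c.sheet_zero z _⟩)

/-- The integral of `dz / w` along the lift `(J₁, ω)`. -/
def betaIntegral (ω : ℝ → ℂ) (s : ℝ) : ℂ := ∫ x in (0 : ℝ)..s, deriv c.J₁ x / ω x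

/-- The integral of `dz / w` along the lift of `I` to the sheet `𝔖^{(0)}`, starting at `a₂`. -/
def alphaIntegral (s : ℝ) : ℂ :=
  ∫ x in (0 : ℝ)..s, deriv (fun r => c.I (1 - r)) x / c.sqrtR (c.I (1 - x))

/-- The integral of `dz / w` along the reversed lift `(J₁, ω)`. -/
def betaIntegralRev (ω : ℝ → ℂ) (s : ℝ) : ℂ :=
  ∫ x in (0 : ℝ)..s, deriv (fun r => c.J₁ (1 - r)) x / ω (1 - x)

theorem one_sub_mem_Icc {s : ℝ} (hs : s ∈ Icc (0 : ℝ) 1) : 1 - s ∈ Icc (0 : ℝ) 1 :=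
  ⟨by linarith [hs.2], by linarith [hs.1]⟩

/-- Inside I the branch is analytic. At the ends ±a₂, which lie on the cuts, |R^{1/2}| = |R|^{1/2}
tends to 0 for any choice of the root. -/
theorem continuousOn_sqrtR_I : ContinuousOn (fun s => c.sqrtR (c.I (1 - s))) (Icc 0 1) := by
  intro s hs
  have hc : ContinuousWithinAt (fun s => c.I (1 - s)) (Icc 0 1) s :=
    c.isArc_I.reverse.continuousOn s hs
  have hend : R t (c.I (1 - s)) = 0 →
      ContinuousWithinAt (fun s => c.sqrtR (c.I (1 - s))) (Icc 0 1) s := by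
    intro h0
    have h1 : c.sqrtR (c.I (1 - s)) = 0 := by
      rw [← c.sqrtR_sq] at h0; exact pow_eq_zero_iff two_ne_zero |>.1 h0
    have h2 : ContinuousWithinAt (fun s => ‖R t (c.I (1 - s))‖) (Icc 0 1) s :=
      ((continuous_R t).continuousAt.comp_continuousWithinAt hc).norm
    have h3 := (Real.continuous_sqrt.continuousAt.comp_continuousWithinAt h2)
    rw [ContinuousWithinAt, h1, tendsto_zero_iff_norm_tendsto_zero]
    rw [ContinuousWithinAt] at h3
    simp only [Function.comp_def, h0, norm_zero, Real.sqrt_zero] at h3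
    refine h3.congr fun x => ?_
    rw [← c.sqrtR_sq, norm_pow, Real.sqrt_sq (norm_nonneg _)]
  rcases hs.1.eq_or_lt with h0 | h0
  · exact hend (by rw [← h0, sub_zero, c.I_one, R]; ring)
  · rcases hs.2.eq_or_lt with h1 | h1
    · exact hend (by rw [h1, sub_self, c.I_zero, R]; ring)
    · exact ContinuousAt.comp_continuousWithinAt (g := c.sqrtR) (f := fun s => c.I (1 - s))
        (c.differentiableAt_sqrtR (c.I_notMem_cuts ⟨by linarith, by linarith⟩)).continuousAt hc

theorem R_I_ne_zero {s : ℝ} (hs : s ∈ Ioo (0 : ℝ) 1) : R t (c.I (1 - s)) ≠ 0 :=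
  c.R_ne_zero (c.I_notMem_cuts ⟨by linarith [hs.2], by linarith [hs.1]⟩)

theorem continuousOn_alphaIntegral : ContinuousOn c.alphaIntegral (Icc 0 1) :=
  c.isArc_I.reverse.continuousOn_integral c.sq_ne_four c.continuousOn_sqrtR_I
    (fun _ _ => c.sqrtR_sq _) fun _ hs => c.R_I_ne_zero hs

theorem sqrtR_a : c.sqrtR (a₂ t) = 0 := by
  have h := c.sqrtR_sq (a₂ t)
  have h0 : R t (a₂ t) = 0 := by rw [R]; ring
  rw [h0] at h
  exact pow_eq_zero_iff two_ne_zero |>.1 h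

theorem act_alphaIntegral {s : ℝ} (hs : s ∈ Icc (0 : ℝ) 1) :
    act (c.alphaIntegral s) (c.sheet 0 (a₂ t)) = c.sheet 0 (c.I (1 - s)) := by
  have h := c.isArc_I.reverse.act_integral c.sq_ne_four c.continuousOn_sqrtR_I
    (fun _ _ => c.sqrtR_sq _) (fun _ hs => c.R_I_ne_zero hs) hs
  rw [liftPath_eq (c.sqrtR_sq _), liftPath_eq (c.sqrtR_sq _)] at h
  rw [c.sheet_zero _ (c.sqrtR_sq _), c.sheet_zero _ (c.sqrtR_sq _)]
  simp only [sub_zero, c.I_one] at h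
  exact h.symm

variable {ω : ℝ → ℂ}

theorem IsBetaLift.continuousOn_betaIntegral {c : Contour t} (hω : c.IsBetaLift ω) :
    ContinuousOn (c.betaIntegral ω) (Icc 0 1) :=
  c.isArc_J₁.continuousOn_integral c.sq_ne_four hω.1 hω.2 fun _ hs => c.R_J₁_ne_zero hs

theorem IsBetaLift.apply_zero {c : Contour t} (hω : c.IsBetaLift ω) : ω 0 = 0 := by
  have h := hω.2 0 ⟨le_rfl, zero_le_one⟩
  rw [c.isArc_J₁.left] at h
  have h0 : R t (-b₂ t) = 0 := by rw [R]; ring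
  rw [h0] at h
  exact pow_eq_zero_iff two_ne_zero |>.1 h

theorem IsBetaLift.apply_one {c : Contour t} (hω : c.IsBetaLift ω) : ω 1 = 0 := by
  have h := hω.2 1 ⟨zero_le_one, le_rfl⟩
  rw [c.isArc_J₁.right] at h
  have h0 : R t (-a₂ t) = 0 := by rw [R]; ring
  rw [h0] at h
  exact pow_eq_zero_iff two_ne_zero |>.1 h

theorem IsBetaLift.neg_sq {c : Contour t} (hω : c.IsBetaLift ω) {s : ℝ} (hs : s ∈ Icc (0 : ℝ) 1) :
    (-ω s) ^ 2 = R t (c.J (1 - s)) := by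
  rw [_root_.neg_sq, hω.2 s hs, J₁, R_neg]

/-- The lift (J₁, ω) starts over -b₂. Its image under `rot` takes the same time, starts over b₂ and
runs along J backwards to a₂. -/
theorem IsBetaLift.act_betaIntegral {c : Contour t} (hω : c.IsBetaLift ω) {s : ℝ}
    (hs : s ∈ Icc (0 : ℝ) 1) :
    act (c.betaIntegral ω s) (bPt t) = pt ⟨(c.J (1 - s), -ω s), hω.neg_sq hs⟩ := by
  have h := c.isArc_J₁.act_integral c.sq_ne_four hω.1 hω.2 (fun _ hs => c.R_J₁_ne_zero hs) hs
  rw [liftPath_eq (hω.2 s hs), liftPath_eq (hω.2 0 ⟨le_rfl, zero_le_one⟩)] at h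
  have h1 := congrArg rot h
  rw [rot_act] at h1
  simp only [rot, c.isArc_J₁.left, neg_neg, hω.apply_zero, neg_zero] at h1
  rw [bPt, betaIntegral, ← h1]
  simp [J₁]

theorem IsBetaLift.act_beta {c : Contour t} (hω : c.IsBetaLift ω) :
    act (c.betaIntegral ω 1) (bPt t) = c.sheet 0 (a₂ t) := by
  rw [hω.act_betaIntegral ⟨zero_le_one, le_rfl⟩, c.sheet_zero _ (c.sqrtR_sq _), pt_eq_pt]
  simp [c.J_zero, hω.apply_one, c.sqrtR_a]

theorem IsBetaLift.act_beta_add_alphaIntegral {c : Contour t} (hω : c.IsBetaLift ω) {s : ℝ}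
    (hs : s ∈ Icc (0 : ℝ) 1) :
    act (c.betaIntegral ω 1 + c.alphaIntegral s) (bPt t) = c.sheet 0 (c.I (1 - s)) := by
  rw [add_comm, act_add, hω.act_beta, c.act_alphaIntegral hs]

theorem IsBetaLift.reverse_continuousOn {c : Contour t} (hω : c.IsBetaLift ω) :
    ContinuousOn (fun s => ω (1 - s)) (Icc 0 1) :=
  hω.1.comp (by fun_prop) fun _ hs => one_sub_mem_Icc hs

theorem IsBetaLift.continuousOn_betaIntegralRev {c : Contour t} (hω : c.IsBetaLift ω) :
    ContinuousOn (c.betaIntegralRev ω) (Icc 0 1) :=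
  c.isArc_J₁.reverse.continuousOn_integral c.sq_ne_four hω.reverse_continuousOn
    (fun _ hs => hω.2 _ (one_sub_mem_Icc hs)) fun _ hs =>
      c.R_J₁_ne_zero ⟨by linarith [hs.2], by linarith [hs.1]⟩

/-- After J and I the route continues along J₁ from -a₂ to -b₂, on the lift that ω prescribes. The
sheet is unambiguous at -a₂, where w = 0. -/
theorem IsBetaLift.act_betaIntegralRev {c : Contour t} (hω : c.IsBetaLift ω) {s : ℝ}
    (hs : s ∈ Icc (0 : ℝ) 1) :
    act (c.betaIntegral ω 1 + c.alphaIntegral 1 + c.betaIntegralRev ω s) (bPt t) =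
      pt ⟨(c.J₁ (1 - s), ω (1 - s)), hω.2 _ (one_sub_mem_Icc hs)⟩ := by
  have hsq : ∀ s ∈ Icc (0 : ℝ) 1, ω (1 - s) ^ 2 = R t (c.J₁ (1 - s)) :=
    fun _ hs => hω.2 _ (one_sub_mem_Icc hs)
  have h := c.isArc_J₁.reverse.act_integral c.sq_ne_four hω.reverse_continuousOn hsq
    (fun _ hs => c.R_J₁_ne_zero ⟨by linarith [hs.2], by linarith [hs.1]⟩) hs
  rw [liftPath_eq (γ := fun s => c.J₁ (1 - s)) (y := fun s => ω (1 - s)) (hsq s hs),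
    liftPath_eq (γ := fun s => c.J₁ (1 - s)) (y := fun s => ω (1 - s))
      (hsq 0 ⟨le_rfl, zero_le_one⟩)] at h
  rw [add_comm, act_add, hω.act_beta_add_alphaIntegral ⟨zero_le_one, le_rfl⟩, h]
  congr 1
  rw [c.sheet_zero _ (c.sqrtR_sq _), pt_eq_pt]
  have h0 : c.sqrtR (-a₂ t) = 0 := by
    rw [c.sqrtR_sq (-a₂ t) |> fun h => pow_eq_zero_iff two_ne_zero |>.1 (h.trans (by rw [R]; ring))]
  simp [c.I_zero, J₁, c.J_zero, hω.apply_one, h0]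

theorem betaIntegralRev_one (ω : ℝ → ℂ) : c.betaIntegralRev ω 1 = -c.betaIntegral ω 1 := by
  unfold betaIntegralRev betaIntegral
  have h := intervalIntegral.integral_comp_sub_left (a := 0) (b := 1)
    (fun x => deriv c.J₁ x / ω x) (1 : ℝ)
  rw [sub_self, sub_zero] at h
  rw [← h, ← intervalIntegral.integral_neg]
  refine intervalIntegral.integral_congr fun x _ => ?_
  rw [deriv_comp_const_sub, neg_div]

/-- On the way back both the direction and the sign of w are reversed, so both halves of α
contribute equally. -/
theorem alphaPeriod_eq : c.alphaPeriod = 2 * c.alphaIntegral 1 := by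
  unfold alphaPeriod alphaIntegral
  have h := intervalIntegral.integral_comp_sub_left (a := 0) (b := 1)
    (fun s => deriv c.I s / (-c.sqrtR (c.I s))) (1 : ℝ)
  rw [sub_self, sub_zero] at h
  rw [← h, two_mul]
  congr 1
  refine intervalIntegral.integral_congr fun x _ => ?_
  rw [deriv_comp_const_sub, neg_div, div_neg]

theorem B_eq (ω : ℝ → ℂ) : c.B ω = c.alphaPeriod⁻¹ * (2 * c.betaIntegral ω 1) := by
  unfold B
  have h := c.betaIntegralRev_one ω
  unfold betaIntegralRev at h
  rw [← betaIntegral, two_mul]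
  congr 2
  rw [← neg_eq_iff_eq_neg] at h
  rw [← h, ← intervalIntegral.integral_neg]
  refine intervalIntegral.integral_congr fun x _ => ?_
  rw [div_neg]

/-- On the route from b₂ over a₂ and -a₂ to -b₂ the first and the last arc contribute opposite
amounts, since the lift over J₁ is run through once rotated and once reversed. Only the integral
over I remains. -/
theorem IsBetaLift.act_alpha {c : Contour t} (hω : c.IsBetaLift ω) :
    act (c.alphaIntegral 1) (bPt t) = rot (bPt t) := by
  have h := hω.act_betaIntegralRev ⟨zero_le_one, le_rfl⟩
  rw [c.betaIntegralRev_one, add_comm (c.betaIntegral ω 1), add_neg_cancel_right] at h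
  rw [h]
  simp [rot, bPt, J₁, c.J_one, hω.apply_zero]

theorem rot_rot (p : Surface t) : rot (rot p) = p := by
  cases p <;> simp [rot]

/-- The involution commutes with the flow and moves b₂ by the half period, so it is a translation
everywhere. -/
theorem IsBetaLift.rot_act {c : Contour t} (hω : c.IsBetaLift ω) (u : ℂ) :
    rot (act u (bPt t)) = act (u + c.alphaIntegral 1) (bPt t) := by
  rw [Surface.rot_act, ← hω.act_alpha, ← act_add]

theorem IsBetaLift.two_alpha_mem {c : Contour t} (hω : c.IsBetaLift ω) :
    2 * c.alphaIntegral 1 ∈ periods t := by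
  rw [mem_periods, two_mul, ← hω.rot_act, hω.act_alpha, rot_rot]

/-- The involution `conj` reverses time and fixes the ramification point over a₂, so this point is
reached at the times β and -β. -/
theorem IsBetaLift.two_beta_mem {c : Contour t} (hω : c.IsBetaLift ω) :
    2 * c.betaIntegral ω 1 ∈ periods t := by
  have h := congrArg conj hω.act_beta
  rw [conj_act_bPt, conj_sheet_zero] at h
  have h1 : c.sheet 1 (a₂ t) = c.sheet 0 (a₂ t) := by
    simp [sheet, c.sqrtR_a]
  rw [h1, ← hω.act_beta, act_bPt_eq_iff] at h
  have := neg_mem h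
  rwa [show -(-c.betaIntegral ω 1 - c.betaIntegral ω 1) = 2 * c.betaIntegral ω 1 by ring] at this

theorem IsBetaLift.alpha_notMem {c : Contour t} (hω : c.IsBetaLift ω) :
    c.alphaIntegral 1 ∉ periods t := by
  rw [mem_periods, hω.act_alpha]
  simp only [rot, bPt, pt_eq_pt, not_and]
  intro h
  exact absurd (self_eq_neg.1 h.symm) c.b_ne_zero

theorem IsBetaLift.alphaPeriod_ne_zero {c : Contour t} (hω : c.IsBetaLift ω) :
    c.alphaPeriod ≠ 0 := by
  rw [c.alphaPeriod_eq]
  refine mul_ne_zero two_ne_zero fun h => hω.alpha_notMem ?_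
  rw [h]; exact zero_mem _

end Contour

/-! ### Times over the spine and the integral off the spine -/

namespace Contour

variable {t : ℂ} (c : Contour t) {ω : ℝ → ℂ}

/-- A continuous family of integrals of `dz / w` from `b₂` to the points over the spine. -/
def spineLift (ω : ℝ → ℂ) : ℝ → ℂ :=
  concat (c.betaIntegral ω) (concat (fun s => c.betaIntegral ω 1 + c.alphaIntegral s)
    (fun s => c.betaIntegral ω 1 + c.alphaIntegral 1 + c.betaIntegralRev ω s) 1) 1

theorem alphaIntegral_zero : c.alphaIntegral 0 = 0 := intervalIntegral.integral_same

theorem betaIntegral_zero (ω : ℝ → ℂ) : c.betaIntegral ω 0 = 0 := intervalIntegral.integral_same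

theorem betaIntegralRev_zero (ω : ℝ → ℂ) : c.betaIntegralRev ω 0 = 0 :=
  intervalIntegral.integral_same

theorem spineLift_of_le_one {s : ℝ} (hs : s ≤ 1) : c.spineLift ω s = c.betaIntegral ω s :=
  concat_left hs

theorem spineLift_of_mem_Icc {s : ℝ} (hs : s ∈ Icc (1 : ℝ) 2) :
    c.spineLift ω s = c.betaIntegral ω 1 + c.alphaIntegral (s - 1) := by
  unfold spineLift
  rw [concat_right _ hs.1, concat_left (by linarith [hs.2])]
  rw [concat_left zero_le_one, c.alphaIntegral_zero, add_zero]

theorem spineLift_of_two_le {s : ℝ} (hs : 2 ≤ s) : c.spineLift ω s =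
    c.betaIntegral ω 1 + c.alphaIntegral 1 + c.betaIntegralRev ω (s - 2) := by
  unfold spineLift
  rw [concat_right _ (by linarith), concat_right _ (by linarith)]
  · ring_nf
  · rw [c.betaIntegralRev_zero, add_zero]
  · rw [concat_left zero_le_one, c.alphaIntegral_zero, add_zero]

theorem spineLift_zero : c.spineLift ω 0 = 0 := by
  rw [c.spineLift_of_le_one zero_le_one, c.betaIntegral_zero]

theorem spineLift_one : c.spineLift ω 1 = c.betaIntegral ω 1 := c.spineLift_of_le_one le_rfl

theorem spineLift_two : c.spineLift ω 2 = c.betaIntegral ω 1 + c.alphaIntegral 1 := by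
  rw [c.spineLift_of_mem_Icc ⟨by norm_num, le_rfl⟩]; norm_num

theorem spineLift_three : c.spineLift ω 3 = c.alphaIntegral 1 := by
  rw [c.spineLift_of_two_le (by norm_num), show (3 : ℝ) - 2 = 1 by norm_num,
    c.betaIntegralRev_one]
  ring

theorem IsBetaLift.continuousOn_spineLift {c : Contour t} (hω : c.IsBetaLift ω) :
    ContinuousOn (c.spineLift ω) (Icc 0 3) := by
  have h1 : ContinuousOn (c.spineLift ω) (Icc 0 1) :=
    hω.continuousOn_betaIntegral.congr fun s hs => c.spineLift_of_le_one hs.2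
  have h2 : ContinuousOn (c.spineLift ω) (Icc 1 2) := by
    refine ContinuousOn.congr (f := fun s => c.betaIntegral ω 1 + c.alphaIntegral (s - 1)) ?_
      fun s hs => c.spineLift_of_mem_Icc hs
    exact continuousOn_const.add (c.continuousOn_alphaIntegral.comp (by fun_prop) fun s hs =>
      ⟨by linarith [hs.1], by linarith [hs.2]⟩)
  have h3 : ContinuousOn (c.spineLift ω) (Icc 2 3) := by
    refine ContinuousOn.congr (f := fun s => c.betaIntegral ω 1 + c.alphaIntegral 1 +
      c.betaIntegralRev ω (s - 2)) ?_ fun s hs => c.spineLift_of_two_le hs.1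
    exact continuousOn_const.add (hω.continuousOn_betaIntegralRev.comp (by fun_prop) fun s hs =>
      ⟨by linarith [hs.1], by linarith [hs.2]⟩)
  have h4 := h1.union_of_isClosed h2 isClosed_Icc isClosed_Icc
  rw [Icc_union_Icc_eq_Icc (by norm_num) (by norm_num)] at h4
  have h5 := h4.union_of_isClosed h3 isClosed_Icc isClosed_Icc
  rwa [Icc_union_Icc_eq_Icc (by norm_num) (by norm_num)] at h5

theorem IsBetaLift.act_spineLift_eq_sheet {c : Contour t} (hω : c.IsBetaLift ω) {s : ℝ}
    (hs : s ∈ Icc (1 : ℝ) 2) : act (c.spineLift ω s) (bPt t) = c.sheet 0 (c.spine s) := by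
  rw [c.spineLift_of_mem_Icc hs, c.spine_of_mem_Icc hs,
    hω.act_beta_add_alphaIntegral ⟨by linarith [hs.1], by linarith [hs.2]⟩]
  ring_nf

theorem IsBetaLift.exists_act_spineLift {c : Contour t} (hω : c.IsBetaLift ω) {s : ℝ}
    (hs : s ∈ Icc (0 : ℝ) 3) :
    ∃ (y : ℂ) (h : y ^ 2 = R t (c.spine s)),
      act (c.spineLift ω s) (bPt t) = pt ⟨(c.spine s, y), h⟩ := by
  rcases le_total s 1 with h1 | h1
  · have hs' : s ∈ Icc (0 : ℝ) 1 := ⟨hs.1, h1⟩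
    refine ⟨-ω s, by rw [c.spine_of_le_one h1]; exact hω.neg_sq hs', ?_⟩
    rw [c.spineLift_of_le_one h1, hω.act_betaIntegral hs', pt_eq_pt]
    exact ⟨(c.spine_of_le_one h1).symm, rfl⟩
  · rcases le_total s 2 with h2 | h2
    · exact ⟨_, c.sqrtR_sq _, by rw [hω.act_spineLift_eq_sheet ⟨h1, h2⟩, c.sheet_zero]⟩
    · have hs' : s - 2 ∈ Icc (0 : ℝ) 1 := ⟨by linarith, by linarith [hs.2]⟩
      have e : c.spine s = c.J₁ (1 - (s - 2)) := by
        rw [c.spine_of_two_le h2]; ring_nf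
      refine ⟨ω (1 - (s - 2)), by rw [e]; exact hω.2 _ (one_sub_mem_Icc hs'), ?_⟩
      rw [c.spineLift_of_two_le h2, hω.act_betaIntegralRev hs', pt_eq_pt]
      exact ⟨e.symm, rfl⟩

theorem spine_zero : c.spine 0 = b₂ t := by
  rw [c.spine_of_le_one zero_le_one]; simp [c.J_one]

theorem spine_one : c.spine 1 = a₂ t := by
  rw [c.spine_of_le_one le_rfl]; simp [c.J_zero]

theorem spine_two : c.spine 2 = -a₂ t := by
  rw [c.spine_of_two_le le_rfl, show (3 : ℝ) - 2 = 1 by norm_num, c.isArc_J₁.right]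

theorem spine_three : c.spine 3 = -b₂ t := by
  rw [c.spine_of_two_le (by norm_num), sub_self, c.isArc_J₁.left]

/-- If 2v is a period, then v and -v lead to the same point, which is therefore fixed by `conj` and
has w = 0. On the spine this happens only over the four branch points. -/
theorem IsBetaLift.eq_of_two_spineLift_mem {c : Contour t} (hω : c.IsBetaLift ω) {s : ℝ}
    (hs : s ∈ Icc (0 : ℝ) 3) (h : 2 * c.spineLift ω s ∈ periods t) :
    s = 0 ∨ s = 1 ∨ s = 2 ∨ s = 3 := by
  obtain ⟨y, hy, hact⟩ := hω.exists_act_spineLift hs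
  have h1 : act (c.spineLift ω s) (bPt t) = act (-c.spineLift ω s) (bPt t) := by
    rw [act_bPt_eq_iff, sub_neg_eq_add, ← two_mul]; exact h
  rw [← conj_act_bPt, hact] at h1
  have h2 : y = -y := (pt_eq_pt.1 h1).2
  have hy0 : R t (c.spine s) = 0 := by rw [← hy, self_eq_neg.1 h2]; simp
  have hinj := c.isTameArc_spine.injOn
  rw [R_eq_zero_iff, ← c.spine_two, ← c.spine_one, ← c.spine_three, ← c.spine_zero] at hy0
  rcases hy0 with (h | h) | (h | h)
  · exact Or.inr (Or.inl (hinj hs ⟨by norm_num, by norm_num⟩ h))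
  · exact Or.inr (Or.inr (Or.inl (hinj hs ⟨by norm_num, by norm_num⟩ h)))
  · exact Or.inl (hinj hs ⟨by norm_num, by norm_num⟩ h)
  · exact Or.inr (Or.inr (Or.inr (hinj hs ⟨by norm_num, by norm_num⟩ h)))

/-- Primitives of `1 / R^{1/2}` are integrals of `dz / w` along the sheet `𝔖^{(0)}`. -/
theorem act_sub_eq_sheet {U : Set ℂ} (hU : IsOpen U) (hc : IsPreconnected U) (hUc : U ⊆ c.cutsᶜ)
    {g : ℂ → ℂ} (hg : ∀ z ∈ U, HasDerivAt g (c.sqrtR z)⁻¹ z) {z₀ z : ℂ} (hz₀ : z₀ ∈ U)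
    (hz : z ∈ U) : act (g z - g z₀) (c.sheet 0 z₀) = c.sheet 0 z := by
  refine hc.induction₂ (fun x y => act (g y - g x) (c.sheet 0 x) = c.sheet 0 y) (fun x hx => ?_)
    (fun x y w _ _ _ h1 h2 => ?_) (fun x y _ _ h => ?_) hz₀ hz
  · have hw : (c.sheet 0 x).w ≠ 0 := by
      rw [c.sheet_zero x (c.sqrtR_sq x)]; exact c.sqrtR_ne_zero (hUc hx)
    -- Locally the flow time G and the given primitive g have the same derivative 1/R^{1/2}, so
    -- their increments agree.
    obtain ⟨G, hG0, hG⟩ := exists_local_primitive c.sq_ne_four hw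
    have hzx : ∀ y, (c.sheet 0 y).z = y := fun y => by rw [c.sheet_zero y (c.sqrtR_sq y)]; rfl
    have hwx : ∀ y, (c.sheet 0 y).w = c.sqrtR y := fun y => by
      rw [c.sheet_zero y (c.sqrtR_sq y)]; rfl
    rw [hzx] at hG0
    have hev := (c.continuousAt_sheet_zero (hUc hx)).eventually hG
    simp only [hzx, hwx] at hev
    obtain ⟨r, hr, hball⟩ := Metric.mem_nhds_iff.1 (inter_mem hev (hU.mem_nhds hx))
    refine eventually_nhdsWithin_of_eventually_nhds ?_
    filter_upwards [Metric.ball_mem_nhds x hr] with y hy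
    have hconst := Metric.isOpen_ball.is_const_of_deriv_eq_zero
      (convex_ball x r).isPreconnected (f := G - g)
      (fun y hy => ((hball hy).1.2.2.sub (hg y (hball hy).2)).differentiableAt.differentiableWithinAt)
      (fun y hy => by
        rw [((hball hy).1.2.2.sub (hg y (hball hy).2)).deriv, sub_self]; rfl)
      hy (Metric.mem_ball_self hr)
    simp only [Pi.sub_apply, hG0, zero_sub] at hconst
    have e : G y = g y - g x := by linear_combination hconst
    rw [← e]
    exact (hball hy).1.2.1
  · rw [← h2, ← h1, ← act_add]
    congr 1
    ring
  · rw [← h, ← act_add, show g x - g y + (g y - g x) = 0 by ring, act_zero]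

/-- `h` is the integral of `dz / w` from `b₂` along the sheet `𝔖^{(0)}`, on the complement of the
spine. -/
structure IsAbelian (h : ℂ → ℂ) : Prop where
  hasDerivAt : ∀ z ∉ c.spineSet, HasDerivAt h (c.sqrtR z)⁻¹ z
  act_eq : ∀ z ∉ c.spineSet, act (h z) (bPt t) = c.sheet 0 z
  tendsto : Tendsto h (𝓝[c.spineSetᶜ] (b₂ t)) (𝓝 0)

variable {c} in
theorem IsAbelian.continuousOn {h : ℂ → ℂ} (hh : c.IsAbelian h) : ContinuousOn h c.spineSetᶜ :=
  fun z hz => (hh.hasDerivAt z hz).continuousAt.continuousWithinAt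

/-- If the points of the sheet `𝔖^{(0)}` are reached at the times `h`, then close to `z₀` these
times are close to those at which the points over `z₀` are reached. -/
theorem clustersAt_of_act_eq {h : ℂ → ℂ} {D : Set ℂ}
    (hh : ∀ z ∈ D, act (h z) (bPt t) = c.sheet 0 z) {z₀ y v : ℂ} {hy : y ^ 2 = R t z₀}
    (hv : act v (bPt t) = pt ⟨(z₀, y), hy⟩) :
    ClustersAt h D (signedTranslations (periods t)) z₀ v := by
  intro ε hε
  obtain ⟨V, hV, h1⟩ := exists_nhds_act c.sq_ne_four v hε
  obtain ⟨V', hV', h2⟩ := exists_nhds_act c.sq_ne_four (-v) hε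
  rw [hv] at hV
  rw [← conj_act_bPt, hv] at hV'
  filter_upwards [eventually_nhdsWithin_of_eventually_nhds (eventually_pt_mem_or hy hV hV'),
    self_mem_nhdsWithin] with z hz hzD
  have h3 := hz _ (c.sqrtR_sq z)
  rw [← c.sheet_zero, ← hh z hzD] at h3
  rcases h3 with h3 | h3
  · obtain ⟨l, hl, hd⟩ := h1 _ h3
    exact ⟨(1, l), ⟨Or.inl rfl, hl⟩, by simpa using hd⟩
  · obtain ⟨l, hl, hd⟩ := h2 _ h3
    exact ⟨(-1, l), ⟨Or.inr rfl, hl⟩, by simpa using hd⟩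

/-- Off the spine 1/R^{1/2} has a primitive, which is a flow time up to an additive constant. The
constant is fixed modulo periods by matching one point, and exactly by requiring the limit 0 at b₂.
Discreteness of the periods and connectedness of small slit discs about b₂ make this possible. -/
theorem exists_isAbelian : ∃ h, c.IsAbelian h := by
  obtain ⟨g, hg⟩ := c.exists_primitive_compl_spineSet
  have ht := c.sq_ne_four
  set D := c.spineSetᶜ with hD
  have hDc : D ⊆ c.cutsᶜ := compl_subset_compl.2 c.cuts_subset_spineSet
  obtain ⟨δ, hδ, hsep⟩ := periods_discrete ht
  obtain ⟨V, hV, hV'⟩ := exists_nhds_act ht 0 (t := t) (ε := δ / 2) (by positivity)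
  rw [act_zero] at hV
  have hV2 : V ∈ 𝓝 (conj (bPt t)) := by rwa [conj_bPt]
  obtain ⟨ρ₀, hρ₀, hball⟩ := c.isTameArc_spine.exists_ball_diff
  rw [c.spine_zero] at hball
  have hev := eventually_pt_mem_or (t := t) (z₀ := b₂ t) (w₀ := 0) (by simp [R]) hV hV2
  obtain ⟨ρ₁, hρ₁, h1⟩ := Metric.mem_nhds_iff.1 hev
  obtain ⟨hpre, z₁, hz₁⟩ := hball (min ρ₀ ρ₁) (lt_min hρ₀ hρ₁) (min_le_left _ _)
  set W := Metric.ball (b₂ t) (min ρ₀ ρ₁) \ c.spineSet with hW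
  have hsheet : ∀ z ∈ W, c.sheet 0 z ∈ V := by
    intro z hz
    have := h1 (Metric.ball_subset_ball (min_le_right _ _) hz.1) _ (c.sqrtR_sq z)
    rw [← c.sheet_zero] at this
    exact this.elim id id
  -- Openness of the orbit map reaches some point z₂ of the sheet close to b₂. The primitive then
  -- leads from z₂ to z₁.
  obtain ⟨u₁, hu₁⟩ : ∃ u₁, act u₁ (bPt t) = c.sheet 0 z₁ := by
    have h2 := (isFlowAt_act (bPt t) 0).image_mem_nhds ht univ_mem
    rw [act_zero] at h2
    have h3 := eventually_pt_mem_or (t := t) (z₀ := b₂ t) (w₀ := 0) (by simp [R]) h2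
      (by rwa [show conj (pt ⟨(b₂ t, 0), _⟩ : Surface t) = bPt t from conj_bPt])
    obtain ⟨ρ₂, hρ₂, h4⟩ := Metric.mem_nhds_iff.1 h3
    obtain ⟨-, z₂, hz₂⟩ := hball (min ρ₀ ρ₂) (lt_min hρ₀ hρ₂) (min_le_left _ _)
    have h5 := h4 (Metric.ball_subset_ball (min_le_right _ _) hz₂.1) _ (c.sqrtR_sq z₂)
    rw [← c.sheet_zero] at h5
    obtain ⟨u, -, hu⟩ := h5.elim id id
    refine ⟨g z₁ - g z₂ + u, ?_⟩
    rw [act_add, show act u (bPt t) = _ from hu, c.act_sub_eq_sheet c.isOpen_compl_spineSet c.isPreconnected_compl_spineSet hDc hg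
      hz₂.2 hz₁.2]
  obtain ⟨l, hl, hd⟩ := hV' u₁ (hu₁ ▸ hsheet z₁ hz₁)
  rw [zero_add] at hd
  set h : ℂ → ℂ := fun z => g z - g z₁ + (u₁ - l) with hh
  have hact : ∀ z ∉ c.spineSet, act (h z) (bPt t) = c.sheet 0 z := by
    intro z hz
    rw [hh, act_add, act_bPt_eq_iff.2 (show u₁ - l - u₁ ∈ periods t by
      rw [sub_sub_cancel_left]; exact neg_mem hl), hu₁,
      c.act_sub_eq_sheet c.isOpen_compl_spineSet c.isPreconnected_compl_spineSet hDc hg hz₁.2 hz]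
  have hder : ∀ z ∉ c.spineSet, HasDerivAt h (c.sqrtR z)⁻¹ z := fun z hz =>
    ((hg z hz).sub_const _).add_const _
  refine ⟨h, hder, hact, ?_⟩
  -- On the connected slit disc W the function stays close to a single period, and at z₁ this is 0
  -- because of the subtraction of l.
  have hWsmall : ∀ z ∈ W, dist (h z) 0 < δ / 2 := by
    intro z hz
    refine dist_lt_of_isPreconnected hpre (S := periods t)
      (fun z hz => (hder z hz.2).continuousAt.continuousWithinAt) ?_ ?_ hz₁ hz (zero_mem _) ?_
    · intro x hx y hy hxy
      rw [dist_eq_norm] at hxy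
      exact sub_eq_zero.1 (hsep _ (sub_mem hx hy) (by linarith))
    · intro z hz
      obtain ⟨l, hl, hd⟩ := hV' (h z) (by rw [hact z hz.2]; exact hsheet z hz)
      rw [zero_add] at hd
      exact ⟨l, hl, hd⟩
    · simp only [hh, sub_self, zero_add]
      rwa [dist_eq_norm, sub_zero, ← dist_eq_norm]
  rw [Metric.tendsto_nhds]
  intro ε hε
  obtain ⟨V₂, hV₂, h2⟩ := exists_nhds_act ht 0 (t := t) (ε := min ε (δ / 2)) (by positivity)
  rw [act_zero] at hV₂
  have hev2 := eventually_pt_mem_or (t := t) (z₀ := b₂ t) (w₀ := 0) (by simp [R]) hV₂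
    (by rwa [show conj (pt ⟨(b₂ t, 0), _⟩ : Surface t) = bPt t from conj_bPt])
  filter_upwards [eventually_nhdsWithin_of_eventually_nhds hev2,
    eventually_nhdsWithin_of_eventually_nhds (Metric.ball_mem_nhds (b₂ t) (lt_min hρ₀ hρ₁)),
    self_mem_nhdsWithin] with z h3 h4 h5
  have h6 := h3 _ (c.sqrtR_sq z)
  rw [← c.sheet_zero, ← hact z h5] at h6
  obtain ⟨l, hl, hd⟩ := h2 _ (h6.elim id id)
  rw [zero_add] at hd
  have h7 := hWsmall z ⟨h4, h5⟩
  have hl0 : l = 0 := hsep l hl (by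
    have := dist_triangle_left l 0 (h z)
    rw [dist_zero_right] at this
    linarith [hd.trans_le (min_le_right ε (δ / 2))])
  rw [hl0] at hd
  exact hd.trans_le (min_le_left _ _)

end Contour

/-! ### Fibers over sets in the plane -/

namespace Surface

variable {t : ℂ}

theorem isOpen_setOf_inv_notMem {K : Set ℂ} (hK : IsCompact K) :
    IsOpen {u : ℂ | u = 0 ∨ u⁻¹ ∉ K} := by
  rw [isOpen_iff_mem_nhds]
  intro u hu
  by_cases h0 : u = 0
  · rw [h0]
    have h1 : ∀ᶠ x : ℂ in 𝓝[≠] 0, x⁻¹ ∈ Kᶜ := by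
      have := tendsto_inv₀_nhdsNE_zero (α := ℂ)
      rw [Metric.cobounded_eq_cocompact] at this
      exact this.eventually hK.compl_mem_cocompact
    filter_upwards [eventually_nhdsWithin_iff.1 h1] with x hx
    by_cases hx0 : x = 0
    · exact Or.inl hx0
    · exact Or.inr (hx hx0)
  · have h1 : u⁻¹ ∈ Kᶜ := hu.resolve_left h0
    filter_upwards [(continuousAt_inv₀ h0).eventually (hK.isClosed.isOpen_compl.mem_nhds h1)]
      with x hx
    exact Or.inr hx

/-- In the chart at infinity the complement is open at u = 0 because a compact set stays away from
∞. -/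
theorem isClosed_fiber {K : Set ℂ} (hK : IsCompact K) : IsClosed (fiber K : Set (Surface t)) := by
  rw [← isOpen_compl_iff, isOpen_iff]
  constructor
  · have : pt ⁻¹' (fiber K : Set (Surface t))ᶜ = {p : AffineCurve t | p.1.1 ∈ Kᶜ} := by
      ext p
      constructor
      · exact fun h hp => h ⟨p, rfl, hp⟩
      · rintro h ⟨q, hq, hqK⟩
        rw [← pt_injective hq] at hqK
        exact h hqK
    rw [this]
    exact hK.isClosed.isOpen_compl.preimage (continuous_fst.comp continuous_subtype_val)
  · have : ofInftyCurve ⁻¹' (fiber K : Set (Surface t))ᶜ =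
        {q : InftyCurve t | q.1.1 = 0 ∨ q.1.1⁻¹ ∉ K} := by
      ext q
      by_cases h0 : q.1.1 = 0
      · have hk : ∃ k, ofInftyCurve q = infty k := by
          rcases ofInftyCurve_of_eq h0 with ⟨-, h⟩ | ⟨-, h⟩
          exacts [⟨_, h⟩, ⟨_, h⟩]
        obtain ⟨k, hk⟩ := hk
        refine ⟨fun _ => Or.inl h0, fun _ => ?_⟩
        rintro ⟨p, hp, -⟩
        rw [hk] at hp
        cases hp
      · constructor
        · intro h
          refine Or.inr fun hK => h ?_
          rw [ofInftyCurve_of_ne h0]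
          exact ⟨_, rfl, by simpa using hK⟩
        · rintro h ⟨p, hp, hpK⟩
          rw [ofInftyCurve_of_ne h0] at hp
          rw [← pt_injective hp] at hpK
          exact h.resolve_left h0 (by simpa using hpK)
    rw [this]
    exact (isOpen_setOf_inv_notMem hK).preimage (continuous_fst.comp continuous_subtype_val)

/-- A small flow time moves p to a point with w ≠ 0, where a local root of R lifts approximating
points of D to the surface. -/
theorem dense_fiber (ht : t ^ 2 ≠ 4) {D : Set ℂ} (hD : Dense D) :
    Dense (fiber D : Set (Surface t)) := by
  intro p
  rw [mem_closure_iff_nhds]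
  intro V hV
  obtain ⟨V', hV'V, hV'o, hpV'⟩ := mem_nhds_iff.1 hV
  have h1 : ∀ᶠ u in 𝓝[≠] (0 : ℂ), act u p ∈ V' := by
    refine eventually_nhdsWithin_of_eventually_nhds ((continuous_act p).continuousAt.eventually ?_)
    simp only [act_zero]; exact hV'o.mem_nhds hpV'
  obtain ⟨u, hu, huw⟩ := (h1.and ((isFlowAt_act p 0).eventually_w_ne_zero ht)).exists
  obtain ⟨⟨⟨z, w⟩, hq⟩, hpt⟩ := exists_eq_pt_of_w_ne_zero huw
  rw [hpt] at hu huw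
  change w ≠ 0 at huw
  simp only at hq
  have hR : R t z ≠ 0 := by rw [← hq]; exact pow_ne_zero 2 huw
  -- A root of R through (z, w): the quotient R(x)/R(z) is near 1, where the principal root is
  -- continuous.
  set f : ℂ → ℂ := fun x => w * (R t x / R t z) ^ (1 / 2 : ℂ) with hf
  have hfsq : ∀ x, f x ^ 2 = R t x := by
    intro x
    simp only [hf]
    rw [mul_pow, ← Complex.cpow_nat_mul, hq]
    norm_num
    field_simp
  have hfz : f z = w := by simp [hf, div_self hR]
  have hfc : ContinuousAt f z := by
    refine continuousAt_const.mul (ContinuousAt.cpow ?_ continuousAt_const ?_)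
    · exact (continuous_R t).continuousAt.div_const _
    · rw [div_self hR]; exact Complex.one_mem_slitPlane
  have hc : ContinuousAt (fun x => (pt ⟨(x, f x), hfsq x⟩ : Surface t)) z :=
    continuousAt_of_eventually_eq_subtype continuous_pt (f := fun x => (x, f x))
      (continuousAt_id.prodMk hfc) (Eventually.of_forall fun x => ⟨hfsq x, rfl⟩)
  have hmem : (pt ⟨(z, f z), hfsq z⟩ : Surface t) ∈ V' := by
    have : (pt ⟨(z, f z), hfsq z⟩ : Surface t) = pt ⟨(z, w), hq⟩ := by rw [pt_eq_pt]; exact ⟨rfl, hfz⟩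
    rw [this]; exact hu
  obtain ⟨x, hxV, hxD⟩ := mem_closure_iff_nhds.1 (hD z) _ (hc.preimage_mem_nhds (hV'o.mem_nhds hmem))
  exact ⟨_, hV'V hxV, ⟨_, rfl, hxD⟩⟩

end Surface

/-- Different pairs can have the same value at v only with opposite signs, and then 2v lies in Λ.
Hence saturation has to be checked only at branch points. -/
theorem eq_or_of_signedTranslation_eq {Λ : AddSubgroup ℂ} {x y : ℂ × ℂ} {v : ℂ}
    (hx : x ∈ signedTranslations Λ) (hy : y ∈ signedTranslations Λ)
    (e : x.1 * v + x.2 = y.1 * v + y.2) :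
    x = y ∨ x.1 = -y.1 ∧ x.2 = y.2 + 2 * y.1 * v ∧ 2 * v ∈ Λ := by
  obtain ⟨x1, x2⟩ := x
  obtain ⟨y1, y2⟩ := y
  obtain ⟨hx1, hx2⟩ := hx
  obtain ⟨hy1, hy2⟩ := hy
  simp only [Prod.mk.injEq] at *
  rcases hx1 with rfl | rfl <;> rcases hy1 with rfl | rfl
  · exact Or.inl ⟨rfl, by linear_combination e⟩
  · refine Or.inr ⟨by ring, by linear_combination e, ?_⟩
    rw [show 2 * v = y2 - x2 by linear_combination e]
    exact sub_mem hy2 hx2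
  · refine Or.inr ⟨by ring, by linear_combination e, ?_⟩
    rw [show 2 * v = x2 - y2 by linear_combination -e]
    exact sub_mem hx2 hy2
  · exact Or.inl ⟨rfl, by linear_combination e⟩

theorem signedTranslations_mono {M Λ : AddSubgroup ℂ} (h : M ≤ Λ) :
    signedTranslations M ⊆ signedTranslations Λ := fun _ hx => ⟨hx.1, h hx.2⟩

/-! ### Limit values of the integral along the spine -/

namespace Contour

variable {t : ℂ} (c : Contour t) {ω : ℝ → ℂ}

/-- The lattice generated by the two periods. -/
def periodLattice (ω : ℝ → ℂ) : AddSubgroup ℂ :=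
  AddSubgroup.closure {2 * c.alphaIntegral 1, 2 * c.betaIntegral ω 1}

variable {c} {h : ℂ → ℂ}

theorem IsBetaLift.periodLattice_le (hω : c.IsBetaLift ω) : c.periodLattice ω ≤ periods t := by
  rw [periodLattice, AddSubgroup.closure_le]
  rintro x (rfl | rfl)
  · exact hω.two_alpha_mem
  · exact hω.two_beta_mem

/-- At the branch points b₂, a₂, -a₂, -b₂ the value 2v is 0, 2β, 2β + 2α and 2α respectively, where
α and β are the half periods. -/
theorem IsBetaLift.two_spineLift_mem (hω : c.IsBetaLift ω) {s : ℝ} (hs : s ∈ Icc (0 : ℝ) 3)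
    (h : 2 * c.spineLift ω s ∈ periods t) : 2 * c.spineLift ω s ∈ c.periodLattice ω := by
  have ha : 2 * c.alphaIntegral 1 ∈ c.periodLattice ω := AddSubgroup.subset_closure (Or.inl rfl)
  have hb : 2 * c.betaIntegral ω 1 ∈ c.periodLattice ω := AddSubgroup.subset_closure (Or.inr rfl)
  rcases hω.eq_of_two_spineLift_mem hs h with rfl | rfl | rfl | rfl
  · rw [c.spineLift_zero, mul_zero]; exact zero_mem _
  · rw [c.spineLift_one]; exact hb
  · rw [c.spineLift_two, mul_add]; exact add_mem hb ha
  · rw [c.spineLift_three]; exact ha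

theorem IsAbelian.clustersAt_spine (hh : c.IsAbelian h) (hω : c.IsBetaLift ω) {s : ℝ}
    (hs : s ∈ Icc (0 : ℝ) 3) : ClustersAt h c.spineSetᶜ (signedTranslations (periods t))
      (c.spine s) (c.spineLift ω s) := by
  obtain ⟨y, hy, hact⟩ := hω.exists_act_spineLift hs
  exact c.clustersAt_of_act_eq (fun z hz => hh.act_eq z hz) hact

theorem IsAbelian.clustersAt_zero (hh : c.IsAbelian h) {F : Set (ℂ × ℂ)} {e : ℂ}
    (hF : (e, 0) ∈ F) : ClustersAt h c.spineSetᶜ F (c.spine 0) (c.spineLift ω 0) := by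
  rw [c.spine_zero, c.spineLift_zero]
  intro ε hε
  filter_upwards [(Metric.tendsto_nhds.1 hh.tendsto) ε hε] with z hz
  exact ⟨_, hF, by simpa using hz⟩

theorem IsAbelian.propagate (hh : c.IsAbelian h) (hω : c.IsBetaLift ω) {F : Set (ℂ × ℂ)}
    (hF : F ⊆ signedTranslations (periods t)) {s₀ s₁ : ℝ} (hs₀ : 0 ≤ s₀) (hs₁ : s₁ ≤ 3)
    (hsat : ∀ s ∈ Ico s₀ s₁, ∀ x ∈ signedTranslations (periods t), ∀ y ∈ F,
      x.1 * c.spineLift ω s + x.2 = y.1 * c.spineLift ω s + y.2 → x ∈ F)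
    (hcl : ClustersAt h c.spineSetᶜ F (c.spine s₀) (c.spineLift ω s₀)) :
    ∀ s ∈ Icc s₀ s₁, ClustersAt h c.spineSetᶜ F (c.spine s) (c.spineLift ω s) :=
  ClustersAt.propagate c.isTameArc_spine hh.continuousOn hω.continuousOn_spineLift
    (periods_discrete c.sq_ne_four) hF (fun _ hs => hh.clustersAt_spine hω hs) hs₀ hs₁ hsat hcl

/-- The limit values along `J`. -/
theorem IsAbelian.clustersAt_J (hh : c.IsAbelian h) (hω : c.IsBetaLift ω) {s : ℝ}
    (hs : s ∈ Icc (0 : ℝ) 1) : ClustersAt h c.spineSetᶜ (signedTranslations ⊥)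
      (c.spine s) (c.spineLift ω s) := by
  refine hh.propagate hω (signedTranslations_mono bot_le) le_rfl (by norm_num) ?_
    (hh.clustersAt_zero (e := 1) ⟨Or.inl rfl, rfl⟩) s hs
  intro s hs x hx y hy e
  rcases eq_or_of_signedTranslation_eq hx (signedTranslations_mono bot_le hy) e with
    rfl | ⟨h1, h2, h3⟩
  · exact hy
  · have hs3 : s ∈ Icc (0 : ℝ) 3 := ⟨hs.1, by linarith [hs.2]⟩
    -- Before a₂ the only branch point is b₂, where v = 0, so a change of sign adds nothing to the
    -- translation.
    have hs0 : s = 0 := by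
      rcases hω.eq_of_two_spineLift_mem hs3 h3 with h | h | h | h <;> linarith [hs.1, hs.2]
    rw [hs0, c.spineLift_zero, mul_zero, add_zero] at h2
    exact ⟨hx.1, by rw [h2]; exact hy.2⟩

/-- The limit values along `I`. -/
theorem IsAbelian.clustersAt_I (hh : c.IsAbelian h) (hω : c.IsBetaLift ω) {s : ℝ}
    (hs : s ∈ Icc (1 : ℝ) 2) : ClustersAt h c.spineSetᶜ
      {(1, 0), (1, -(2 * c.betaIntegral ω 1)), (-1, 0), (-1, 2 * c.betaIntegral ω 1)}
      (c.spine s) (c.spineLift ω s) := by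
  have hF : ({(1, 0), (1, -(2 * c.betaIntegral ω 1)), (-1, 0), (-1, 2 * c.betaIntegral ω 1)} :
      Set (ℂ × ℂ)) ⊆ signedTranslations (periods t) := by
    rintro x (rfl | rfl | rfl | rfl)
    · exact ⟨Or.inl rfl, zero_mem _⟩
    · exact ⟨Or.inl rfl, neg_mem hω.two_beta_mem⟩
    · exact ⟨Or.inr rfl, zero_mem _⟩
    · exact ⟨Or.inr rfl, hω.two_beta_mem⟩
  refine hh.propagate hω hF zero_le_one (by norm_num) ?_ ?_ s hs
  · intro s hs x hx y hy e
    rcases eq_or_of_signedTranslation_eq hx (hF hy) e with rfl | ⟨h1, h2, h3⟩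
    · exact hy
    · have hs3 : s ∈ Icc (0 : ℝ) 3 := ⟨by linarith [hs.1], by linarith [hs.2]⟩
      -- The only branch point before -a₂ is a₂, where v = β. The change of sign (e, l) ↦ (-e, l +
      -- 2eβ) permutes the four pairs.
      have hs1 : s = 1 := by
        rcases hω.eq_of_two_spineLift_mem hs3 h3 with h | h | h | h <;> linarith [hs.1, hs.2]
      rw [hs1, c.spineLift_one] at h2
      obtain ⟨x1, x2⟩ := x
      simp only at h1 h2
      subst h1 h2
      rcases hy with rfl | rfl | rfl | rfl
      · refine Or.inr (Or.inr (Or.inr ?_)); simp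
      · refine Or.inr (Or.inr (Or.inl ?_)); simp
      · refine Or.inr (Or.inl ?_); simp
      · refine Or.inl ?_; simp
  · refine (hh.clustersAt_J hω ⟨zero_le_one, le_rfl⟩).mono ?_
    rintro ⟨x1, x2⟩ ⟨h1, h2⟩
    have h2' : x2 = 0 := h2
    subst h2'
    rcases h1 with h1 | h1 <;> simp only at h1 <;> subst h1
    · exact Or.inl rfl
    · exact Or.inr (Or.inr (Or.inl rfl))

/-- The limit values along the spine, modulo the lattice of periods. -/
theorem IsAbelian.clustersAt_periodLattice (hh : c.IsAbelian h) (hω : c.IsBetaLift ω) {s : ℝ}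
    (hs : s ∈ Icc (0 : ℝ) 3) : ClustersAt h c.spineSetᶜ (signedTranslations (c.periodLattice ω))
      (c.spine s) (c.spineLift ω s) := by
  have hF := signedTranslations_mono hω.periodLattice_le
  refine hh.propagate hω hF le_rfl le_rfl ?_
    (hh.clustersAt_zero (e := 1) ⟨Or.inl rfl, zero_mem _⟩) s hs
  intro s hs x hx y hy e
  rcases eq_or_of_signedTranslation_eq hx (hF hy) e with rfl | ⟨h1, h2, h3⟩
  · exact hy
  · have h4 := hω.two_spineLift_mem (Ico_subset_Icc_self hs) h3
    refine ⟨hx.1, ?_⟩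
    rw [h2]
    refine add_mem hy.2 ?_
    rcases hy.1 with h5 | h5 <;> rw [h5]
    · simpa using h4
    · simpa using neg_mem h4

theorem mem_fiber_compl {p : Surface t} (hp : p ∈ fiber (c.spineSetᶜ)) :
    ∃ z ∉ c.spineSet, p = c.sheet 0 z ∨ p = c.sheet 1 z := by
  obtain ⟨⟨⟨z, w⟩, hw⟩, rfl, hz⟩ := hp
  refine ⟨z, hz, ?_⟩
  have hsq : w ^ 2 = c.sqrtR z ^ 2 := by rw [c.sqrtR_sq]; exact hw
  rcases sq_eq_sq_iff_eq_or_eq_neg.1 hsq with rfl | rfl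
  · exact Or.inl (c.sheet_zero z hw).symm
  · exact Or.inr (c.sheet_one z hw).symm

theorem IsAbelian.act_neg_eq (hh : c.IsAbelian h) {z : ℂ} (hz : z ∉ c.spineSet) :
    act (-h z) (bPt t) = c.sheet 1 z := by
  rw [← conj_act_bPt, hh.act_eq z hz, conj_sheet_zero]

/-- The flow acts transitively. -/
theorem IsAbelian.exists_act_eq (hh : c.IsAbelian h) (p : Surface t) : ∃ u, act u (bPt t) = p := by
  have h1 := (isFlowAt_act p 0).image_mem_nhds c.sq_ne_four univ_mem
  rw [act_zero] at h1
  obtain ⟨q, ⟨u, -, hu⟩, hq⟩ := mem_closure_iff_nhds.1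
    (dense_fiber c.sq_ne_four c.dense_compl_spineSet p) _ h1
  obtain ⟨z, hz, hqz⟩ := mem_fiber_compl hq
  obtain ⟨v, hv⟩ : ∃ v, act v (bPt t) = q := by
    rcases hqz with rfl | rfl
    · exact ⟨h z, hh.act_eq z hz⟩
    · exact ⟨-h z, hh.act_neg_eq hz⟩
  refine ⟨-u + v, ?_⟩
  rw [act_add, hv, ← show act u p = q from hu, act_neg_act]

end Contour

theorem isPreconnected_ball_diff_center (x : ℂ) (r : ℝ) :
    IsPreconnected (Metric.ball x r \ {x}) := by
  have h1 : Metric.ball x r \ {x} = (fun q : ℝ × ℝ => circleMap x q.1 q.2) '' (Ioo 0 r ×ˢ univ) := by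
    ext z
    constructor
    · rintro ⟨hz, hzx⟩
      have hpos : 0 < dist z x := dist_pos.2 hzx
      obtain ⟨θ, -, hθ⟩ := exists_eq_circleMap (c := x) (z := z) (r := dist z x) rfl hpos 0
      exact ⟨(dist z x, θ), ⟨⟨hpos, hz⟩, mem_univ _⟩, hθ⟩
    · rintro ⟨⟨ρ, θ⟩, ⟨hρ, -⟩, rfl⟩
      have hd : dist (circleMap x ρ θ) x = ρ := circleMap_mem_sphere x hρ.1.le θ
      refine ⟨by rw [Metric.mem_ball, hd]; exact hρ.2, fun h => ?_⟩
      have h' : circleMap x ρ θ = x := h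
      rw [h', dist_self] at hd
      exact hρ.1.ne hd
  rw [h1]
  refine (isPreconnected_Ioo.prod isPreconnected_univ).image _ (Continuous.continuousOn ?_)
  unfold circleMap
  fun_prop

/-! ### Defects and the lattice of periods -/

namespace Contour

variable {t : ℂ} (c : Contour t)

/-- `l` is the difference of `u` and of the integral of `dz / w`, taken within one sheet, from
`b₂` to the point that is reached at time `u`. -/
def IsDefect (h : ℂ → ℂ) (u l : ℂ) : Prop :=
  ∃ z ∉ c.spineSet, act u (bPt t) = c.sheet 0 z ∧ l = u - h z ∨
    act u (bPt t) = c.sheet 1 z ∧ l = u + h z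

variable {c} {h : ℂ → ℂ} {ω : ℝ → ℂ}

theorem sheet_zero_ne_sheet_one {z z' : ℂ} (hz : z ∉ c.cuts) : c.sheet 0 z ≠ c.sheet 1 z' := by
  intro e
  rw [c.sheet_zero z (c.sqrtR_sq z), c.sheet_one z' (by rw [neg_sq]; exact c.sqrtR_sq z'),
    pt_eq_pt] at e
  obtain ⟨rfl, e⟩ := e
  exact c.sqrtR_ne_zero hz (self_eq_neg.1 e)

theorem notMem_cuts_of_notMem_spineSet {z : ℂ} (hz : z ∉ c.spineSet) : z ∉ c.cuts :=
  fun h => hz (c.cuts_subset_spineSet h)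

theorem IsAbelian.isDefect_zero (hh : c.IsAbelian h) {z : ℂ} (hz : z ∉ c.spineSet) {l : ℂ}
    (hl : l ∈ periods t) : c.IsDefect h (h z + l) l := by
  refine ⟨z, hz, Or.inl ⟨?_, by ring⟩⟩
  rw [← hh.act_eq z hz, act_bPt_eq_iff]
  simpa using hl

theorem IsAbelian.mem_periods_of_isDefect (hh : c.IsAbelian h) {u l : ℂ} (hl : c.IsDefect h u l) :
    l ∈ periods t := by
  obtain ⟨z, hz, ⟨h1, rfl⟩ | ⟨h1, rfl⟩⟩ := hl
  · rw [← hh.act_eq z hz, act_bPt_eq_iff] at h1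
    exact h1
  · rw [← hh.act_neg_eq hz, act_bPt_eq_iff] at h1
    rwa [sub_neg_eq_add] at h1

theorem exists_isDefect {u : ℂ} (hu : act u (bPt t) ∈ fiber c.spineSetᶜ) (h : ℂ → ℂ) :
    ∃ l, c.IsDefect h u l := by
  obtain ⟨z, hz, h1 | h1⟩ := mem_fiber_compl hu
  · exact ⟨_, z, hz, Or.inl ⟨h1, rfl⟩⟩
  · exact ⟨_, z, hz, Or.inr ⟨h1, rfl⟩⟩

/-- Points off the spine are dense on the surface and the orbit map is open, so times with a defect
accumulate everywhere. This is enough to compare local constants. -/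
theorem frequently_isDefect (c : Contour t) (h : ℂ → ℂ) (u₀ : ℂ) :
    ∃ᶠ u in 𝓝 u₀, ∃ l, c.IsDefect h u l := by
  rw [frequently_iff]
  intro U hU
  have h1 := (isFlowAt_act (bPt t) u₀).image_mem_nhds c.sq_ne_four hU
  obtain ⟨q, ⟨u, hu, rfl⟩, hq⟩ := mem_closure_iff_nhds.1
    (dense_fiber c.sq_ne_four c.dense_compl_spineSet (act u₀ (bPt t))) _ h1
  exact ⟨u, hu, exists_isDefect hq h⟩

/-- The defects near `u₀` are all congruent modulo `M` if the limit values of `h` are. -/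
theorem IsAbelian.exists_eventually_isDefect (hh : c.IsAbelian h) {M : AddSubgroup ℂ} {z₀ v y : ℂ}
    (hcl : ClustersAt h c.spineSetᶜ (signedTranslations M) z₀ v) (hM : M ≤ periods t)
    {hy : y ^ 2 = R t z₀} (hv : act v (bPt t) = pt ⟨(z₀, y), hy⟩)
    (h2v : 2 * v ∈ periods t → 2 * v ∈ M) {u₀ : ℂ} {q : AffineCurve t}
    (hu₀ : act u₀ (bPt t) = pt q) (hq : q.1.1 = z₀) :
    ∃ l₀, ∀ᶠ u in 𝓝 u₀, ∀ l, c.IsDefect h u l → l - l₀ ∈ M := by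
  obtain ⟨⟨z, w⟩, hw⟩ := q
  simp only at hq hw
  subst hq
  -- The point reached at u₀ lies over z₀, so it is the point reached at v or its conjugate. Hence
  -- u₀ is ±v up to a period.
  obtain ⟨σ, hσ, l₀, hl₀, hul⟩ : ∃ σ : ℂ, (σ = 1 ∨ σ = -1) ∧ ∃ l₀ ∈ periods t, u₀ = σ * v + l₀ := by
    rcases sq_eq_sq_iff_eq_or_eq_neg.1 (hw.trans hy.symm) with rfl | rfl
    · exact ⟨1, Or.inl rfl, u₀ - v, act_bPt_eq_iff.1 (hu₀.trans hv.symm), by ring⟩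
    · refine ⟨-1, Or.inr rfl, u₀ + v, ?_, by ring⟩
      have : act u₀ (bPt t) = act (-v) (bPt t) := by
        rw [hu₀, ← conj_act_bPt, hv]; rfl
      rw [act_bPt_eq_iff] at this
      rwa [sub_neg_eq_add] at this
  have hdisc := periods_discrete c.sq_ne_four
  obtain ⟨δ₀, hδ₀, s₀⟩ := exists_separation hdisc 0
  obtain ⟨δ₁, hδ₁, s₁⟩ := exists_separation hdisc (2 * v)
  obtain ⟨δ₂, hδ₂, s₂⟩ := exists_separation hdisc (-(2 * v))
  set δ := min δ₀ (min δ₁ δ₂) with hδ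
  have hδpos : 0 < δ := lt_min hδ₀ (lt_min hδ₁ hδ₂)
  -- Up to a small error and an element of M, the quantity l - l₀ equals 0, 2v or -2v. Being a
  -- period it equals this value exactly, and `h2v` puts 2v into M if it is a period.
  have hkey : ∀ x : ℂ, (x = 0 ∨ x = 2 * v ∨ x = -(2 * v)) → ∀ l ∈ periods t, ‖x - l‖ < δ →
      l ∈ M := by
    intro x hx l hl hlt
    have hl' := neg_mem hl
    rw [sub_eq_add_neg] at hlt
    rcases hx with rfl | rfl | rfl
    · have := s₀ _ hl' (hlt.trans_le (min_le_left _ _))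
      rw [zero_add, neg_eq_zero] at this
      rw [this]; exact zero_mem _
    · have := s₁ _ hl' (hlt.trans_le ((min_le_right _ _).trans (min_le_left _ _)))
      rw [← sub_eq_add_neg, sub_eq_zero] at this
      rw [← this] at hl ⊢
      exact h2v hl
    · have := s₂ _ hl' (hlt.trans_le ((min_le_right _ _).trans (min_le_right _ _)))
      rw [← sub_eq_add_neg, sub_eq_zero] at this
      rw [← this] at hl ⊢
      exact neg_mem (h2v (by simpa using neg_mem hl))
  have hz : Tendsto (fun u => (act u (bPt t)).z) (𝓝 u₀) (𝓝 z) := by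
    have h1 : ContinuousAt (Surface.z : Surface t → ℂ) (act u₀ (bPt t)) := by
      rw [hu₀]; exact continuousAt_z
    have h2 := h1.tendsto.comp ((continuous_act (bPt t)).tendsto u₀)
    rw [hu₀] at h2
    exact h2
  refine ⟨l₀, ?_⟩
  filter_upwards [hz.eventually (eventually_nhdsWithin_iff.1 (hcl (δ / 2) (by positivity))),
    Metric.ball_mem_nhds u₀ (half_pos hδpos)] with u hu1 hu2 l hl
  have hlper := hh.mem_periods_of_isDefect hl
  rw [Metric.mem_ball, dist_eq_norm, hul] at hu2
  obtain ⟨x, hx, ⟨h1, hlx⟩ | ⟨h1, hlx⟩⟩ := hl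
  · rw [h1, c.sheet_zero x (c.sqrtR_sq x)] at hu1
    obtain ⟨⟨e, m⟩, ⟨he, hm⟩, hd⟩ := hu1 hx
    change dist (h x) (e * v + m) < _ at hd
    rw [dist_eq_norm] at hd
    simp only at he hm
    have h3 : l - l₀ + m ∈ M := by
      refine hkey ((σ - e) * v) ?_ _ (add_mem (sub_mem hlper hl₀) (hM hm)) ?_
      · rcases hσ with rfl | rfl <;> rcases he with rfl | rfl
        · left; ring
        · right; left; ring
        · right; right; ring
        · left; ring
      · rw [show (σ - e) * v - (l - l₀ + m) =
          (h x - (e * v + m)) - (u - (σ * v + l₀)) by rw [hlx]; ring]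
        exact (norm_sub_le _ _).trans_lt (by linarith)
    have := sub_mem h3 hm
    rwa [add_sub_cancel_right] at this
  · rw [h1, c.sheet_one x (by rw [neg_sq]; exact c.sqrtR_sq x)] at hu1
    obtain ⟨⟨e, m⟩, ⟨he, hm⟩, hd⟩ := hu1 hx
    change dist (h x) (e * v + m) < _ at hd
    rw [dist_eq_norm] at hd
    simp only at he hm
    have h3 : l - l₀ - m ∈ M := by
      refine hkey ((σ + e) * v) ?_ _ (sub_mem (sub_mem hlper hl₀) (hM hm)) ?_
      · rcases hσ with rfl | rfl <;> rcases he with rfl | rfl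
        · right; left; ring
        · left; ring
        · left; ring
        · right; right; ring
      · rw [show (σ + e) * v - (l - l₀ - m) =
          -((h x - (e * v + m)) + (u - (σ * v + l₀))) by rw [hlx]; ring, norm_neg]
        exact (norm_add_le _ _).trans_lt (by linarith)
    have := add_mem h3 hm
    rwa [sub_add_cancel] at this

/-- Off the spine h is continuous, so its only limit value is h itself. The two sheets are not
confused since w ≠ 0. -/
theorem IsAbelian.exists_eventually_isDefect_of_notMem (hh : c.IsAbelian h) {u₀ : ℂ}
    (hu₀ : act u₀ (bPt t) ∈ fiber c.spineSetᶜ) :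
    ∃ l₀, ∀ᶠ u in 𝓝 u₀, ∀ l, c.IsDefect h u l → l = l₀ := by
  obtain ⟨q, hq, hqz⟩ := hu₀
  have hz : q.1.1 ∉ c.spineSet := hqz
  have hcl : ClustersAt h c.spineSetᶜ (signedTranslations ⊥) q.1.1 (h q.1.1) := by
    intro ε hε
    filter_upwards [eventually_nhdsWithin_of_eventually_nhds
      ((hh.hasDerivAt _ hz).continuousAt.eventually (Metric.ball_mem_nhds _ hε))] with z hz
    exact ⟨(1, 0), ⟨Or.inl rfl, zero_mem _⟩, by simpa using hz⟩
  have hact := hh.act_eq _ hz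
  rw [c.sheet_zero _ (c.sqrtR_sq _)] at hact
  obtain ⟨l₀, hl₀⟩ := hh.exists_eventually_isDefect hcl bot_le hact (fun h2 => by
    exfalso
    have h3 : act (h q.1.1) (bPt t) = act (-h q.1.1) (bPt t) := by
      rw [act_bPt_eq_iff, sub_neg_eq_add, ← two_mul]; exact h2
    rw [hh.act_eq _ hz, hh.act_neg_eq hz] at h3
    exact sheet_zero_ne_sheet_one (notMem_cuts_of_notMem_spineSet hz) h3) hq rfl
  exact ⟨l₀, hl₀.mono fun u hu l hl => sub_eq_zero.1 (hu l hl)⟩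

/-- All other times near u₀ lead off the spine, where the defect is locally constant, and a
punctured disc is connected. At u₀ itself there is no defect. -/
theorem IsAbelian.exists_eventually_isDefect_infty (hh : c.IsAbelian h) {u₀ : ℂ} {k : Fin 2}
    (hu₀ : act u₀ (bPt t) = infty k) : ∃ l₀, ∀ᶠ u in 𝓝 u₀, ∀ l, c.IsDefect h u l → l = l₀ := by
  have hK : IsCompact c.spineSet := c.isTameArc_spine.isCompact
  have h1 : ∀ᶠ u in 𝓝[≠] u₀, act u (bPt t) ∈ fiber c.spineSetᶜ := by
    have h2 : ∀ᶠ u in 𝓝 u₀, act u (bPt t) ∈ (fiber c.spineSet : Set (Surface t))ᶜ := by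
      refine (continuous_act (bPt t)).continuousAt.eventually
        ((isClosed_fiber hK).isOpen_compl.mem_nhds ?_)
      rintro ⟨q, hq, -⟩
      simp only [hu₀] at hq
      cases hq
    filter_upwards [eventually_nhdsWithin_of_eventually_nhds h2,
      (isFlowAt_act (bPt t) u₀).eventually_w_ne_zero c.sq_ne_four] with u hu hw
    obtain ⟨q, hq⟩ := exists_eq_pt_of_w_ne_zero hw
    exact ⟨q, hq, fun hqK => hu ⟨q, hq, hqK⟩⟩
  obtain ⟨r, hr, hball⟩ := Metric.mem_nhdsWithin_iff.1 h1
  have hgen : ∀ u ∈ Metric.ball u₀ r \ {u₀}, act u (bPt t) ∈ fiber c.spineSetᶜ := fun u hu =>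
    hball ⟨hu.1, hu.2⟩
  have hconst : ∀ u ∈ Metric.ball u₀ r \ {u₀}, ∀ u' ∈ Metric.ball u₀ r \ {u₀}, ∀ l l',
      c.IsDefect h u l → c.IsDefect h u' l' → l = l' := by
    intro u hu u' hu'
    refine (isPreconnected_ball_diff_center u₀ r).induction₂ (fun u u' => ∀ l l',
      c.IsDefect h u l → c.IsDefect h u' l' → l = l') (fun x hx => ?_)
      (fun x y z _ hy _ h1 h2 l l' hl hl' => ?_) (fun x y _ _ h1 l l' hl hl' => ?_) hu hu'
    · obtain ⟨l₀, hl₀⟩ := hh.exists_eventually_isDefect_of_notMem (hgen x hx)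
      refine eventually_nhdsWithin_of_eventually_nhds ?_
      filter_upwards [hl₀] with y hy l l' hl hl'
      rw [hl₀.self_of_nhds l hl, hy l' hl']
    · obtain ⟨m, hm⟩ := exists_isDefect (hgen y hy) h
      rw [h1 l m hl hm, h2 m l' hm hl']
    · exact (h1 l' l hl' hl).symm
  obtain ⟨u₁, hu₁⟩ : (Metric.ball u₀ r \ {u₀}).Nonempty := by
    refine ⟨u₀ + (r / 2 : ℝ), ?_, ?_⟩
    · simp [abs_of_pos hr, hr]
    · simp [hr.ne']
  obtain ⟨l₁, hl₁⟩ := exists_isDefect (hgen u₁ hu₁) h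
  refine ⟨l₁, ?_⟩
  filter_upwards [Metric.ball_mem_nhds u₀ hr] with u hu l hl
  refine hconst u ⟨hu, ?_⟩ u₁ hu₁ l l₁ hl hl₁
  rintro rfl
  obtain ⟨z, -, ⟨h2, -⟩ | ⟨h2, -⟩⟩ := hl <;> rw [hu₀] at h2 <;> cases h2

/-- On a connected set on which the defects are locally constant modulo `M`, they are constant
modulo `M`. -/
theorem isDefect_sub_mem {M : AddSubgroup ℂ} {U : Set ℂ}
    (hU : IsPreconnected U)
    (hloc : ∀ u₀ ∈ U, ∃ l₀, ∀ᶠ u in 𝓝 u₀, ∀ l, c.IsDefect h u l → l - l₀ ∈ M) {u u' l l' : ℂ}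
    (hu : u ∈ U) (hu' : u' ∈ U) (hl : c.IsDefect h u l) (hl' : c.IsDefect h u' l') : l - l' ∈ M := by
  suffices key : ∃ l₀, (∀ᶠ u in 𝓝 u, ∀ l, c.IsDefect h u l → l - l₀ ∈ M) ∧
      ∀ᶠ u in 𝓝 u', ∀ l, c.IsDefect h u l → l - l₀ ∈ M by
    obtain ⟨l₀, h1, h2⟩ := key
    have := sub_mem (h1.self_of_nhds l hl) (h2.self_of_nhds l' hl')
    rwa [sub_sub_sub_cancel_right] at this
  refine hU.induction₂ (fun x y => ∃ l₀, (∀ᶠ u in 𝓝 x, ∀ l, c.IsDefect h u l → l - l₀ ∈ M) ∧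
    ∀ᶠ u in 𝓝 y, ∀ l, c.IsDefect h u l → l - l₀ ∈ M) (fun x hx => ?_)
    (fun x y z _ _ _ h1 h2 => ?_) (fun x y _ _ h1 => ?_) hu hu'
  · obtain ⟨l₀, hl₀⟩ := hloc x hx
    refine eventually_nhdsWithin_of_eventually_nhds ?_
    filter_upwards [eventually_eventually_nhds.2 hl₀] with y hy
    exact ⟨l₀, hl₀, hy⟩
  · obtain ⟨l₁, hx1, hy1⟩ := h1
    obtain ⟨l₂, hy2, hz2⟩ := h2
    refine ⟨l₁, hx1, ?_⟩
    -- A time near y that has a defect shows that the two local constants agree modulo M.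
    obtain ⟨w, ⟨m, hm⟩, hw1, hw2⟩ := ((frequently_isDefect c h y).and_eventually
      (hy1.and hy2)).exists
    have h3 := sub_mem (hw1 m hm) (hw2 m hm)
    filter_upwards [hz2] with u hu l hl
    have := add_mem (hu l hl) h3
    rwa [show l - l₂ + (m - l₁ - (m - l₂)) = l - l₁ by ring] at this
  · obtain ⟨l₁, h2, h3⟩ := h1
    exact ⟨l₁, h3, h2⟩

/-- The periods are generated by the periods over `α` and `β`. -/
theorem IsAbelian.periods_eq (hh : c.IsAbelian h) (hω : c.IsBetaLift ω) :
    periods t = c.periodLattice ω := by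
  refine le_antisymm (fun l hl => ?_) hω.periodLattice_le
  obtain ⟨z, hz⟩ : ∃ z, z ∉ c.spineSet := c.dense_compl_spineSet.nonempty
  have hloc : ∀ u₀ ∈ (univ : Set ℂ), ∃ l₀, ∀ᶠ u in 𝓝 u₀, ∀ l, c.IsDefect h u l →
      l - l₀ ∈ c.periodLattice ω := by
    have hweak : ∀ {u₀ : ℂ}, (∃ l₀, ∀ᶠ u in 𝓝 u₀, ∀ l, c.IsDefect h u l → l = l₀) →
        ∃ l₀, ∀ᶠ u in 𝓝 u₀, ∀ l, c.IsDefect h u l → l - l₀ ∈ c.periodLattice ω := by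
      rintro u₀ ⟨l₀, hl₀⟩
      exact ⟨l₀, hl₀.mono fun u hu l hl => by rw [hu l hl, sub_self]; exact zero_mem _⟩
    intro u₀ _
    cases hp : act u₀ (bPt t) with
    | infty k => exact hweak (hh.exists_eventually_isDefect_infty hp)
    | pt q =>
      by_cases hq : q.1.1 ∈ c.spineSet
      · obtain ⟨s, hs, hsq⟩ := hq
        obtain ⟨y, hy, hact⟩ := hω.exists_act_spineLift hs
        exact hh.exists_eventually_isDefect (hh.clustersAt_periodLattice hω hs)
          hω.periodLattice_le hact (hω.two_spineLift_mem hs) hp hsq.symm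
      · exact hweak (hh.exists_eventually_isDefect_of_notMem (hp ▸ ⟨q, rfl, hq⟩))
  -- The times h z + l and h z lead to the same point and have the defects l and 0, so l lies in the
  -- lattice.
  have := isDefect_sub_mem isPreconnected_univ hloc (mem_univ _) (mem_univ _)
    (hh.isDefect_zero hz hl) (hh.isDefect_zero hz (zero_mem _))
  rwa [sub_zero] at this

end Contour

/-! ### The abelian integral and the Abel map -/

namespace Contour

variable {t : ℂ} (c : Contour t) {h : ℂ → ℂ} {ω : ℝ → ℂ}

/-- The values of the integral of `dz / w` along paths in an open set `U` of the surface are the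
times that can be joined to `0` within the set of times that lead from `b₂` into `U`. -/
theorem isAbelValue_iff {U : Set (Surface t)} (hU : IsOpen U) {p : Surface t} {v : ℂ} :
    c.IsAbelValue U p v ↔ ∃ u, JoinedIn {u | act u (bPt t) ∈ U} 0 u ∧ act u (bPt t) = p ∧
      v = c.alphaPeriod⁻¹ * u := by
  have ht := c.sq_ne_four
  constructor
  · rintro ⟨γ, hγ, h0, h1, hmem, rfl⟩
    refine ⟨pathIntegral γ, ?_, ?_, rfl⟩
    · refine JoinedIn.ofLine hγ.continuousOn_partialIntegral intervalIntegral.integral_same rfl ?_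
      rintro _ ⟨s, hs, rfl⟩
      have h2 := hγ.eq_act ht hs
      rw [h0] at h2
      show act (partialIntegral γ s) (bPt t) ∈ U
      rw [← h2]
      exact hmem s hs
    · rw [← h0, ← hγ.apply_one ht, h1]
  · rintro ⟨u, hu, rfl, rfl⟩
    -- A continuous curve of times need not give an integrable path on the surface. A nonconstant
    -- polynomial curve does, with the same end points.
    obtain ⟨P, hP, h0, h1, hmem⟩ := exists_polynomial_joinedIn
      (hU.preimage (continuous_act (bPt t))) hu
    obtain ⟨h2, h3⟩ := isPath_act_polynomial ht (bPt t) hP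
    refine ⟨_, h2, ?_, ?_, hmem, ?_⟩
    · simp only [Complex.ofReal_zero, h0, act_zero]
    · simp only [Complex.ofReal_one, h1]
    · rw [h3, h0, h1, sub_zero]

theorem isAbelValue_univ_iff {p : Surface t} {v : ℂ} :
    c.IsAbelValue univ p v ↔ ∃ u, act u (bPt t) = p ∧ v = c.alphaPeriod⁻¹ * u := by
  rw [c.isAbelValue_iff isOpen_univ]
  simp only [mem_univ, ofPred_true]
  refine exists_congr fun u => and_iff_right ?_
  exact (isPathConnected_univ (X := ℂ)).joinedIn _ (mem_univ _) _ (mem_univ _)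

theorem isOpen_cutSurface : IsOpen c.cutSurface := by
  refine (isClosed_fiber ?_).isOpen_compl
  exact (isCompact_Icc.image_of_continuousOn c.isArc_I.contDiffOn.continuousOn).union
    (isCompact_Icc.image_of_continuousOn c.isArc_J₁.contDiffOn.continuousOn)

theorem bPt_mem_cutSurface : bPt t ∈ c.cutSurface := by
  rintro ⟨q, hq, hqz⟩
  have hqb : q.1.1 = b₂ t := by cases hq; rfl
  have hL : b₂ t ∈ c.L '' Ici 0 := ⟨0, self_mem_Ici, c.L_zero⟩
  rw [hqb, c.image_J₁] at hqz
  rcases hqz with h | h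
  · exact disjoint_left.1 c.L_I hL h
  · exact disjoint_left.1 c.L_neg_J hL h

theorem pt_mem_cutSurface {q : AffineCurve t} (hq : q.1.1 ∉ c.spineSet) : pt q ∈ c.cutSurface := by
  rintro ⟨q', hq', hz⟩
  cases hq'
  rw [c.spineSet_eq] at hq
  rcases hz with hz | hz
  · exact hq (Or.inr hz)
  · exact hq (Or.inl (Or.inl hz))

theorem sheet_mem_cutSurface (k : Fin 2) {z : ℂ} (hz : z ∉ c.spineSet) :
    c.sheet k z ∈ c.cutSurface :=
  c.pt_mem_cutSurface hz

/-- The times that lead from `b₂` into the cut surface. -/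
def cutTimes : Set ℂ := {u | act u (bPt t) ∈ c.cutSurface}

theorem isOpen_cutTimes : IsOpen c.cutTimes := c.isOpen_cutSurface.preimage (continuous_act (bPt t))

theorem zero_mem_cutTimes : (0 : ℂ) ∈ c.cutTimes := by
  show act 0 (bPt t) ∈ c.cutSurface
  rw [act_zero]
  exact c.bPt_mem_cutSurface

/-- The values of the abelian integral of `dz / w` on the cut surface. -/
def principalTimes : Set ℂ := connectedComponentIn c.cutTimes 0

theorem isOpen_principalTimes : IsOpen c.principalTimes := c.isOpen_cutTimes.connectedComponentIn

theorem principalTimes_subset : c.principalTimes ⊆ c.cutTimes := connectedComponentIn_subset _ _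

theorem mem_principalTimes_of_mem_closure {u : ℂ} (hu : u ∈ c.cutTimes)
    (hcl : u ∈ closure c.principalTimes) : u ∈ c.principalTimes := by
  obtain ⟨r, hr, hball⟩ := Metric.isOpen_iff.1 c.isOpen_cutTimes u hu
  obtain ⟨v, hv, hv'⟩ := mem_closure_iff.1 hcl _ Metric.isOpen_ball (Metric.mem_ball_self hr)
  rw [principalTimes, connectedComponentIn_eq hv']
  exact (convex_ball u r).isPreconnected.subset_connectedComponentIn hv hball
    (Metric.mem_ball_self hr)

theorem joinedIn_cutTimes_iff {u : ℂ} : JoinedIn c.cutTimes 0 u ↔ u ∈ c.principalTimes := by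
  constructor
  · intro hu
    have h1 : IsPathConnected (pathComponentIn c.cutTimes 0) :=
      isPathConnected_pathComponentIn c.zero_mem_cutTimes
    exact h1.isConnected.isPreconnected.subset_connectedComponentIn
      (mem_pathComponentIn_self c.zero_mem_cutTimes) pathComponentIn_subset hu
  · intro hu
    have h0 : (0 : ℂ) ∈ c.principalTimes := mem_connectedComponentIn c.zero_mem_cutTimes
    have h1 : IsConnected c.principalTimes := ⟨⟨0, h0⟩, isPreconnected_connectedComponentIn⟩
    exact ((c.isOpen_principalTimes.isConnected_iff_isPathConnected.1 h1).joinedIn 0 h0 u hu).mono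
      c.principalTimes_subset

variable {c}

/-- The cut surface meets the part over the spine only over J without a₂, and along J the limit
values carry no translation. -/
theorem IsAbelian.exists_eventually_isDefect_cutTimes (hh : c.IsAbelian h) (hω : c.IsBetaLift ω)
    {u₀ : ℂ} (hu₀ : u₀ ∈ c.cutTimes) :
    ∃ l₀, ∀ᶠ u in 𝓝 u₀, ∀ l, c.IsDefect h u l → l - l₀ ∈ (⊥ : AddSubgroup ℂ) := by
  have hweak : (∃ l₀, ∀ᶠ u in 𝓝 u₀, ∀ l, c.IsDefect h u l → l = l₀) →
      ∃ l₀, ∀ᶠ u in 𝓝 u₀, ∀ l, c.IsDefect h u l → l - l₀ ∈ (⊥ : AddSubgroup ℂ) := by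
    rintro ⟨l₀, hl₀⟩
    exact ⟨l₀, hl₀.mono fun u hu l hl => by rw [hu l hl, sub_self]; exact zero_mem _⟩
  cases hp : act u₀ (bPt t) with
  | infty k => exact hweak (hh.exists_eventually_isDefect_infty hp)
  | pt q =>
    by_cases hq : q.1.1 ∈ c.spineSet
    · obtain ⟨s, hs, hsq⟩ := hq
      have hnot : q.1.1 ∉ c.I '' Icc 0 1 ∪ c.J₁ '' Icc 0 1 := fun hz => hu₀ ⟨q, hp, hz⟩
      have hs1 : s < 1 := by
        by_contra! hs1
        rcases le_total s 2 with h2 | h2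
        · rw [c.spine_of_mem_Icc ⟨hs1, h2⟩] at hsq
          exact hnot (Or.inl ⟨2 - s, ⟨by linarith, by linarith⟩, hsq⟩)
        · rw [c.spine_of_two_le h2] at hsq
          exact hnot (Or.inr ⟨3 - s, ⟨by linarith [hs.2], by linarith⟩, hsq⟩)
      obtain ⟨y, hy, hact⟩ := hω.exists_act_spineLift hs
      refine hh.exists_eventually_isDefect (hh.clustersAt_J hω ⟨hs.1, hs1.le⟩) bot_le hact
        (fun h2 => ?_) hp hsq.symm
      have hs0 : s = 0 := by
        rcases hω.eq_of_two_spineLift_mem hs h2 with h | h | h | h <;> linarith [hs.1]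
      rw [hs0, c.spineLift_zero, mul_zero]
      exact zero_mem _
    · exact hweak (hh.exists_eventually_isDefect_of_notMem (hp ▸ ⟨q, rfl, hq⟩))

/-- The image of the connected complement of the spine accumulates at 0, so it lies in the component
of 0. This serves for both h and -h, the times of the two sheets. -/
theorem mem_principalTimes_of_tendsto {f : ℂ → ℂ} (hf : ContinuousOn f c.spineSetᶜ)
    (hf0 : Tendsto f (𝓝[c.spineSetᶜ] (b₂ t)) (𝓝 0)) (hmem : ∀ z ∉ c.spineSet, f z ∈ c.cutTimes)
    {z : ℂ} (hz : z ∉ c.spineSet) : f z ∈ c.principalTimes := by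
  have hpre : IsPreconnected (f '' c.spineSetᶜ) := c.isPreconnected_compl_spineSet.image f hf
  have : NeBot (𝓝[c.spineSetᶜ] (b₂ t)) := mem_closure_iff_nhdsWithin_neBot.1
    (c.dense_compl_spineSet (b₂ t))
  have h0 : (0 : ℂ) ∈ closure (f '' c.spineSetᶜ) :=
    mem_closure_of_tendsto hf0 (eventually_mem_nhdsWithin.mono fun z hz => ⟨z, hz, rfl⟩)
  have hpre' := hpre.subset_closure (subset_insert 0 _) (insert_subset h0 subset_closure)
  refine hpre'.subset_connectedComponentIn (mem_insert _ _) ?_ (mem_insert_of_mem _ ⟨z, hz, rfl⟩)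
  refine insert_subset c.zero_mem_cutTimes ?_
  rintro _ ⟨z, hz, rfl⟩
  exact hmem z hz

theorem IsAbelian.mem_principalTimes (hh : c.IsAbelian h) {z : ℂ} (hz : z ∉ c.spineSet) :
    h z ∈ c.principalTimes := by
  refine mem_principalTimes_of_tendsto hh.continuousOn hh.tendsto (fun z hz => ?_) hz
  show act _ (bPt t) ∈ c.cutSurface
  rw [hh.act_eq z hz]
  exact c.sheet_mem_cutSurface 0 hz

theorem IsAbelian.neg_mem_principalTimes (hh : c.IsAbelian h) {z : ℂ} (hz : z ∉ c.spineSet) :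
    -h z ∈ c.principalTimes := by
  refine mem_principalTimes_of_tendsto (f := fun z => -h z) hh.continuousOn.neg
    (by simpa using hh.tendsto.neg) (fun z hz => ?_) hz
  show act _ (bPt t) ∈ c.cutSurface
  rw [hh.act_neg_eq hz]
  exact c.sheet_mem_cutSurface 1 hz

/-- The time h z is principal and has defect 0, and defects are constant on the connected set of
principal times. -/
theorem IsAbelian.eq_zero_of_isDefect (hh : c.IsAbelian h) (hω : c.IsBetaLift ω) {u l : ℂ}
    (hu : u ∈ c.principalTimes) (hl : c.IsDefect h u l) : l = 0 := by
  obtain ⟨z, hz⟩ : ∃ z, z ∉ c.spineSet := c.dense_compl_spineSet.nonempty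
  have h1 := hh.isDefect_zero hz (zero_mem (periods t))
  rw [add_zero] at h1
  have := isDefect_sub_mem isPreconnected_connectedComponentIn
    (fun u hu => hh.exists_eventually_isDefect_cutTimes hω (c.principalTimes_subset hu)) hu
    (hh.mem_principalTimes hz) hl h1
  rwa [sub_zero, AddSubgroup.mem_bot] at this

theorem IsDefect.add {u l m : ℂ} (hl : c.IsDefect h u l) (hm : m ∈ periods t) :
    c.IsDefect h (u + m) (l + m) := by
  have h1 : act (u + m) (bPt t) = act u (bPt t) := by
    rw [act_bPt_eq_iff, add_sub_cancel_left]; exact hm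
  obtain ⟨z, hz, ⟨h2, rfl⟩ | ⟨h2, rfl⟩⟩ := hl
  · exact ⟨z, hz, Or.inl ⟨h1.trans h2, by ring⟩⟩
  · exact ⟨z, hz, Or.inr ⟨h1.trans h2, by ring⟩⟩

/-- The cut surface is parametrized by the principal times. -/
theorem IsAbelian.injOn_principalTimes (hh : c.IsAbelian h) (hω : c.IsBetaLift ω) :
    InjOn (fun u => act u (bPt t)) c.principalTimes := by
  intro u hu u' hu' e
  have hm : u' - u ∈ periods t := act_bPt_eq_iff.1 e.symm
  have h1 : ∀ᶠ v in 𝓝 u, v ∈ c.principalTimes := c.isOpen_principalTimes.mem_nhds hu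
  have h2 : ∀ᶠ v in 𝓝 u, v + (u' - u) ∈ c.principalTimes := by
    have : Tendsto (fun v => v + (u' - u)) (𝓝 u) (𝓝 u') := by
      have := (continuous_add_const (u' - u)).tendsto u
      rwa [add_sub_cancel] at this
    exact this.eventually (c.isOpen_principalTimes.mem_nhds hu')
  -- If two principal times differ by the period u' - u, then so do the defects at nearby principal
  -- times; but both defects vanish.
  obtain ⟨v, ⟨l, hl⟩, hv1, hv2⟩ := ((frequently_isDefect c h u).and_eventually (h1.and h2)).exists
  have h3 := hh.eq_zero_of_isDefect hω hv1 hl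
  have h4 := hh.eq_zero_of_isDefect hω hv2 (hl.add hm)
  rw [h3, zero_add] at h4
  exact (sub_eq_zero.1 h4).symm

/-- Choose any time for p and subtract its local defect, which is a period. Arbitrarily close to the
new time there are times ±h z, which are principal, and a component is closed relative to the open
set of cut times. -/
theorem IsAbelian.exists_mem_principalTimes (hh : c.IsAbelian h) (hω : c.IsBetaLift ω)
    {p : Surface t} (hp : p ∈ c.cutSurface) : ∃ u ∈ c.principalTimes, act u (bPt t) = p := by
  obtain ⟨u, rfl⟩ := hh.exists_act_eq p
  obtain ⟨l₀, hl₀⟩ := hh.exists_eventually_isDefect_cutTimes hω hp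
  have hfreq := (frequently_isDefect c h u).and_eventually hl₀
  have hl₀p : l₀ ∈ periods t := by
    obtain ⟨v, ⟨l, hl⟩, hv⟩ := hfreq.exists
    have := hv l hl
    rw [AddSubgroup.mem_bot, sub_eq_zero] at this
    rw [← this]
    exact hh.mem_periods_of_isDefect hl
  have hact : act (u - l₀) (bPt t) = act u (bPt t) := by
    rw [act_bPt_eq_iff]
    simpa using neg_mem hl₀p
  refine ⟨u - l₀, c.mem_principalTimes_of_mem_closure ?_ ?_, hact⟩
  · show act _ (bPt t) ∈ c.cutSurface
    rwa [hact]
  · rw [mem_closure_iff_frequently]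
    have htend : Tendsto (fun v => v - l₀) (𝓝 u) (𝓝 (u - l₀)) :=
      (continuous_id.sub continuous_const).tendsto u
    refine htend.frequently (hfreq.mono ?_)
    rintro v ⟨⟨l, hl⟩, hv⟩
    have h1 := hv l hl
    rw [AddSubgroup.mem_bot, sub_eq_zero] at h1
    rw [← h1]
    obtain ⟨z, hz, ⟨-, rfl⟩ | ⟨-, rfl⟩⟩ := hl
    · rw [sub_sub_cancel]; exact hh.mem_principalTimes hz
    · rw [sub_add_cancel_left]; exact hh.neg_mem_principalTimes hz

theorem IsAbelian.abelIntegral_eq (hh : c.IsAbelian h) (hω : c.IsBetaLift ω) {u : ℂ}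
    (hu : u ∈ c.principalTimes) :
    c.abelIntegral (act u (bPt t)) = c.alphaPeriod⁻¹ * u := by
  have h1 : ∃ v, c.IsAbelValue c.cutSurface (act u (bPt t)) v :=
    ⟨_, (c.isAbelValue_iff c.isOpen_cutSurface).2 ⟨u, c.joinedIn_cutTimes_iff.2 hu, rfl, rfl⟩⟩
  rw [abelIntegral, dif_pos h1]
  obtain ⟨u', hu', hact, he⟩ := (c.isAbelValue_iff c.isOpen_cutSurface).1 h1.choose_spec
  rw [he, hh.injOn_principalTimes hω (c.joinedIn_cutTimes_iff.1 hu') hu hact]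

theorem IsAbelian.abelIntegral_sheet_zero (hh : c.IsAbelian h) (hω : c.IsBetaLift ω) {z : ℂ}
    (hz : z ∉ c.spineSet) : c.abelIntegral (c.sheet 0 z) = c.alphaPeriod⁻¹ * h z := by
  rw [← hh.act_eq z hz, hh.abelIntegral_eq hω (hh.mem_principalTimes hz)]

theorem IsAbelian.abelIntegral_sheet_one (hh : c.IsAbelian h) (hω : c.IsBetaLift ω) {z : ℂ}
    (hz : z ∉ c.spineSet) : c.abelIntegral (c.sheet 1 z) = -(c.alphaPeriod⁻¹ * h z) := by
  rw [← hh.act_neg_eq hz, hh.abelIntegral_eq hω (hh.neg_mem_principalTimes hz), mul_neg]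

theorem mul_mem_periodLattice_iff (hω : c.IsBetaLift ω) {x : ℂ} :
    c.alphaPeriod * x ∈ c.periodLattice ω ↔ x ∈ c.lattice ω := by
  have hα := hω.alphaPeriod_ne_zero
  have h1 : c.periodLattice ω = (c.lattice ω).map (AddMonoidHom.mulLeft c.alphaPeriod) := by
    rw [periodLattice, lattice, AddMonoidHom.map_closure, image_pair]
    simp only [AddMonoidHom.coe_mulLeft, mul_one, c.B_eq, mul_inv_cancel_left₀ hα]
    rw [c.alphaPeriod_eq]
  rw [h1, AddSubgroup.mem_map]
  constructor
  · rintro ⟨y, hy, e⟩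
    rwa [← mul_left_cancel₀ hα e]
  · exact fun hx => ⟨x, hx, rfl⟩

theorem IsAbelian.toJac_eq_iff (hh : c.IsAbelian h) (hω : c.IsBetaLift ω) {u v : ℂ} :
    c.toJac ω (c.alphaPeriod⁻¹ * u) = c.toJac ω (c.alphaPeriod⁻¹ * v) ↔
      act u (bPt t) = act v (bPt t) := by
  have hα := hω.alphaPeriod_ne_zero
  rw [act_bPt_eq_iff, hh.periods_eq hω, toJac, toJac, QuotientAddGroup.eq_iff_sub_mem,
    ← mul_sub, ← mul_mem_periodLattice_iff hω, mul_inv_cancel_left₀ hα]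

theorem IsAbelian.abelMap_act (hh : c.IsAbelian h) (hω : c.IsBetaLift ω) (u : ℂ) :
    c.abelMap ω (act u (bPt t)) = c.toJac ω (c.alphaPeriod⁻¹ * u) := by
  have h1 : ∃ v, c.IsAbelValue univ (act u (bPt t)) v :=
    ⟨_, c.isAbelValue_univ_iff.2 ⟨u, rfl, rfl⟩⟩
  rw [abelMap, dif_pos h1]
  obtain ⟨u', hact, he⟩ := c.isAbelValue_univ_iff.1 h1.choose_spec
  rw [he, hh.toJac_eq_iff hω, hact]

theorem IsAbelian.abelMap_eq_toJac_abelIntegral (hh : c.IsAbelian h) (hω : c.IsBetaLift ω)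
    {p : Surface t} (hp : p ∈ c.cutSurface) : c.abelMap ω p = c.toJac ω (c.abelIntegral p) := by
  obtain ⟨u, hu, rfl⟩ := hh.exists_mem_principalTimes hω hp
  rw [hh.abelMap_act hω, hh.abelIntegral_eq hω hu]

theorem rot_sheet (c : Contour t) (k : Fin 2) : rot (c.sheet k 0) = c.sheet (1 - k) 0 := by
  fin_cases k
  · show rot (c.sheet 0 0) = c.sheet 1 0
    rw [c.sheet_zero 0 (c.sqrtR_sq 0), c.sheet_one 0 (by rw [neg_sq]; exact c.sqrtR_sq 0)]
    simp [rot]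
  · show rot (c.sheet 1 0) = c.sheet 0 0
    rw [c.sheet_zero 0 (c.sqrtR_sq 0), c.sheet_one 0 (by rw [neg_sq]; exact c.sqrtR_sq 0)]
    simp [rot]

/-- After normalization the half period `alphaIntegral 1` is 1/2. Adding it applies `rot`, which
changes the sign of w over z = 0. -/
theorem IsAbelian.abelMap_eq_add_half_iff (hh : c.IsAbelian h) (hω : c.IsBetaLift ω) (k : Fin 2)
    (p : Surface t) : c.abelMap ω p = c.abelMap ω (c.sheet k 0) + c.toJac ω (1 / 2) ↔
      p = c.sheet (1 - k) 0 := by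
  obtain ⟨u, rfl⟩ := hh.exists_act_eq p
  obtain ⟨v, hv⟩ := hh.exists_act_eq (c.sheet k 0)
  have hα := hω.alphaPeriod_ne_zero
  have h1 : c.abelMap ω (c.sheet k 0) + c.toJac ω (1 / 2) =
      c.toJac ω (c.alphaPeriod⁻¹ * (v + c.alphaIntegral 1)) := by
    rw [← hv, hh.abelMap_act hω, mul_add, show c.alphaPeriod⁻¹ * c.alphaIntegral 1 = 1 / 2 by
      rw [c.alphaPeriod_eq] at hα ⊢
      have := right_ne_zero_of_mul hα
      field_simp]
    rfl
  rw [h1, hh.abelMap_act hω, hh.toJac_eq_iff hω, ← hω.rot_act, hv, c.rot_sheet]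

end Contour

/-! ### Limits along the normals of an arc -/

theorem re_circleMap_sub_mul_conj (x T : ℂ) (r θ : ℝ) :
    ((circleMap x r (T.arg + θ) - x) * starRingEnd ℂ T).re = r * ‖T‖ * Real.cos θ := by
  have h1 : starRingEnd ℂ T = ‖T‖ * Complex.exp (-(T.arg * Complex.I)) := by
    conv_lhs => rw [← Complex.norm_mul_exp_arg_mul_I T]
    rw [map_mul, Complex.conj_ofReal, ← Complex.exp_conj, map_mul, Complex.conj_ofReal,
      Complex.conj_I, mul_neg]
  have h2 : (circleMap x r (T.arg + θ) - x) * starRingEnd ℂ T =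
      ((r * ‖T‖ : ℝ) : ℂ) * Complex.exp (θ * Complex.I) := by
    rw [h1, circleMap, add_sub_cancel_left]
    push_cast
    rw [show Complex.exp ((T.arg + θ) * Complex.I) =
      Complex.exp (T.arg * Complex.I) * Complex.exp (θ * Complex.I) by rw [← Complex.exp_add]; ring_nf,
      Complex.exp_neg]
    field_simp [Complex.exp_ne_zero]
  rw [h2, Complex.re_ofReal_mul, Complex.exp_ofReal_mul_I_re]

theorem circleMap_arg_add_pi_div_two {x T : ℂ} (hT : T ≠ 0) (r : ℝ) :
    circleMap x r (T.arg + Real.pi / 2) = x + (r / ‖T‖ : ℝ) * (Complex.I * T) := by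
  have hn : (‖T‖ : ℂ) ≠ 0 := by simpa using hT
  conv_rhs => rw [← Complex.norm_mul_exp_arg_mul_I T]
  rw [circleMap]
  push_cast
  rw [add_mul, Complex.exp_add, Complex.exp_pi_div_two_mul_I]
  simp only [norm_mul, Complex.norm_real, norm_norm, Complex.norm_exp_ofReal_mul_I, mul_one]
  field_simp

theorem circleMap_arg_add_three_pi_div_two {x T : ℂ} (hT : T ≠ 0) (r : ℝ) :
    circleMap x r (T.arg + (Real.pi / 2 + Real.pi)) = x - (r / ‖T‖ : ℝ) * (Complex.I * T) := by
  have h1 := circleMap_arg_add_pi_div_two (x := x) hT r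
  rw [circleMap] at h1 ⊢
  rw [← add_assoc, Complex.ofReal_add _ Real.pi, add_mul, Complex.exp_add, Complex.exp_pi_mul_I]
  linear_combination -h1

/-- On a circle about `x`, from which a point on each side of the normal of direction `iT` is
removed, each point can be joined to one of the end points of the normal. -/
theorem exists_arc_to_normal {x T p q z : ℂ} {r : ℝ} (hr : 0 < r) (hT : T ≠ 0)
    (hp : p ∈ Metric.sphere x r) (hq : q ∈ Metric.sphere x r)
    (hp' : 0 < ((p - x) * starRingEnd ℂ T).re) (hq' : ((q - x) * starRingEnd ℂ T).re < 0)
    (hz : z ∈ Metric.sphere x r) (hzp : z ≠ p) (hzq : z ≠ q) :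
    ∃ W : Set ℂ, IsPreconnected W ∧ z ∈ W ∧ W ⊆ Metric.sphere x r \ {p, q} ∧
      (x + (r / ‖T‖ : ℝ) * (Complex.I * T) ∈ W ∨ x - (r / ‖T‖ : ℝ) * (Complex.I * T) ∈ W) := by
  have hpi := Real.pi_pos
  have hrT : 0 < r * ‖T‖ := mul_pos hr (norm_pos_iff.2 hT)
  have hmem : ∀ θ, circleMap x r θ ∈ Metric.sphere x r := fun θ => circleMap_mem_sphere x hr.le θ
  -- Angles are measured from the direction of T. Then p lies in (-π/2, π/2), q in (π/2, 3π/2), and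
  -- the two normals are at π/2 and 3π/2, one in each of the arcs between p and q.
  have hlift : ∀ {y : ℂ}, y ∈ Metric.sphere x r → ∃ θ ∈ Ico (-(Real.pi / 2)) (Real.pi / 2 + Real.pi),
      circleMap x r (T.arg + θ) = y := by
    intro y hy
    obtain ⟨θ, hθ, e⟩ := exists_eq_circleMap hy hr (T.arg - Real.pi / 2)
    refine ⟨θ - T.arg, ⟨by linarith [hθ.1], by linarith [hθ.2]⟩, by rw [add_sub_cancel]; exact e⟩
  obtain ⟨θp, hθp, rfl⟩ := hlift hp
  obtain ⟨θq, hθq, rfl⟩ := hlift hq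
  rw [re_circleMap_sub_mul_conj] at hp' hq'
  have hcp : 0 < Real.cos θp := pos_of_mul_pos_right hp' hrT.le
  have hcq : Real.cos θq < 0 := by
    by_contra! h
    exact absurd hq' (not_lt.2 (mul_nonneg hrT.le h))
  have hp2 : θp < Real.pi / 2 := by
    by_contra! h
    exact absurd hcp (not_lt.2 (Real.cos_nonpos_of_pi_div_two_le_of_le h (by linarith [hθp.2])))
  have hq2 : Real.pi / 2 < θq := by
    by_contra! h
    exact absurd hcq (not_lt.2 (Real.cos_nonneg_of_neg_pi_div_two_le_of_le hθq.1 h))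
  have hp1 : -(Real.pi / 2) < θp := by
    refine lt_of_le_of_ne hθp.1 fun e => ?_
    rw [← e, Real.cos_neg, Real.cos_pi_div_two] at hcp
    exact lt_irrefl _ hcp
  have hinj := circleMap_injOn_Ico x hr.ne' (T.arg + θp)
  obtain ⟨θz, hθz, rfl⟩ := exists_eq_circleMap hz hr (T.arg + θp)
  have hlt : T.arg + θp < θz := lt_of_le_of_ne hθz.1 (by rintro rfl; exact hzp rfl)
  have hne : θz ≠ T.arg + θq := by rintro rfl; exact hzq rfl
  have hP : T.arg + θp ∈ Ico (T.arg + θp) (T.arg + θp + 2 * Real.pi) := ⟨le_rfl, by linarith⟩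
  have hQ : T.arg + θq ∈ Ico (T.arg + θp) (T.arg + θp + 2 * Real.pi) :=
    ⟨by linarith, by linarith [hθq.2]⟩
  rcases lt_or_gt_of_ne hne with h | h
  · refine ⟨circleMap x r '' Ioo (T.arg + θp) (T.arg + θq),
      circleMap_image_preconnected x r isPreconnected_Ioo, ⟨θz, ⟨hlt, h⟩, rfl⟩, ?_, Or.inl ?_⟩
    · rintro _ ⟨θ, hθ, rfl⟩
      have hθ' : θ ∈ Ico (T.arg + θp) (T.arg + θp + 2 * Real.pi) := ⟨hθ.1.le, hθ.2.trans hQ.2⟩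
      refine ⟨hmem θ, ?_⟩
      rintro (e | e)
      · exact hθ.1.ne' (hinj hθ' hP e)
      · exact hθ.2.ne (hinj hθ' hQ e)
    · exact ⟨T.arg + Real.pi / 2, ⟨by linarith, by linarith⟩, circleMap_arg_add_pi_div_two hT r⟩
  · refine ⟨circleMap x r '' Ioo (T.arg + θq) (T.arg + θp + 2 * Real.pi),
      circleMap_image_preconnected x r isPreconnected_Ioo, ⟨θz, ⟨h, hθz.2⟩, rfl⟩, ?_, Or.inr ?_⟩
    · rintro _ ⟨θ, hθ, rfl⟩
      have hθ' : θ ∈ Ico (T.arg + θp) (T.arg + θp + 2 * Real.pi) := ⟨hQ.1.trans hθ.1.le, hθ.2⟩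
      refine ⟨hmem θ, ?_⟩
      rintro (e | e)
      · exact (hQ.1.trans_lt hθ.1).ne' (hinj hθ' hP e)
      · exact hθ.1.ne' (hinj hθ' hQ e)
    · exact ⟨T.arg + (Real.pi / 2 + Real.pi), ⟨by linarith [hθq.2], by linarith⟩,
        circleMap_arg_add_three_pi_div_two hT r⟩

/-- A simple arc that is differentiable at an interior parameter with derivative `T ≠ 0` is locally
separated by its normal. -/
theorem IsTameArc.exists_normal {κ : ℝ → ℂ} {S : ℝ} (hκ : IsTameArc κ S) {s₀ : ℝ}
    (hs₀ : s₀ ∈ Ioo 0 S) {T : ℂ} (hT : T ≠ 0) (hd : HasDerivAt κ T s₀) :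
    ∃ δ > 0, ∀ r ∈ Ioo 0 δ,
      κ s₀ + (r / ‖T‖ : ℝ) * (Complex.I * T) ∉ κ '' Icc 0 S ∧
      κ s₀ - (r / ‖T‖ : ℝ) * (Complex.I * T) ∉ κ '' Icc 0 S ∧
      ∀ z ∉ κ '' Icc 0 S, dist z (κ s₀) = r → ∃ W : Set ℂ, IsPreconnected W ∧ z ∈ W ∧
        W ⊆ Metric.sphere (κ s₀) r \ κ '' Icc 0 S ∧
        (κ s₀ + (r / ‖T‖ : ℝ) * (Complex.I * T) ∈ W ∨
          κ s₀ - (r / ‖T‖ : ℝ) * (Complex.I * T) ∈ W) := by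
  have hTn : 0 < ‖T‖ := norm_pos_iff.2 hT
  -- Later points of the arc lie on the forward side of the normal line and earlier ones on the
  -- backward side, by differentiability.
  have hcone : ∀ᶠ s in 𝓝[≠] s₀, 0 < (s - s₀) * ((κ s - κ s₀) * starRingEnd ℂ T).re := by
    have h1 : Tendsto (fun s => (slope κ s₀ s * starRingEnd ℂ T).re) (𝓝[≠] s₀)
        (𝓝 (T * starRingEnd ℂ T).re) :=
      (Complex.continuous_re.tendsto _).comp ((hasDerivAt_iff_tendsto_slope.1 hd).mul_const _)
    have h2 : 0 < (T * starRingEnd ℂ T).re := by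
      rw [Complex.mul_conj, Complex.ofReal_re]
      exact Complex.normSq_pos.2 hT
    filter_upwards [h1.eventually (lt_mem_nhds h2), self_mem_nhdsWithin] with s hs hne
    have hne' : s - s₀ ≠ 0 := sub_ne_zero.2 hne
    have h3 : (κ s - κ s₀) * starRingEnd ℂ T =
        ((s - s₀ : ℝ) : ℂ) * (slope κ s₀ s * starRingEnd ℂ T) := by
      rw [slope_def_module, Complex.real_smul, ← mul_assoc, ← mul_assoc, ← Complex.ofReal_mul,
        mul_inv_cancel₀ hne', Complex.ofReal_one, one_mul]
    rw [h3, Complex.re_ofReal_mul, ← mul_assoc, ← sq]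
    exact mul_pos (by positivity) hs
  obtain ⟨η, hη, hball⟩ := Metric.mem_nhdsWithin_iff.1 hcone
  obtain ⟨δ₁, hδ₁, hl⟩ := hκ.circle_left (Ioo_subset_Ioc_self hs₀) hη
  obtain ⟨δ₂, hδ₂, hr⟩ := hκ.circle_right (Ioo_subset_Ico_self hs₀) hη
  refine ⟨min δ₁ δ₂, lt_min hδ₁ hδ₂, fun r hrr => ?_⟩
  obtain ⟨s₁, hs₁, hs₁0, hd₁, hu₁⟩ := hl r ⟨hrr.1, hrr.2.trans_le (min_le_left _ _)⟩
  obtain ⟨s₂, hs₂, hs₂S, hd₂, hu₂⟩ := hr r ⟨hrr.1, hrr.2.trans_le (min_le_right _ _)⟩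
  have hq : ((κ s₁ - κ s₀) * starRingEnd ℂ T).re < 0 := by
    have h1 := hball ⟨show dist s₁ s₀ < η by
      rw [Real.dist_eq, abs_lt]; constructor <;> linarith [hs₁.1, hs₁.2], hs₁.2.ne⟩
    exact neg_of_mul_pos_right h1 (by linarith [hs₁.2])
  have hp : 0 < ((κ s₂ - κ s₀) * starRingEnd ℂ T).re := by
    have h1 := hball ⟨show dist s₂ s₀ < η by
      rw [Real.dist_eq, abs_lt]; constructor <;> linarith [hs₂.1, hs₂.2], hs₂.1.ne'⟩
    exact pos_of_mul_pos_right h1 (by linarith [hs₂.1])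
  have hK : ∀ z ∈ κ '' Icc 0 S, dist z (κ s₀) = r → z = κ s₂ ∨ z = κ s₁ := by
    rintro _ ⟨s, hs, rfl⟩ hz
    rcases le_total s s₀ with h | h
    · exact Or.inr (congrArg κ (hu₁ s ⟨hs.1, h⟩ hz))
    · exact Or.inl (congrArg κ (hu₂ s ⟨h, hs.2⟩ hz))
  have hnorm : ∀ e : ℝ, |e| = 1 → κ s₀ + e * ((r / ‖T‖ : ℝ) * (Complex.I * T)) ∉ κ '' Icc 0 S := by
    intro e he hmem
    have hre : (κ s₀ + e * ((r / ‖T‖ : ℝ) * (Complex.I * T)) - κ s₀) * starRingEnd ℂ T =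
        ((e * (r / ‖T‖) * Complex.normSq T : ℝ) : ℂ) * Complex.I := by
      rw [add_sub_cancel_left]
      push_cast
      rw [← Complex.mul_conj]
      ring
    have hre' : ((κ s₀ + e * ((r / ‖T‖ : ℝ) * (Complex.I * T)) - κ s₀) * starRingEnd ℂ T).re = 0 := by
      rw [hre, Complex.re_ofReal_mul, Complex.I_re, mul_zero]
    have hdist : dist (κ s₀ + e * ((r / ‖T‖ : ℝ) * (Complex.I * T))) (κ s₀) = r := by
      rw [dist_eq_norm, add_sub_cancel_left, norm_mul, norm_mul, norm_mul, Complex.norm_I,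
        Complex.norm_real, Complex.norm_real, Real.norm_eq_abs, Real.norm_eq_abs, he, one_mul,
        one_mul, abs_of_pos (div_pos hrr.1 hTn), div_mul_cancel₀ _ hTn.ne']
    rcases hK _ hmem hdist with h | h
    · rw [h] at hre'; exact hp.ne' hre'
    · rw [h] at hre'; exact hq.ne hre'
  refine ⟨?_, ?_, fun z hz hzr => ?_⟩
  · have := hnorm 1 (by norm_num)
    rwa [Complex.ofReal_one, one_mul] at this
  · have := hnorm (-1) (by norm_num)
    rwa [Complex.ofReal_neg, Complex.ofReal_one, neg_one_mul, ← sub_eq_add_neg] at this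
  · obtain ⟨W, hW, hzW, hWs, hn⟩ := exists_arc_to_normal hrr.1 hT hd₂ hd₁ hp hq hzr
      (by rintro rfl; exact hz ⟨s₂, ⟨hs₀.1.le.trans hs₂.1.le, hs₂S⟩, rfl⟩)
      (by rintro rfl; exact hz ⟨s₁, ⟨hs₁0, hs₁.2.le.trans hs₀.2.le⟩, rfl⟩)
    refine ⟨W, hW, hzW, fun y hy => ⟨(hWs hy).1, fun hyK => (hWs hy).2 ?_⟩, hn⟩
    exact hK y hyK (hWs hy).1

/-- On an interval a continuous function that is close to one of two separated points cannot change
from one to the other. -/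
theorem tendsto_or_tendsto_of_clusters {f : ℝ → ℂ} {p q : ℂ} {r₀ : ℝ} (hr₀ : 0 < r₀)
    (hf : ContinuousOn f (Ioo 0 r₀))
    (hcl : ∀ ε > 0, ∀ᶠ r in 𝓝[>] (0 : ℝ), dist (f r) p < ε ∨ dist (f r) q < ε) :
    Tendsto f (𝓝[>] 0) (𝓝 p) ∨ Tendsto f (𝓝[>] 0) (𝓝 q) := by
  by_cases hpq : p = q
  · subst hpq
    exact Or.inl (Metric.tendsto_nhds.2 fun ε hε => (hcl ε hε).mono fun r hr => hr.elim id id)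
  have hε : 0 < dist p q / 2 := half_pos (dist_pos.2 hpq)
  obtain ⟨r₁, hr₁, h1⟩ := mem_nhdsGT_iff_exists_Ioo_subset.1 (hcl _ hε)
  have hr₁' : (0 : ℝ) < r₁ := hr₁
  set ρ := min r₀ r₁ with hρ
  have hρ0 : 0 < ρ := lt_min hr₀ hr₁'
  have hev : ∀ᶠ r in 𝓝[>] (0 : ℝ), r ∈ Ioo 0 ρ := Ioo_mem_nhdsGT hρ0
  have key : ∀ y ∈ ({p, q} : Set ℂ), ∀ r ∈ Ioo 0 ρ, dist (f r) y < dist p q / 2 →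
      ∀ r' ∈ Ioo 0 ρ, dist (f r') y < dist p q / 2 := by
    intro y hy r hr hry r' hr'
    refine dist_lt_of_isPreconnected (S := {p, q}) (isPreconnected_Ioo (a := 0) (b := ρ))
      (hf.mono (Ioo_subset_Ioo_right (min_le_left _ _))) ?_ ?_ hr hr' hy hry
    · rintro x (rfl | rfl) z (rfl | rfl) h
      · rfl
      · exact absurd h (by linarith)
      · rw [dist_comm] at h; exact absurd h (by linarith)
      · rfl
    · intro z hz
      rcases h1 ⟨hz.1, hz.2.trans_le (min_le_right _ _)⟩ with h | h
      · exact ⟨p, Or.inl rfl, h⟩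
      · exact ⟨q, Or.inr rfl, h⟩
  have hmid : ρ / 2 ∈ Ioo 0 ρ := ⟨half_pos hρ0, half_lt_self hρ0⟩
  rcases h1 ⟨hmid.1, hmid.2.trans_le (min_le_right _ _)⟩ with h | h
  · refine Or.inl (Metric.tendsto_nhds.2 fun ε hε' => ?_)
    filter_upwards [hcl (min ε (dist p q / 2)) (lt_min hε' hε), hev] with r hr hrρ
    rcases hr with hr | hr
    · exact hr.trans_le (min_le_left _ _)
    · have h2 := key p (Or.inl rfl) _ hmid h r hrρ
      have h3 := hr.trans_le (min_le_right _ _)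
      exact absurd (dist_triangle_left p q (f r)) (by linarith)
  · refine Or.inr (Metric.tendsto_nhds.2 fun ε hε' => ?_)
    filter_upwards [hcl (min ε (dist p q / 2)) (lt_min hε' hε), hev] with r hr hrρ
    rcases hr with hr | hr
    · have h2 := key q (Or.inr rfl) _ hmid h r hrρ
      have h3 := hr.trans_le (min_le_right _ _)
      exact absurd (dist_triangle_left p q (f r)) (by linarith)
    · exact hr.trans_le (min_le_left _ _)

/-- If a continuous function off a simple arc clusters at two values at an interior point of the
arc, then it has limits along both normals. If these limits coincide, then the function has a
limit. -/
theorem IsTameArc.exists_tendsto_normal {κ : ℝ → ℂ} {S : ℝ} (hκ : IsTameArc κ S) {s₀ : ℝ}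
    (hs₀ : s₀ ∈ Ioo 0 S) {T : ℂ} (hT : T ≠ 0) (hd : HasDerivAt κ T s₀) {h : ℂ → ℂ}
    (hh : ContinuousOn h (κ '' Icc 0 S)ᶜ) {p q : ℂ}
    (hcl : ∀ ε > 0, ∀ᶠ z in 𝓝[(κ '' Icc 0 S)ᶜ] (κ s₀), dist (h z) p < ε ∨ dist (h z) q < ε) :
    (∀ᶠ r : ℝ in 𝓝[>] 0, κ s₀ + r * (Complex.I * T) ∉ κ '' Icc 0 S ∧
      κ s₀ - r * (Complex.I * T) ∉ κ '' Icc 0 S) ∧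
    ∃ v ∈ ({p, q} : Set ℂ), ∃ v' ∈ ({p, q} : Set ℂ),
      Tendsto (fun r : ℝ => h (κ s₀ + r * (Complex.I * T))) (𝓝[>] 0) (𝓝 v) ∧
      Tendsto (fun r : ℝ => h (κ s₀ - r * (Complex.I * T))) (𝓝[>] 0) (𝓝 v') ∧
      (v = v' → Tendsto h (𝓝[(κ '' Icc 0 S)ᶜ] (κ s₀)) (𝓝 v)) := by
  obtain ⟨δ, hδ, hn⟩ := hκ.exists_normal hs₀ hT hd
  have hTn : 0 < ‖T‖ := norm_pos_iff.2 hT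
  have hδT : 0 < δ / ‖T‖ := div_pos hδ hTn
  have hmem : ∀ r ∈ Ioo 0 (δ / ‖T‖), κ s₀ + r * (Complex.I * T) ∉ κ '' Icc 0 S ∧
      κ s₀ - r * (Complex.I * T) ∉ κ '' Icc 0 S := by
    intro r hr
    have h1 := hn (r * ‖T‖) ⟨mul_pos hr.1 hTn, (lt_div_iff₀ hTn).1 hr.2⟩
    rw [mul_div_cancel_right₀ _ hTn.ne'] at h1
    exact ⟨h1.1, h1.2.1⟩
  have hev : ∀ᶠ r : ℝ in 𝓝[>] 0, r ∈ Ioo 0 (δ / ‖T‖) := Ioo_mem_nhdsGT hδT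
  have hc1 : Continuous fun r : ℝ => κ s₀ + r * (Complex.I * T) := by fun_prop
  have hc2 : Continuous fun r : ℝ => κ s₀ - r * (Complex.I * T) := by fun_prop
  have ht1 : Tendsto (fun r : ℝ => κ s₀ + r * (Complex.I * T)) (𝓝[>] 0)
      (𝓝[(κ '' Icc 0 S)ᶜ] (κ s₀)) := by
    refine tendsto_nhdsWithin_iff.2 ⟨?_, hev.mono fun r hr => (hmem r hr).1⟩
    have := hc1.tendsto 0
    simp only [Complex.ofReal_zero, zero_mul, add_zero] at this
    exact this.mono_left nhdsWithin_le_nhds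
  have ht2 : Tendsto (fun r : ℝ => κ s₀ - r * (Complex.I * T)) (𝓝[>] 0)
      (𝓝[(κ '' Icc 0 S)ᶜ] (κ s₀)) := by
    refine tendsto_nhdsWithin_iff.2 ⟨?_, hev.mono fun r hr => (hmem r hr).2⟩
    have := hc2.tendsto 0
    simp only [Complex.ofReal_zero, zero_mul, sub_zero] at this
    exact this.mono_left nhdsWithin_le_nhds
  refine ⟨hev.mono hmem, ?_⟩
  obtain ⟨v, hv, hvt⟩ : ∃ v ∈ ({p, q} : Set ℂ),
      Tendsto (fun r : ℝ => h (κ s₀ + r * (Complex.I * T))) (𝓝[>] 0) (𝓝 v) := by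
    rcases tendsto_or_tendsto_of_clusters hδT (f := fun r : ℝ => h (κ s₀ + r * (Complex.I * T)))
      (hh.comp hc1.continuousOn fun r hr => (hmem r hr).1)
      (fun ε hε => ht1.eventually (hcl ε hε)) with h1 | h1
    · exact ⟨p, Or.inl rfl, h1⟩
    · exact ⟨q, Or.inr rfl, h1⟩
  obtain ⟨v', hv', hvt'⟩ : ∃ v ∈ ({p, q} : Set ℂ),
      Tendsto (fun r : ℝ => h (κ s₀ - r * (Complex.I * T))) (𝓝[>] 0) (𝓝 v) := by
    rcases tendsto_or_tendsto_of_clusters hδT (f := fun r : ℝ => h (κ s₀ - r * (Complex.I * T)))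
      (hh.comp hc2.continuousOn fun r hr => (hmem r hr).2)
      (fun ε hε => ht2.eventually (hcl ε hε)) with h1 | h1
    · exact ⟨p, Or.inl rfl, h1⟩
    · exact ⟨q, Or.inr rfl, h1⟩
  refine ⟨v, hv, v', hv', hvt, hvt', ?_⟩
  rintro rfl
  obtain ⟨ε₀, hε₀, hsep⟩ : ∃ ε₀ > 0, ∀ ε ≤ ε₀, ∀ x ∈ ({p, q} : Set ℂ), ∀ y ∈ ({p, q} : Set ℂ),
      dist x y < 2 * ε → x = y := by
    by_cases hpq : p = q
    · subst hpq
      refine ⟨1, one_pos, fun ε _ x hx y hy _ => ?_⟩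
      simp only [mem_insert_iff, mem_singleton_iff, or_self] at hx hy
      rw [hx, hy]
    · refine ⟨dist p q / 2, half_pos (dist_pos.2 hpq), ?_⟩
      rintro ε hε x (rfl | rfl) z (rfl | rfl) h
      · rfl
      · exact absurd h (by linarith)
      · rw [dist_comm] at h; exact absurd h (by linarith)
      · rfl
  refine Metric.tendsto_nhds.2 fun ε' hε' => ?_
  set ε := min ε' ε₀ with hε
  have hεpos : 0 < ε := lt_min hε' hε₀
  obtain ⟨ρ₁, hρ₁, h1⟩ := Metric.mem_nhdsWithin_iff.1 (hcl ε hεpos)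
  obtain ⟨ρ₂, hρ₂, h2⟩ := mem_nhdsGT_iff_exists_Ioo_subset.1
    ((Metric.tendsto_nhds.1 hvt ε hεpos).and (Metric.tendsto_nhds.1 hvt' ε hεpos))
  have hρ₂' : (0 : ℝ) < ρ₂ := hρ₂
  have hρ : 0 < min (min δ ρ₁) (ρ₂ * ‖T‖) := lt_min (lt_min hδ hρ₁) (mul_pos hρ₂' hTn)
  filter_upwards [self_mem_nhdsWithin,
    mem_nhdsWithin_of_mem_nhds (Metric.ball_mem_nhds (κ s₀) hρ)] with z hz hzρ
  rw [Metric.mem_ball, lt_min_iff, lt_min_iff] at hzρ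
  have hr : 0 < dist z (κ s₀) := by
    refine dist_pos.2 ?_
    rintro rfl
    exact hz ⟨s₀, Ioo_subset_Icc_self hs₀, rfl⟩
  obtain ⟨W, hW, hzW, hWs, hnW⟩ := (hn _ ⟨hr, hzρ.1.1⟩).2.2 z hz rfl
  have h3 := h2 ⟨div_pos hr hTn, (div_lt_iff₀ hTn).2 hzρ.2⟩
  have h4 : ∃ y ∈ W, dist (h y) v < ε := by
    -- The circle through z leads, off the arc, to one of the normals, where h is close to the
    -- common limit; h cannot leave this value along the way.
    rcases hnW with h5 | h5
    · exact ⟨_, h5, h3.1⟩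
    · exact ⟨_, h5, h3.2⟩
  obtain ⟨y, hyW, hy⟩ := h4
  refine lt_of_lt_of_le ?_ (min_le_left ε' ε₀)
  refine dist_lt_of_isPreconnected (S := {p, q}) hW (hh.mono fun w hw => (hWs hw).2)
    (hsep ε (min_le_right _ _)) ?_ hyW hzW hv hy
  intro w hw
  have hwd : dist w (κ s₀) = dist z (κ s₀) := (hWs hw).1
  have h5 := h1 ⟨show dist w (κ s₀) < ρ₁ by rw [hwd]; exact hzρ.1.2, (hWs hw).2⟩
  rcases h5 with h5 | h5
  · exact ⟨p, Or.inl rfl, h5⟩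
  · exact ⟨q, Or.inr rfl, h5⟩

namespace Contour

variable {t : ℂ} {c : Contour t} {h : ℂ → ℂ} {ω : ℝ → ℂ}

/-! ### The jump of the abelian integral across `I` -/

theorem IsBetaLift.two_spineLift_notMem (hω : c.IsBetaLift ω) {s : ℝ} (hs : s ∈ Ioo (1 : ℝ) 2) :
    2 * c.spineLift ω s ∉ periods t := fun h => by
  rcases hω.eq_of_two_spineLift_mem ⟨by linarith [hs.1], by linarith [hs.2]⟩ h with h | h | h | h <;>
    linarith [hs.1, hs.2]

/-- The sheet 0 is continuous across the inner points of I, so the sign must be +1. The two pairs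
with sign -1 are excluded because 2v is not a period there. -/
theorem IsAbelian.clustersAt_I_interior (hh : c.IsAbelian h) (hω : c.IsBetaLift ω) {s : ℝ}
    (hs : s ∈ Ioo (1 : ℝ) 2) : ClustersAt h c.spineSetᶜ {(1, 0), (1, -(2 * c.betaIntegral ω 1))}
      (c.spine s) (c.spineLift ω s) := by
  have hs' := Ioo_subset_Icc_self hs
  have hcuts : c.spine s ∉ c.cuts := by
    rw [c.spine_of_mem_Icc hs']
    exact c.I_notMem_cuts ⟨by linarith [hs.2], by linarith [hs.1]⟩
  have h2 : ClustersAt h c.spineSetᶜ {y | y.1 = 1 ∧ y.2 ∈ periods t} (c.spine s)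
      (c.spineLift ω s) := by
    intro ε hε
    obtain ⟨V, hV, h1⟩ := exists_nhds_act c.sq_ne_four (c.spineLift ω s) hε
    rw [hω.act_spineLift_eq_sheet hs'] at hV
    filter_upwards [mem_nhdsWithin_of_mem_nhds ((c.continuousAt_sheet_zero hcuts).preimage_mem_nhds hV),
      self_mem_nhdsWithin] with z hz hzD
    rw [mem_preimage, ← hh.act_eq z hzD] at hz
    obtain ⟨l, hl, hd⟩ := h1 _ hz
    exact ⟨(1, l), ⟨rfl, hl⟩, by simpa using hd⟩
  refine (hh.clustersAt_I hω hs').inter (periods_discrete c.sq_ne_four)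
    (F' := {y | y.1 = 1 ∧ y.2 ∈ periods t}) ?_ (fun y hy => ⟨Or.inl hy.1, hy.2⟩) h2 ?_
  · rintro x (rfl | rfl | rfl | rfl)
    · exact ⟨Or.inl rfl, zero_mem _⟩
    · exact ⟨Or.inl rfl, neg_mem hω.two_beta_mem⟩
    · exact ⟨Or.inr rfl, zero_mem _⟩
    · exact ⟨Or.inr rfl, hω.two_beta_mem⟩
  · rintro x hx ⟨y1, y2⟩ ⟨rfl, hy2⟩ e
    simp only at e hy2
    rcases hx with rfl | rfl | rfl | rfl
    · exact Or.inl rfl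
    · exact Or.inr rfl
    · refine absurd ?_ (hω.two_spineLift_notMem hs)
      simp only at e
      rw [show 2 * c.spineLift ω s = -y2 by linear_combination -e]
      exact neg_mem hy2
    · refine absurd ?_ (hω.two_spineLift_notMem hs)
      simp only at e
      rw [show 2 * c.spineLift ω s = 2 * c.betaIntegral ω 1 - y2 by linear_combination -e]
      exact sub_mem hω.two_beta_mem hy2

theorem image_spine_reverse (c : Contour t) :
    (fun s => c.spine (3 - s)) '' Icc 0 3 = c.spineSet := by
  rw [spineSet, ← image_image c.spine (fun s => 3 - s), image_const_sub_Icc]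
  norm_num

/-- Propagation from s₀ towards a₂, along the reversed spine. No branch point is met before a₂, so
saturation holds even for a single pair. -/
theorem IsAbelian.clustersAt_of_ge (hh : c.IsAbelian h) (hω : c.IsBetaLift ω) {s₀ : ℝ}
    (hs₀ : s₀ ∈ Ioo (1 : ℝ) 2) {m : ℂ} (hm : m ∈ periods t)
    (hcl : ClustersAt h c.spineSetᶜ {(1, m)} (c.spine s₀) (c.spineLift ω s₀)) {s : ℝ}
    (hs : s ∈ Icc 1 s₀) : ClustersAt h c.spineSetᶜ {(1, m)} (c.spine s) (c.spineLift ω s) := by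
  have hF : ({(1, m)} : Set (ℂ × ℂ)) ⊆ signedTranslations (periods t) := by
    rintro x rfl
    exact ⟨Or.inl rfl, hm⟩
  have hlift : ContinuousOn (fun s => c.spineLift ω (3 - s)) (Icc 0 3) :=
    hω.continuousOn_spineLift.comp (by fun_prop) fun s hs =>
      ⟨by linarith [hs.2], by linarith [hs.1]⟩
  have key := ClustersAt.propagate (F := {(1, m)}) (h := h) (Λ := periods t) (s₀ := 3 - s₀) (s₁ := 2)
    c.isTameArc_spine.reverse (by rw [image_spine_reverse]; exact hh.continuousOn)
    hlift (periods_discrete c.sq_ne_four) hF (fun s hs => by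
      rw [image_spine_reverse]
      exact hh.clustersAt_spine hω ⟨by linarith [hs.2], by linarith [hs.1]⟩)
    (by linarith [hs₀.2]) (by norm_num) (fun s hs x hx y hy e => by
      rcases eq_or_of_signedTranslation_eq hx (hF hy) e with rfl | ⟨-, -, h3⟩
      · exact hy
      · exact absurd h3 (hω.two_spineLift_notMem ⟨by linarith [hs.2], by linarith [hs.1, hs₀.2]⟩))
    (by rw [image_spine_reverse, sub_sub_cancel]; exact hcl) (3 - s)
    ⟨by linarith [hs.2], by linarith [hs.1]⟩
  rwa [image_spine_reverse, sub_sub_cancel] at key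

theorem IsBetaLift.beta_notMem (hω : c.IsBetaLift ω) : c.betaIntegral ω 1 ∉ periods t := by
  intro hb
  have h1 : act (c.betaIntegral ω 1) (bPt t) = act 0 (bPt t) := by
    rw [act_bPt_eq_iff, sub_zero]; exact hb
  rw [hω.act_beta, act_zero, c.sheet_zero _ (c.sqrtR_sq _), bPt, pt_eq_pt] at h1
  exact c.a_ne_b h1.1

/-- The abelian integral has no limit at the inner points of `I`. -/
theorem IsAbelian.not_clustersAt_singleton (hh : c.IsAbelian h) (hω : c.IsBetaLift ω) {s₀ : ℝ}
    (hs₀ : s₀ ∈ Ioo (1 : ℝ) 2) {m : ℂ} (hm : m ∈ periods t) :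
    ¬ ClustersAt h c.spineSetᶜ {(1, m)} (c.spine s₀) (c.spineLift ω s₀) := by
  intro hcl
  set β := c.betaIntegral ω 1 with hβ
  have hsub : Icc s₀ 3 ⊆ Icc 0 3 := Icc_subset_Icc_left (by linarith [hs₀.1])
  have hK : IsCompact (c.spine '' Icc s₀ 3) :=
    isCompact_Icc.image_of_continuousOn (c.isTameArc_spine.continuousOn.mono hsub)
  have haK : a₂ t ∉ c.spine '' Icc s₀ 3 := by
    rintro ⟨s, hs, e⟩
    rw [← c.spine_one] at e
    have := c.isTameArc_spine.injOn (hsub hs) ⟨zero_le_one, by norm_num⟩ e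
    linarith [hs.1, hs₀.1]
  -- Near the ramification point over a₂ only the part of the spine before s₀ matters. If h had a
  -- single limit value at s₀, it would have none but this one between a₂ and s₀ either.
  have hev : ∀ᶠ u in 𝓝[≠] β, act u (bPt t) ∉ fiber (c.spine '' Icc s₀ 3) ∧
      (act u (bPt t)).w ≠ 0 := by
    refine (eventually_nhdsWithin_of_eventually_nhds ?_).and
      ((isFlowAt_act (bPt t) β).eventually_w_ne_zero c.sq_ne_four)
    refine (continuous_act (bPt t)).continuousAt.eventually
      ((isClosed_fiber hK).isOpen_compl.mem_nhds ?_)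
    show act β (bPt t) ∉ fiber _
    rw [hω.act_beta, c.sheet_zero _ (c.sqrtR_sq _)]
    rintro ⟨q, hq, hqK⟩
    cases hq
    exact haK hqK
  obtain ⟨r, hr, hball⟩ := Metric.mem_nhdsWithin_iff.1 hev
  -- Defects are then locally constant on a full punctured disc about β: over J no translation
  -- occurs, and over I the single translation m is absorbed into v.
  have hloc : ∀ u₀ ∈ Metric.ball β r \ {β}, ∃ l₀, ∀ᶠ u in 𝓝 u₀, ∀ l, c.IsDefect h u l →
      l - l₀ ∈ (⊥ : AddSubgroup ℂ) := by
    intro u₀ hu₀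
    obtain ⟨h1, h2⟩ := hball ⟨hu₀.1, hu₀.2⟩
    obtain ⟨q, hq⟩ := exists_eq_pt_of_w_ne_zero h2
    by_cases hqs : q.1.1 ∈ c.spineSet
    · obtain ⟨s, hs, hsq⟩ := hqs
      have hss₀ : s < s₀ := by
        by_contra! hle
        exact h1 ⟨q, hq, ⟨s, ⟨hle, hs.2⟩, hsq⟩⟩
      have hs1 : s ≠ 1 := by
        rintro rfl
        rw [hq] at h2
        have h3 := q.2
        rw [← hsq, c.spine_one, show R t (a₂ t) = 0 by rw [R]; ring] at h3
        exact h2 (pow_eq_zero_iff two_ne_zero |>.1 h3)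
      obtain ⟨y, hy, hact⟩ := hω.exists_act_spineLift hs
      rcases lt_or_gt_of_ne hs1 with hlt | hgt
      · refine hh.exists_eventually_isDefect (hh.clustersAt_J hω ⟨hs.1, hlt.le⟩) bot_le hact
          (fun h2 => ?_) hq hsq.symm
        have hs0 : s = 0 := by
          rcases hω.eq_of_two_spineLift_mem hs h2 with h | h | h | h <;> linarith [hs.1]
        rw [hs0, c.spineLift_zero, mul_zero]
        exact zero_mem _
      · have hcl' : ClustersAt h c.spineSetᶜ (signedTranslations ⊥) (c.spine s)
            (c.spineLift ω s + m) := by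
          intro ε hε
          filter_upwards [hh.clustersAt_of_ge hω hs₀ hm hcl ⟨hgt.le, hss₀.le⟩ ε hε] with z hz
          obtain ⟨y, rfl, hd⟩ := hz
          exact ⟨(1, 0), ⟨Or.inl rfl, zero_mem _⟩, by simpa using hd⟩
        have hact' : act (c.spineLift ω s + m) (bPt t) = act (c.spineLift ω s) (bPt t) := by
          rw [act_bPt_eq_iff, add_sub_cancel_left]; exact hm
        refine hh.exists_eventually_isDefect hcl' bot_le (hact'.trans hact) (fun h2 => ?_) hq
          hsq.symm
        refine absurd ?_ (hω.two_spineLift_notMem ⟨hgt, hss₀.trans hs₀.2⟩)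
        rw [show 2 * c.spineLift ω s = 2 * (c.spineLift ω s + m) - (m + m) by ring]
        exact sub_mem h2 (add_mem hm hm)
    · obtain ⟨l₀, hl₀⟩ := hh.exists_eventually_isDefect_of_notMem ⟨q, hq, hqs⟩
      exact ⟨l₀, hl₀.mono fun u hu l hl => by rw [hu l hl, sub_self]; exact zero_mem _⟩
  obtain ⟨u, ⟨l, hl⟩, hu⟩ := ((frequently_isDefect c h β).and_eventually
    (Metric.ball_mem_nhds β hr)).exists
  have huβ : u ≠ β := by
    rintro rfl
    have hmem : a₂ t ∈ c.spineSet := c.cuts_subset_spineSet c.a_mem_cuts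
    obtain ⟨z, hz, ⟨h1, -⟩ | ⟨h1, -⟩⟩ := hl <;> rw [hω.act_beta, c.sheet_zero _ (c.sqrtR_sq _)] at h1
    · rw [c.sheet_zero _ (c.sqrtR_sq _), pt_eq_pt] at h1
      exact hz (h1.1 ▸ hmem)
    · rw [c.sheet_one _ (by rw [neg_sq]; exact c.sqrtR_sq _), pt_eq_pt] at h1
      exact hz (h1.1 ▸ hmem)
  -- The reflection u ↦ 2β - u at β corresponds to `conj`, since 2β is a period. It exchanges the
  -- sheets over the same point z.
  have hu' : 2 * β - u ∈ Metric.ball β r \ {β} := by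
    refine ⟨?_, fun e => huβ ?_⟩
    · rw [Metric.mem_ball, dist_eq_norm, show 2 * β - u - β = -(u - β) by ring, norm_neg,
        ← dist_eq_norm]
      exact hu
    · have e' : 2 * β - u = β := e
      linear_combination -e'
  have hconj : act (2 * β - u) (bPt t) = conj (act u (bPt t)) := by
    rw [conj_act_bPt, act_bPt_eq_iff, show 2 * β - u - -u = 2 * β by ring]
    exact hω.two_beta_mem
  have hconst : ∀ l l', c.IsDefect h u l → c.IsDefect h (2 * β - u) l' → l = l' := by
    intro l l' hl hl'
    have := isDefect_sub_mem (isPreconnected_ball_diff_center β r) hloc ⟨hu, huβ⟩ hu' hl hl'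
    rwa [AddSubgroup.mem_bot, sub_eq_zero] at this
  -- On the two sheets the defects are u - h z and 2β - u + h z, or the same with the roles
  -- exchanged. Their equality makes the defect equal to β, whereas defects are periods.
  refine hω.beta_notMem ?_
  obtain ⟨z, hz, ⟨h1, -⟩ | ⟨h1, -⟩⟩ := hl
  · have h2 : act (2 * β - u) (bPt t) = c.sheet 1 z := by rw [hconj, h1, conj_sheet_zero]
    have h3 := hconst _ _ ⟨z, hz, Or.inl ⟨h1, rfl⟩⟩ ⟨z, hz, Or.inr ⟨h2, rfl⟩⟩
    rw [← hh.act_eq z hz, act_bPt_eq_iff] at h1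
    rwa [show u - h z = β by linear_combination h3 / 2] at h1
  · have h2 : act (2 * β - u) (bPt t) = c.sheet 0 z := by rw [hconj, h1, conj_sheet_one]
    have h3 := hconst _ _ ⟨z, hz, Or.inr ⟨h1, rfl⟩⟩ ⟨z, hz, Or.inl ⟨h2, rfl⟩⟩
    rw [← hh.act_eq z hz, act_bPt_eq_iff] at h2
    rwa [show 2 * β - u - h z = β by linear_combination -h3 / 2] at h2

theorem hasDerivAt_spine (c : Contour t) {s : ℝ} (hs : s ∈ Ioo (0 : ℝ) 1) :
    HasDerivAt c.spine (-deriv c.I s) (2 - s) := by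
  have h1 : HasDerivAt c.I (deriv c.I s) (2 - (2 - s)) := by
    rw [sub_sub_cancel]; exact (c.isArc_I.differentiableAt hs).hasDerivAt
  refine (h1.comp_const_sub 2 (2 - s)).congr_of_eventuallyEq ?_
  have h2 : Ioo (1 : ℝ) 2 ∈ 𝓝 (2 - s) := Ioo_mem_nhds (by linarith [hs.2]) (by linarith [hs.1])
  filter_upwards [h2] with x hx
  exact c.spine_of_mem_Icc (Ioo_subset_Icc_self hx)

/-- The abelian integral has limits along both normals of `I`. Their sum is twice the integral over
the part of `I` that leads to `a₂`. -/
theorem IsAbelian.tendsto_normal (hh : c.IsAbelian h) (hω : c.IsBetaLift ω) {s : ℝ}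
    (hs : s ∈ Ioo (0 : ℝ) 1) :
    (∀ᶠ r : ℝ in 𝓝[>] 0, c.I s + r * (Complex.I * deriv c.I s) ∉ c.spineSet ∧
      c.I s - r * (Complex.I * deriv c.I s) ∉ c.spineSet) ∧
    ∃ v v' : ℂ, Tendsto (fun r : ℝ => h (c.I s + r * (Complex.I * deriv c.I s))) (𝓝[>] 0) (𝓝 v) ∧
      Tendsto (fun r : ℝ => h (c.I s - r * (Complex.I * deriv c.I s))) (𝓝[>] 0) (𝓝 v') ∧
      v + v' = 2 * c.alphaIntegral (1 - s) := by
  have hs2 : 2 - s ∈ Ioo (1 : ℝ) 2 := ⟨by linarith [hs.2], by linarith [hs.1]⟩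
  have hs2' := Ioo_subset_Icc_self hs2
  have hT : -deriv c.I s ≠ 0 := by
    rw [neg_ne_zero, c.isArc_I.deriv_eq hs]
    exact c.isArc_I.derivWithin_ne_zero s (Ioo_subset_Icc_self hs)
  have hκ : c.spine (2 - s) = c.I s := by rw [c.spine_of_mem_Icc hs2', sub_sub_cancel]
  have hlift : c.spineLift ω (2 - s) = c.betaIntegral ω 1 + c.alphaIntegral (1 - s) := by
    rw [c.spineLift_of_mem_Icc hs2']
    ring_nf
  set V := c.spineLift ω (2 - s) with hV
  have hcl : ∀ ε > 0, ∀ᶠ z in 𝓝[(c.spine '' Icc 0 3)ᶜ] (c.spine (2 - s)),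
      dist (h z) V < ε ∨ dist (h z) (V - 2 * c.betaIntegral ω 1) < ε := by
    intro ε hε
    filter_upwards [hh.clustersAt_I_interior hω hs2 ε hε] with z hz
    obtain ⟨y, rfl | rfl, hd⟩ := hz
    · exact Or.inl (by simpa using hd)
    · exact Or.inr (by simpa only [one_mul, ← sub_eq_add_neg] using hd)
  obtain ⟨hev, v, hv, v', hv', h1, h2, h3⟩ := c.isTameArc_spine.exists_tendsto_normal
    ⟨by linarith [hs.2], by linarith [hs.1]⟩ hT (c.hasDerivAt_spine hs) hh.continuousOn hcl
  -- Equal limits along both normals would be a limit of h, hence a single limit value. So the two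
  -- limits are V and V - 2β in some order, and only their sum is needed.
  have hne : v ≠ v' := by
    intro e
    have h4 := h3 e
    refine hh.not_clustersAt_singleton hω hs2 (m := v - V) ?_ fun ε hε => ?_
    · rcases hv with rfl | rfl
      · rw [sub_self]; exact zero_mem _
      · rw [sub_sub_cancel_left]; exact neg_mem hω.two_beta_mem
    · filter_upwards [Metric.tendsto_nhds.1 h4 ε hε] with z hz
      exact ⟨(1, v - V), rfl, by simpa [hV] using hz⟩
  simp only [mul_neg, ← sub_eq_add_neg, sub_neg_eq_add, hκ] at hev h1 h2
  refine ⟨hev.mono fun r hr => ⟨hr.2, hr.1⟩, v', v, h2, h1, ?_⟩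
  rcases hv with rfl | rfl <;> rcases hv' with rfl | rfl
  · exact absurd rfl hne
  · rw [hlift]; ring
  · rw [hlift]; ring
  · exact absurd rfl hne

end Contour

namespace Contour

variable {t : ℂ} {c : Contour t} {h : ℂ → ℂ} {ω : ℝ → ℂ}

/-! ### The integral over one half of `I` -/

theorem I_notMem_slits (c : Contour t) {s : ℝ} (hs : s ∈ Ioo (0 : ℝ) 1) : c.I s ∉ c.slits := by
  have hI : c.I s ∈ c.I '' Icc 0 1 := ⟨s, Ioo_subset_Icc_self hs, rfl⟩
  rintro (h | h | h)
  · exact c.I_notMem_cuts hs h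
  · exact disjoint_left.1 c.L_I h hI
  · exact disjoint_left.1 c.neg_L_I h hI

/-- Close to `a₂`, the complement of the slits is the complement of `J`. -/
theorem exists_ball_diff_J (c : Contour t) : ∃ δ > 0, ∀ ρ, 0 < ρ → ρ ≤ δ →
    IsPreconnected (Metric.ball (a₂ t) ρ \ c.J '' Icc 0 1) ∧
      Metric.ball (a₂ t) ρ \ c.J '' Icc 0 1 ⊆ c.slitsᶜ := by
  obtain ⟨δ₁, hδ₁, h1⟩ := c.isArc_J.isTameArc.exists_ball_diff
  rw [c.J_zero] at h1
  have hclosed : IsClosed (c.J₁ '' Icc 0 1 ∪ (c.L '' Ici 0 ∪ -(c.L '' Ici 0))) :=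
    (isCompact_Icc.image_of_continuousOn c.isArc_J₁.continuousOn).isClosed.union
      (c.isClosed_L.union c.isClosed_L.neg)
  have haI : a₂ t ∈ c.I '' Icc 0 1 := ⟨1, ⟨zero_le_one, le_rfl⟩, c.I_one⟩
  have ha : a₂ t ∉ c.J₁ '' Icc 0 1 ∪ (c.L '' Ici 0 ∪ -(c.L '' Ici 0)) := by
    rintro (h | h | h)
    · rw [c.image_J₁] at h
      exact disjoint_left.1 c.J_neg_J c.a_mem_J h
    · exact disjoint_left.1 c.L_I h haI
    · exact disjoint_left.1 c.neg_L_I h haI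
  obtain ⟨δ₂, hδ₂, h2⟩ := Metric.isOpen_iff.1 hclosed.isOpen_compl _ ha
  refine ⟨min δ₁ δ₂, lt_min hδ₁ hδ₂, fun ρ hρ hρδ =>
    ⟨(h1 ρ hρ (hρδ.trans (min_le_left _ _))).1, ?_⟩⟩
  rintro z ⟨hz, hzJ⟩ hzs
  have h3 := h2 (Metric.ball_subset_ball (hρδ.trans (min_le_right _ _)) hz)
  rcases hzs with (h | h) | h
  · exact h3 (Or.inl h)
  · exact hzJ h
  · exact h3 (Or.inr h)

/-- If `I` passes through the origin, then the origin bisects the integral over `I`. -/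
theorem IsBetaLift.alphaIntegral_one_eq (hω : c.IsBetaLift ω) {s : ℝ}
    (hs : s ∈ Ioo (0 : ℝ) 1) (hs0 : c.I s = 0) :
    c.alphaIntegral 1 = 2 * c.alphaIntegral (1 - s) := by
  have ht := c.sq_ne_four
  have h0 : (0 : ℂ) ∈ c.slitsᶜ := hs0 ▸ c.I_notMem_slits hs
  set E := connectedComponentIn c.slitsᶜ 0 with hE
  have hEo : IsOpen E := c.isOpen_compl_slits.connectedComponentIn
  have hEp : IsPreconnected E := isPreconnected_connectedComponentIn
  have hEs : E ⊆ c.slitsᶜ := connectedComponentIn_subset _ _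
  have hEc : E ⊆ c.cutsᶜ := fun z hz hzc => hEs hz (Or.inl hzc)
  have h0E : (0 : ℂ) ∈ E := mem_connectedComponentIn h0
  -- The slits are symmetric, so the component of the origin is symmetric as well, although I need
  -- not be.
  have hnegE : ∀ z ∈ E, -z ∈ E := by
    have h1 : IsPreconnected ((fun z : ℂ => -z) '' E) := hEp.image _ continuous_neg.continuousOn
    have h2 := h1.subset_connectedComponentIn (x := 0) (F := c.slitsᶜ) ⟨0, h0E, neg_zero⟩ (by
      rintro _ ⟨z, hz, rfl⟩
      exact fun h => hEs hz (c.neg_mem_slits.1 h))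
    exact fun z hz => h2 ⟨z, hz, rfl⟩
  have hIE : ∀ x ∈ Ioo (0 : ℝ) 1, c.I x ∈ E := by
    have h1 : IsPreconnected (c.I '' Ioo 0 1) := isPreconnected_Ioo.image _
      (c.isArc_I.continuousOn.mono Ioo_subset_Icc_self)
    have h2 := h1.subset_connectedComponentIn (x := 0) (F := c.slitsᶜ) ⟨s, hs, hs0⟩ (by
      rintro _ ⟨x, hx, rfl⟩
      exact c.I_notMem_slits hx)
    exact fun x hx => h2 ⟨x, hx, rfl⟩
  obtain ⟨g₀, hg₀⟩ := c.exists_primitive_of_subset_compl_slits hEo hEp hEs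
  -- the primitive is odd up to a constant
  have hodd : ∀ z ∈ E, g₀ z + g₀ (-z) = 2 * g₀ 0 := by
    intro z hz
    have hd : ∀ z ∈ E, HasDerivAt (fun z => g₀ z + g₀ (-z)) 0 z := by
      intro z hz
      have h1 : HasDerivAt (fun z => g₀ (-z)) (-(c.sqrtR (-z))⁻¹) z := by
        have := (hg₀ (-z) (hnegE z hz)).comp z (hasDerivAt_neg z)
        exact this.congr_deriv (by ring)
      refine ((hg₀ z hz).add h1).congr_deriv ?_
      rw [c.sqrtR_neg (hEc hz), add_neg_cancel]
    have h1 := hEo.is_const_of_deriv_eq_zero hEp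
      (fun z hz => (hd z hz).differentiableAt.differentiableWithinAt)
      (fun z hz => (hd z hz).deriv) hz h0E
    simp only [neg_zero] at h1
    rw [h1, two_mul]
  set k := c.betaIntegral ω 1 + c.alphaIntegral (1 - s) with hk
  have hks : act k (bPt t) = c.sheet 0 0 := by
    rw [hω.act_beta_add_alphaIntegral ⟨by linarith [hs.2], by linarith [hs.1]⟩, sub_sub_cancel, hs0]
  set g : ℂ → ℂ := fun z => g₀ z - g₀ 0 + k with hg
  have hgact : ∀ z ∈ E, act (g z) (bPt t) = c.sheet 0 z := by
    intro z hz
    rw [hg]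
    simp only
    rw [act_add, hks, c.act_sub_eq_sheet hEo hEp hEc hg₀ h0E hz]
  have hgc : ContinuousOn g E := fun z hz =>
    (((hg₀ z hz).sub_const _).add_const _).continuousAt.continuousWithinAt
  obtain ⟨δ, hδ, hdisc⟩ := periods_discrete ht
  -- along `I` the primitive is the integral
  have hgI : ∀ x ∈ Ioo (0 : ℝ) 1, g (c.I (1 - x)) = c.betaIntegral ω 1 + c.alphaIntegral x := by
    intro x hx
    have hs' : 1 - s ∈ Ioo (0 : ℝ) 1 := ⟨by linarith [hs.2], by linarith [hs.1]⟩
    have hflip : ∀ y ∈ Ioo (0 : ℝ) 1, 1 - y ∈ Ioo (0 : ℝ) 1 := fun y hy =>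
      ⟨by linarith [hy.2], by linarith [hy.1]⟩
    set f : ℝ → ℂ := fun y => g (c.I (1 - y)) - (c.betaIntegral ω 1 + c.alphaIntegral y) with hf
    have hfc : ContinuousOn f (Ioo 0 1) := by
      refine ContinuousOn.sub (hgc.comp ?_ fun y hy => hIE _ (hflip y hy)) ?_
      · exact c.isArc_I.reverse.continuousOn.mono Ioo_subset_Icc_self
      · exact continuousOn_const.add (c.continuousOn_alphaIntegral.mono Ioo_subset_Icc_self)
    have hfper : ∀ y ∈ Ioo (0 : ℝ) 1, f y ∈ periods t := by
      intro y hy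
      rw [← act_bPt_eq_iff, hgact _ (hIE _ (hflip y hy)),
        hω.act_beta_add_alphaIntegral (Ioo_subset_Icc_self hy)]
    have hfs : f (1 - s) = 0 := by
      simp only [hf, hg, sub_sub_cancel, hs0, sub_self, zero_add, hk]
    have hlt := dist_lt_of_isPreconnected (S := (periods t : Set ℂ)) (ε := δ / 2)
      isPreconnected_Ioo hfc (fun x hx y hy hxy => by
        rw [dist_eq_norm, mul_div_cancel₀ _ (two_ne_zero' ℝ)] at hxy
        exact sub_eq_zero.1 (hdisc _ (sub_mem hx hy) hxy))
      (fun y hy => ⟨f y, hfper y hy, by rw [dist_self]; positivity⟩) hs' hx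
      (zero_mem (periods t)) (by rw [hfs, dist_self]; positivity)
    rw [dist_zero_right] at hlt
    exact sub_eq_zero.1 (hdisc _ (hfper x hx) (by linarith))
  -- the primitive has a limit at `a₂`
  obtain ⟨δ', hδ', hball⟩ := c.exists_ball_diff_J
  have hlim1 : Tendsto (fun x : ℝ => c.I (1 - x)) (𝓝[>] 0) (𝓝 (a₂ t)) := by
    have := c.isArc_I.reverse.continuousOn 0 ⟨le_rfl, zero_le_one⟩
    have h2 := this.mono_left (nhdsWithin_mono (0 : ℝ) (Ioo_subset_Icc_self (a := 0) (b := 1)))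
    rw [nhdsWithin_Ioo_eq_nhdsGT zero_lt_one] at h2
    simpa only [sub_zero, c.I_one] using h2
  have hlim2 : Tendsto (fun x : ℝ => -c.I x) (𝓝[>] 0) (𝓝 (a₂ t)) := by
    have := c.isArc_I.continuousOn 0 ⟨le_rfl, zero_le_one⟩
    have h2 := this.mono_left (nhdsWithin_mono (0 : ℝ) (Ioo_subset_Icc_self (a := 0) (b := 1)))
    rw [nhdsWithin_Ioo_eq_nhdsGT zero_lt_one] at h2
    simpa only [c.I_zero, neg_neg] using h2.neg
  have hpos : ∀ᶠ x : ℝ in 𝓝[>] 0, x ∈ Ioo (0 : ℝ) 1 := Ioo_mem_nhdsGT zero_lt_one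
  have hnotJ : ∀ z ∈ E, z ∉ c.J '' Icc 0 1 := fun z hz hzJ => hEc hz (Or.inr hzJ)
  -- The points I(1 - x) and -I(x) both tend to a₂ but are different in general. Near a₂ both lie in
  -- the connected slit disc U, on which the limit values of g cannot be changed.
  have hclose : ∀ ε > 0, ∀ᶠ x : ℝ in 𝓝[>] 0, dist (g (c.I (1 - x))) (g (-c.I x)) < ε := by
    intro ε hε
    have hcl : ClustersAt g E (signedTranslations (periods t)) (a₂ t) (c.betaIntegral ω 1) := by
      refine c.clustersAt_of_act_eq hgact (y := c.sqrtR (a₂ t)) (hy := c.sqrtR_sq _) ?_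
      rw [hω.act_beta, c.sheet_zero _ (c.sqrtR_sq _)]
    obtain ⟨δ'', hδ'', hsep⟩ := exists_separation_signedTranslations (periods_discrete ht)
      (c.betaIntegral ω 1)
    set ε' := min (ε / 2) (δ'' / 2) with hε'
    have hε'pos : 0 < ε' := lt_min (half_pos hε) (half_pos hδ'')
    obtain ⟨ρ', hρ', h1⟩ := Metric.mem_nhdsWithin_iff.1 (hcl ε' hε'pos)
    set ρ := min δ' ρ' with hρ
    have hρpos : 0 < ρ := lt_min hδ' hρ'
    obtain ⟨hUp, hUs⟩ := hball ρ hρpos (min_le_left _ _)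
    set U := Metric.ball (a₂ t) ρ \ c.J '' Icc 0 1 with hU
    have hev1 : ∀ᶠ x : ℝ in 𝓝[>] 0, c.I (1 - x) ∈ U := by
      filter_upwards [hlim1.eventually (Metric.ball_mem_nhds _ hρpos), hpos] with x hx hx1
      exact ⟨hx, hnotJ _ (hIE _ ⟨by linarith [hx1.2], by linarith [hx1.1]⟩)⟩
    have hev2 : ∀ᶠ x : ℝ in 𝓝[>] 0, -c.I x ∈ U := by
      filter_upwards [hlim2.eventually (Metric.ball_mem_nhds _ hρpos), hpos] with x hx hx1
      exact ⟨hx, hnotJ _ (hnegE _ (hIE _ hx1))⟩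
    have hUE : U ⊆ E := by
      obtain ⟨x, hx, hx1⟩ := (hev1.and hpos).exists
      have h2 := hIE (1 - x) ⟨by linarith [hx1.2], by linarith [hx1.1]⟩
      rw [hE, connectedComponentIn_eq h2]
      -- U avoids the slits and contains a point of I, so it lies in the component of the origin,
      -- where g is defined as a primitive.
      exact hUp.subset_connectedComponentIn hx hUs
    filter_upwards [hev1, hev2] with x hx hx'
    have hnear : ∀ z ∈ U, ∃ y ∈ (fun y : ℂ × ℂ => y.1 * c.betaIntegral ω 1 + y.2) ''
        signedTranslations (periods t), dist (g z) y < ε' := by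
      intro z hz
      obtain ⟨y, hy, hd⟩ := h1 ⟨Metric.ball_subset_ball (min_le_right _ _) hz.1, hUE hz⟩
      exact ⟨_, ⟨y, hy, rfl⟩, hd⟩
    obtain ⟨y, hy, hd⟩ := hnear _ hx
    have h2 := dist_lt_of_isPreconnected hUp (hgc.mono hUE) (by
      rintro _ ⟨x, hx, rfl⟩ _ ⟨y, hy, rfl⟩ hxy
      exact hsep x hx y hy (hxy.trans_le (by linarith [min_le_right (ε / 2) (δ'' / 2)])))
      hnear hx hx' hy hd
    have h3 := dist_triangle_right (g (c.I (1 - x))) (g (-c.I x)) y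
    linarith [min_le_left (ε / 2) (δ'' / 2)]
  -- compare the two limits
  have hA : Tendsto (fun x : ℝ => g (c.I (1 - x))) (𝓝[>] 0) (𝓝 (c.betaIntegral ω 1)) := by
    have h1 := c.continuousOn_alphaIntegral 0 ⟨le_rfl, zero_le_one⟩
    have h2 := h1.mono_left (nhdsWithin_mono (0 : ℝ) (Ioo_subset_Icc_self (a := 0) (b := 1)))
    rw [nhdsWithin_Ioo_eq_nhdsGT zero_lt_one, c.alphaIntegral_zero] at h2
    have h3 := h2.const_add (c.betaIntegral ω 1)
    rw [add_zero] at h3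
    refine h3.congr' ?_
    filter_upwards [hpos] with x hx
    exact (hgI x hx).symm
  have hB : Tendsto (fun x : ℝ => g (-c.I x)) (𝓝[>] 0)
      (𝓝 (2 * k - (c.betaIntegral ω 1 + c.alphaIntegral 1))) := by
    have h1 := c.continuousOn_alphaIntegral.comp (t := Icc 0 1) (f := fun x : ℝ => 1 - x)
      (s := Icc 0 1) (by fun_prop) (fun _ hx => one_sub_mem_Icc hx) 0 ⟨le_rfl, zero_le_one⟩
    have h2 := h1.mono_left (nhdsWithin_mono (0 : ℝ) (Ioo_subset_Icc_self (a := 0) (b := 1)))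
    rw [nhdsWithin_Ioo_eq_nhdsGT zero_lt_one] at h2
    simp only [Function.comp_def, sub_zero] at h2
    refine ((h2.const_add (c.betaIntegral ω 1)).const_sub (2 * k)).congr' ?_
    -- By oddness g(-I x) = 2k - g(I x), and g along I is the integral from a₂, which tends to its
    -- full value as x → 0.
    filter_upwards [hpos] with x hx
    have h4 := hgI (1 - x) ⟨by linarith [hx.2], by linarith [hx.1]⟩
    rw [sub_sub_cancel] at h4
    rw [← h4]
    simp only [hg]
    linear_combination -hodd _ (hIE x hx)
  have heq : dist (c.betaIntegral ω 1) (2 * k - (c.betaIntegral ω 1 + c.alphaIntegral 1)) ≤ 0 := by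
    refine le_of_forall_pos_le_add fun ε hε => ?_
    rw [zero_add]
    exact le_of_tendsto (hA.dist hB) ((hclose ε hε).mono fun x hx => hx.le)
  have heq' := dist_le_zero.1 heq
  rw [hk] at heq'
  linear_combination heq'

/-- The boundary values of the abelian integral at the two points on top of the origin. -/
theorem IsAbelian.exists_isBoundaryValue (hh : c.IsAbelian h) (hω : c.IsBetaLift ω) {s : ℝ}
    (hs : s ∈ Icc (0 : ℝ) 1) (hs0 : c.I s = 0) {σ : ℝ} (hσ : σ = 1 ∨ σ = -1) :
    ∃ v : Fin 2 → ℂ, (∀ k, c.IsBoundaryValue σ k s (v k)) ∧ v 0 = v 1 + 1 / 2 := by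
  have hs' : s ∈ Ioo (0 : ℝ) 1 := by
    refine ⟨lt_of_le_of_ne hs.1 ?_, lt_of_le_of_ne hs.2 ?_⟩
    · rintro rfl
      rw [c.I_zero, neg_eq_zero] at hs0
      exact c.a_ne_zero hs0
    · rintro rfl
      rw [c.I_one] at hs0
      exact c.a_ne_zero hs0
  obtain ⟨hev, v, v', hv, hv', hsum⟩ := hh.tendsto_normal hω hs'
  rw [← hω.alphaIntegral_one_eq hs' hs0] at hsum
  set T := deriv c.I s with hT
  have hα := hω.alphaPeriod_ne_zero
  have hhalf : c.alphaPeriod⁻¹ * c.alphaIntegral 1 = 1 / 2 := by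
    rw [c.alphaPeriod_eq] at hα ⊢
    have := right_ne_zero_of_mul hα
    field_simp
  have h0 : ∀ {f : ℝ → ℂ} {y : ℂ}, Tendsto (fun r => h (f r)) (𝓝[>] 0) (𝓝 y) →
      (∀ᶠ r in 𝓝[>] 0, f r ∉ c.spineSet) →
      Tendsto (fun r => c.abelIntegral (c.sheet 0 (f r))) (𝓝[>] 0) (𝓝 (c.alphaPeriod⁻¹ * y)) := by
    intro f y hf hfs
    refine (hf.const_mul _).congr' ?_
    filter_upwards [hfs] with r hr
    exact (hh.abelIntegral_sheet_zero hω hr).symm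
  have h1 : ∀ {f : ℝ → ℂ} {y : ℂ}, Tendsto (fun r => h (f r)) (𝓝[>] 0) (𝓝 y) →
      (∀ᶠ r in 𝓝[>] 0, f r ∉ c.spineSet) →
      Tendsto (fun r => c.abelIntegral (c.sheet 1 (f r))) (𝓝[>] 0)
        (𝓝 (-(c.alphaPeriod⁻¹ * y))) := by
    intro f y hf hfs
    refine (hf.const_mul _).neg.congr' ?_
    filter_upwards [hfs] with r hr
    exact (hh.abelIntegral_sheet_one hω hr).symm
  rcases hσ with rfl | rfl
  -- In the sheet 0 the cycle α runs against I, so its left normal is -iI'; in the sheet 1 it runs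
  -- along I, its left normal is iI', and the integral is -h. Hence the two boundary values differ
  -- by the normalized sum of v and v'.
  · refine ⟨![c.alphaPeriod⁻¹ * v', -(c.alphaPeriod⁻¹ * v)], fun k => ?_, ?_⟩
    · fin_cases k
      · refine (h0 hv' (hev.mono fun r hr => hr.2)).congr fun r => ?_
        congr 2
        simp
        ring
      · refine (h1 hv (hev.mono fun r hr => hr.1)).congr fun r => ?_
        congr 2
        simp
        ring
    · show c.alphaPeriod⁻¹ * v' = -(c.alphaPeriod⁻¹ * v) + 1 / 2
      rw [← hhalf, ← hsum]
      ring
  · refine ⟨![c.alphaPeriod⁻¹ * v, -(c.alphaPeriod⁻¹ * v')], fun k => ?_, ?_⟩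
    · fin_cases k
      · refine (h0 hv (hev.mono fun r hr => hr.1)).congr fun r => ?_
        congr 2
        simp
        ring
      · refine (h1 hv' (hev.mono fun r hr => hr.2)).congr fun r => ?_
        congr 2
        simp
        ring
    · show c.alphaPeriod⁻¹ * v = -(c.alphaPeriod⁻¹ * v') + 1 / 2
      rw [← hhalf, ← hsum]
      ring

end Contour

end TwoCut

end

theorem proposition2 (t : ℂ) (c : TwoCut.Contour t) (ω : ℝ → ℂ) (hω : c.IsBetaLift ω) :
    -- the Abel map on the whole surface is the class of the abelian integral on the cut surface
    (∀ p ∈ c.cutSurface, c.abelMap ω p = c.toJac ω (c.abelIntegral p)) ∧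
    -- the Jacobi inversion problem has the unique solution `0^{(1-k)}`
    (∀ (k : Fin 2) (p : TwoCut.Surface t),
      c.abelMap ω p = c.abelMap ω (c.sheet k 0) + c.toJac ω (1 / 2) ↔ p = c.sheet (1 - k) 0) ∧
    -- the exact identity, for the boundary values from either side of `α` if `α` contains `0^{(k)}`
    (∀ s ∈ Set.Icc (0 : ℝ) 1, c.I s = 0 → ∀ σ : ℝ, σ = 1 ∨ σ = -1 →
      ∃ v : Fin 2 → ℂ, (∀ k, c.IsBoundaryValue σ k s (v k)) ∧ v 0 = v 1 + 1 / 2) := by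
  obtain ⟨h, hh⟩ := c.exists_isAbelian
  exact ⟨fun p hp => hh.abelMap_eq_toJac_abelIntegral hω hp, hh.abelMap_eq_add_half_iff hω,
    fun s hs hs0 σ hσ => hh.exists_isBoundaryValue hω hs hs0 hσ⟩
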